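/- **Notation.** For $0<|q|,|p|<1$ put $(x;q)=\prod_{r\ge 0}(1-xq^r)$, $(x;p,q)=\prod_{r,s\ge 0}(1-xp^rq^s)$, $\theta(x;q)=(x;q)(q/x;q)$ and $\Gamma(x)=\Gamma(x;p,q)=\prod_{i,j\ge 0}\frac{1-p^{i+1}q^{j+1}/x}{1-p^iq^jx}$. Several arguments before the semicolon, and signs $\pm$ in exponents, indicate products, e.g. $(x,y;q)=(x;q)(y;q)$ and $\Gamma(tz^{\pm1})=\Gamma(tz)\Gamma(t/z)$. A factor $X^{1_{\zeta=-1/2}}$ is $X$ if $\zeta=-\frac12$ and $1$ otherwise. A contour $C$ is a cycle (a finite integer combination of closed $C^1$ curves) in $\mathbb C^*$; it contains (excludes) a point off $C$ if its winding number around the point is $1$ (is $0$), and it contains the contour $cC$ if, for every $w\in C$, it contains $cw$ and excludes $w/c$. Let $n\ge 1$, $m\ge 0$ be integers, and $p,q,t\in\mathbb C^*$ with $|p|,|q|,|t|<1$. For $T_0,\dots,T_{2m+5}\in\mathbb C^*$ with $t^{2(n-1)}\prod_r T_r=(pq)^{m+1}$ that are generic ($T_rT_s\ne p^{-i}q^{-j}t^{-k}$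 for all $r,s$ and all integers $i,j,k\ge 0$) let $$I\!I_m^{(n)}(T_r;t,p,q)=\prod_{i=1}^n\prod_{0\le r<s\le 2m+5}(t^{i-1}T_rT_s;p,q)\,\frac{(q;q)^n(p;p)^n\Gamma(t)^n}{2^n n!}\int_{C^n}\prod_{1\le j<k\le n}\frac{\Gamma(tz_j^{\pm1}z_k^{\pm1})}{\Gamma(z_j^{\pm1}z_k^{\pm1})}\prod_{j=1}^n\frac{\prod_{r=0}^{2m+5}\Gamma(T_rz_j^{\pm1})}{\Gamma(z_j^{\pm2})}\frac{dz_j}{2\pi i z_j},$$ where $C=C^{-1}$ contains the points $p^iq^jT_r$, excludes their reciprocals, and contains the contours $p^iq^jtC$ ($i,j\ge 0$); if all $|T_r|<1$ the unit circle can be taken. For the other balanced $T_r\in\mathbb C^*$ the value is that of the holomorphic extension. **Proposition.** Let $q,t\in\mathbb C^*$ with $|q|,|t|<1$, and let $t_0,\dots,t_{2m+5}\in\mathbb C^*$ satisfy $t^{2(n-1)}\prod_r t_r=q^{m+1}$ and be generic: $t_rt_s\ne q^{-j}t^{-k}$ for all $r,s$ and all integers $j,k\ge 0$. Let $\zeta\in\mathbb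 R$ and $\alpha\in\mathbb R^{2m+6}$ satisfy $-\frac12\le\zeta=\alpha_0=\alpha_1<0$, $-\zeta\le\alpha_r\le 1+\zeta$ for $r\ge 2$, and $\sum_{r=0}^{2m+5}\alpha_r=m+1$. Then there are contours $C$ such that $C$ contains the points $q^jt_0$ and $q^jt_1$ ($j\ge 0$), excludes $q^{-j}/t_r$ ($j\ge 0$, $r$ with $\alpha_r=-\zeta$), contains the contours $tq^jC$ ($j\ge 0$), and, if $\zeta=-\frac12$, excludes moreover $q^{-j}/t_0$, $q^{-j}/t_1$ and $q^{-j}t^{-1}w^{-1}$ for all $j\ge 0$ and all $w\in C$. For every such $C$, and every $v\in\mathbb C^*$ for which the factors $\theta(t^{n-j}t_0v,t^{n-j}t_1v;q)$, $1\le j\le n$, in the denominator below do not vanish, $$\begin{aligned}\lim_{p\to 0}I\!I_m^{(n)}(t_rp^{\alpha_r};t,p,q)={}&\frac{(q;q)^n}{n!\,(t;q)^n}\prod_{j=1}^n\frac{(t^{n-j}t_0t_1;q)^{1_{\zeta=-1/2}}\prod_{r:\alpha_r=-\zeta}(t^{n-j}t_rt_0,t^{n-j}t_rt_1;q)}{\theta(t^{n-j}t_0v,t^{n-j}t_1v;q)}\\&\times\int_{C^n}\prod_{1\le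 j<k\le n}\frac{(z_j/z_k,z_k/z_j;q)}{(tz_j/z_k,tz_k/z_j;q)}\left(\frac{(z_jz_k,qz_jz_k/t;q)}{(tz_jz_k,qz_jz_k;q)}\right)^{1_{\zeta=-1/2}}\\&\quad\times\prod_{j=1}^n\frac{\prod_{r:\alpha_r=1+\zeta}(qz_j/t_r;q)}{(t_0/z_j,t_1/z_j;q)\prod_{r:\alpha_r=-\zeta}(t_rz_j;q)}\left(\frac{(z_j^2;q)}{(t_0z_j,t_1z_j,qz_j^2;q)}\right)^{1_{\zeta=-1/2}}\theta\Big(vz_j,\frac{qz_j}{t^{n-1}vt_0t_1};q\Big)\frac{dz_j}{2\pi i z_j}.\end{aligned}$$ Here $p\to 0$ through $p\in\mathbb C^*$, and $p^{\alpha}$ is the principal power. -/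

import Mathlib

open Filter Topology

noncomputable section

namespace EllipticSelberg

/-- The infinite `q`-Pochhammer symbol `(x;q) = ∏_{r ≥ 0} (1 - x q^r)`. -/
def poch (x q : ℂ) : ℂ := ∏' r : ℕ, (1 - x * q ^ r)

/-- The double symbol `(x;p,q) = ∏_{r,s ≥ 0} (1 - x p^r q^s)`. -/
def poch2 (x p q : ℂ) : ℂ := ∏' rs : ℕ × ℕ, (1 - x * p ^ rs.1 * q ^ rs.2)

/-- The theta function `θ(x;q) = (x;q) (q/x;q)`. -/
def theta (x q : ℂ) : ℂ := poch x q * poch (q / x) q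

/-- The elliptic gamma function
`Γ(x;p,q) = ∏_{i,j ≥ 0} (1 - p^(i+1) q^(j+1) / x) / (1 - p^i q^j x)`. -/
def ellGamma (x p q : ℂ) : ℂ := poch2 (p * q / x) p q / poch2 x p q

/-- A contour: a one-dimensional cycle in `ℂ ∖ {0}`, that is, a finite formal integer combination
of closed continuously differentiable curves `[0,1] → ℂ ∖ {0}`. -/
structure Contour where
  size : ℕ
  mult : Fin size → ℤ
  path : Fin size → ℝ → ℂ
  contDiff : ∀ i, ContDiff ℝ 1 (path i)
  closed : ∀ i, path i 0 = path i 1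
  ne_zero : ∀ i, ∀ x ∈ Set.Icc (0 : ℝ) 1, path i x ≠ 0

namespace Contour

/-- The set of points on the contour. -/
def support (C : Contour) : Set ℂ := ⋃ i, C.path i '' Set.Icc (0 : ℝ) 1

/-- `∫_C f(z) dz`. -/
def integral (C : Contour) (f : ℂ → ℂ) : ℂ :=
  ∑ i, (C.mult i : ℂ) * ∫ x in (0 : ℝ)..1, f (C.path i x) * deriv (C.path i) x

/-- The winding number of `C` around `w` (for `w` off the contour). -/
def index (C : Contour) (w : ℂ) : ℂ :=
  (2 * Real.pi * Complex.I)⁻¹ * C.integral fun z => (z - w)⁻¹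

/-- The `n`-fold integral `∫_{C^n} F(z_1, …, z_n) ∏_j dz_j / (2 π i z_j)`. -/
def integralPow (C : Contour) (n : ℕ) (F : (Fin n → ℂ) → ℂ) : ℂ :=
  ∑ a : Fin n → Fin C.size, (∏ j, (C.mult (a j) : ℂ)) *
    ∫ x in Set.Icc (0 : Fin n → ℝ) 1,
      F (fun j => C.path (a j) (x j)) *
        ∏ j, deriv (C.path (a j)) (x j) / (2 * Real.pi * Complex.I * C.path (a j) (x j))

/-- `C` contains (or includes) the point `w`. -/
def Includes (C : Contour) (w : ℂ) : Prop := w ∉ C.support ∧ C.index w = 1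

/-- `C` excludes the point `w`. -/
def Excludes (C : Contour) (w : ℂ) : Prop := w ∉ C.support ∧ C.index w = 0

/-- `C` contains the contour `c • C`: the points of `c • C` are inside `C`, and the points
of `C` are outside `c • C` (the winding number of `c • C` around `w` is that of `C` around
`w / c`). -/
def ContainsScaled (C : Contour) (c : ℂ) : Prop :=
  ∀ w ∈ C.support, C.Includes (c * w) ∧ C.Excludes (w / c)

/-- `C = C⁻¹`: the image of `C` under `z ↦ 1/z`, with its orientation reversed, is `C`, as a set
and for the integration of functions. (Under `z ↦ 1/z` the form `dz/z` changes sign, which is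
compensated by the change of orientation.) -/
def InversionInvariant (C : Contour) : Prop :=
  (∀ w ∈ C.support, w⁻¹ ∈ C.support) ∧
  ∀ f : ℂ → ℂ, ContinuousOn f C.support →
    C.integral (fun z => f z⁻¹ / z) = C.integral (fun z => f z / z)

end Contour

/-- The balancing condition `t^(2(n-1)) ∏_r T_r = (pq)^(m+1)`, with all `T_r` nonzero. -/
def Balanced (n m : ℕ) (T : Fin (2 * m + 6) → ℂ) (t p q : ℂ) : Prop :=
  (∀ r, T r ≠ 0) ∧ t ^ (2 * (n - 1)) * ∏ r, T r = (p * q) ^ (m + 1)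

/-- Generic parameters: no product `T_r T_s` lies in `p^(ℤ≤0) q^(ℤ≤0) t^(ℤ≤0)`. -/
def Generic (m : ℕ) (T : Fin (2 * m + 6) → ℂ) (t p q : ℂ) : Prop :=
  ∀ r s, ∀ i j k : ℕ, T r * T s * (p ^ i * q ^ j * t ^ k) ≠ 1

/-- The integrand of the elliptic Selberg integral (with respect to `∏_j dz_j / (2 π i z_j)`). -/
def integrand (n m : ℕ) (T : Fin (2 * m + 6) → ℂ) (t p q : ℂ) (z : Fin n → ℂ) : ℂ :=
  (∏ j : Fin n, ∏ k ∈ Finset.Ioi j,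
    (ellGamma (t * z j * z k) p q * ellGamma (t * z j / z k) p q *
      ellGamma (t * z k / z j) p q * ellGamma (t / (z j * z k)) p q) /
    (ellGamma (z j * z k) p q * ellGamma (z j / z k) p q *
      ellGamma (z k / z j) p q * ellGamma (1 / (z j * z k)) p q)) *
  ∏ j : Fin n,
    (∏ r, ellGamma (T r * z j) p q * ellGamma (T r / z j) p q) /
      (ellGamma (z j ^ 2) p q * ellGamma (1 / z j ^ 2) p q)

/-- The prefactor of the elliptic Selberg integral. -/
def prefactor (n m : ℕ) (T : Fin (2 * m + 6) → ℂ) (t p q : ℂ) : ℂ :=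
  (∏ i ∈ Finset.range n, ∏ r : Fin (2 * m + 6), ∏ s ∈ Finset.Ioi r,
      poch2 (t ^ i * T r * T s) p q) *
    (poch q q ^ n * poch p p ^ n * ellGamma t p q ^ n / (2 ^ n * (n.factorial : ℂ)))

/-- The contours for generic parameters: `C = C⁻¹`, containing all `p^i q^j T_r`, excluding their
reciprocals, and containing the contours `p^i q^j t C`. If all `|T_r| < 1`, the unit circle
is such a contour. -/
structure IsContour (m : ℕ) (T : Fin (2 * m + 6) → ℂ) (t p q : ℂ) (C : Contour) : Prop where
  inv : C.InversionInvariant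
  includes : ∀ r, ∀ i j : ℕ, C.Includes (p ^ i * q ^ j * T r)
  excludes : ∀ r, ∀ i j : ℕ, C.Excludes (p ^ i * q ^ j * T r)⁻¹
  scaled : ∀ i j : ℕ, C.ContainsScaled (p ^ i * q ^ j * t)

open Classical in
/-- The integral for generic parameters, over any contour as above. -/
def genericII (n m : ℕ) (T : Fin (2 * m + 6) → ℂ) (t p q : ℂ) : ℂ :=
  if h : ∃ C, IsContour m T t p q C then
    prefactor n m T t p q * h.choose.integralPow n (integrand n m T t p q)
  else 0

open Classical in
/-- The function `II_m^(n)(T; t, p, q)` on balanced parameters: the contour integral for generic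
parameters, and its holomorphic extension at the remaining ones, where the value of the extension
is the limit along generic balanced parameters. -/
def II (n m : ℕ) (T : Fin (2 * m + 6) → ℂ) (t p q : ℂ) : ℂ :=
  if Generic m T t p q then genericII n m T t p q
  else limUnder (𝓝[{T' | Balanced n m T' t p q ∧ Generic m T' t p q}] T)
    fun T' => genericII n m T' t p q

/-- Generic parameters in the limit `p → 0`: no product `t_r t_s` lies in
`q^(ℤ≤0) t^(ℤ≤0)`. -/
def LimitGeneric (m : ℕ) (T : Fin (2 * m + 6) → ℂ) (t q : ℂ) : Prop :=
  ∀ r s, ∀ j k : ℕ, T r * T s * (q ^ j * t ^ k) ≠ 1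

/-- The contours of the limiting integral. For `ζ = -1/2` the integrand also has poles
at `z_j z_k = q^(-l) / t`; they are kept outside, i.e. `C` excludes the contours
`q^(-l) t⁻¹ C⁻¹`. -/
structure IsLimitContour (m : ℕ) (T : Fin (2 * m + 6) → ℂ) (t q : ℂ)
    (α : Fin (2 * m + 6) → ℝ) (ζ : ℝ) (C : Contour) : Prop where
  includes_zero : ∀ j : ℕ, C.Includes (q ^ j * T 0)
  includes_one : ∀ j : ℕ, C.Includes (q ^ j * T 1)
  excludes : ∀ r, α r = -ζ → ∀ j : ℕ, C.Excludes (q ^ j * T r)⁻¹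
  excludes_zero : ζ = -1 / 2 → ∀ j : ℕ, C.Excludes (q ^ j * T 0)⁻¹
  excludes_one : ζ = -1 / 2 → ∀ j : ℕ, C.Excludes (q ^ j * T 1)⁻¹
  scaled : ∀ j : ℕ, C.ContainsScaled (t * q ^ j)
  excludes_inv : ζ = -1 / 2 → ∀ j : ℕ, ∀ w ∈ C.support, C.Excludes (t * q ^ j * w)⁻¹

open Classical in
/-- The integrand of the limiting integral (with respect to `∏_j dz_j / (2 π i z_j)`). -/
def limitIntegrand (n m : ℕ) (T : Fin (2 * m + 6) → ℂ) (t q : ℂ)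
    (α : Fin (2 * m + 6) → ℝ) (ζ : ℝ) (v : ℂ) (z : Fin n → ℂ) : ℂ :=
  (∏ j : Fin n, ∏ k ∈ Finset.Ioi j,
    (poch (z j / z k) q * poch (z k / z j) q) /
      (poch (t * z j / z k) q * poch (t * z k / z j) q) *
    (if ζ = -1 / 2 then
      (poch (z j * z k) q * poch (q * z j * z k / t) q) /
        (poch (t * z j * z k) q * poch (q * z j * z k) q)
    else 1)) *
  ∏ j : Fin n,
    ((∏ r with α r = 1 + ζ, poch (q * z j / T r) q) /
      (poch (T 0 / z j) q * poch (T 1 / z j) q * ∏ r with α r = -ζ, poch (T r * z j) q) *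
    (if ζ = -1 / 2 then
      poch (z j ^ 2) q / (poch (T 0 * z j) q * poch (T 1 * z j) q * poch (q * z j ^ 2) q)
    else 1) *
    (theta (v * z j) q * theta (q * z j / (t ^ (n - 1) * v * T 0 * T 1)) q))

open Classical in
/-- The prefactor of the limiting integral; `i` plays the role of `n - j`, `1 ≤ j ≤ n`. -/
def limitPrefactor (n m : ℕ) (T : Fin (2 * m + 6) → ℂ) (t q : ℂ)
    (α : Fin (2 * m + 6) → ℝ) (ζ : ℝ) (v : ℂ) : ℂ :=
  poch q q ^ n / ((n.factorial : ℂ) * poch t q ^ n) *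
  ∏ i ∈ Finset.range n,
    ((if ζ = -1 / 2 then poch (t ^ i * T 0 * T 1) q else 1) *
      ∏ r with α r = -ζ, poch (t ^ i * T r * T 0) q * poch (t ^ i * T r * T 1) q) /
    (theta (t ^ i * T 0 * v) q * theta (t ^ i * T 1 * v) q)

end EllipticSelberg

end

/-!
# The limit `p → 0` of the elliptic Selberg integral

The integrand of the elliptic Selberg integral is invariant under inversion of each variable, while
the limiting integrand is not: the symmetry has to be broken before the limit is taken.

*Breaking the symmetry.* Put `e = q / (t^(n-1) v T₀ T₁)`. The sum of
`∏_j θ(T₀ z_j, T₁ z_j, v z_j, e z_j) / θ(z_j²) · ∏_{j<k} θ(t z_j z_k) / θ(z_j z_k)` over all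
inversions of the variables is a constant, an explicit product of theta functions
(`sum_thetaTerm`, proved by Liouville's theorem and induction on `n`). Since both the integrand and
the contour are invariant under inversion, the integral is, up to this constant, the integral of the
integrand multiplied by a single term of the sum (`mul_integralPow_integrand`). The product, the
*regularized integrand*, is a quotient `Params.num / Params.den` of holomorphic functions on `(ℂ*)^n`;
it has no longer the poles at `1 / T₀` and `1 / T₁`, only those at `1 / (p T₀)` and `1 / (p T₁)`;
likewise the poles at `z_j z_k = 1 / t` have given way to those at `z_j z_k = 1 / (p t)`.

*Moving the contour.* With `z = p^ζ y`, the regularized integrand converges as `p → 0`, with all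
its parameters (`tends_limitParams`). A contour `C` of the limiting integral separates the poles of the
limit, hence also those of the rescaled integrand for small `p` (`Params.Tends.eventually_separates`).
It remains to see that the contour `p^ζ C` may replace the inversion invariant one
(`integralPow_eq_of_separates`). A cycle only enters through its winding numbers: by the
Cauchy–Pompeiu formula it may be replaced by any smooth compactly supported cutoff function `χ` which
equals its winding number off a neighbourhood of its support, the form `dz / z` becoming
`∂̄χ dA / z`, up to a constant. Cutoff functions, unlike contours, can be multiplied, which yields a
path of finitely many admissible steps between the cutoff `y` of the rescaled contour and the
inversion invariant cutoff `z` (`iint_cutoff_eq`). It runs through the cutoffs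
`1 - (1 - y z) (y ∘ inv)` (`Cutoff.majority`), where the cutoff of a disc is adjoined first
to `y`, the disc shrinking from a huge one, then to `z`, the disc growing again.

*The remaining points.* The contours for generic parameters are a curve close to the unit circle, small
circles around the finitely many points left outside, and the inverses of these circles
(`exists_separating_contour`). Rescaled by `p^(-ζ)`, such a contour is one for the limiting integral
(`IsContour.isLimitContour`). At nongeneric parameters the integral is a limit over generic ones; these
are dense (`Balanced.mem_closure`), and the formula in terms of the regularized integral depends
continuously on the parameters (`continuousAt_limitForm`).
-/

noncomputable section

namespace EllipticSelberg

/-! ### Infinite products -/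

lemma summable_norm_mul_pow_mul_pow (x : ℂ) {p q : ℂ} (hp : ‖p‖ < 1) (hq : ‖q‖ < 1) :
    Summable fun rs : ℕ × ℕ => ‖-(x * p ^ rs.1 * q ^ rs.2)‖ := by
  have h := ((summable_geometric_of_lt_one (norm_nonneg p) hp).mul_of_nonneg
    (summable_geometric_of_lt_one (norm_nonneg q) hq)
    (fun _ => by positivity) (fun _ => by positivity)).mul_left ‖x‖
  refine h.congr fun rs => ?_
  simp only [norm_neg, norm_mul, norm_pow]; ring

lemma poch2_eq_zero_iff {x p q : ℂ} (hp : ‖p‖ < 1) (hq : ‖q‖ < 1) :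
    poch2 x p q = 0 ↔ ∃ i j : ℕ, x * p ^ i * q ^ j = 1 := by
  constructor
  · intro h
    by_contra! hne
    refine tprod_one_add_ne_zero_of_summable (f := fun rs : ℕ × ℕ => -(x * p ^ rs.1 * q ^ rs.2))
      (fun rs => ?_) (summable_norm_mul_pow_mul_pow x hp hq) ?_
    · rw [← sub_eq_add_neg, sub_ne_zero]; exact (hne _ _).symm
    · simpa only [poch2, sub_eq_add_neg] using h
  · rintro ⟨i, j, h⟩
    have h0 : (1 : ℂ) - x * p ^ (i, j).1 * q ^ (i, j).2 = 0 := by simp [h]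
    exact tprod_of_exists_eq_zero ⟨(i, j), h0⟩

lemma poch2_ne_zero_iff {x p q : ℂ} (hp : ‖p‖ < 1) (hq : ‖q‖ < 1) :
    poch2 x p q ≠ 0 ↔ ∀ i j : ℕ, x * p ^ i * q ^ j ≠ 1 := by
  rw [Ne, poch2_eq_zero_iff hp hq]; push Not; rfl

/-- The double symbol at `p = 0` is the single one, because `0 ^ 0 = 1`. This makes the limit
`p → 0` an instance of joint continuity. -/
lemma poch2_zero (x q : ℂ) : poch2 x 0 q = poch x q := by
  have hinj : Function.Injective (fun s : ℕ => ((0 : ℕ), s)) := fun a b h => by simpa using h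
  rw [poch2, poch, ← hinj.tprod_eq]
  · simp
  · rintro ⟨r, s⟩ h
    rcases Nat.eq_zero_or_pos r with rfl | hr
    · exact ⟨s, rfl⟩
    · simp [zero_pow hr.ne'] at h

lemma poch2_comm (x p q : ℂ) : poch2 x p q = poch2 x q p := by
  rw [poch2, ← (Equiv.prodComm ℕ ℕ).tprod_eq]
  refine tprod_congr fun rs => ?_
  simp only [Equiv.prodComm_apply, Prod.fst_swap, Prod.snd_swap]; ring

lemma poch2_eq_poch_mul (x : ℂ) {p q : ℂ} (hp : ‖p‖ < 1) (hq : ‖q‖ < 1) :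
    poch2 x p q = poch x q * poch2 (p * x) p q := by
  let a : ℕ × ℕ → ℂ := fun rs => -(x * p ^ rs.1 * q ^ rs.2)
  let f : ℕ × ℕ → ℂ := fun rs => if rs.1 = 0 then a rs else 0
  let g : ℕ × ℕ → ℂ := fun rs => if rs.1 = 0 then 0 else a rs
  have hs := summable_norm_mul_pow_mul_pow x hp hq
  have hf : Summable fun rs => ‖f rs‖ := by
    refine Summable.of_nonneg_of_le (fun _ => norm_nonneg _) (fun rs => ?_) hs
    dsimp only [f]; split_ifs <;> simp [a]
    positivity
  have hg : Summable fun rs => ‖g rs‖ := by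
    refine Summable.of_nonneg_of_le (fun _ => norm_nonneg _) (fun rs => ?_) hs
    dsimp only [g]; split_ifs <;> simp [a]
    positivity
  have key := (multipliable_one_add_of_summable hf).tprod_mul (multipliable_one_add_of_summable hg)
  have e1 : ∏' rs, (1 + f rs) * (1 + g rs) = poch2 x p q := by
    refine tprod_congr fun rs => ?_
    dsimp only [f, g, a]; split_ifs <;> ring
  have e2 : ∏' rs, (1 + f rs) = poch x q := by
    have hinj : Function.Injective (fun s : ℕ => ((0 : ℕ), s)) := fun a b h => by simpa using h
    rw [poch, ← hinj.tprod_eq]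
    · simp [f, a, sub_eq_add_neg]
    · rintro ⟨r, s⟩ h
      rcases Nat.eq_zero_or_pos r with rfl | hr
      · exact ⟨s, rfl⟩
      · simp [f, hr.ne'] at h
  have e3 : ∏' rs, (1 + g rs) = poch2 (p * x) p q := by
    have hinj : Function.Injective (fun rs : ℕ × ℕ => (rs.1 + 1, rs.2)) := by
      rintro ⟨a, b⟩ ⟨c, d⟩ h; simpa using h
    rw [poch2, ← hinj.tprod_eq]
    · refine tprod_congr fun rs => ?_
      simp only [g, a, Nat.add_eq_zero_iff, one_ne_zero, and_false, if_false]; ring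
    · rintro ⟨r, s⟩ h
      rcases r with _ | r
      · simp [g] at h
      · exact ⟨(r, s), rfl⟩
  rw [← e1, key, e2, e3]

lemma poch2_eq_poch_mul' (x : ℂ) {p q : ℂ} (hp : ‖p‖ < 1) (hq : ‖q‖ < 1) :
    poch2 x p q = poch x p * poch2 (q * x) p q := by
  rw [poch2_comm, poch2_eq_poch_mul x hq hp, poch2_comm]

lemma poch_eq_mul (x : ℂ) {q : ℂ} (hq : ‖q‖ < 1) : poch x q = (1 - x) * poch (q * x) q := by
  have h := poch2_eq_poch_mul' x (p := 0) (by simp) hq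
  rw [poch2_zero, poch2_zero] at h
  rw [h]; congr 1
  rw [poch, tprod_eq_mulSingle 0]
  · simp
  · intro r hr; simp [zero_pow hr]

/-- `(x;0) = 1 - x`. -/
lemma poch_zero_right (x : ℂ) : poch x 0 = 1 - x := by
  rw [poch, tprod_eq_mulSingle 0]
  · simp
  · intro r hr; simp [zero_pow hr]

lemma poch_zero_left (q : ℂ) : poch 0 q = 1 := by simp [poch]

lemma poch2_zero_left (p q : ℂ) : poch2 0 p q = 1 := by simp [poch2]

lemma poch_ne_zero_iff {x q : ℂ} (hq : ‖q‖ < 1) : poch x q ≠ 0 ↔ ∀ j : ℕ, x * q ^ j ≠ 1 := by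
  rw [← poch2_zero, poch2_ne_zero_iff (by simp) hq]
  constructor
  · intro h j; simpa using h 0 j
  · intro h i j
    rcases Nat.eq_zero_or_pos i with rfl | hi
    · simpa using h j
    · simp [zero_pow hi.ne']

/-- Local uniform convergence of the double product in all three variables. -/
lemma hasProdLocallyUniformlyOn_poch2 {R ρ : ℝ} (hρ : ρ < 1) (hρ₀ : 0 ≤ ρ) (hR : 0 ≤ R) :
    HasProdLocallyUniformlyOn
      (fun (rs : ℕ × ℕ) (w : ℂ × ℂ × ℂ) => 1 + -(w.1 * w.2.1 ^ rs.1 * w.2.2 ^ rs.2))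
      (fun w => ∏' rs : ℕ × ℕ, (1 + -(w.1 * w.2.1 ^ rs.1 * w.2.2 ^ rs.2)))
      (Metric.ball 0 R ×ˢ Metric.ball 0 ρ ×ˢ Metric.ball 0 ρ) := by
  have hu : Summable fun rs : ℕ × ℕ => R * (ρ ^ rs.1 * ρ ^ rs.2) :=
    ((summable_geometric_of_lt_one hρ₀ hρ).mul_of_nonneg (summable_geometric_of_lt_one hρ₀ hρ)
      (fun _ => by positivity) (fun _ => by positivity)).mul_left R
  refine hu.hasProdLocallyUniformlyOn_one_add
    (Metric.isOpen_ball.prod (Metric.isOpen_ball.prod Metric.isOpen_ball))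
    (Eventually.of_forall ?_) (fun rs => by fun_prop)
  rintro rs ⟨x, p, q⟩ ⟨hx, hp, hq⟩
  simp only [Metric.mem_ball, dist_zero_right] at hx hp hq
  simp only [norm_neg, norm_mul, norm_pow, mul_assoc]
  gcongr

lemma continuousAt_poch2 {w : ℂ × ℂ × ℂ} (hp : ‖w.2.1‖ < 1) (hq : ‖w.2.2‖ < 1) :
    ContinuousAt (fun w : ℂ × ℂ × ℂ => poch2 w.1 w.2.1 w.2.2) w := by
  obtain ⟨ρ, h1, h2⟩ := exists_between (max_lt hp hq)
  have hρ₀ : 0 ≤ ρ := (norm_nonneg _).trans ((le_max_left _ _).trans h1.le)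
  have hR : (0 : ℝ) ≤ ‖w.1‖ + 1 := by positivity
  have h := hasProdLocallyUniformlyOn_poch2 h2 hρ₀ hR
  have hopen : IsOpen (Metric.ball (0 : ℂ) (‖w.1‖ + 1) ×ˢ Metric.ball (0 : ℂ) ρ ×ˢ
    Metric.ball (0 : ℂ) ρ) := Metric.isOpen_ball.prod (Metric.isOpen_ball.prod Metric.isOpen_ball)
  have hc : ContinuousOn (fun w : ℂ × ℂ × ℂ => poch2 w.1 w.2.1 w.2.2)
      (Metric.ball (0 : ℂ) (‖w.1‖ + 1) ×ˢ Metric.ball (0 : ℂ) ρ ×ˢ Metric.ball (0 : ℂ) ρ) := by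
    have h' := hasProdLocallyUniformlyOn_iff_tendstoLocallyUniformlyOn.1 h
    have := h'.continuousOn (Eventually.frequently (Eventually.of_forall fun s => by fun_prop))
    simpa only [poch2, sub_eq_add_neg] using this
  refine hc.continuousAt (hopen.mem_nhds ⟨?_, ?_, ?_⟩)
  · simp
  · simpa using (le_max_left _ _).trans_lt h1
  · simpa using (le_max_right _ _).trans_lt h1

lemma tendsto_poch2 {ι : Type*} {l : Filter ι} {f g h : ι → ℂ} {x p q : ℂ}
    (hf : Tendsto f l (𝓝 x)) (hg : Tendsto g l (𝓝 p)) (hh : Tendsto h l (𝓝 q))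
    (hp : ‖p‖ < 1) (hq : ‖q‖ < 1) :
    Tendsto (fun i => poch2 (f i) (g i) (h i)) l (𝓝 (poch2 x p q)) := by
  have h2 := (continuousAt_poch2 (w := (x, p, q)) (by simpa using hp) (by simpa using hq)).tendsto
  dsimp only at h2
  exact Tendsto.comp (f := fun i => (f i, g i, h i)) h2 (hf.prodMk_nhds (hg.prodMk_nhds hh))

lemma tendsto_poch {ι : Type*} {l : Filter ι} {f h : ι → ℂ} {x q : ℂ}
    (hf : Tendsto f l (𝓝 x)) (hh : Tendsto h l (𝓝 q)) (hq : ‖q‖ < 1) :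
    Tendsto (fun i => poch (f i) (h i)) l (𝓝 (poch x q)) := by
  simpa only [poch2_zero] using
    tendsto_poch2 hf (tendsto_const_nhds (x := (0 : ℂ))) hh (by simp) hq

lemma differentiable_poch2 {p q : ℂ} (hp : ‖p‖ < 1) (hq : ‖q‖ < 1) :
    Differentiable ℂ fun x => poch2 x p q := by
  intro x
  have hu : Summable fun rs : ℕ × ℕ => (‖x‖ + 1) * (‖p‖ ^ rs.1 * ‖q‖ ^ rs.2) :=
    ((summable_geometric_of_lt_one (norm_nonneg _) hp).mul_of_nonneg
      (summable_geometric_of_lt_one (norm_nonneg _) hq)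
      (fun _ => by positivity) (fun _ => by positivity)).mul_left _
  have h := hu.hasProdLocallyUniformlyOn_one_add (K := Metric.ball (0 : ℂ) (‖x‖ + 1))
    (f := fun rs x => -(x * p ^ rs.1 * q ^ rs.2)) Metric.isOpen_ball
    (Eventually.of_forall fun rs y hy => by
      simp only [Metric.mem_ball, dist_zero_right] at hy
      simp only [norm_neg, norm_mul, norm_pow, mul_assoc]
      gcongr) (fun rs => by fun_prop)
  have hd := (hasProdLocallyUniformlyOn_iff_tendstoLocallyUniformlyOn.1 h).differentiableOn
    (Eventually.of_forall fun s => by fun_prop) Metric.isOpen_ball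
  refine DifferentiableOn.differentiableAt (s := Metric.ball (0 : ℂ) (‖x‖ + 1)) ?_
    (Metric.isOpen_ball.mem_nhds (by simp))
  simpa only [poch2, sub_eq_add_neg] using hd

lemma differentiable_poch {q : ℂ} (hq : ‖q‖ < 1) : Differentiable ℂ fun x => poch x q := by
  simpa only [poch2_zero] using differentiable_poch2 (p := 0) (by simp) hq

lemma continuous_poch2 {p q : ℂ} (hp : ‖p‖ < 1) (hq : ‖q‖ < 1) :
    Continuous fun x => poch2 x p q := (differentiable_poch2 hp hq).continuous

/-! ### Theta functions -/

lemma theta_div {x q : ℂ} (hx : x ≠ 0) (hq₀ : q ≠ 0) : theta (q / x) q = theta x q := by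
  have : q / (q / x) = x := by field_simp
  rw [theta, theta, this, mul_comm]

lemma theta_mul {x q : ℂ} (hx : x ≠ 0) (hq₀ : q ≠ 0) (hq : ‖q‖ < 1) :
    theta (q * x) q = -x⁻¹ * theta x q := by
  have h1 : q / (q * x) = x⁻¹ := by field_simp
  rw [theta, theta, h1, poch_eq_mul x hq, poch_eq_mul x⁻¹ hq, ← div_eq_mul_inv]
  field_simp; ring

lemma theta_inv {x q : ℂ} (hx : x ≠ 0) (hq₀ : q ≠ 0) (hq : ‖q‖ < 1) :
    theta x⁻¹ q = -x⁻¹ * theta x q := by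
  rw [← theta_mul hx hq₀ hq, ← theta_div (inv_ne_zero hx) hq₀]; congr 1; field_simp

lemma theta_eq_zero_iff {x q : ℂ} (hx : x ≠ 0) (hq₀ : q ≠ 0) (hq : ‖q‖ < 1) :
    theta x q = 0 ↔ ∃ k : ℤ, x = q ^ k := by
  rw [theta, mul_eq_zero]
  constructor
  · rintro (h | h)
    · obtain ⟨j, hj⟩ := not_forall.1 (mt (poch_ne_zero_iff hq).2 (not_not.2 h))
      refine ⟨-j, ?_⟩
      rw [not_not] at hj
      rw [zpow_neg, zpow_natCast]; exact eq_inv_of_mul_eq_one_left hj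
    · obtain ⟨j, hj⟩ := not_forall.1 (mt (poch_ne_zero_iff hq).2 (not_not.2 h))
      rw [not_not] at hj
      refine ⟨j + 1, ?_⟩
      rw [zpow_add₀ hq₀, zpow_natCast, zpow_one]
      field_simp at hj
      linear_combination -hj
  · rintro ⟨k, rfl⟩
    rcases le_or_gt k 0 with hk | hk
    · left
      by_contra h
      refine (poch_ne_zero_iff hq).1 h k.natAbs ?_
      rw [← zpow_natCast, ← zpow_add₀ hq₀, Int.natCast_natAbs, abs_of_nonpos hk]; simp
    · right
      by_contra h
      refine (poch_ne_zero_iff hq).1 h (k - 1).natAbs ?_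
      rw [← zpow_natCast, Int.natCast_natAbs, abs_of_nonneg (by omega), div_mul_eq_mul_div,
        div_eq_one_iff_eq (zpow_ne_zero _ hq₀), ← zpow_one_add₀ hq₀]
      congr 1; ring

lemma differentiableAt_theta {x q : ℂ} (hx : x ≠ 0) (hq : ‖q‖ < 1) :
    DifferentiableAt ℂ (fun x => theta x q) x := by
  unfold theta
  exact (differentiable_poch hq x).mul
    ((differentiable_poch hq (q / x)).comp (f := fun x => q / x) x
      ((differentiableAt_const q).div differentiableAt_id hx))

open MeasureTheory Set

/-! ### The Cauchy–Pompeiu formula -/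

/-- The Wirtinger derivative `∂g/∂z̄`. -/
def dbar (g : ℂ → ℂ) (w : ℂ) : ℂ := (fderiv ℝ g w 1 + Complex.I * fderiv ℝ g w Complex.I) / 2

lemma continuous_dbar {g : ℂ → ℂ} (hg : ContDiff ℝ 1 g) : Continuous (dbar g) := by
  have h := hg.continuous_fderiv one_ne_zero
  unfold dbar
  fun_prop

lemma tsupport_dbar_subset (g : ℂ → ℂ) : tsupport (dbar g) ⊆ tsupport g := by
  refine closure_minimal (fun w hw => ?_) (isClosed_tsupport g)
  by_contra h
  refine hw ?_
  have : fderiv ℝ g w = 0 := by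
    by_contra h0
    exact h (tsupport_fderiv_subset ℝ (subset_tsupport _ h0))
  simp [dbar, this]

lemma dbar_polar (g : ℂ → ℂ) (w : ℂ) (θ : ℝ) :
    dbar g w * Complex.exp (-(θ * Complex.I)) =
      (fderiv ℝ g w (Complex.exp (θ * Complex.I)) +
        Complex.I * fderiv ℝ g w (Complex.I * Complex.exp (θ * Complex.I))) / 2 := by
  have e : Complex.exp (θ * Complex.I) =
      Real.cos θ • (1 : ℂ) + Real.sin θ • Complex.I := by
    rw [Complex.exp_mul_I]; simp
  have e2 : Complex.I * Complex.exp (θ * Complex.I) =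
      (-Real.sin θ) • (1 : ℂ) + Real.cos θ • Complex.I := by
    rw [e]; simp only [Complex.real_smul, mul_one, Complex.ofReal_neg]
    linear_combination (Real.sin θ : ℂ) * Complex.I_mul_I
  have e3 : Complex.exp (-(θ * Complex.I)) = Real.cos θ - Real.sin θ * Complex.I := by
    rw [← neg_mul, ← Complex.ofReal_neg, Complex.exp_mul_I]; simp [sub_eq_add_neg]
  rw [e2, e, e3, map_add, map_add, map_smul, map_smul, map_smul, map_smul]
  simp only [dbar, Complex.real_smul, Complex.ofReal_neg]
  linear_combination (-(Real.sin θ : ℂ) * fderiv ℝ g w Complex.I / 2) * Complex.I_mul_I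

lemma hasDerivAt_expI (θ : ℝ) : HasDerivAt (fun θ : ℝ => Complex.exp (θ * Complex.I))
    (Complex.I * Complex.exp (θ * Complex.I)) θ := by
  have h : HasDerivAt (fun θ : ℝ => (θ : ℂ) * Complex.I) Complex.I θ := by
    simpa using (Complex.ofRealCLM.hasDerivAt (x := θ)).mul_const Complex.I
  simpa [mul_comm] using h.cexp

/-- The Cauchy–Pompeiu formula for compactly supported functions, proved in polar coordinates
around `z`. -/
theorem integral_dbar_div {g : ℂ → ℂ} (hg : ContDiff ℝ 1 g) (hc : HasCompactSupport g) (z : ℂ) :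
    ∫ w, dbar g w / (w - z) = -(Real.pi * g z) := by
  obtain ⟨R, hR0, hR⟩ : ∃ R : ℝ, 0 < R ∧ ∀ w, w ∈ tsupport g → ‖w - z‖ < R := by
    obtain ⟨R, hR⟩ := hc.isBounded.subset_ball z
    exact ⟨max R 1, by positivity, fun w hw => by
      have := hR hw; rw [Metric.mem_ball, dist_eq_norm] at this; exact this.trans_le (le_max_left _ _)⟩
  have hE : ∀ r θ : ℝ, 0 ≤ r → ‖z + r * Complex.exp (θ * Complex.I) - z‖ = r := fun r θ hr => by
    rw [add_sub_cancel_left, norm_mul, Complex.norm_exp_ofReal_mul_I, mul_one,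
      Complex.norm_real, Real.norm_of_nonneg hr]
  have hzero : ∀ r θ : ℝ, R ≤ r → g (z + r * Complex.exp (θ * Complex.I)) = 0 := fun r θ hr => by
    by_contra h0
    have := hR _ (subset_tsupport _ h0)
    rw [hE r θ (hR0.le.trans hr)] at this; linarith
  have hdz : ∀ r θ : ℝ, R ≤ r → dbar g (z + r * Complex.exp (θ * Complex.I)) = 0 :=
    fun r θ hr => by
      by_contra h0
      have := hR _ (tsupport_dbar_subset g (subset_tsupport _ h0))
      rw [hE r θ (hR0.le.trans hr)] at this; linarith
  have hfd := hg.continuous_fderiv one_ne_zero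
  -- the radial and the angular part of the integrand
  let f₁ : ℝ × ℝ → ℂ := fun x => fderiv ℝ g (z + x.1 * Complex.exp (x.2 * Complex.I))
    (Complex.exp (x.2 * Complex.I))
  let f₂ : ℝ × ℝ → ℂ := fun x => fderiv ℝ g (z + x.1 * Complex.exp (x.2 * Complex.I))
    (Complex.I * Complex.exp (x.2 * Complex.I))
  have hf₁ : Continuous f₁ := by dsimp only [f₁]; fun_prop
  have hf₂ : Continuous f₂ := by dsimp only [f₂]; fun_prop
  have hint : ∀ f : ℝ × ℝ → ℂ, Continuous f →
      IntegrableOn f (Ioc 0 R ×ˢ Ioo (-Real.pi) Real.pi) (volume.prod volume) := fun f hf =>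
    (hf.continuousOn.integrableOn_compact (isCompact_Icc.prod isCompact_Icc)).mono_set
      (prod_mono Ioc_subset_Icc_self Ioo_subset_Icc_self)
  have hderiv : ∀ w, HasFDerivAt g (fderiv ℝ g w) w := fun w =>
    (hg.differentiable (by norm_num) w).hasFDerivAt
  have I₁ : ∫ x in Ioc 0 R ×ˢ Ioo (-Real.pi) Real.pi, f₁ x ∂(volume.prod volume) =
      -(2 * Real.pi * g z) := by
    rw [← Measure.prod_restrict, integral_prod_symm _ (by
      rw [Measure.prod_restrict]; exact hint _ hf₁)]
    have : ∀ θ : ℝ, ∫ r in Ioc 0 R, f₁ (r, θ) = -g z := fun θ => by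
      rw [← intervalIntegral.integral_of_le hR0.le,
        intervalIntegral.integral_eq_sub_of_hasDerivAt
          (f := fun r : ℝ => g (z + r * Complex.exp (θ * Complex.I)))]
      · rw [hzero R θ le_rfl]; simp
      · intro r _
        have h1 : HasDerivAt (fun r : ℝ => z + r * Complex.exp (θ * Complex.I))
            (Complex.exp (θ * Complex.I)) r := by
          simpa using ((Complex.ofRealCLM.hasDerivAt (x := r)).mul_const
            (Complex.exp (θ * Complex.I))).const_add z
        exact (hderiv _).comp_hasDerivAt r h1
      · exact (hf₁.comp (by fun_prop : Continuous fun r : ℝ => (r, θ))).intervalIntegrable _ _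
    simp only [this]
    rw [setIntegral_const]
    have : (volume : Measure ℝ).real (Ioo (-Real.pi) Real.pi) = 2 * Real.pi := by
      rw [Real.volume_real_Ioo_of_le (by linarith [Real.pi_pos])]; ring
    rw [this]; simp
  have I₂ : ∫ x in Ioc 0 R ×ˢ Ioo (-Real.pi) Real.pi, f₂ x ∂(volume.prod volume) = 0 := by
    rw [← Measure.prod_restrict, integral_prod _ (by
      rw [Measure.prod_restrict]; exact hint _ hf₂)]
    refine setIntegral_eq_zero_of_forall_eq_zero fun r hr => ?_
    have hr0 : (r : ℂ) ≠ 0 := by exact_mod_cast hr.1.ne'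
    have key : ∫ θ in (-Real.pi)..Real.pi, (r : ℂ) * f₂ (r, θ) = 0 := by
      rw [intervalIntegral.integral_eq_sub_of_hasDerivAt
          (f := fun θ : ℝ => g (z + r * Complex.exp (θ * Complex.I)))]
      · simp [Complex.exp_neg]
      · intro θ _
        have h1 : HasDerivAt (fun θ : ℝ => z + r * Complex.exp (θ * Complex.I))
            (r * (Complex.I * Complex.exp (θ * Complex.I))) θ :=
          ((hasDerivAt_expI θ).const_mul (r : ℂ)).const_add z
        have h2 := (hderiv _).comp_hasDerivAt θ h1
        convert! h2 using 1
        rw [← Complex.real_smul (x := r) (z := Complex.I * _), map_smul, Complex.real_smul]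
      · exact (continuous_const.mul (hf₂.comp
          (by fun_prop : Continuous fun θ : ℝ => (r, θ)))).intervalIntegrable _ _
    rw [intervalIntegral.integral_const_mul, mul_eq_zero] at key
    have := key.resolve_left hr0
    rwa [intervalIntegral.integral_of_le (by linarith [Real.pi_pos]),
      integral_Ioc_eq_integral_Ioo] at this
  have T : ∫ w, dbar g w / (w - z) = ∫ w, dbar g (z + w) / w := by
    rw [← integral_add_left_eq_self _ z]; simp
  rw [T, ← Complex.integral_comp_polarCoord_symm, polarCoord_target]
  have step : ∫ x in Ioi (0 : ℝ) ×ˢ Ioo (-Real.pi) Real.pi, x.1 • (dbar g (z +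
      Complex.polarCoord.symm x) / Complex.polarCoord.symm x) =
      ∫ x in Ioc 0 R ×ˢ Ioo (-Real.pi) Real.pi, (f₁ x + Complex.I * f₂ x) / 2 := by
    have e : ∀ x ∈ Ioi (0 : ℝ) ×ˢ Ioo (-Real.pi) Real.pi, x.1 • (dbar g (z +
        Complex.polarCoord.symm x) / Complex.polarCoord.symm x) =
        dbar g (z + x.1 * Complex.exp (x.2 * Complex.I)) * Complex.exp (-(x.2 * Complex.I)) := by
      rintro ⟨r, θ⟩ ⟨hr, -⟩
      have hr0 : (r : ℂ) ≠ 0 := by exact_mod_cast (mem_Ioi.1 hr).ne'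
      have : Complex.polarCoord.symm (r, θ) = r * Complex.exp (θ * Complex.I) := by
        rw [Complex.polarCoord_symm_apply, Complex.exp_mul_I]; simp
      rw [this, Complex.exp_neg, Complex.real_smul]
      field_simp
    rw [setIntegral_congr_fun (measurableSet_Ioi.prod measurableSet_Ioo) e]
    have hsub : Ioc (0 : ℝ) R ×ˢ Ioo (-Real.pi) Real.pi ⊆
      Ioi (0 : ℝ) ×ˢ Ioo (-Real.pi) Real.pi := prod_mono Ioc_subset_Ioi_self subset_rfl
    rw [setIntegral_eq_of_subset_of_forall_sdiff_eq_zero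
      (measurableSet_Ioi.prod measurableSet_Ioo) hsub]
    · exact setIntegral_congr_fun (measurableSet_Ioc.prod measurableSet_Ioo)
        fun x _ => dbar_polar g _ _
    · rintro ⟨r, θ⟩ ⟨⟨hr, hθ⟩, hn⟩
      have : R ≤ r := by
        by_contra h
        exact hn ⟨⟨hr, (not_le.1 h).le⟩, hθ⟩
      rw [hdz r θ this, zero_mul]
  rw [step, Measure.volume_eq_prod, integral_div, integral_add (hint _ hf₁)
    ((hint _ hf₂).const_mul _), integral_const_mul, I₁, I₂]
  ring

/-- A `C¹` cutoff function for a compact set inside an open set. -/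
lemma exists_cutoff {K U : Set ℂ} (hK : IsCompact K) (hU : IsOpen U) (hKU : K ⊆ U) :
    ∃ χ : ℂ → ℂ, ContDiff ℝ 1 χ ∧ HasCompactSupport χ ∧ tsupport χ ⊆ U ∧
      ∀ᶠ x in 𝓝ˢ K, χ x = 1 := by
  obtain ⟨L, hL, hKL, hLU⟩ := exists_compact_between hK hU hKU
  obtain ⟨f, h0, h1, -⟩ := exists_contMDiffMap_zero_one_nhds_of_isClosed (n := 1)
    (modelWithCornersSelf ℝ ℂ)
    (isOpen_interior (s := L)).isClosed_compl hK.isClosed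
    (disjoint_left.2 fun x hx hx' => hx (hKL hx'))
  have hts : tsupport (fun x => (f x : ℂ)) ⊆ interior L := by
    intro x hx
    by_contra hxL
    rw [← mem_compl_iff] at hxL
    have := h0.filter_mono (nhds_le_nhdsSet hxL)
    refine notMem_tsupport_iff_eventuallyEq.2 ?_ hx
    filter_upwards [this] with y hy
    simp [hy]
  refine ⟨fun x => (f x : ℂ), Complex.ofRealCLM.contDiff.comp f.contMDiff.contDiff,
    hL.of_isClosed_subset (isClosed_tsupport _) (hts.trans interior_subset),
    hts.trans (interior_subset.trans hLU), ?_⟩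
  filter_upwards [h1] with x hx
  simp [hx]

lemma dbar_eq_zero {g : ℂ → ℂ} {w : ℂ} (h : DifferentiableAt ℂ g w) : dbar g w = 0 := by
  have h1 := (h.hasFDerivAt.restrictScalars ℝ).fderiv
  have h2 : fderiv ℂ g w Complex.I = Complex.I * fderiv ℂ g w 1 := by
    rw [← smul_eq_mul, ← map_smul, smul_eq_mul, mul_one]
  rw [dbar, h1]
  simp only [ContinuousLinearMap.coe_restrictScalars', h2]
  linear_combination (fderiv ℂ g w 1 / 2) * Complex.I_mul_I

/-! ### Chains -/

/-- A weighted chain in `ℂ ∖ {0}`: a finite measure on pairs (point, weight), whose points lie in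
a compact set and whose weights are bounded. Both contours (with weight `dz / (2πiz)`) and smooth
cutoff functions (with a multiple of `∂χ/∂z̄`) define chains, which allows one to deform contours
without constructing curves. -/
structure Chain where
  meas : Measure (ℂ × ℂ)
  supp : Set ℂ
  isFiniteMeasure : IsFiniteMeasure meas
  isCompact : IsCompact supp
  zero_notMem : (0 : ℂ) ∉ supp
  bound : ℝ
  ae_mem : ∀ᵐ x ∂meas, x.1 ∈ supp ∧ ‖x.2‖ ≤ bound

namespace Chain

instance (Λ : Chain) : IsFiniteMeasure Λ.meas := Λ.isFiniteMeasure

/-- The integral of a function over a chain. -/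
def eval (Λ : Chain) (f : ℂ → ℂ) : ℂ := ∫ x, f x.1 * x.2 ∂Λ.meas

/-- The generalized winding number of a chain around `w`. -/
def ind (Λ : Chain) (w : ℂ) : ℂ := Λ.eval fun z => z / (z - w)

/-- The integral of a function of several variables over a product of chains. -/
def iint {n : ℕ} (Λ : Fin n → Chain) (F : (Fin n → ℂ) → ℂ) : ℂ :=
  ∫ x : Fin n → ℂ × ℂ, F (fun j => (x j).1) * ∏ j, (x j).2 ∂Measure.pi fun j => (Λ j).meas

lemma eval_congr (Λ : Chain) {f g : ℂ → ℂ} (h : ∀ z ∈ Λ.supp, f z = g z) :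
    Λ.eval f = Λ.eval g := by
  refine integral_congr_ae ?_
  filter_upwards [Λ.ae_mem] with x hx
  rw [h _ hx.1]

lemma aestronglyMeasurable_comp_fst (Λ : Chain) {f : ℂ → ℂ} (hf : ContinuousOn f Λ.supp) :
    AEStronglyMeasurable (fun x : ℂ × ℂ => f x.1) Λ.meas := by
  have hm : MeasurableSet {x : ℂ × ℂ | x.1 ∈ Λ.supp} :=
    measurable_fst Λ.isCompact.isClosed.measurableSet
  rw [← Measure.restrict_eq_self_of_ae_mem (s := {x : ℂ × ℂ | x.1 ∈ Λ.supp})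
    (Λ.ae_mem.mono fun x hx => hx.1)]
  exact (hf.comp continuous_fst.continuousOn fun x hx => hx).aestronglyMeasurable hm

lemma integrable_eval (Λ : Chain) {f : ℂ → ℂ} (hf : ContinuousOn f Λ.supp) :
    Integrable (fun x : ℂ × ℂ => f x.1 * x.2) Λ.meas := by
  obtain ⟨B, hB⟩ := Λ.isCompact.exists_bound_of_continuousOn hf
  refine Integrable.of_bound ((Λ.aestronglyMeasurable_comp_fst hf).mul
    measurable_snd.aestronglyMeasurable) (B * Λ.bound) ?_
  filter_upwards [Λ.ae_mem] with x hx
  rw [norm_mul]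
  exact mul_le_mul (hB _ hx.1) hx.2 (norm_nonneg _) ((norm_nonneg _).trans (hB _ hx.1))

/-- A holomorphic function is integrated against the winding numbers, by the Cauchy–Pompeiu
formula for its product with a cutoff function. -/
lemma eval_eq_integral_ind (Λ : Chain) {K : Set ℂ} (hs : Λ.supp ⊆ K) {f g : ℂ → ℂ}
    (hg : ContDiff ℝ 1 g) (hc : HasCompactSupport g) (hgf : ∀ z ∈ K, z * g z = f z)
    (hgK : ∀ᶠ z in 𝓝ˢ K, dbar g z = 0) :
    Λ.eval f = (Real.pi : ℂ)⁻¹ * ∫ w, dbar g w * Λ.ind w := by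
  set D := tsupport (dbar g) with hD
  have hDc : IsCompact D := hc.of_isClosed_subset (isClosed_tsupport _) (tsupport_dbar_subset g)
  have hKD : ∀ z ∈ K, z ∉ D := fun z hz =>
    notMem_tsupport_iff_eventuallyEq.2 (hgK.filter_mono (nhds_le_nhdsSet hz))
  have hdc := continuous_dbar hg
  have hπ : (Real.pi : ℂ) ≠ 0 := by exact_mod_cast Real.pi_ne_zero
  have hCP : ∀ z ∈ Λ.supp, f z = (Real.pi : ℂ)⁻¹ * ∫ w in D, dbar g w * (z / (z - w)) := by
    intro z hz
    rw [setIntegral_eq_integral_of_forall_compl_eq_zero fun w hw => by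
      rw [image_eq_zero_of_notMem_tsupport hw, zero_mul]]
    have h := integral_dbar_div hg hc z
    have e : ∫ w, dbar g w * (z / (z - w)) = (-z) * ∫ w, dbar g w / (w - z) := by
      rw [← integral_const_mul]
      refine integral_congr_ae (Eventually.of_forall fun w => ?_)
      have : z - w = -(w - z) := by ring
      simp only [this, div_neg]; ring
    rw [e, h, ← hgf z (hs hz)]
    field_simp
  have hcont : ContinuousOn (fun x : ℂ × ℂ => dbar g x.2 * (x.1 / (x.1 - x.2)))
      (Λ.supp ×ˢ D) := by
    refine (hdc.comp continuous_snd).continuousOn.mul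
      (continuousOn_fst.div (continuousOn_fst.sub continuousOn_snd) ?_)
    rintro ⟨z, w⟩ ⟨hz, hw⟩ h0
    have hzw : z = w := sub_eq_zero.1 h0
    subst hzw
    exact hKD z (hs hz) hw
  obtain ⟨B, hB⟩ := (Λ.isCompact.prod hDc).exists_bound_of_continuousOn hcont
  have : IsFiniteMeasure (volume.restrict D) :=
    ⟨by rw [Measure.restrict_apply_univ]; exact hDc.measure_lt_top⟩
  have hae : ∀ᵐ x ∂Λ.meas.prod (volume.restrict D),
      (x.1.1 ∈ Λ.supp ∧ ‖x.1.2‖ ≤ Λ.bound) ∧ x.2 ∈ D :=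
    ((Measure.quasiMeasurePreserving_fst (μ := Λ.meas) (ν := volume.restrict D)).ae
      Λ.ae_mem).and ((Measure.quasiMeasurePreserving_snd (μ := Λ.meas)
        (ν := volume.restrict D)).ae (ae_restrict_mem hDc.measurableSet))
  have hint : Integrable (Function.uncurry fun (x : ℂ × ℂ) (w : ℂ) =>
      dbar g w * (x.1 / (x.1 - w)) * x.2) (Λ.meas.prod (volume.restrict D)) := by
    refine Integrable.of_bound (C := B * Λ.bound) ?_ ?_
    · refine Measurable.aestronglyMeasurable ?_
      have := hdc.measurable
      unfold Function.uncurry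
      fun_prop
    · filter_upwards [hae] with x hx
      have := hB (x.1.1, x.2) ⟨hx.1.1, hx.2⟩
      simp only [Function.uncurry, norm_mul (_ * _) x.1.2]
      exact mul_le_mul this hx.1.2 (norm_nonneg _) ((norm_nonneg _).trans this)
  calc Λ.eval f = Λ.eval fun z => (Real.pi : ℂ)⁻¹ * ∫ w in D, dbar g w * (z / (z - w)) :=
        Λ.eval_congr hCP
    _ = (Real.pi : ℂ)⁻¹ * ∫ x, (∫ w in D, dbar g w * (x.1 / (x.1 - w)) * x.2) ∂Λ.meas := by
        rw [eval, ← integral_const_mul]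
        refine integral_congr_ae (Eventually.of_forall fun x => ?_)
        simp only [integral_mul_const]; ring
    _ = (Real.pi : ℂ)⁻¹ * ∫ w in D, dbar g w * Λ.ind w := by
        rw [integral_integral_swap hint]
        congr 1
        refine integral_congr_ae (Eventually.of_forall fun w => ?_)
        simp only [ind, eval, ← integral_const_mul, mul_assoc]
    _ = _ := by
        rw [setIntegral_eq_integral_of_forall_compl_eq_zero fun w hw => by
          rw [image_eq_zero_of_notMem_tsupport hw, zero_mul]]

/-- Cauchy's theorem for chains: two chains with the same winding numbers off a compact set
containing their supports integrate functions holomorphic near that set to the same value. -/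
theorem eval_eq_of_ind_eq {Λ Λ' : Chain} {K U : Set ℂ} (hK : IsCompact K) (hU : IsOpen U)
    (hKU : K ⊆ U) (h0 : (0 : ℂ) ∉ U) (hs : Λ.supp ⊆ K) (hs' : Λ'.supp ⊆ K)
    (hind : ∀ w, w ≠ 0 → w ∉ K → Λ.ind w = Λ'.ind w) {f : ℂ → ℂ} (hf : DifferentiableOn ℂ f U) :
    Λ.eval f = Λ'.eval f := by
  obtain ⟨χ, hχ, hχc, hχU, hχ1⟩ := exists_cutoff hK hU hKU
  set g : ℂ → ℂ := fun z => χ z * (f z / z) with hgdef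
  have hfz : ∀ z ∈ U, AnalyticAt ℂ (fun z => f z / z) z := fun z hz =>
    (hf.analyticAt (hU.mem_nhds hz)).div analyticAt_id fun h => h0 (by simpa [h] using hz)
  have hsupp : tsupport g ⊆ tsupport χ := tsupport_mul_subset_left
  have hg : ContDiff ℝ 1 g := contDiff_iff_contDiffAt.2 fun z => by
    by_cases hz : z ∈ tsupport χ
    · exact hχ.contDiffAt.mul ((hfz z (hχU hz)).contDiffAt.restrict_scalars ℝ)
    · have : g =ᶠ[𝓝 z] fun _ => 0 := by
        filter_upwards [notMem_tsupport_iff_eventuallyEq.1 hz] with y hy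
        simp [g, hy]
      exact contDiffAt_const.congr_of_eventuallyEq this
  have hgc : HasCompactSupport g := hχc.of_isClosed_subset (isClosed_tsupport _) hsupp
  have hgf : ∀ z ∈ K, z * g z = f z := fun z hz => by
    have hz0 : z ≠ 0 := fun h => h0 (by simpa [h] using hKU hz)
    simp only [g, (hχ1.self_of_nhdsSet z hz)]; field_simp
  have hgK : ∀ᶠ z in 𝓝ˢ K, dbar g z = 0 := by
    filter_upwards [hχ1.eventually_nhdsSet, hU.mem_nhdsSet.2 hKU] with z hz hzU
    refine dbar_eq_zero ((hfz z hzU).differentiableAt.congr_of_eventuallyEq ?_)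
    filter_upwards [hz] with y hy
    simp [g, hy]
  rw [Λ.eval_eq_integral_ind hs hg hgc hgf hgK, Λ'.eval_eq_integral_ind hs' hg hgc hgf hgK]
  congr 1
  refine integral_congr_ae (Eventually.of_forall fun w => ?_)
  by_cases hw : dbar g w = 0
  · simp [hw]
  · have hwK : w ∉ K := fun h => hw (hgK.self_of_nhdsSet w h)
    have hw0 : w ≠ 0 := fun h => h0 (h ▸ hχU (hsupp (tsupport_dbar_subset g
      (subset_tsupport _ hw))))
    simp only [hind w hw0 hwK]

/-! ### Integrals over products of chains -/

lemma ae_pi_mem {n : ℕ} (Λ : Fin n → Chain) :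
    ∀ᵐ x ∂Measure.pi fun j => (Λ j).meas, ∀ j, (x j).1 ∈ (Λ j).supp ∧ ‖(x j).2‖ ≤ (Λ j).bound :=
  ae_all_iff.2 fun j => (Measure.tendsto_eval_ae_ae (μ := fun j => (Λ j).meas) (i := j)).eventually
    (Λ j).ae_mem

lemma integrable_iint {n : ℕ} (Λ : Fin n → Chain) {F : (Fin n → ℂ) → ℂ}
    (hF : ContinuousOn F (univ.pi fun j => (Λ j).supp)) :
    Integrable (fun x : Fin n → ℂ × ℂ => F (fun j => (x j).1) * ∏ j, (x j).2)
      (Measure.pi fun j => (Λ j).meas) := by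
  have hc : IsCompact (univ.pi fun j => (Λ j).supp) := isCompact_univ_pi fun j => (Λ j).isCompact
  have hm1 : Measurable fun (x : Fin n → ℂ × ℂ) (j : Fin n) => (x j).1 := by fun_prop
  have hm : MeasurableSet {x : Fin n → ℂ × ℂ | (fun j => (x j).1) ∈ univ.pi fun j => (Λ j).supp} :=
    hm1 hc.isClosed.measurableSet
  have hae := ae_pi_mem Λ
  have haes : AEStronglyMeasurable (fun x : Fin n → ℂ × ℂ => F (fun j => (x j).1))
      (Measure.pi fun j => (Λ j).meas) := by
    rw [← Measure.restrict_eq_self_of_ae_mem (hae.mono fun x hx =>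
      (show x ∈ {x : Fin n → ℂ × ℂ | (fun j => (x j).1) ∈ univ.pi fun j => (Λ j).supp} from
        fun j _ => (hx j).1))]
    exact ContinuousOn.aestronglyMeasurable
      (s := {x : Fin n → ℂ × ℂ | (fun j => (x j).1) ∈ univ.pi fun j => (Λ j).supp})
      (hF.comp (by fun_prop) fun x hx => hx) hm
  obtain ⟨B, hB⟩ := hc.exists_bound_of_continuousOn hF
  refine Integrable.of_bound (haes.mul (Measurable.aestronglyMeasurable (by fun_prop)))
    (B * ∏ j, (Λ j).bound) ?_
  filter_upwards [hae] with x hx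
  rw [norm_mul, norm_prod]
  have h1 := hB (fun j => (x j).1) fun j _ => (hx j).1
  exact mul_le_mul h1 (Finset.prod_le_prod (fun _ _ => norm_nonneg _) fun j _ => (hx j).2)
    (Finset.prod_nonneg fun _ _ => norm_nonneg _) ((norm_nonneg _).trans h1)

/-- Fubini: the integration over the `j`-th variable is performed first. -/
lemma iint_eq_integral_eval {n : ℕ} (Λ : Fin (n + 1) → Chain) (j : Fin (n + 1))
    {F : (Fin (n + 1) → ℂ) → ℂ} (hF : ContinuousOn F (univ.pi fun j => (Λ j).supp)) :
    iint Λ F = ∫ y : Fin n → ℂ × ℂ,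
      (∏ k, (y k).2) * (Λ j).eval (fun x => F (j.insertNth x fun k => (y k).1))
      ∂Measure.pi fun k => (Λ (j.succAbove k)).meas := by
  have hmp := measurePreserving_piFinSuccAbove (fun j => (Λ j).meas) j
  have hint := integrable_iint Λ hF
  let G : (ℂ × ℂ) × (Fin n → ℂ × ℂ) → ℂ := fun x =>
    F (j.insertNth x.1.1 fun k => (x.2 k).1) * (x.1.2 * ∏ k, (x.2 k).2)
  have hG : (fun x : Fin (n + 1) → ℂ × ℂ => F (fun j => (x j).1) * ∏ j, (x j).2) =
      G ∘ MeasurableEquiv.piFinSuccAbove (fun _ => ℂ × ℂ) j := by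
    funext x
    have h1 : (fun i => (x i).1) = j.insertNth (x j).1 fun k => (x (j.succAbove k)).1 := by
      funext i
      refine Fin.succAboveCases j ?_ (fun k => ?_) i <;> simp
    simp only [Function.comp, G, MeasurableEquiv.piFinSuccAbove_apply, Fin.insertNthEquiv_symm_apply,
      Fin.removeNth]
    rw [h1, Fin.prod_univ_succAbove _ j]
  have hi := hmp.integral_comp (MeasurableEquiv.measurableEmbedding _) G
  rw [iint, hG]
  refine Eq.trans hi ?_
  rw [hG, hmp.integrable_comp_emb (MeasurableEquiv.measurableEmbedding _)] at hint
  rw [integral_prod_symm _ hint]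
  refine integral_congr_ae (Eventually.of_forall fun y => ?_)
  simp only [G, eval, ← integral_const_mul]
  exact integral_congr_ae (Eventually.of_forall fun x => by ring)

/-- Two integrals over products of chains agree if the chains agree in all variables but one, and
the one-dimensional integrals over the remaining variable agree. -/
lemma iint_eq_of_eval_eq {n : ℕ} {Λ Λ' : Fin (n + 1) → Chain} (j : Fin (n + 1))
    (hΛ : ∀ k, k ≠ j → Λ' k = Λ k) {F F' : (Fin (n + 1) → ℂ) → ℂ}
    (hF : ContinuousOn F (univ.pi fun j => (Λ j).supp))
    (hF' : ContinuousOn F' (univ.pi fun j => (Λ' j).supp))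
    (h : ∀ z : Fin n → ℂ, (∀ k, z k ∈ (Λ (j.succAbove k)).supp) →
      (Λ j).eval (fun x => F (j.insertNth x z)) = (Λ' j).eval (fun x => F' (j.insertNth x z))) :
    iint Λ F = iint Λ' F' := by
  rw [iint_eq_integral_eval Λ j hF, iint_eq_integral_eval Λ' j hF']
  have e : (fun k => Λ' (j.succAbove k)) = fun k => Λ (j.succAbove k) :=
    funext fun k => hΛ _ (Fin.succAbove_ne j k)
  have e' : (fun k => (Λ' (j.succAbove k)).meas) = fun k => (Λ (j.succAbove k)).meas :=
    funext fun k => by rw [hΛ _ (Fin.succAbove_ne j k)]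
  rw [e']
  refine integral_congr_ae ?_
  filter_upwards [ae_pi_mem fun k => Λ (j.succAbove k)] with y hy
  simp only [h (fun k => (y k).1) fun k => (hy k).1]

/-- Contour deformation in all variables at once: a quotient `N / D` of functions that are
holomorphic in each variable, whose denominator has no zero on `Kⁿ`, has the same integral over
`Λⁿ` and `Λ'ⁿ` if the winding numbers of the two chains agree off `K`. -/
theorem iint_const_eq_of_ind_eq {n : ℕ} {Λ Λ' : Chain} {K : Set ℂ} (hK : IsCompact K)
    (h0 : (0 : ℂ) ∉ K) (hs : Λ.supp ⊆ K) (hs' : Λ'.supp ⊆ K)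
    (hind : ∀ w, w ≠ 0 → w ∉ K → Λ.ind w = Λ'.ind w) {N D : (Fin n → ℂ) → ℂ}
    (hN : ContinuousOn N {z | ∀ j, z j ≠ 0}) (hD : ContinuousOn D {z | ∀ j, z j ≠ 0})
    (hN' : ∀ (z : Fin n → ℂ) (j : Fin n), (∀ j, z j ≠ 0) →
      DifferentiableOn ℂ (fun x => N (Function.update z j x)) {0}ᶜ)
    (hD' : ∀ (z : Fin n → ℂ) (j : Fin n), (∀ j, z j ≠ 0) →
      DifferentiableOn ℂ (fun x => D (Function.update z j x)) {0}ᶜ)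
    (hD0 : ∀ z, (∀ j, z j ∈ K) → D z ≠ 0) :
    iint (fun _ : Fin n => Λ) (fun z => N z / D z) =
      iint (fun _ : Fin n => Λ') (fun z => N z / D z) := by
  have hne : ∀ {x}, x ∈ K → x ≠ 0 := fun hx h => h0 (h ▸ hx)
  have hcont : ContinuousOn (fun z => N z / D z) (univ.pi fun _ => K) := by
    have hsub : (univ.pi fun _ : Fin n => K) ⊆ {z | ∀ j, z j ≠ 0} := fun z hz j =>
      hne (hz j (mem_univ j))
    exact (hN.mono hsub).div (hD.mono hsub) fun z hz => hD0 z fun j => hz j (mem_univ j)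
  -- the hybrid families, in which the first `a` chains have been replaced
  let H : ℕ → Fin n → Chain := fun a j => if (j : ℕ) < a then Λ' else Λ
  have hH : ∀ a j, (H a j).supp ⊆ K := fun a j => by dsimp only [H]; split_ifs <;> assumption
  have hcH : ∀ a, ContinuousOn (fun z => N z / D z) (univ.pi fun j => (H a j).supp) := fun a =>
    hcont.mono (Set.pi_mono fun j _ => hH a j)
  have step : ∀ a, a ≤ n → iint (H 0) (fun z => N z / D z) = iint (H a) (fun z => N z / D z) := by
    intro a
    induction a with
    | zero => intro _; rfl
    | succ a ih =>
      intro ha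
      rw [ih (by omega)]
      obtain ⟨n, rfl⟩ : ∃ n', n = n' + 1 := ⟨n - 1, by omega⟩
      let j : Fin (n + 1) := ⟨a, by omega⟩
      have hj : H a j = Λ := if_neg (lt_irrefl a)
      have hj' : H (a + 1) j = Λ' := if_pos (Nat.lt_succ_self a)
      refine iint_eq_of_eval_eq j (fun k hk => ?_) (hcH a) (hcH (a + 1)) fun z hz => ?_
      · have : (k : ℕ) ≠ a := fun h => hk (Fin.ext h)
        dsimp only [H]
        congr 1
        exact propext ⟨fun h => by omega, fun h => by omega⟩
      · rw [hj, hj']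
        have hzK : ∀ k, z k ∈ K := fun k => hH _ _ (hz k)
        have hzu : ∀ x, j.insertNth x z = Function.update (j.insertNth 1 z : Fin (n + 1) → ℂ) j x :=
          fun x => (Fin.update_insertNth (α := fun _ => ℂ) j (1 : ℂ) x z).symm
        have hz1 : ∀ i, (j.insertNth 1 z : Fin (n + 1) → ℂ) i ≠ 0 := by
          intro i
          refine Fin.succAboveCases j ?_ (fun k => ?_) i
          · simp
          · simpa using hne (hzK k)
        have hNd := hN' _ j hz1
        have hDd := hD' _ j hz1
        simp only [← hzu] at hNd hDd
        have hopen : IsOpen {x : ℂ | x ≠ 0 ∧ D (j.insertNth x z) ≠ 0} := by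
          have := hDd.continuousOn.isOpen_inter_preimage isOpen_compl_singleton
            (isOpen_compl_singleton (x := (0 : ℂ)))
          exact this
        refine eval_eq_of_ind_eq hK hopen (fun x hx => ⟨hne hx, hD0 _ fun i => ?_⟩)
          (fun h => h.1 rfl) hs hs' hind ?_
        · refine Fin.succAboveCases j ?_ (fun k => ?_) i
          · simpa using hx
          · simpa using hzK k
        · exact (hNd.mono fun x hx => hx.1).div (hDd.mono fun x hx => hx.1) fun x hx => hx.2
  have h1 : H 0 = fun _ => Λ := funext fun j => if_neg (Nat.not_lt_zero _)
  have h2 : H n = fun _ => Λ' := funext fun j => if_pos j.2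
  rw [← h1, ← h2]
  exact step n le_rfl

/-! ### The chain of a cutoff function -/

/-- The chain `-(1/π) (∂χ/∂z̄) / z` of a smooth cutoff function `χ`; its winding number around any
point is the value of `χ` there. -/
def ofCutoff (χ : ℂ → ℂ) (hχ : ContDiff ℝ 1 χ) (hc : HasCompactSupport χ)
    (h0 : (0 : ℂ) ∉ tsupport (dbar χ)) : Chain where
  meas := (volume.restrict (tsupport (dbar χ))).map fun w => (w, -(Real.pi : ℂ)⁻¹ * dbar χ w / w)
  supp := tsupport (dbar χ)
  isFiniteMeasure := by
    have hD : IsCompact (tsupport (dbar χ)) :=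
      hc.of_isClosed_subset (isClosed_tsupport _) (tsupport_dbar_subset χ)
    have : IsFiniteMeasure (volume.restrict (tsupport (dbar χ))) :=
      ⟨by rw [Measure.restrict_apply_univ]; exact hD.measure_lt_top⟩
    infer_instance
  isCompact := hc.of_isClosed_subset (isClosed_tsupport _) (tsupport_dbar_subset χ)
  zero_notMem := h0
  bound := Classical.choose ((show IsCompact (tsupport (dbar χ)) from
    hc.of_isClosed_subset (isClosed_tsupport _)
      (tsupport_dbar_subset χ)).exists_bound_of_continuousOn
      (f := fun w => -(Real.pi : ℂ)⁻¹ * dbar χ w / w)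
      ((continuous_const.mul (continuous_dbar hχ)).continuousOn.div continuousOn_id
        fun w hw h => h0 (by simpa [show w = 0 from h] using hw)))
  ae_mem := by
    have hm := (continuous_dbar hχ).measurable
    have hD : IsClosed (tsupport (dbar χ)) := isClosed_tsupport _
    generalize_proofs hb
    have hm' : Measurable fun w => (w, -(Real.pi : ℂ)⁻¹ * dbar χ w / w) := by fun_prop
    have hms : MeasurableSet {x : ℂ × ℂ | x.1 ∈ tsupport (dbar χ) ∧ ‖x.2‖ ≤ Classical.choose hb} :=
      (measurable_fst hD.measurableSet).inter (measurableSet_le measurable_snd.norm measurable_const)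
    rw [ae_map_iff hm'.aemeasurable hms]
    filter_upwards [ae_restrict_mem hD.measurableSet] with w hw
    exact ⟨hw, Classical.choose_spec hb w hw⟩

lemma ind_ofCutoff {χ : ℂ → ℂ} (hχ : ContDiff ℝ 1 χ) (hc : HasCompactSupport χ)
    (h0 : (0 : ℂ) ∉ tsupport (dbar χ)) (w : ℂ) : (ofCutoff χ hχ hc h0).ind w = χ w := by
  have hm := (continuous_dbar hχ).measurable
  have hm' : Measurable fun w => (w, -(Real.pi : ℂ)⁻¹ * dbar χ w / w) := by fun_prop
  have hπ : (Real.pi : ℂ) ≠ 0 := by exact_mod_cast Real.pi_ne_zero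
  rw [ind, eval, ofCutoff, integral_map hm'.aemeasurable
    (Measurable.aestronglyMeasurable (by fun_prop))]
  have e : ∀ z ∈ tsupport (dbar χ), z / (z - w) * (-(Real.pi : ℂ)⁻¹ * dbar χ z / z) =
      -(Real.pi : ℂ)⁻¹ * (dbar χ z / (z - w)) := fun z hz => by
    have hz0 : z ≠ 0 := fun h => h0 (by simpa [h] using hz)
    field_simp
  rw [setIntegral_congr_fun (isClosed_tsupport _).measurableSet e, integral_const_mul,
    setIntegral_eq_integral_of_forall_compl_eq_zero fun z hz => by
      rw [image_eq_zero_of_notMem_tsupport hz, zero_div], integral_dbar_div hχ hc]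
  field_simp

end Chain

namespace Contour

/-! ### The chain of a contour -/

lemma isCompact_support (C : Contour) : IsCompact C.support :=
  isCompact_iUnion fun i => isCompact_Icc.image (C.contDiff i).continuous

lemma path_mem_support (C : Contour) (i : Fin C.size) {x : ℝ} (hx : x ∈ Icc (0 : ℝ) 1) :
    C.path i x ∈ C.support := mem_iUnion.2 ⟨i, x, hx, rfl⟩

lemma zero_notMem_support (C : Contour) : (0 : ℂ) ∉ C.support := fun h => by
  obtain ⟨i, x, hx, h⟩ := mem_iUnion.1 h
  exact C.ne_zero i x hx h

lemma continuous_deriv_path (C : Contour) (i : Fin C.size) : Continuous (deriv (C.path i)) :=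
  (C.contDiff i).continuous_deriv le_rfl

/-- The density of `dz / (2πiz)` along the `i`-th curve, with its multiplicity. -/
def weight (C : Contour) (i : Fin C.size) (x : ℝ) : ℂ :=
  C.mult i * (deriv (C.path i) x / (2 * Real.pi * Complex.I * C.path i x))

lemma measurable_weight (C : Contour) (i : Fin C.size) : Measurable (C.weight i) := by
  have h1 := (C.continuous_deriv_path i).measurable
  have h2 := (C.contDiff i).continuous.measurable
  unfold weight
  fun_prop

lemma measurable_param (C : Contour) :
    Measurable fun x : Fin C.size × ℝ => (C.path x.1 x.2, C.weight x.1 x.2) :=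
  measurable_from_prod_countable_right fun i =>
    (C.contDiff i).continuous.measurable.prodMk (C.measurable_weight i)

lemma continuousOn_weight (C : Contour) (i : Fin C.size) : ContinuousOn (C.weight i) (Icc 0 1) := by
  have h1 := C.continuous_deriv_path i
  have h2 := (C.contDiff i).continuous
  unfold weight
  refine continuousOn_const.mul (h1.continuousOn.div (by fun_prop) fun x hx => ?_)
  exact mul_ne_zero Complex.two_pi_I_ne_zero (C.ne_zero i x hx)

lemma exists_weight_bound (C : Contour) :
    ∃ M : ℝ, ∀ i, ∀ x ∈ Icc (0 : ℝ) 1, ‖C.weight i x‖ ≤ M := by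
  choose M hM using fun i =>
    isCompact_Icc.exists_bound_of_continuousOn (C.continuousOn_weight i)
  exact ⟨∑ i, |M i|, fun i x hx => (hM i x hx).trans ((le_abs_self _).trans
    (Finset.single_le_sum (f := fun i => |M i|) (fun _ _ => abs_nonneg _) (Finset.mem_univ i)))⟩

/-- The parameter measure of a contour. -/
def paramMeasure (C : Contour) : Measure (Fin C.size × ℝ) :=
  Measure.count.prod (volume.restrict (Icc 0 1))

instance (C : Contour) : IsFiniteMeasure C.paramMeasure := by unfold paramMeasure; infer_instance

lemma ae_paramMeasure (C : Contour) : ∀ᵐ x ∂C.paramMeasure, x.2 ∈ Icc (0 : ℝ) 1 :=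
  (Measure.quasiMeasurePreserving_snd (μ := Measure.count)
    (ν := volume.restrict (Icc (0 : ℝ) 1))).ae (ae_restrict_mem measurableSet_Icc)

/-- A contour as a chain, with the weight `dz / (2πiz)`. -/
def chain (C : Contour) : Chain where
  meas := C.paramMeasure.map fun x => (C.path x.1 x.2, C.weight x.1 x.2)
  supp := C.support
  isFiniteMeasure := inferInstance
  isCompact := C.isCompact_support
  zero_notMem := C.zero_notMem_support
  bound := Classical.choose C.exists_weight_bound
  ae_mem := by
    have hms : MeasurableSet {x : ℂ × ℂ | x.1 ∈ C.support ∧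
        ‖x.2‖ ≤ Classical.choose C.exists_weight_bound} :=
      (measurable_fst C.isCompact_support.isClosed.measurableSet).inter
        (measurableSet_le measurable_snd.norm measurable_const)
    rw [ae_map_iff C.measurable_param.aemeasurable hms]
    filter_upwards [C.ae_paramMeasure] with x hx
    exact ⟨C.path_mem_support _ hx, Classical.choose_spec C.exists_weight_bound _ _ hx⟩

lemma chain_eval (C : Contour) {f : ℂ → ℂ} (hf : ContinuousOn f C.support) :
    C.chain.eval f = (2 * Real.pi * Complex.I)⁻¹ * C.integral fun z => f z / z := by
  have hint := C.chain.integrable_eval hf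
  have hint' : Integrable (fun x : Fin C.size × ℝ => f (C.path x.1 x.2) * C.weight x.1 x.2)
      C.paramMeasure := hint.comp_measurable C.measurable_param
  have e : C.chain.eval f = ∫ x : Fin C.size × ℝ, f (C.path x.1 x.2) * C.weight x.1 x.2
      ∂C.paramMeasure := integral_map C.measurable_param.aemeasurable hint.1
  rw [e, paramMeasure, integral_prod _ hint', integral_fintype (by simp [Integrable.of_finite]),
    integral, Finset.mul_sum]
  refine Finset.sum_congr rfl fun i _ => ?_
  rw [intervalIntegral.integral_of_le zero_le_one, integral_Icc_eq_integral_Ioc,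
    ← integral_const_mul, ← integral_const_mul]
  simp only [measureReal_def, Measure.count_singleton, ENNReal.toReal_one, one_smul]
  refine integral_congr_ae (Eventually.of_forall fun x => ?_)
  simp only [weight]
  ring

lemma chain_ind (C : Contour) {w : ℂ} (hw : w ∉ C.support) : C.chain.ind w = C.index w := by
  have hne : ∀ z ∈ C.support, z - w ≠ 0 := fun z hz h => hw (by rwa [← sub_eq_zero.1 h])
  rw [Chain.ind, chain_eval, index]
  · congr 1
    unfold integral
    refine Finset.sum_congr rfl fun i _ => ?_
    congr 1
    refine intervalIntegral.integral_congr fun x hx => ?_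
    rw [uIcc_of_le zero_le_one] at hx
    have h0 := C.ne_zero i x hx
    have h1 := hne _ (C.path_mem_support i hx)
    simp only
    field_simp
  · exact continuousOn_id.div (by fun_prop) hne

lemma integralPow_eq_iint (C : Contour) {n : ℕ} {F : (Fin n → ℂ) → ℂ}
    (hF : ContinuousOn F (univ.pi fun _ => C.support)) :
    C.integralPow n F = Chain.iint (fun _ => C.chain) F := by
  have hint := Chain.integrable_iint (fun _ : Fin n => C.chain) hF
  let φ : (Fin n → Fin C.size × ℝ) → Fin n → ℂ × ℂ := fun x j =>
    (C.path (x j).1 (x j).2, C.weight (x j).1 (x j).2)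
  have hφm : Measurable φ := measurable_pi_lambda _ fun j =>
    C.measurable_param.comp (measurable_pi_apply j)
  have hmap : (Measure.pi fun _ : Fin n => C.chain.meas) =
      (Measure.pi fun _ : Fin n => C.paramMeasure).map φ :=
    (Measure.pi_map_pi (μ := fun _ : Fin n => C.paramMeasure)
      (f := fun _ x => (C.path x.1 x.2, C.weight x.1 x.2))
      (hμ := fun _ => (inferInstance : SigmaFinite C.chain.meas))
      fun _ => C.measurable_param.aemeasurable).symm
  let e := MeasurableEquiv.arrowProdEquivProdArrow (Fin C.size) ℝ (Fin n)
  have hmp := measurePreserving_arrowProdEquivProdArrow (Fin C.size) ℝ (Fin n)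
    (fun _ => Measure.count) (fun _ => volume.restrict (Icc (0 : ℝ) 1))
  let G : (Fin n → Fin C.size) × (Fin n → ℝ) → ℂ := fun x =>
    F (fun j => C.path (x.1 j) (x.2 j)) * ∏ j, C.weight (x.1 j) (x.2 j)
  have hGe : (fun x : Fin n → Fin C.size × ℝ =>
      F (fun j => (φ x j).1) * ∏ j, (φ x j).2) = G ∘ e := rfl
  rw [hmap] at hint
  have hint' := hint.comp_measurable hφm
  change Integrable (G ∘ e) _ at hint'
  have h1 : Chain.iint (fun _ : Fin n => C.chain) F =
      ∫ x, (G ∘ e) x ∂(Measure.pi fun _ : Fin n => C.paramMeasure) := by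
    rw [Chain.iint, hmap, integral_map hφm.aemeasurable hint.1]
    rfl
  have h2 := hmp.integral_comp (MeasurableEquiv.measurableEmbedding e) G
  have h3 : Integrable G ((Measure.pi fun _ : Fin n => Measure.count).prod
      (Measure.pi fun _ : Fin n => volume.restrict (Icc (0 : ℝ) 1))) :=
    (hmp.integrable_comp_emb (MeasurableEquiv.measurableEmbedding e)).1 hint'
  rw [h1]
  refine Eq.trans ?_ h2.symm
  rw [integral_prod _ h3, integral_fintype (by simp [Integrable.of_finite]), integralPow]
  refine Finset.sum_congr rfl fun a _ => ?_
  have hs : (Measure.pi fun _ : Fin n => (Measure.count : Measure (Fin C.size))).real {a} = 1 := by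
    rw [measureReal_def, Measure.pi_singleton]; simp
  have hI : (volume : Measure (Fin n → ℝ)).restrict (Icc 0 1) =
      Measure.pi fun _ : Fin n => volume.restrict (Icc (0 : ℝ) 1) := by
    rw [← Measure.restrict_pi_pi, ← volume_pi, pi_univ_Icc]; rfl
  rw [hs, one_smul, ← integral_const_mul, hI]
  refine integral_congr_ae (Eventually.of_forall fun x => ?_)
  simp only [G, weight, Finset.prod_mul_distrib]
  ring

/-! ### Winding numbers -/

/-- Winding numbers are locally constant: the derivative of `(z - w)⁻¹` in `w` is a derivative
in `z`, which integrates to zero along closed curves. -/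
lemma hasDerivAt_index (C : Contour) {w : ℂ} (hw : w ∉ C.support) :
    HasDerivAt C.index 0 w := by
  have hopen : IsOpen C.supportᶜ := C.isCompact_support.isClosed.isOpen_compl
  obtain ⟨ε, hε, hball⟩ := Metric.isOpen_iff.1 hopen w hw
  have hfar : ∀ i, ∀ x ∈ Icc (0 : ℝ) 1, ∀ u ∈ Metric.ball w (ε / 2), ε / 2 ≤ ‖C.path i x - u‖ := by
    intro i x hx u hu
    by_contra! h
    refine hball ?_ (C.path_mem_support i hx)
    rw [Metric.mem_ball, dist_eq_norm] at hu ⊢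
    calc ‖C.path i x - w‖ = ‖(C.path i x - u) + (u - w)‖ := by ring_nf
      _ ≤ _ := norm_add_le _ _
      _ < ε := by linarith
  have hi : ∀ i, HasDerivAt (fun w => ∫ x in (0 : ℝ)..1, (C.path i x - w)⁻¹ * deriv (C.path i) x)
      0 w := by
    intro i
    obtain ⟨B, hB⟩ := (isCompact_Icc (a := (0 : ℝ)) (b := 1)).exists_bound_of_continuousOn
      (C.continuous_deriv_path i).continuousOn
    have hdp := C.continuous_deriv_path i
    have hp := (C.contDiff i).continuous
    have hmeas : ∀ u, AEStronglyMeasurable (fun x => (C.path i x - u)⁻¹ * deriv (C.path i) x)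
        (volume.restrict (uIoc (0 : ℝ) 1)) := fun u => by
      have := hdp.measurable
      have := hp.measurable
      exact Measurable.aestronglyMeasurable (by fun_prop)
    have hmeas' : AEStronglyMeasurable
        (fun x => ((C.path i x - w) ^ 2)⁻¹ * deriv (C.path i) x)
        (volume.restrict (uIoc (0 : ℝ) 1)) := by
      have := hdp.measurable
      have := hp.measurable
      exact Measurable.aestronglyMeasurable (by fun_prop)
    have hsub : uIoc (0 : ℝ) 1 ⊆ Icc 0 1 := by rw [uIoc_of_le zero_le_one]; exact Ioc_subset_Icc_self
    have hne : ∀ x ∈ Icc (0 : ℝ) 1, ∀ u ∈ Metric.ball w (ε / 2), C.path i x - u ≠ 0 :=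
      fun x hx u hu h => by
        have := hfar i x hx u hu; rw [h, norm_zero] at this; linarith
    have hw' : w ∈ Metric.ball w (ε / 2) := Metric.mem_ball_self (by linarith)
    have hcont : ContinuousOn (fun x => (C.path i x - w)⁻¹ * deriv (C.path i) x) (Icc 0 1) :=
      ((hp.continuousOn.sub continuousOn_const).inv₀ fun x hx => hne x hx w hw').mul hdp.continuousOn
    have key := intervalIntegral.hasDerivAt_integral_of_dominated_loc_of_deriv_le
      (μ := volume) (a := (0 : ℝ)) (b := 1)
      (F := fun u x => (C.path i x - u)⁻¹ * deriv (C.path i) x)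
      (F' := fun u x => ((C.path i x - u) ^ 2)⁻¹ * deriv (C.path i) x)
      (bound := fun _ => ((ε / 2) ^ 2)⁻¹ * B) (x₀ := w) (s := Metric.ball w (ε / 2))
      (Metric.isOpen_ball.mem_nhds hw') (Eventually.of_forall hmeas)
      (by
        refine ContinuousOn.intervalIntegrable ?_
        rwa [uIcc_of_le zero_le_one])
      hmeas'
      (Eventually.of_forall fun x hx u hu => by
        rw [norm_mul, norm_inv, norm_pow]
        have h1 := hfar i x (hsub hx) u hu
        have h2 := hB x (hsub hx)
        gcongr)
      intervalIntegrable_const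
      (Eventually.of_forall fun x hx u hu => by
        have h1 := hne x (hsub hx) u hu
        have h2 := ((hasDerivAt_id u).const_sub (C.path i x)).inv h1
        convert! h2.mul_const (deriv (C.path i) x) using 1
        simp [div_eq_mul_inv])
    have hz : ∫ x in (0 : ℝ)..1, ((C.path i x - w) ^ 2)⁻¹ * deriv (C.path i) x = 0 := by
      rw [intervalIntegral.integral_eq_sub_of_hasDerivAt (f := fun x => -(C.path i x - w)⁻¹)]
      · simp [C.closed i]
      · intro x hx
        rw [uIcc_of_le zero_le_one] at hx
        have h1 : HasDerivAt (C.path i) (deriv (C.path i) x) x :=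
          ((C.contDiff i).differentiable one_ne_zero x).hasDerivAt
        have h2 := ((h1.sub_const w).inv (hne x hx w hw')).neg
        convert! h2 using 1
        rw [neg_div, neg_neg, div_eq_mul_inv, mul_comm]
      · refine ContinuousOn.intervalIntegrable ?_
        rw [uIcc_of_le zero_le_one]
        exact (((hp.continuousOn.sub continuousOn_const).pow 2).inv₀ fun x hx =>
          pow_ne_zero 2 (hne x hx w hw')).mul hdp.continuousOn
    rw [hz] at key
    exact key.2
  have hsum := (HasDerivAt.fun_sum (u := Finset.univ) fun i _ =>
    (hi i).const_mul (C.mult i : ℂ)).const_mul (2 * Real.pi * Complex.I : ℂ)⁻¹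
  rw [show C.index = fun w => (2 * Real.pi * Complex.I)⁻¹ * ∑ i, (C.mult i : ℂ) *
    ∫ x in (0 : ℝ)..1, (C.path i x - w)⁻¹ * deriv (C.path i) x from rfl]
  simpa only [mul_zero, Finset.sum_const_zero] using hsum

lemma eventually_index_eq (C : Contour) {w : ℂ} (hw : w ∉ C.support) :
    ∀ᶠ u in 𝓝 w, u ∉ C.support ∧ C.index u = C.index w := by
  have hopen : IsOpen C.supportᶜ := C.isCompact_support.isClosed.isOpen_compl
  obtain ⟨ε, hε, hball⟩ := Metric.isOpen_iff.1 hopen w hw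
  filter_upwards [Metric.ball_mem_nhds w hε] with u hu
  refine ⟨hball hu, ?_⟩
  refine Convex.is_const_of_fderivWithin_eq_zero (𝕜 := ℂ) (convex_ball w ε) ?_ ?_ hu
    (Metric.mem_ball_self hε)
  · exact fun x hx => (C.hasDerivAt_index (hball hx)).differentiableAt.differentiableWithinAt
  · intro x hx
    have h := (C.hasDerivAt_index (hball hx)).hasFDerivAt.hasFDerivWithinAt (s := Metric.ball w ε)
    rw [h.fderivWithin (Metric.isOpen_ball.uniqueDiffWithinAt hx)]
    ext; simp

/-- The winding number is constant on connected sets off the contour. -/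
lemma index_eq_of_isPreconnected (C : Contour) {s : Set ℂ} (hs : IsPreconnected s)
    (h : ∀ w ∈ s, w ∉ C.support) {u w : ℂ} (hu : u ∈ s) (hw : w ∈ s) : C.index u = C.index w := by
  have hU : IsOpen {x | x ∉ C.support ∧ C.index x = C.index w} := isOpen_iff_mem_nhds.2 fun x hx => by
    filter_upwards [C.eventually_index_eq hx.1] with y hy
    exact ⟨hy.1, hy.2.trans hx.2⟩
  have hV : IsOpen {x | x ∉ C.support ∧ C.index x ≠ C.index w} := isOpen_iff_mem_nhds.2 fun x hx => by
    filter_upwards [C.eventually_index_eq hx.1] with y hy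
    exact ⟨hy.1, fun h => hx.2 (hy.2.symm.trans h)⟩
  refine (hs.subset_left_of_subset_union hU hV
    (disjoint_left.2 fun x hx hx' => hx'.2 hx.2) (fun x hx => ?_) ⟨w, hw, h w hw, rfl⟩ hu).2
  by_cases hx' : C.index x = C.index w
  · exact Or.inl ⟨h x hx, hx'⟩
  · exact Or.inr ⟨h x hx, hx'⟩

/-- Far away the winding number vanishes. -/
lemma exists_index_eq_zero (C : Contour) :
    ∃ R : ℝ, 0 < R ∧ ∀ w, R < ‖w‖ → w ∉ C.support ∧ C.index w = 0 := by
  obtain ⟨R, hR0, hR⟩ : ∃ R : ℝ, 0 < R ∧ ∀ w ∈ C.support, ‖w‖ ≤ R := by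
    obtain ⟨R, hR⟩ := C.isCompact_support.isBounded.exists_norm_le
    exact ⟨max R 1, by positivity, fun w hw => (hR w hw).trans (le_max_left _ _)⟩
  have hoff : ∀ w, R < ‖w‖ → w ∉ C.support := fun w hw h => absurd (hR w h) (not_le.2 hw)
  refine ⟨R, hR0, fun w hw => ⟨hoff w hw, ?_⟩⟩
  have hw0 : w ≠ 0 := fun h => by rw [h, norm_zero] at hw; linarith
  -- the winding number is constant along the ray through `w`, and tends to zero there
  have hray : ∀ s : ℝ, 1 ≤ s → C.index (s * w) = C.index w := fun s hs => by
    refine C.index_eq_of_isPreconnected (s := (fun s : ℝ => (s : ℂ) * w) '' Ici 1)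
      (isPreconnected_Ici.image _ (by fun_prop)) ?_ ⟨s, hs, rfl⟩ ⟨1, by simp, by simp⟩
    rintro _ ⟨r, hr, rfl⟩
    refine hoff _ ?_
    rw [norm_mul, Complex.norm_real, Real.norm_of_nonneg (zero_le_one.trans hr)]
    nlinarith [norm_nonneg w, show (1 : ℝ) ≤ r from hr]
  have hlim : Tendsto (fun s : ℝ => C.index (s * w)) atTop (𝓝 0) := by
    have hev : ∀ᶠ s : ℝ in atTop, C.index (s * w) = C.chain.eval fun z => z / (z - s * w) := by
      filter_upwards [eventually_ge_atTop 1] with s hs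
      rw [← C.chain_ind, Chain.ind]
      refine hoff _ ?_
      rw [norm_mul, Complex.norm_real, Real.norm_of_nonneg (zero_le_one.trans hs)]
      nlinarith [norm_nonneg w]
    rw [tendsto_congr' hev]
    have h0 : ∫ x : ℂ × ℂ, (0 : ℂ) ∂C.chain.meas = 0 := by simp
    rw [← h0]
    have hbn : ∀ s : ℝ, 1 ≤ s → ∀ z ∈ C.support, (s - 1) * ‖w‖ < ‖z - s * w‖ := fun s hs z hz => by
      have h1 := norm_sub_norm_le ((s : ℂ) * w) z
      rw [norm_mul, Complex.norm_real, Real.norm_of_nonneg (zero_le_one.trans hs),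
        norm_sub_rev] at h1
      linarith [hR z hz]
    refine tendsto_integral_filter_of_dominated_convergence
      (fun _ => R / ‖w‖ * C.chain.bound) ?_ ?_ (integrable_const _) ?_
    · filter_upwards [] with s
      exact Measurable.aestronglyMeasurable (by fun_prop)
    · filter_upwards [eventually_ge_atTop 2] with s hs
      filter_upwards [C.chain.ae_mem] with x hx
      have h1 := hbn s (by linarith) x.1 hx.1
      have h2 : ‖w‖ ≤ ‖x.1 - s * w‖ := by nlinarith [norm_nonneg w]
      have h3 : 0 < ‖w‖ := norm_pos_iff.2 hw0
      rw [norm_mul, norm_div]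
      have := hR _ hx.1
      have := hx.2
      gcongr
    · filter_upwards [C.chain.ae_mem] with x hx
      rw [show (0 : ℂ) = 0 * x.2 by simp]
      refine Tendsto.mul_const _ ?_
      rw [tendsto_zero_iff_norm_tendsto_zero]
      have h4 : Tendsto (fun s : ℝ => R / ((s - 1) * ‖w‖)) atTop (𝓝 0) :=
        tendsto_const_nhds.div_atTop
          ((tendsto_atTop_add_const_right _ (-1) tendsto_id).atTop_mul_const (norm_pos_iff.2 hw0))
      refine squeeze_zero' (Eventually.of_forall fun s => norm_nonneg _) ?_ h4
      filter_upwards [eventually_gt_atTop 1] with s hs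
      have h1 := hbn s hs.le x.1 hx.1
      have h3 : 0 < ‖w‖ := norm_pos_iff.2 hw0
      have h5 : 0 < (s - 1) * ‖w‖ := mul_pos (by linarith) h3
      rw [norm_div]
      have := hR _ hx.1
      gcongr
  have := hlim.congr' (f₂ := fun _ => C.index w) (by
    filter_upwards [eventually_ge_atTop 1] with s hs using hray s hs)
  exact tendsto_nhds_unique tendsto_const_nhds this

/-! ### Exceptional sets of measure zero -/

lemma countable_setOf_path_eq (C : Contour) (i : Fin C.size) (w : ℂ) :
    {x | C.path i x = w ∧ deriv (C.path i) x ≠ 0}.Countable := by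
  set S := {x | C.path i x = w ∧ deriv (C.path i) x ≠ 0} with hS
  have : DiscreteTopology S := by
    refine discreteTopology_subtype_iff.2 fun x hx => ?_
    have h1 : HasDerivAt (C.path i) (deriv (C.path i) x) x :=
      ((C.contDiff i).differentiable one_ne_zero x).hasDerivAt
    have h2 := h1.eventually_ne (c := w) hx.2
    rw [inf_principal_eq_bot]
    filter_upwards [h2] with y hy hy'
    exact hy hy'.1
  exact countable_of_Lindelof_of_discrete (X := S)

/-- The value of an `n`-fold integral does not see points where a coordinate lies in a countable
set, or where the quotient or the product of two coordinates does: there, up to a null set, a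
derivative of the parametrization vanishes. -/
lemma integralPow_congr (C : Contour) {n : ℕ} {F G : (Fin n → ℂ) → ℂ} {Q : Set ℂ}
    (hQ : Q.Countable)
    (h : ∀ z, (∀ j, z j ∈ C.support) → (∀ j, z j ∉ Q) →
      (∀ j k, j ≠ k → z j / z k ∉ Q ∧ z j * z k ∉ Q) → F z = G z) :
    C.integralPow n F = C.integralPow n G := by
  unfold integralPow
  refine Finset.sum_congr rfl fun a _ => ?_
  congr 1
  have hI : MeasurableSet (Icc (0 : Fin n → ℝ) 1) := measurableSet_Icc
  -- for `j ≠ k`, almost surely the `j`-th point is no prescribed function of the other points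
  have hnull : ∀ (j : Fin n) (φ : (Fin n → ℝ) → ℂ), Measurable φ →
      (∀ x y, (∀ k, k ≠ j → x k = y k) → φ x = φ y) →
      ∀ᵐ x : Fin n → ℝ, C.path (a j) (x j) = φ x → deriv (C.path (a j)) (x j) = 0 := by
    intro j φ hφ hφj
    obtain ⟨n, rfl⟩ : ∃ n', n = n' + 1 := ⟨n - 1, by have := j.2; omega⟩
    have hmp := volume_preserving_piFinSuccAbove (fun _ : Fin (n + 1) => ℝ) j
    let φ' : (Fin n → ℝ) → ℂ := fun y => φ (j.insertNth 0 y)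
    have hφ' : Measurable φ' := by
      refine hφ.comp (measurable_pi_lambda _ fun i => ?_)
      refine Fin.succAboveCases j ?_ (fun k => ?_) i
      · simp
      · simpa using measurable_pi_apply k
    have hp := (C.contDiff (a j)).continuous.measurable
    have hd := (C.continuous_deriv_path (a j)).measurable
    have hms : MeasurableSet {x : ℝ × (Fin n → ℝ) |
        C.path (a j) x.1 = φ' x.2 ∧ deriv (C.path (a j)) x.1 ≠ 0} :=
      (measurableSet_eq_fun (hp.comp measurable_fst) (hφ'.comp measurable_snd)).inter
        ((measurableSet_eq_fun (hd.comp measurable_fst) measurable_const).compl)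
    have h0 : (volume : Measure (ℝ × (Fin n → ℝ))) {x : ℝ × (Fin n → ℝ) |
        C.path (a j) x.1 = φ' x.2 ∧ deriv (C.path (a j)) x.1 ≠ 0} = 0 := by
      rw [Measure.volume_eq_prod, Measure.prod_apply_symm hms]
      refine lintegral_eq_zero_of_ae_eq_zero (Eventually.of_forall fun y => ?_)
      exact (C.countable_setOf_path_eq (a j) (φ' y)).measure_zero _
    have h1 := hmp.quasiMeasurePreserving.ae (p := fun x => C.path (a j) x.1 = φ' x.2 →
      deriv (C.path (a j)) x.1 = 0) (by
        rw [ae_iff]; simpa only [Classical.not_imp] using h0)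
    filter_upwards [h1] with x hx hx'
    refine hx ?_
    simp only [MeasurableEquiv.piFinSuccAbove_apply, Fin.insertNthEquiv_symm_apply, φ']
    rw [hx']
    refine hφj _ _ fun k hk => ?_
    obtain ⟨k, rfl⟩ := Fin.exists_succAbove_eq hk
    simp [Fin.removeNth]
  have hpm : ∀ k, Measurable fun x : Fin n → ℝ => C.path (a k) (x k) := fun k =>
    (C.contDiff (a k)).continuous.measurable.comp (measurable_pi_apply k)
  have A1 : ∀ᵐ x : Fin n → ℝ, ∀ c ∈ Q, ∀ j, C.path (a j) (x j) = c →
      deriv (C.path (a j)) (x j) = 0 :=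
    (ae_ball_iff hQ).2 fun c _ => ae_all_iff.2 fun j =>
      hnull j (fun _ => c) measurable_const fun _ _ _ => rfl
  have A2 : ∀ᵐ x : Fin n → ℝ, ∀ c ∈ Q, ∀ j k, j ≠ k → C.path (a j) (x j) =
      c * C.path (a k) (x k) → deriv (C.path (a j)) (x j) = 0 := by
    refine (ae_ball_iff hQ).2 fun c _ => ae_all_iff.2 fun j => ae_all_iff.2 fun k => ?_
    by_cases hjk : j = k
    · simp [hjk]
    · filter_upwards [hnull j (fun x => c * C.path (a k) (x k)) ((hpm k).const_mul c)
        fun x y hxy => by rw [hxy k fun h => hjk h.symm]] with x hx _ using hx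
  have A3 : ∀ᵐ x : Fin n → ℝ, ∀ c ∈ Q, ∀ j k, j ≠ k → C.path (a j) (x j) =
      c / C.path (a k) (x k) → deriv (C.path (a j)) (x j) = 0 := by
    refine (ae_ball_iff hQ).2 fun c _ => ae_all_iff.2 fun j => ae_all_iff.2 fun k => ?_
    by_cases hjk : j = k
    · simp [hjk]
    · filter_upwards [hnull j (fun x => c / C.path (a k) (x k)) ((hpm k).const_div c)
        fun x y hxy => by rw [hxy k fun h => hjk h.symm]] with x hx _ using hx
  refine setIntegral_congr_ae hI ?_
  filter_upwards [A1, A2, A3] with x h1 h2 h3 hx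
  have hxI : ∀ j, x j ∈ Icc (0 : ℝ) 1 := fun j => ⟨hx.1 j, hx.2 j⟩
  have hne : ∀ j, C.path (a j) (x j) ≠ 0 := fun j => C.ne_zero _ _ (hxI j)
  by_cases hw : ∃ j, deriv (C.path (a j)) (x j) = 0
  · obtain ⟨j, hj⟩ := hw
    have : ∏ j, deriv (C.path (a j)) (x j) / (2 * Real.pi * Complex.I * C.path (a j) (x j)) = 0 :=
      Finset.prod_eq_zero (Finset.mem_univ j) (by rw [hj, zero_div])
    rw [this, mul_zero, mul_zero]
  · push Not at hw
    rw [h _ (fun j => C.path_mem_support _ (hxI j)) (fun j hj => hw j (h1 _ hj j rfl))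
      fun j k hjk => ⟨fun hq => hw j (h2 _ hq j k hjk ?_), fun hq => hw j (h3 _ hq j k hjk ?_)⟩]
    · have := hne k; field_simp
    · have := hne k; field_simp

end Contour

namespace Contour

/-! ### Interior and exterior of a contour -/

/-- The contour together with all points of nonzero winding number. -/
def hull (C : Contour) : Set ℂ := {w | w ∈ C.support ∨ C.index w ≠ 0}

/-- The contour together with all points of winding number different from one. -/
def outer (C : Contour) : Set ℂ := {w | w ∈ C.support ∨ C.index w ≠ 1}

/-- The image of the exterior under `w ↦ w⁻¹`, with `0` (the image of `∞`) added. -/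
def outerInv (C : Contour) : Set ℂ := {u | u = 0 ∨ u⁻¹ ∈ C.outer}

lemma excludes_iff (C : Contour) {w : ℂ} : C.Excludes w ↔ w ∉ C.hull := by
  simp [Excludes, hull]

lemma includes_iff (C : Contour) {w : ℂ} : C.Includes w ↔ w ∉ C.outer := by
  simp [Includes, outer]

lemma isClosed_hull (C : Contour) : IsClosed C.hull := by
  refine isOpen_compl_iff.1 (isOpen_iff_mem_nhds.2 fun w hw => ?_)
  simp only [hull, mem_compl_iff, mem_ofPred_eq, not_or, not_not] at hw
  filter_upwards [C.eventually_index_eq hw.1] with u hu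
  simp [hull, hu.1, hu.2, hw.2]

lemma isClosed_outer (C : Contour) : IsClosed C.outer := by
  refine isOpen_compl_iff.1 (isOpen_iff_mem_nhds.2 fun w hw => ?_)
  simp only [outer, mem_compl_iff, mem_ofPred_eq, not_or, not_not] at hw
  filter_upwards [C.eventually_index_eq hw.1] with u hu
  simp [outer, hu.1, hu.2, hw.2]

lemma isCompact_hull (C : Contour) : IsCompact C.hull := by
  obtain ⟨R, -, hR⟩ := C.exists_index_eq_zero
  refine (isCompact_closedBall (0 : ℂ) R).of_isClosed_subset C.isClosed_hull fun w hw => ?_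
  rw [mem_closedBall_zero_iff]
  by_contra! h
  have := hR w h
  rcases hw with hw | hw
  · exact this.1 hw
  · exact hw this.2

lemma isCompact_outerInv (C : Contour) (h0 : C.index 0 = 1) : IsCompact C.outerInv := by
  have hz : (0 : ℂ) ∉ C.outer := by simp [outer, h0, C.zero_notMem_support]
  obtain ⟨ε, hε, hball⟩ := Metric.isOpen_iff.1 C.isClosed_outer.isOpen_compl 0 hz
  obtain ⟨R, hR0, hR⟩ := C.exists_index_eq_zero
  refine (isCompact_closedBall (0 : ℂ) ε⁻¹).of_isClosed_subset ?_ fun u hu => ?_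
  · refine isOpen_compl_iff.1 (isOpen_iff_mem_nhds.2 fun u hu => ?_)
    simp only [outerInv, mem_compl_iff, mem_ofPred_eq, not_or] at hu
    have h1 : Tendsto (fun u : ℂ => u⁻¹) (𝓝 u) (𝓝 u⁻¹) := tendsto_inv₀ hu.1
    filter_upwards [h1.eventually (C.isClosed_outer.isOpen_compl.mem_nhds hu.2),
      isOpen_ne.mem_nhds hu.1] with v hv hv0
    exact fun h => h.elim hv0 hv
  · rw [mem_closedBall_zero_iff]
    rcases hu with rfl | hu
    · simp [hε.le]
    · have : ε ≤ ‖u⁻¹‖ := by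
        by_contra! h
        exact hball (by simpa using h) hu
      rw [norm_inv] at this
      exact le_inv_of_le_inv₀ hε this

/-- A contour containing the points `q ^ j * a`, which accumulate at zero, winds around zero. -/
lemma index_zero_of_includes (C : Contour) {q a : ℂ} (hq : ‖q‖ < 1)
    (h : ∀ j : ℕ, C.Includes (q ^ j * a)) : C.index 0 = 1 := by
  have hl : Tendsto (fun j : ℕ => q ^ j * a) atTop (𝓝 0) := by
    simpa using (tendsto_pow_atTop_nhds_zero_of_norm_lt_one hq).mul_const a
  obtain ⟨j, hj⟩ := (hl.eventually (C.eventually_index_eq C.zero_notMem_support)).exists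
  rw [← hj.2, (h j).2]

/-- From each point of the hull a radial segment inside the hull leads outwards to the contour. -/
lemma exists_ray (C : Contour) {x : ℂ} (hx : x ∈ C.hull) (hx0 : x ≠ 0) :
    ∃ s : ℝ, 1 ≤ s ∧ (s : ℂ) * x ∈ C.support ∧ ∀ r ∈ Icc 1 s, (r : ℂ) * x ∈ C.hull := by
  let E : Set ℝ := {r | 1 ≤ r ∧ (r : ℂ) * x ∈ C.support}
  have hEc : IsClosed E := isClosed_Ici.inter
    (C.isCompact_support.isClosed.preimage (by fun_prop : Continuous fun r : ℝ => (r : ℂ) * x))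
  -- off `E` the winding number is constant along the ray
  have hconst : ∀ s : ℝ, 1 ≤ s → (∀ r ∈ Icc 1 s, r ∉ E) →
      C.index (s * x) = C.index x := fun s hs h => by
    refine C.index_eq_of_isPreconnected (s := (fun r : ℝ => (r : ℂ) * x) '' Icc 1 s)
      (isPreconnected_Icc.image _ (by fun_prop)) ?_ ⟨s, ⟨hs, le_rfl⟩, rfl⟩
      ⟨1, ⟨le_rfl, hs⟩, by simp⟩
    rintro _ ⟨r, hr, rfl⟩ hmem
    exact h r hr ⟨hr.1, hmem⟩
  have hEn : E.Nonempty := by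
    by_contra hE
    rw [not_nonempty_iff_eq_empty] at hE
    have hxs : x ∉ C.support := fun h => by
      have : (1 : ℝ) ∈ E := ⟨le_rfl, by simpa using h⟩
      rw [hE] at this; exact this
    obtain ⟨R, hR0, hR⟩ := C.exists_index_eq_zero
    have hpos : 0 < ‖x‖ := norm_pos_iff.2 hx0
    have hs : (1 : ℝ) ≤ max 1 (2 * R / ‖x‖) := le_max_left _ _
    have h1 := hconst _ hs fun r _ h => by rw [hE] at h; exact h
    have h2 := (hR (((max 1 (2 * R / ‖x‖) : ℝ) : ℂ) * x) (by
      rw [norm_mul, Complex.norm_real, Real.norm_of_nonneg (by positivity)]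
      calc R < 2 * R / ‖x‖ * ‖x‖ := by rw [div_mul_cancel₀ _ hpos.ne']; linarith
        _ ≤ _ := by gcongr; exact le_max_right _ _)).2
    rcases hx with hx | hx
    · exact hxs hx
    · exact hx (h1.symm.trans h2)
  have hbdd : BddBelow E := ⟨1, fun r hr => hr.1⟩
  have hmem : sInf E ∈ E := hEc.csInf_mem hEn hbdd
  refine ⟨sInf E, hmem.1, hmem.2, fun r hr => ?_⟩
  rcases eq_or_lt_of_le hr.2 with h | h
  · rw [h]; exact Or.inl hmem.2
  · have hoff : ∀ r' ∈ Icc 1 r, r' ∉ E := fun r' hr' h' =>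
      absurd (csInf_le hbdd h') (not_le.2 (hr'.2.trans_lt h))
    have h1 := hconst r hr.1 hoff
    rcases hx with hx | hx
    · exact absurd ⟨le_rfl, by simpa using hx⟩ (hoff 1 ⟨le_rfl, hr.1⟩)
    · exact Or.inr (h1 ▸ hx)

/-- If `C` contains `c C`, then `c` maps the whole hull of `C` into the interior of `C`. -/
lemma ContainsScaled.mul_notMem_outer {C : Contour} {c : ℂ} (h : C.ContainsScaled c) (hc : c ≠ 0)
    {x : ℂ} (hx : x ∈ C.hull) (hx0 : x ≠ 0) : c * x ∉ C.outer := by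
  obtain ⟨s, hs, hsx, hray⟩ := C.exists_ray hx hx0
  have hoff : ∀ w ∈ (fun r : ℝ => c * (r * x)) '' Icc 1 s, w ∉ C.support := by
    rintro _ ⟨r, hr, rfl⟩ hmem
    have := (h _ hmem).2
    rw [excludes_iff, mul_div_cancel_left₀ _ hc] at this
    exact this (hray r hr)
  have h1 : C.index (c * x) = C.index (c * (s * x)) := C.index_eq_of_isPreconnected
    (isPreconnected_Icc.image _ (by fun_prop)) hoff ⟨1, ⟨le_rfl, hs⟩, by simp⟩
    ⟨s, ⟨hs, le_rfl⟩, rfl⟩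
  rw [← includes_iff]
  exact ⟨hoff _ ⟨1, ⟨le_rfl, hs⟩, by simp⟩, h1.trans (h _ hsx).1.2⟩

/-- If `C` excludes the points `(c w)⁻¹` for `w` on `C`, then also for `w` in the hull of `C`. -/
lemma inv_notMem_hull {C : Contour} {c : ℂ} (h : ∀ w ∈ C.support, C.Excludes (c * w)⁻¹) (hc : c ≠ 0)
    {x : ℂ} (hx : x ∈ C.hull) (hx0 : x ≠ 0) : (c * x)⁻¹ ∉ C.hull := by
  obtain ⟨s, hs, hsx, hray⟩ := C.exists_ray hx hx0
  have hoff : ∀ w ∈ (fun r : ℝ => (c * (r * x))⁻¹) '' Icc 1 s, w ∉ C.support := by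
    rintro _ ⟨r, hr, rfl⟩ hmem
    have := h _ hmem
    rw [excludes_iff, mul_inv, inv_inv, inv_mul_cancel_left₀ hc] at this
    exact this (hray r hr)
  have hcont : ContinuousOn (fun r : ℝ => (c * (r * x))⁻¹) (Icc 1 s) := by
    refine ContinuousOn.inv₀ (by fun_prop) fun r hr => ?_
    have : (r : ℂ) ≠ 0 := by exact_mod_cast (zero_lt_one.trans_le hr.1).ne'
    positivity
  have h1 : C.index (c * x)⁻¹ = C.index (c * (s * x))⁻¹ := C.index_eq_of_isPreconnected
    (isPreconnected_Icc.image _ hcont) hoff ⟨1, ⟨le_rfl, hs⟩, by simp⟩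
    ⟨s, ⟨hs, le_rfl⟩, rfl⟩
  rw [← excludes_iff]
  exact ⟨hoff _ ⟨1, ⟨le_rfl, hs⟩, by simp⟩, h1.trans (h _ hsx).2⟩

/-! ### Inversion -/

lemma InversionInvariant.inv_mem_support {C : Contour} (h : C.InversionInvariant) {w : ℂ} :
    w⁻¹ ∈ C.support ↔ w ∈ C.support :=
  ⟨fun hw => by simpa using h.1 _ hw, fun hw => h.1 _ hw⟩

lemma InversionInvariant.continuousOn_inv {C : Contour} (h : C.InversionInvariant) {f : ℂ → ℂ}
    (hf : ContinuousOn f C.support) : ContinuousOn (fun z => f z⁻¹) C.support :=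
  hf.comp (continuousOn_id.inv₀ fun z hz h0 => C.zero_notMem_support (by
    simpa [show z = 0 from h0] using hz)) fun z hz => h.1 z hz

lemma InversionInvariant.eval_inv {C : Contour} (h : C.InversionInvariant) {f : ℂ → ℂ}
    (hf : ContinuousOn f C.support) : C.chain.eval (fun z => f z⁻¹) = C.chain.eval f := by
  rw [chain_eval _ hf, chain_eval _ (h.continuousOn_inv hf), h.2 f hf]

lemma InversionInvariant.index_inv {C : Contour} (h : C.InversionInvariant) (h0 : C.index 0 = 1)
    {w : ℂ} (hw0 : w ≠ 0) (hw : w ∉ C.support) : C.index w⁻¹ = 1 - C.index w := by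
  have hw' : w⁻¹ ∉ C.support := fun h' => hw (h.inv_mem_support.1 h')
  have hne : ∀ {u}, u ∉ C.support → ∀ z ∈ C.support, z - u ≠ 0 :=
    fun hu z hz h => hu (by rwa [← sub_eq_zero.1 h])
  have hcont : ∀ {u}, u ∉ C.support → ContinuousOn (fun z => z / (z - u)) C.support :=
    fun hu => continuousOn_id.div (by fun_prop) (hne hu)
  have hsub : C.chain.eval (fun z => z / (z - 0) - z / (z - w)) =
      C.chain.ind 0 - C.chain.ind w := by
    rw [Chain.ind, Chain.ind, Chain.eval, Chain.eval, Chain.eval, ← integral_sub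
      (C.chain.integrable_eval (hcont C.zero_notMem_support)) (C.chain.integrable_eval (hcont hw))]
    simp only [sub_mul]
  rw [← chain_ind _ hw', ← chain_ind _ hw, ← h0, ← chain_ind _ C.zero_notMem_support, ← hsub,
    Chain.ind, ← h.eval_inv (hcont hw')]
  refine C.chain.eval_congr fun z hz => ?_
  have hz0 : z ≠ 0 := fun h => C.zero_notMem_support (h ▸ hz)
  have h1 := hne hw z hz
  have h2 : z⁻¹ - w⁻¹ ≠ 0 := fun h => h1 (by rw [sub_eq_zero] at h ⊢; exact inv_injective h)
  have h3 : w - z ≠ 0 := fun h => h1 (by rw [← neg_sub, h, neg_zero])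
  have e : z⁻¹ - w⁻¹ = (w - z) / (z * w) := by field_simp
  rw [e, sub_zero, div_self hz0]
  field_simp
  ring

lemma InversionInvariant.inv_mem_outer {C : Contour} (h : C.InversionInvariant)
    (h0 : C.index 0 = 1) {w : ℂ} (hw0 : w ≠ 0) : w⁻¹ ∈ C.outer ↔ w ∈ C.hull := by
  by_cases hw : w ∈ C.support
  · exact ⟨fun _ => Or.inl hw, fun _ => Or.inl (h.1 _ hw)⟩
  · have hw' : w⁻¹ ∉ C.support := fun h' => hw (h.inv_mem_support.1 h')
    simp [outer, hull, hw, hw', h.index_inv h0 hw0 hw]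

/-- Inversion of the coordinates in `s`. -/
def invertAt {n : ℕ} (s : Finset (Fin n)) (z : Fin n → ℂ) (j : Fin n) : ℂ :=
  if j ∈ s then (z j)⁻¹ else z j

lemma InversionInvariant.continuousOn_invertAt {C : Contour} (h : C.InversionInvariant) {n : ℕ}
    {F : (Fin n → ℂ) → ℂ} (hF : ContinuousOn F (univ.pi fun _ => C.support)) (s : Finset (Fin n)) :
    ContinuousOn (fun z => F (invertAt s z)) (univ.pi fun _ => C.support) := by
  refine hF.comp (continuousOn_pi.2 fun j => ?_) fun z hz j _ => ?_
  · unfold invertAt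
    split_ifs
    · exact ContinuousOn.inv₀ (by fun_prop) fun z hz h0 =>
        C.zero_notMem_support (h0 ▸ hz j (mem_univ j))
    · fun_prop
  · unfold invertAt
    split_ifs
    · exact h.1 _ (hz j (mem_univ j))
    · exact hz j (mem_univ j)

/-- Integrals over powers of an inversion invariant contour do not change if some of the variables
are inverted. -/
lemma InversionInvariant.iint_invertAt {C : Contour} (h : C.InversionInvariant) {n : ℕ}
    {F : (Fin n → ℂ) → ℂ} (hF : ContinuousOn F (univ.pi fun _ => C.support)) (s : Finset (Fin n)) :
    Chain.iint (fun _ => C.chain) (fun z => F (invertAt s z)) =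
      Chain.iint (fun _ => C.chain) F := by
  induction s using Finset.induction_on with
  | empty => simp only [show ∀ z : Fin n → ℂ, invertAt ∅ z = z from fun z => funext fun j => by simp [invertAt]]
  | insert j s hj ih =>
    rw [← ih]
    obtain ⟨n, rfl⟩ : ∃ n', n = n' + 1 := ⟨n - 1, by have := j.2; omega⟩
    refine Chain.iint_eq_of_eval_eq (Λ := fun _ => C.chain) (Λ' := fun _ => C.chain) j
      (fun _ _ => rfl) (h.continuousOn_invertAt hF _) (h.continuousOn_invertAt hF _) fun z hz => ?_
    have e : ∀ x, invertAt (insert j s) (j.insertNth x z) = invertAt s (j.insertNth x⁻¹ z) := fun x => by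
      funext i
      rcases Fin.eq_self_or_eq_succAbove j i with rfl | ⟨k, rfl⟩
      · simp [invertAt, hj]
      · by_cases hk : j.succAbove k ∈ s <;> simp [invertAt, Fin.succAbove_ne, hk]
    simp only [e]
    refine h.eval_inv (f := fun x => F (invertAt s (j.insertNth x z))) ?_
    refine (h.continuousOn_invertAt hF s).comp
      (Continuous.continuousOn (continuous_pi fun i => ?_)) fun x hx i _ => ?_
    · refine Fin.succAboveCases j ?_ (fun k => ?_) i
      · simpa using continuous_id'
      · simpa using continuous_const
    · refine Fin.succAboveCases j ?_ (fun k => ?_) i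
      · simpa using hx
      · rw [Fin.insertNth_apply_succAbove]
        exact hz k

/-! ### Scaled contours -/

/-- The contour `c C`. -/
def scale (C : Contour) (c : ℂ) (hc : c ≠ 0) : Contour where
  size := C.size
  mult := C.mult
  path i x := c * C.path i x
  contDiff i := contDiff_const.mul (C.contDiff i)
  closed i := by rw [C.closed i]
  ne_zero i x hx := mul_ne_zero hc (C.ne_zero i x hx)

lemma deriv_const_mul_path (C : Contour) (c : ℂ) (i : Fin C.size) (x : ℝ) :
    deriv (fun x => c * C.path i x) x = c * deriv (C.path i) x :=
  deriv_const_mul c ((C.contDiff i).differentiable one_ne_zero x)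

lemma mem_scale_support (C : Contour) {c : ℂ} (hc : c ≠ 0) {w : ℂ} :
    c * w ∈ (C.scale c hc).support ↔ w ∈ C.support := by
  simp only [support, mem_iUnion, scale, mem_image]
  exact exists_congr fun i => exists_congr fun x => and_congr_right fun _ => mul_right_inj' hc

lemma scale_index (C : Contour) {c : ℂ} (hc : c ≠ 0) (w : ℂ) :
    (C.scale c hc).index (c * w) = C.index w := by
  unfold index
  congr 1
  change ∑ i : Fin C.size, (C.mult i : ℂ) * (∫ x in (0 : ℝ)..1,
    (c * C.path i x - c * w)⁻¹ * deriv (fun x => c * C.path i x) x) = C.integral _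
  unfold integral
  refine Finset.sum_congr rfl fun i _ => ?_
  congr 1
  refine intervalIntegral.integral_congr fun x _ => ?_
  simp only [deriv_const_mul_path, ← mul_sub, mul_inv]
  field_simp

lemma mem_scale_hull (C : Contour) {c : ℂ} (hc : c ≠ 0) {w : ℂ} :
    c * w ∈ (C.scale c hc).hull ↔ w ∈ C.hull := by
  simp only [hull, mem_ofPred_eq, mem_scale_support, scale_index]

lemma mem_scale_outer (C : Contour) {c : ℂ} (hc : c ≠ 0) {w : ℂ} :
    c * w ∈ (C.scale c hc).outer ↔ w ∈ C.outer := by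
  simp only [outer, mem_ofPred_eq, mem_scale_support, scale_index]

lemma scale_integralPow (C : Contour) {c : ℂ} (hc : c ≠ 0) (n : ℕ) (F : (Fin n → ℂ) → ℂ) :
    (C.scale c hc).integralPow n F = C.integralPow n fun z => F fun j => c * z j := by
  change ∑ a : Fin n → Fin C.size, (∏ j, (C.mult (a j) : ℂ)) *
    (∫ x in Icc (0 : Fin n → ℝ) 1, F (fun j => c * C.path (a j) (x j)) *
      ∏ j, deriv (fun x => c * C.path (a j) x) (x j) /
        (2 * Real.pi * Complex.I * (c * C.path (a j) (x j)))) = _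
  unfold integralPow
  refine Finset.sum_congr rfl fun a _ => ?_
  congr 1
  refine integral_congr_ae (Eventually.of_forall fun x => ?_)
  simp only [deriv_const_mul_path]
  congr 1
  refine Finset.prod_congr rfl fun j _ => ?_
  rw [mul_left_comm, mul_div_mul_left _ _ hc]

end Contour

/-! ### The regularized integrand -/

lemma poch2_ne_zero_of_norm_lt_one {x p q : ℂ} (hp : ‖p‖ < 1) (hq : ‖q‖ < 1) (hx : ‖x‖ < 1) :
    poch2 x p q ≠ 0 := by
  refine (poch2_ne_zero_iff hp hq).2 fun i j h => ?_
  have h1 : ‖x * p ^ i * q ^ j‖ < 1 := by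
    rw [norm_mul, norm_mul, norm_pow, norm_pow]
    calc ‖x‖ * ‖p‖ ^ i * ‖q‖ ^ j ≤ ‖x‖ * 1 * 1 := by
          gcongr
          · exact pow_le_one₀ (norm_nonneg _) hp.le
          · exact pow_le_one₀ (norm_nonneg _) hq.le
      _ < 1 := by linarith
  rw [h, norm_one] at h1
  exact lt_irrefl _ h1

lemma poch2_mul_ne_zero {x p q : ℂ} (hp : ‖p‖ < 1) (hq : ‖q‖ < 1) (h : poch2 x p q ≠ 0) :
    poch2 (p * x) p q ≠ 0 := by
  rw [poch2_eq_poch_mul x hp hq] at h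
  exact right_ne_zero_of_mul h

lemma differentiableAt_finset_prod {E ι : Type*} [NormedAddCommGroup E] [NormedSpace ℂ E]
    {f : ι → E → ℂ} {u : Finset ι} {x : E} (h : ∀ i ∈ u, DifferentiableAt ℂ (f i) x) :
    DifferentiableAt ℂ (fun x => ∏ i ∈ u, f i x) x := by
  classical
  have := (HasFDerivAt.finsetProd fun i hi => (h i hi).hasFDerivAt).differentiableAt
  exact this

/-- The parameters of the regularized integrand. In the original coordinates `s = p` and `s' = 1`;
after the rescaling `z = p^ζ y` one has `s = p^(1+2ζ)` and `s' = p^(-2ζ)`. The families `b`, `d`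
describe the poles at `(b r)⁻¹ p^(-i) q^(-j)` and `d r p^i q^j`, and `b'`, `d'` the corresponding
zeros. -/
@[ext] structure Params (N : ℕ) where
  p : ℂ
  q : ℂ
  t : ℂ
  s : ℂ
  s' : ℂ
  v : ℂ
  e : ℂ
  b : Fin N → ℂ
  b' : Fin N → ℂ
  d : Fin N → ℂ
  d' : Fin N → ℂ

namespace Params

variable {N : ℕ}

/-- The function `1 / (Γ(x) Γ(1/x))`, written without denominators. -/
def weyl (P : Params N) (x : ℂ) : ℂ :=
  poch x P.q * poch x⁻¹ P.q * (poch (P.p * x) P.p * poch (P.p * x⁻¹) P.p)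

/-- The numerator of the regularized integrand. -/
def num (P : Params N) {n : ℕ} (z : Fin n → ℂ) : ℂ :=
  (∏ j : Fin n, ∏ k ∈ Finset.Ioi j,
    poch2 (P.q * P.s' / P.t * (z j * z k)⁻¹) P.p P.q * poch2 (P.q * P.s / P.t * (z j * z k)) P.p P.q *
    (poch2 (P.p * P.q / P.t * (z k / z j)) P.p P.q * poch2 (P.p * P.q / P.t * (z j / z k)) P.p P.q) *
    (P.weyl (z j / z k) * (poch (P.s' * (z j * z k)⁻¹) P.p * poch (P.s * (z j * z k)) P.p))) *
  ∏ j : Fin n, (∏ r, poch2 (P.b' r * (z j)⁻¹) P.p P.q * poch2 (P.d' r * z j) P.p P.q) *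
    (poch (P.s' * (z j * z j)⁻¹) P.p * poch (P.s * (z j * z j)) P.p) *
    (theta (P.v * z j) P.q * theta (P.e * z j) P.q)

/-- The denominator of the regularized integrand. -/
def den (P : Params N) {n : ℕ} (z : Fin n → ℂ) : ℂ :=
  (∏ j : Fin n, ∏ k ∈ Finset.Ioi j,
    poch2 (P.t * P.s * (z j * z k)) P.p P.q * poch2 (P.t * P.s' * (z j * z k)⁻¹) P.p P.q *
    (poch2 (P.t * (z j / z k)) P.p P.q * poch2 (P.t * (z k / z j)) P.p P.q)) *
  ∏ j : Fin n, ∏ r, poch2 (P.b r * z j) P.p P.q * poch2 (P.d r * (z j)⁻¹) P.p P.q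

/-- A pair of sets is admissible if a function which is `1` off `D` and `0` off `S` separates the
poles of the integrand correctly, the other variables being in `S ∩ D`. -/
structure Adm (P : Params N) (S D : Set ℂ) : Prop where
  scaled : ∀ x ∈ S, ∀ y ∈ D, poch2 (P.t * (x / y)) P.p P.q ≠ 0
  inner : ∀ x ∈ D, ∀ y ∈ D, poch2 (P.t * P.s' * (x * y)⁻¹) P.p P.q ≠ 0
  outer : ∀ x ∈ S, ∀ y ∈ S, poch2 (P.t * P.s * (x * y)) P.p P.q ≠ 0
  left : ∀ r, ∀ x ∈ S, poch2 (P.b r * x) P.p P.q ≠ 0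
  right : ∀ r, ∀ y ∈ D, poch2 (P.d r * y⁻¹) P.p P.q ≠ 0

lemma Adm.mono {P : Params N} {S D S' D' : Set ℂ} (h : P.Adm S D) (hS : S' ⊆ S) (hD : D' ⊆ D) :
    P.Adm S' D' :=
  ⟨fun x hx y hy => h.scaled x (hS hx) y (hD hy), fun x hx y hy => h.inner x (hD hx) y (hD hy),
    fun x hx y hy => h.outer x (hS hx) y (hS hy), fun r x hx => h.left r x (hS hx),
    fun r y hy => h.right r y (hD hy)⟩

lemma Adm.den_ne_zero {P : Params N} {S D : Set ℂ} (h : P.Adm S D) {n : ℕ} {z : Fin n → ℂ}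
    (hS : ∀ j, z j ∈ S) (hD : ∀ j, z j ∈ D) : P.den z ≠ 0 := by
  refine mul_ne_zero (Finset.prod_ne_zero_iff.2 fun j _ => Finset.prod_ne_zero_iff.2 fun k _ => ?_)
    (Finset.prod_ne_zero_iff.2 fun j _ => Finset.prod_ne_zero_iff.2 fun r _ => ?_)
  · exact mul_ne_zero (mul_ne_zero (h.outer _ (hS j) _ (hS k)) (h.inner _ (hD j) _ (hD k)))
      (mul_ne_zero (h.scaled _ (hS j) _ (hD k)) (h.scaled _ (hS k) _ (hD j)))
  · exact mul_ne_zero (h.left r _ (hS j)) (h.right r _ (hD j))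

/-- The standing assumptions on the moduli. -/
structure Small (P : Params N) : Prop where
  p : ‖P.p‖ < 1
  q : ‖P.q‖ < 1

lemma differentiableOn_num {P : Params N} (hP : P.Small) (n : ℕ) (hv : P.v ≠ 0) (he : P.e ≠ 0) :
    DifferentiableOn ℂ (P.num (n := n)) {z | ∀ j, z j ≠ 0} := by
  intro z hz
  refine DifferentiableAt.differentiableWithinAt ?_
  have h2 : ∀ {f : (Fin n → ℂ) → ℂ}, DifferentiableAt ℂ f z →
      DifferentiableAt ℂ (fun z => poch2 (f z) P.p P.q) z := fun hf =>
    (differentiable_poch2 hP.p hP.q _).comp z hf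
  have hp : ∀ {f : (Fin n → ℂ) → ℂ}, DifferentiableAt ℂ f z →
      DifferentiableAt ℂ (fun z => poch (f z) P.p) z := fun hf =>
    (differentiable_poch hP.p _).comp z hf
  have hq : ∀ {f : (Fin n → ℂ) → ℂ}, DifferentiableAt ℂ f z →
      DifferentiableAt ℂ (fun z => poch (f z) P.q) z := fun hf =>
    (differentiable_poch hP.q _).comp z hf
  have hc : ∀ j, DifferentiableAt ℂ (fun z : Fin n → ℂ => z j) z := fun j => by fun_prop
  have hci : ∀ j, DifferentiableAt ℂ (fun z : Fin n → ℂ => (z j)⁻¹) z := fun j => (hc j).inv (hz j)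
  have hm : ∀ j k, DifferentiableAt ℂ (fun z : Fin n → ℂ => z j * z k) z := fun j k =>
    (hc j).mul (hc k)
  have hmi : ∀ j k, DifferentiableAt ℂ (fun z : Fin n → ℂ => (z j * z k)⁻¹) z := fun j k =>
    (hm j k).inv (mul_ne_zero (hz j) (hz k))
  have hd : ∀ j k, DifferentiableAt ℂ (fun z : Fin n → ℂ => z j / z k) z := fun j k => by
    simpa only [div_eq_mul_inv] using (hc j).fun_mul (hci k)
  have hdi : ∀ j k, DifferentiableAt ℂ (fun z : Fin n → ℂ => (z j / z k)⁻¹) z := fun j k =>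
    (hd j k).inv (div_ne_zero (hz j) (hz k))
  have hth : ∀ (c : ℂ), c ≠ 0 → ∀ j, DifferentiableAt ℂ (fun z : Fin n → ℂ => theta (c * z j) P.q) z :=
    fun c hc0 j => DifferentiableAt.comp (g := fun x => theta x P.q) z
      (differentiableAt_theta (mul_ne_zero hc0 (hz j)) hP.q) ((hc j).const_mul c)
  unfold num weyl
  refine DifferentiableAt.mul ?_ ?_
  · refine differentiableAt_finset_prod fun j _ => differentiableAt_finset_prod fun k _ => ?_
    exact ((h2 ((hmi j k).const_mul _)).mul (h2 ((hm j k).const_mul _))).mul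
      ((h2 ((hd k j).const_mul _)).mul (h2 ((hd j k).const_mul _))) |>.mul
      ((((hq (hd j k)).mul (hq (hdi j k))).mul ((hp ((hd j k).const_mul _)).mul
        (hp ((hdi j k).const_mul _)))).mul
        ((hp ((hmi j k).const_mul _)).mul (hp ((hm j k).const_mul _))))
  · refine differentiableAt_finset_prod fun j _ => ?_
    refine ((differentiableAt_finset_prod fun r _ => ?_).mul ?_).mul ?_
    · exact (h2 ((hci j).const_mul _)).mul (h2 ((hc j).const_mul _))
    · exact (hp ((hmi j j).const_mul _)).mul (hp ((hm j j).const_mul _))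
    · exact (hth _ hv j).mul (hth _ he j)

lemma differentiableOn_den {P : Params N} (hP : P.Small) (n : ℕ) :
    DifferentiableOn ℂ (P.den (n := n)) {z | ∀ j, z j ≠ 0} := by
  intro z hz
  refine DifferentiableAt.differentiableWithinAt ?_
  have h2 : ∀ {f : (Fin n → ℂ) → ℂ}, DifferentiableAt ℂ f z →
      DifferentiableAt ℂ (fun z => poch2 (f z) P.p P.q) z := fun hf =>
    (differentiable_poch2 hP.p hP.q _).comp z hf
  have hc : ∀ j, DifferentiableAt ℂ (fun z : Fin n → ℂ => z j) z := fun j => by fun_prop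
  have hci : ∀ j, DifferentiableAt ℂ (fun z : Fin n → ℂ => (z j)⁻¹) z := fun j => (hc j).inv (hz j)
  have hm : ∀ j k, DifferentiableAt ℂ (fun z : Fin n → ℂ => z j * z k) z := fun j k =>
    (hc j).mul (hc k)
  have hmi : ∀ j k, DifferentiableAt ℂ (fun z : Fin n → ℂ => (z j * z k)⁻¹) z := fun j k =>
    (hm j k).inv (mul_ne_zero (hz j) (hz k))
  have hd : ∀ j k, DifferentiableAt ℂ (fun z : Fin n → ℂ => z j / z k) z := fun j k => by
    simpa only [div_eq_mul_inv] using (hc j).fun_mul (hci k)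
  unfold den
  refine DifferentiableAt.mul ?_ ?_
  · refine differentiableAt_finset_prod fun j _ => differentiableAt_finset_prod fun k _ => ?_
    exact ((h2 ((hm j k).const_mul _)).mul (h2 ((hmi j k).const_mul _))).mul
      ((h2 ((hd j k).const_mul _)).mul (h2 ((hd k j).const_mul _)))
  · refine differentiableAt_finset_prod fun j _ => differentiableAt_finset_prod fun r _ => ?_
    exact (h2 ((hc j).const_mul _)).mul (h2 ((hci j).const_mul _))

/-- The change of parameters corresponding to the substitution `z ↦ c z`. -/
def rescale (P : Params N) (c : ℂ) : Params N where
  p := P.p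
  q := P.q
  t := P.t
  s := P.s * c ^ 2
  s' := P.s' / c ^ 2
  v := P.v * c
  e := P.e * c
  b r := P.b r * c
  b' r := P.b' r / c
  d r := P.d r / c
  d' r := P.d' r * c

lemma num_rescale (P : Params N) {c : ℂ} (hc : c ≠ 0) {n : ℕ} (z : Fin n → ℂ) :
    (P.rescale c).num z = P.num fun j => c * z j := by
  have h1 : ∀ x y : ℂ, c * x / (c * y) = x / y := fun x y => mul_div_mul_left _ _ hc
  have h2 : ∀ a x y : ℂ, a * (c * x * (c * y)) = a * c ^ 2 * (x * y) := fun a x y => by ring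
  have h3 : ∀ a x y : ℂ, a * (c * x * (c * y))⁻¹ = a / c ^ 2 * (x * y)⁻¹ := fun a x y => by
    rw [show c * x * (c * y) = c ^ 2 * (x * y) by ring, mul_inv]; ring
  have h4 : ∀ a x : ℂ, a * (c * x)⁻¹ = a / c * x⁻¹ := fun a x => by rw [mul_inv]; ring
  have h5 : ∀ a x : ℂ, a * (c * x) = a * c * x := fun a x => by ring
  have h6 : ∀ x y : ℂ, P.q * (P.s' / c ^ 2) / P.t * (x * y)⁻¹ =
      P.q * P.s' / P.t / c ^ 2 * (x * y)⁻¹ := fun x y => by ring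
  have h7 : ∀ x y : ℂ, P.q * (P.s * c ^ 2) / P.t * (x * y) =
      P.q * P.s / P.t * c ^ 2 * (x * y) := fun x y => by ring
  simp only [num, weyl, rescale, h1, h2, h3, h4, h5 (P.d' _), h5 P.v, h5 P.e, h6, h7]

lemma den_rescale (P : Params N) {c : ℂ} (hc : c ≠ 0) {n : ℕ} (z : Fin n → ℂ) :
    (P.rescale c).den z = P.den fun j => c * z j := by
  have h1 : ∀ x y : ℂ, c * x / (c * y) = x / y := fun x y => mul_div_mul_left _ _ hc
  have h2 : ∀ a x y : ℂ, a * (c * x * (c * y)) = a * c ^ 2 * (x * y) := fun a x y => by ring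
  have h3 : ∀ a x y : ℂ, a * (c * x * (c * y))⁻¹ = a / c ^ 2 * (x * y)⁻¹ := fun a x y => by
    rw [show c * x * (c * y) = c ^ 2 * (x * y) by ring, mul_inv]; ring
  have h4 : ∀ a x : ℂ, a * (c * x)⁻¹ = a / c * x⁻¹ := fun a x => by rw [mul_inv]; ring
  have h5 : ∀ a x : ℂ, a * (c * x) = a * c * x := fun a x => by ring
  have h6 : ∀ x y : ℂ, P.t * (P.s' / c ^ 2) * (x * y)⁻¹ =
      P.t * P.s' / c ^ 2 * (x * y)⁻¹ := fun x y => by ring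
  have h7 : ∀ x y : ℂ, P.t * (P.s * c ^ 2) * (x * y) =
      P.t * P.s * c ^ 2 * (x * y) := fun x y => by ring
  simp only [den, rescale, h1, h2, h3, h4, h5 (P.b _), h6, h7]

/-! ### Cutoff functions and deformation -/

end Params

/-- A smooth compactly supported function which is `1` near the origin. It plays the role of the
function "winding number" of a contour. -/
structure Cutoff where
  toFun : ℂ → ℂ
  contDiff : ContDiff ℝ 1 toFun
  compact : HasCompactSupport toFun
  near : ∀ᶠ w in 𝓝 0, toFun w = 1

namespace Cutoff

instance : CoeFun Cutoff fun _ => ℂ → ℂ := ⟨toFun⟩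

/-- The closed support of a cutoff function. -/
def S (χ : Cutoff) : Set ℂ := tsupport χ

/-- The closed support of `1 - χ`. -/
def D (χ : Cutoff) : Set ℂ := tsupport fun w => 1 - χ w

lemma eq_zero (χ : Cutoff) {w : ℂ} (h : w ∉ χ.S) : χ w = 0 := image_eq_zero_of_notMem_tsupport h

lemma eq_one (χ : Cutoff) {w : ℂ} (h : w ∉ χ.D) : χ w = 1 :=
  (sub_eq_zero.1 (image_eq_zero_of_notMem_tsupport (f := fun w => 1 - χ w) h)).symm

lemma notMem_S {χ : Cutoff} {w : ℂ} : w ∉ χ.S ↔ ∀ᶠ u in 𝓝 w, χ u = 0 :=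
  notMem_tsupport_iff_eventuallyEq

lemma notMem_D {χ : Cutoff} {w : ℂ} : w ∉ χ.D ↔ ∀ᶠ u in 𝓝 w, χ u = 1 := by
  rw [D, notMem_tsupport_iff_eventuallyEq]
  exact eventually_congr (Eventually.of_forall fun u => by
    rw [Pi.zero_apply, sub_eq_zero, eq_comm])

lemma zero_notMem_D (χ : Cutoff) : (0 : ℂ) ∉ χ.D := notMem_D.2 χ.near

lemma tsupport_dbar_subset_D (χ : Cutoff) : tsupport (dbar χ) ⊆ χ.D := fun w hw => by
  by_contra h
  refine notMem_tsupport_iff_eventuallyEq.2 ?_ hw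
  filter_upwards [(notMem_D.1 h).eventually_nhds] with u hu
  exact dbar_eq_zero ((differentiableAt_const (1 : ℂ)).congr_of_eventuallyEq hu)

/-- The chain of a cutoff function. -/
def chain (χ : Cutoff) : Chain := Chain.ofCutoff χ χ.contDiff χ.compact
  fun h => χ.zero_notMem_D (χ.tsupport_dbar_subset_D h)

lemma chain_supp (χ : Cutoff) : χ.chain.supp = tsupport (dbar χ) := rfl

lemma chain_ind (χ : Cutoff) (w : ℂ) : χ.chain.ind w = χ w := Chain.ind_ofCutoff ..

@[ext] lemma ext' {χ χ' : Cutoff} (h : ∀ w, χ w = χ' w) : χ = χ' := by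
  cases χ; cases χ'; congr; exact funext h

end Cutoff

open Params in
/-- Deformation of the regularized integral between chains whose winding numbers agree off a
compact set on which the denominator does not vanish. -/
lemma iint_eq_of_ind_eq {N : ℕ} {P : Params N} (hP : P.Small) (hv : P.v ≠ 0) (he : P.e ≠ 0) (n : ℕ)
    {Λ Λ' : Chain} {K : Set ℂ} (hK : IsCompact K) (h0 : (0 : ℂ) ∉ K) (hs : Λ.supp ⊆ K)
    (hs' : Λ'.supp ⊆ K) (hind : ∀ w, w ≠ 0 → w ∉ K → Λ.ind w = Λ'.ind w)
    (hden : ∀ z : Fin n → ℂ, (∀ j, z j ∈ K) → P.den z ≠ 0) :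
    Chain.iint (fun _ : Fin n => Λ) (fun z => P.num z / P.den z) =
      Chain.iint (fun _ : Fin n => Λ') (fun z => P.num z / P.den z) := by
  have hN := differentiableOn_num hP n hv he
  have hD := differentiableOn_den hP n
  have hup : ∀ (z : Fin n → ℂ) (j : Fin n), (∀ j, z j ≠ 0) →
      ∀ x ∈ ({0}ᶜ : Set ℂ), Function.update z j x ∈ {z : Fin n → ℂ | ∀ j, z j ≠ 0} := by
    intro z j hz x hx k
    by_cases hk : k = j
    · subst hk; simpa using hx
    · simpa [hk] using hz k
  have hud : ∀ (z : Fin n → ℂ) (j : Fin n),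
      DifferentiableOn ℂ (fun x => Function.update z j x) {0}ᶜ := fun z j =>
    differentiableOn_pi.2 fun k => by
      by_cases hk : k = j
      · subst hk
        simp only [Function.update_self]
        exact differentiableOn_id
      · simp only [Function.update_of_ne hk]
        exact differentiableOn_const _
  exact Chain.iint_const_eq_of_ind_eq hK h0 hs hs' hind hN.continuousOn hD.continuousOn
    (fun z j hz => hN.comp (hud z j) (hup z j hz)) (fun z j hz => hD.comp (hud z j) (hup z j hz)) hden

open Params in
lemma iint_cutoff_eq_of_adm {N : ℕ} {P : Params N} (hP : P.Small) (hv : P.v ≠ 0) (he : P.e ≠ 0)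
    (n : ℕ) {χ χ' : Cutoff} {S D : Set ℂ} (h : P.Adm S D) (hS : χ.S ⊆ S) (hS' : χ'.S ⊆ S)
    (hD : χ.D ⊆ D) (hD' : χ'.D ⊆ D) :
    Chain.iint (fun _ : Fin n => χ.chain) (fun z => P.num z / P.den z) =
      Chain.iint (fun _ : Fin n => χ'.chain) (fun z => P.num z / P.den z) := by
  refine iint_eq_of_ind_eq hP hv he n (K := (χ.S ∪ χ'.S) ∩ (χ.D ∪ χ'.D)) ?_ ?_ ?_ ?_ ?_ ?_
  · exact (IsCompact.union χ.compact χ'.compact).inter_right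
      ((isClosed_tsupport _).union (isClosed_tsupport _))
  · rintro ⟨-, h | h⟩
    · exact χ.zero_notMem_D h
    · exact χ'.zero_notMem_D h
  · exact fun w hw => ⟨Or.inl (tsupport_dbar_subset _ hw), Or.inl (χ.tsupport_dbar_subset_D hw)⟩
  · exact fun w hw => ⟨Or.inr (tsupport_dbar_subset _ hw), Or.inr (χ'.tsupport_dbar_subset_D hw)⟩
  · intro w _ hw
    rw [Cutoff.chain_ind, Cutoff.chain_ind]
    rw [mem_inter_iff, not_and_or, mem_union, mem_union, not_or, not_or] at hw
    rcases hw with hw | hw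
    · rw [χ.eq_zero hw.1, χ'.eq_zero hw.2]
    · rw [χ.eq_one hw.1, χ'.eq_one hw.2]
  · exact fun z hz => h.den_ne_zero (fun j => union_subset hS hS' (hz j).1)
      fun j => union_subset hD hD' (hz j).2

namespace Cutoff

/-- The union of two cutoff functions, regarded as fuzzy sets. -/
def union (χ η : Cutoff) : Cutoff where
  toFun w := 1 - (1 - χ w) * (1 - η w)
  contDiff := contDiff_const.sub ((contDiff_const.sub χ.contDiff).mul (contDiff_const.sub η.contDiff))
  compact := by
    refine (IsCompact.union χ.compact η.compact).of_isClosed_subset (isClosed_tsupport _) fun w hw => ?_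
    by_contra h
    rw [mem_union, not_or] at h
    refine notMem_tsupport_iff_eventuallyEq.2 ?_ hw
    filter_upwards [notMem_S.1 h.1, notMem_S.1 h.2] with u h1 h2
    simp [h1, h2]
  near := by
    filter_upwards [χ.near] with u hu
    simp [hu]

lemma union_apply (χ η : Cutoff) (w : ℂ) : χ.union η w = 1 - (1 - χ w) * (1 - η w) := rfl

lemma union_S (χ η : Cutoff) : (χ.union η).S ⊆ χ.S ∪ η.S := fun w hw => by
  by_contra h
  rw [mem_union, not_or] at h
  refine notMem_S.2 ?_ hw
  filter_upwards [notMem_S.1 h.1, notMem_S.1 h.2] with u h1 h2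
  simp [h1, h2, union_apply]

lemma union_D (χ η : Cutoff) : (χ.union η).D ⊆ χ.D ∩ η.D := fun w hw => by
  constructor
  · by_contra h
    refine notMem_D.2 ?_ hw
    filter_upwards [notMem_D.1 h] with u h1
    simp [h1, union_apply]
  · by_contra h
    refine notMem_D.2 ?_ hw
    filter_upwards [notMem_D.1 h] with u h1
    simp [h1, union_apply]

/-- The fuzzy set `(Y ∩ Z) ∪ Y*`, where `Y*` is the complement of the inverse of `Y`. If
`Y* ⊆ Y`, it is the majority of `Y`, `Y*` and `Z`. -/
def majority (y z : Cutoff) : Cutoff where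
  toFun w := 1 - (1 - y w * z w) * y w⁻¹
  contDiff := contDiff_iff_contDiffAt.2 fun w => by
    by_cases hw : w = 0
    · subst hw
      refine (contDiffAt_const (c := (1 : ℂ))).congr_of_eventuallyEq ?_
      filter_upwards [y.near, z.near] with u h1 h2
      simp [h1, h2]
    · have h1 : ContDiffAt ℝ 1 (fun w : ℂ => y w⁻¹) w :=
        y.contDiff.contDiffAt.comp w (contDiffAt_inv ℝ hw)
      exact contDiffAt_const.sub ((contDiffAt_const.sub
        (y.contDiff.contDiffAt.mul z.contDiff.contDiffAt)).mul h1)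
  compact := by
    obtain ⟨ε, hε, hball⟩ := Metric.eventually_nhds_iff_ball.1 y.near
    refine HasCompactSupport.of_support_subset_isCompact
      (IsCompact.union y.compact (isCompact_closedBall (0 : ℂ) ε⁻¹)) fun w hw => ?_
    by_contra h
    rw [mem_union, not_or, mem_closedBall_zero_iff, not_le] at h
    refine hw ?_
    have h1 : y w = 0 := y.eq_zero h.1
    have h2 : y w⁻¹ = 1 := hball _ (by
      rw [mem_ball_zero_iff, norm_inv]; exact inv_lt_of_inv_lt₀ hε h.2)
    simp [h1, h2]
  near := by
    filter_upwards [y.near, z.near] with u h1 h2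
    simp [h1, h2]

lemma majority_apply (y z : Cutoff) (w : ℂ) : y.majority z w = 1 - (1 - y w * z w) * y w⁻¹ := rfl

lemma zero_mem_S (χ : Cutoff) : (0 : ℂ) ∈ χ.S := by
  by_contra h
  have := χ.near.self_of_nhds
  rw [χ.eq_zero h] at this
  exact zero_ne_one this

lemma majority_S (y z : Cutoff) : (y.majority z).S ⊆ (y.S ∩ z.S) ∪ {w | w⁻¹ ∈ y.D} := fun w hw => by
  by_contra h
  rw [mem_union, not_or, mem_inter_iff, not_and_or] at h
  have hw0 : w ≠ 0 := fun h0 => by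
    subst h0
    rcases h.1 with h | h
    · exact h y.zero_mem_S
    · exact h z.zero_mem_S
  refine notMem_S.2 ?_ hw
  have h2 : ∀ᶠ u in 𝓝 w, y u⁻¹ = 1 := (tendsto_inv₀ hw0).eventually (notMem_D.1 h.2)
  rcases h.1 with h | h
  · filter_upwards [notMem_S.1 h, h2] with u h1 h2
    simp [h1, h2, majority_apply]
  · filter_upwards [notMem_S.1 h, h2] with u h1 h2
    simp [h1, h2, majority_apply]

lemma majority_D (y z : Cutoff) : (y.majority z).D ⊆ (y.D ∪ z.D) ∩ {w | w⁻¹ ∈ y.S} := fun w hw => by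
  constructor
  · by_contra h
    rw [mem_union, not_or] at h
    refine notMem_D.2 ?_ hw
    filter_upwards [notMem_D.1 h.1, notMem_D.1 h.2] with u h1 h2
    simp [h1, h2, majority_apply]
  · by_contra h
    have hw0 : w ≠ 0 := fun h0 => h (by simpa [h0] using y.zero_mem_S)
    refine notMem_D.2 ?_ hw
    filter_upwards [(tendsto_inv₀ hw0).eventually (notMem_S.1 h)] with u h1
    simp [h1, majority_apply]

lemma exists_disc {ρ ρ' : ℝ} (hρ : 0 < ρ) (h : ρ < ρ') :
    ∃ η : Cutoff, η.S ⊆ Metric.closedBall 0 ρ' ∧ (∀ w ∈ η.D, ρ ≤ ‖w‖) ∧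
      ∀ w, ‖w‖ ≤ ρ → η w = 1 := by
  obtain ⟨χ, h1, h2, h3, h4⟩ := exists_cutoff (isCompact_closedBall (0 : ℂ) ρ) Metric.isOpen_ball
    (Metric.closedBall_subset_ball h)
  have hin : ∀ w : ℂ, ‖w‖ ≤ ρ → ∀ᶠ u in 𝓝 w, χ u = 1 := fun w hw =>
    h4.filter_mono (nhds_le_nhdsSet (by simpa using hw))
  refine ⟨⟨χ, h1, h2, hin 0 (by simpa using hρ.le)⟩, h3.trans Metric.ball_subset_closedBall,
    fun w hw => ?_, fun w hw => (hin w hw).self_of_nhds⟩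
  by_contra! hlt
  exact notMem_D.2 (hin w hlt.le) hw

/-- Any two disc cutoffs are connected by a finite chain of disc cutoffs with nearby radii. -/
lemma disc_induction {κ : ℝ} (hκ : 1 < κ) {X : Type*} (v : Cutoff → X)
    (H : ∀ ρ > 0, ∀ η η' : Cutoff, η.S ⊆ Metric.closedBall 0 (κ ^ 2 * ρ) → (∀ w ∈ η.D, ρ ≤ ‖w‖) →
      η'.S ⊆ Metric.closedBall 0 (κ ^ 2 * ρ) → (∀ w ∈ η'.D, ρ ≤ ‖w‖) → v η = v η')
    {ρ₁ ρ₂ : ℝ} (h₁ : 0 < ρ₁) (h₂ : 0 < ρ₂) {η₁ η₂ : Cutoff}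
    (hS₁ : η₁.S ⊆ Metric.closedBall 0 (κ * ρ₁)) (hD₁ : ∀ w ∈ η₁.D, ρ₁ ≤ ‖w‖)
    (hS₂ : η₂.S ⊆ Metric.closedBall 0 (κ * ρ₂)) (hD₂ : ∀ w ∈ η₂.D, ρ₂ ≤ ‖w‖) : v η₁ = v η₂ := by
  wlog hle : ρ₁ ≤ ρ₂ generalizing ρ₁ ρ₂ η₁ η₂
  · exact (this h₂ h₁ hS₂ hD₂ hS₁ hD₁ (le_of_not_ge hle)).symm
  have key : ∀ k : ℕ, ∀ η : Cutoff, ∀ ρ > 0, ρ₁ * κ ^ k ≤ ρ → ρ < ρ₁ * κ ^ (k + 1) →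
      η.S ⊆ Metric.closedBall 0 (κ * ρ) → (∀ w ∈ η.D, ρ ≤ ‖w‖) → v η₁ = v η := by
    intro k
    induction k with
    | zero =>
      intro η ρ hρ hl hu hS hD
      rw [pow_zero, mul_one] at hl
      rw [zero_add, pow_one] at hu
      refine H ρ₁ h₁ _ _ (hS₁.trans (Metric.closedBall_subset_closedBall ?_)) hD₁
        (hS.trans (Metric.closedBall_subset_closedBall ?_)) fun w hw => hl.trans (hD w hw)
      · nlinarith [mul_pos (zero_lt_one.trans hκ) h₁]
      · nlinarith
    | succ k ih =>
      intro η ρ hρ hl hu hS hD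
      have hpos : 0 < ρ₁ * κ ^ k := by positivity
      obtain ⟨η', hS', hD', -⟩ := exists_disc hpos
        (show ρ₁ * κ ^ k < κ * (ρ₁ * κ ^ k) by nlinarith)
      have e1 := ih η' _ hpos le_rfl (by rw [pow_succ]; nlinarith) hS' hD'
      -- an intermediate disc, comparable with both
      have hpos2 : 0 < ρ₁ * κ ^ (k + 1) := by positivity
      obtain ⟨η'', hS'', hD'', -⟩ := exists_disc hpos2
        (show ρ₁ * κ ^ (k + 1) < κ * (ρ₁ * κ ^ (k + 1)) by nlinarith)
      have hk : ρ₁ * κ ^ (k + 1) = κ * (ρ₁ * κ ^ k) := by ring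
      have e2 : v η' = v η'' := H _ hpos _ _
        (hS'.trans (Metric.closedBall_subset_closedBall (by nlinarith))) hD'
        (hS''.trans (Metric.closedBall_subset_closedBall (by rw [hk]; nlinarith)))
        fun w hw => le_trans (by rw [hk]; nlinarith) (hD'' w hw)
      have hk2 : ρ₁ * κ ^ (k + 1 + 1) = κ * (ρ₁ * κ ^ (k + 1)) := by ring
      rw [hk2] at hu
      have e3 : v η'' = v η := H _ hpos2 _ _
        (hS''.trans (Metric.closedBall_subset_closedBall (by nlinarith))) hD''
        (hS.trans (Metric.closedBall_subset_closedBall (by nlinarith)))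
        fun w hw => hl.trans (hD w hw)
      exact e1.trans (e2.trans e3)
  obtain ⟨k, hk1, hk2⟩ := exists_nat_pow_near (x := ρ₂ / ρ₁) (y := κ) ((one_le_div h₁).2 hle) hκ
  refine key k η₂ ρ₂ h₂ ?_ ?_ hS₂ hD₂
  · rwa [le_div_iff₀ h₁, mul_comm] at hk1
  · rwa [div_lt_iff₀ h₁, mul_comm] at hk2

end Cutoff

namespace Params

variable {N : ℕ}

/-- Admissibility of the pair of sets carrying the supports of `Cutoff.majority`. -/
lemma adm_majority {P : Params N} (hP : P.Small) (hs : P.s = P.p) (hs' : P.s' = 1)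
    (ht : ‖P.t‖ < 1) (hbd : ∀ r x, poch2 (P.d r * x) P.p P.q ≠ 0 → poch2 (P.b r * x) P.p P.q ≠ 0)
    {SY DY SZ DZ : Set ℂ}
    (hY : ∀ x ∈ SY, ∀ y ∈ DY, poch2 (P.t * (x / y)) P.p P.q ≠ 0)
    (hZ : ∀ x ∈ SZ, ∀ y ∈ DZ, poch2 (P.t * (x / y)) P.p P.q ≠ 0)
    (hinner : ∀ x ∈ DZ, ∀ y ∈ DZ, poch2 (P.t * P.s' * (x * y)⁻¹) P.p P.q ≠ 0)
    (houter : ∀ x ∈ SY ∩ SZ, ∀ y ∈ SY ∩ SZ, poch2 (P.t * P.s * (x * y)) P.p P.q ≠ 0)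
    (hleft : ∀ r, ∀ x ∈ SY ∩ SZ, poch2 (P.b r * x) P.p P.q ≠ 0)
    (hrY : ∀ r, ∀ y ∈ DY, poch2 (P.d r * y⁻¹) P.p P.q ≠ 0)
    (hrZ : ∀ r, ∀ y ∈ DZ, poch2 (P.d r * y⁻¹) P.p P.q ≠ 0)
    (h1 : ∀ w ∈ DY, 1 < ‖w‖) :
    P.Adm ((SY ∩ SZ) ∪ {w | w⁻¹ ∈ DY}) ((DY ∪ DZ) ∩ {w | w⁻¹ ∈ SY}) where
  scaled := by
    rintro x (hx | hx) y ⟨hy, hy'⟩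
    · exact hy.elim (hY x hx.1 y) (hZ x hx.2 y)
    · have := hY _ hy' _ hx
      rwa [show y⁻¹ / x⁻¹ = x / y by rw [div_inv_eq_mul, div_eq_mul_inv, mul_comm]] at this
  inner := by
    have key : ∀ x y : ℂ, x⁻¹ ∈ SY → y ∈ DY → poch2 (P.t * P.s' * (x * y)⁻¹) P.p P.q ≠ 0 := by
      intro x y hx hy
      have := hY _ hx _ hy
      rwa [show x⁻¹ / y = (x * y)⁻¹ by rw [mul_inv, div_eq_mul_inv], ← mul_one P.t, ← hs'] at this
    rintro x ⟨hx | hx, hx'⟩ y ⟨hy | hy, hy'⟩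
    · exact key x y hx' hy
    · rw [mul_comm x]; exact key y x hy' hx
    · exact key x y hx' hy
    · exact hinner x hx y hy
  outer := by
    have key : ∀ x y : ℂ, x ∈ SY → y⁻¹ ∈ DY → poch2 (P.t * P.s * (x * y)) P.p P.q ≠ 0 := by
      intro x y hx hy
      have := poch2_mul_ne_zero hP.p hP.q (hY _ hx _ hy)
      rwa [div_inv_eq_mul, show P.p * (P.t * (x * y)) = P.t * P.s * (x * y) by rw [hs]; ring]
        at this
    rintro x (hx | hx) y (hy | hy)
    · exact houter x hx y hy
    · exact key x y hx.1 hy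
    · rw [mul_comm x]; exact key y x hy.1 hx
    · refine poch2_ne_zero_of_norm_lt_one hP.p hP.q ?_
      have hb : ∀ w : ℂ, w⁻¹ ∈ DY → ‖w‖ ≤ 1 := fun w hw => by
        have := h1 _ hw
        rw [norm_inv] at this
        exact (one_lt_inv_iff₀.1 this).2.le
      rw [hs, norm_mul, norm_mul, norm_mul]
      calc ‖P.t‖ * ‖P.p‖ * (‖x‖ * ‖y‖) ≤ ‖P.t‖ * 1 * (1 * 1) := by
            gcongr
            · exact hP.p.le
            · exact hb x hx
            · exact hb y hy
        _ < 1 := by linarith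
  left := by
    rintro r x (hx | hx)
    · exact hleft r x hx
    · have := hbd r _ (hrY r _ hx)
      rwa [inv_inv] at this
  right := by
    rintro r y ⟨hy | hy, -⟩
    · exact hrY r y hy
    · exact hrZ r y hy

end Params

/-- If `y` and `z` both separate the poles of the regularized integrand, then they give the same
integral, although they may be far apart. The interpolation runs through
`majority (y ∪ disc) z` for discs shrinking from a huge one (where the majority is `z`) to a tiny
one, then through `majority y (z ∪ disc)` for growing discs, until the majority is `y`. -/
lemma iint_cutoff_eq {N : ℕ} {P : Params N} (hP : P.Small) (hv : P.v ≠ 0) (he : P.e ≠ 0)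
    (hs : P.s = P.p) (hs' : P.s' = 1) (ht : ‖P.t‖ < 1)
    (hbd : ∀ r x, poch2 (P.d r * x) P.p P.q ≠ 0 → poch2 (P.b r * x) P.p P.q ≠ 0) (n : ℕ)
    {y z : Cutoff} (hy : P.Adm y.S y.D) (hz : P.Adm z.S z.D) (h1 : ∀ w ∈ y.D, 1 < ‖w‖) :
    Chain.iint (fun _ : Fin n => z.chain) (fun z => P.num z / P.den z) =
      Chain.iint (fun _ : Fin n => y.chain) (fun z => P.num z / P.den z) := by
  obtain ⟨κ, hκ, hκt⟩ : ∃ κ : ℝ, 1 < κ ∧ ‖P.t‖ * κ ^ 2 < 1 := by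
    have hc : ContinuousAt (fun κ : ℝ => ‖P.t‖ * κ ^ 2) 1 := by fun_prop
    have h := hc.eventually_lt (g := fun _ => (1 : ℝ)) continuousAt_const (by simpa using ht)
    obtain ⟨κ, h1, h2⟩ := ((h.filter_mono nhdsWithin_le_nhds).and
      (self_mem_nhdsWithin : Ioi (1 : ℝ) ∈ 𝓝[>] 1)).exists
    exact ⟨κ, h2, h1⟩
  -- the discs of nearby radii are separated by `t`
  have hdisc : ∀ {S D : Set ℂ} {ρ : ℝ}, 0 < ρ →
      (∀ x ∈ S, ∀ y ∈ D, poch2 (P.t * (x / y)) P.p P.q ≠ 0) →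
      ∀ x ∈ S ∪ Metric.closedBall 0 (κ ^ 2 * ρ), ∀ y ∈ D ∩ {w | ρ ≤ ‖w‖},
        poch2 (P.t * (x / y)) P.p P.q ≠ 0 := by
    rintro S D ρ hρ h x (hx | hx) y ⟨hy, hy'⟩
    · exact h x hx y hy
    · refine poch2_ne_zero_of_norm_lt_one hP.p hP.q ?_
      rw [mem_closedBall_zero_iff] at hx
      rw [norm_mul, norm_div]
      have hy0 : 0 < ‖y‖ := hρ.trans_le hy'
      calc ‖P.t‖ * (‖x‖ / ‖y‖) ≤ ‖P.t‖ * κ ^ 2 := by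
            gcongr
            rw [div_le_iff₀ hy0]
            exact hx.trans (mul_le_mul_of_nonneg_left hy' (by positivity))
        _ < 1 := hκt
  have hball : ∀ χ : Cutoff, ∃ ρ > 0, ∀ w, ρ ≤ ‖w‖ → χ w = 0 := fun χ => by
    obtain ⟨R, hR⟩ := χ.compact.isBounded.subset_closedBall 0
    refine ⟨max R 0 + 1, by positivity, fun w hw => χ.eq_zero fun h => ?_⟩
    have := mem_closedBall_zero_iff.1 (hR h)
    linarith [le_max_left R 0]
  have hone : ∀ χ : Cutoff, ∃ ρ > 0, ∀ w, ‖w‖ ≤ ρ → χ w = 1 := fun χ => by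
    obtain ⟨ε, hε, h⟩ := Metric.eventually_nhds_iff_ball.1 χ.near
    exact ⟨ε / 2, by positivity, fun w hw => h w (by rw [mem_ball_zero_iff]; linarith)⟩
  obtain ⟨R, hR, hyR⟩ := hball y
  obtain ⟨R', hR', hzR⟩ := hball z
  obtain ⟨r, hr, hyr⟩ := hone y
  obtain ⟨r', hr', hzr⟩ := hone z
  set big := max (max R R') (max r'⁻¹ 1) with hbig
  have hbig0 : 0 < big := lt_max_of_lt_right (lt_max_of_lt_right one_pos)
  have hbR : R ≤ big := (le_max_left _ _).trans (le_max_left _ _)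
  have hbR' : R' ≤ big := (le_max_right _ _).trans (le_max_left _ _)
  have hbr' : r'⁻¹ ≤ big := (le_max_left _ _).trans (le_max_right _ _)
  have hb1 : 1 ≤ big := (le_max_right _ _).trans (le_max_right _ _)
  obtain ⟨η, hηS, hηD, hη1⟩ := Cutoff.exists_disc hbig0 (show big < κ * big by nlinarith)
  set tiny := min r r' / κ with htiny
  have hκ0 : 0 < κ := by linarith
  have htiny0 : 0 < tiny := div_pos (lt_min hr hr') hκ0
  have hκtiny : κ * tiny = min r r' := by rw [htiny]; field_simp
  obtain ⟨τ, hτS, hτD, hτ1⟩ := Cutoff.exists_disc htiny0 (show tiny < κ * tiny by nlinarith)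
  have hτ0 : ∀ w, min r r' < ‖w‖ → τ w = 0 := fun w hw => τ.eq_zero fun h => by
    have := mem_closedBall_zero_iff.1 (hτS h)
    linarith
  have e1 : (y.union η).majority z = z := Cutoff.ext' fun w => by
    rw [Cutoff.majority_apply, Cutoff.union_apply, Cutoff.union_apply]
    rcases le_or_gt ‖w‖ big with hw | hw
    · rw [hη1 w hw]
      rcases le_or_gt ‖w⁻¹‖ big with hw' | hw'
      · rw [hη1 _ hw']; ring
      · rw [hzr w]
        · ring
        · rw [norm_inv] at hw'
          have h3 : 0 < ‖w‖ := inv_pos.1 (hbig0.trans hw')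
          exact (inv_le_inv₀ hr' h3).1 (hbr'.trans hw'.le)
    · rw [hzR w (hbR'.trans hw.le), hη1 w⁻¹]
      · ring
      · rw [norm_inv]
        exact (inv_le_one_of_one_le₀ (hb1.trans hw.le)).trans hb1
  have e2 : y.union τ = y := Cutoff.ext' fun w => by
    rw [Cutoff.union_apply]
    rcases le_or_gt ‖w‖ (min r r') with hw | hw
    · rw [hyr w (hw.trans (min_le_left _ _))]; ring
    · rw [hτ0 w hw]; ring
  have e3 : z.union τ = z := Cutoff.ext' fun w => by
    rw [Cutoff.union_apply]
    rcases le_or_gt ‖w‖ (min r r') with hw | hw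
    · rw [hzr w (hw.trans (min_le_right _ _))]; ring
    · rw [hτ0 w hw]; ring
  have e4 : y.majority (z.union η) = y := Cutoff.ext' fun w => by
    rw [Cutoff.majority_apply, Cutoff.union_apply]
    have hyy : y w = 1 ∨ y w⁻¹ = 1 := by
      by_contra! h
      have h2 := h1 w (by by_contra h'; exact h.1 (y.eq_one h'))
      have h3 := h1 w⁻¹ (by by_contra h'; exact h.2 (y.eq_one h'))
      rw [norm_inv] at h3
      exact absurd (one_lt_inv_iff₀.1 h3).2 (by linarith)
    have : y w * (1 - (1 - z w) * (1 - η w)) = y w := by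
      rcases le_or_gt ‖w‖ big with hw | hw
      · rw [hη1 w hw]; ring
      · rw [hyR w (hbR.trans hw.le)]; ring
    rw [this]
    rcases hyy with h | h <;> rw [h] <;> ring
  set I : Cutoff → ℂ := fun χ =>
    Chain.iint (fun _ : Fin n => χ.chain) (fun z => P.num z / P.den z) with hI
  have p1 : I ((y.union η).majority z) = I ((y.union τ).majority z) := by
    refine Cutoff.disc_induction hκ (fun χ => I ((y.union χ).majority z)) ?_ hbig0 htiny0
      hηS hηD hτS hτD
    intro ρ hρ χ χ' hS hD hS' hD'
    have adm := Params.adm_majority hP hs hs' ht hbd (SY := y.S ∪ Metric.closedBall 0 (κ ^ 2 * ρ))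
      (DY := y.D ∩ {w | ρ ≤ ‖w‖}) (hdisc hρ hy.scaled) hz.scaled hz.inner
      (fun x hx w hw => hz.outer x hx.2 w hw.2) (fun r x hx => hz.left r x hx.2)
      (fun r x hx => hy.right r x hx.1) hz.right (fun w hw => h1 w hw.1)
    have hs : ∀ χ : Cutoff, χ.S ⊆ Metric.closedBall 0 (κ ^ 2 * ρ) → (∀ w ∈ χ.D, ρ ≤ ‖w‖) →
        ((y.union χ).majority z).S ⊆ ((y.S ∪ Metric.closedBall 0 (κ ^ 2 * ρ)) ∩ z.S) ∪
          {w | w⁻¹ ∈ y.D ∩ {w | ρ ≤ ‖w‖}} ∧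
        ((y.union χ).majority z).D ⊆ ((y.D ∩ {w | ρ ≤ ‖w‖}) ∪ z.D) ∩
          {w | w⁻¹ ∈ y.S ∪ Metric.closedBall 0 (κ ^ 2 * ρ)} := by
      intro χ hS hD
      have u1 : (y.union χ).S ⊆ y.S ∪ Metric.closedBall 0 (κ ^ 2 * ρ) :=
        (Cutoff.union_S _ _).trans (union_subset_union_right _ hS)
      have u2 : (y.union χ).D ⊆ y.D ∩ {w | ρ ≤ ‖w‖} := (Cutoff.union_D _ _).trans
        (inter_subset_inter_right _ hD)
      exact ⟨(Cutoff.majority_S _ _).trans (union_subset_union (inter_subset_inter_left _ u1)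
        fun w hw => u2 hw), (Cutoff.majority_D _ _).trans (inter_subset_inter
          (union_subset_union_left _ u2) fun w hw => u1 hw)⟩
    exact iint_cutoff_eq_of_adm hP hv he n adm (hs χ hS hD).1 (hs χ' hS' hD').1 (hs χ hS hD).2
      (hs χ' hS' hD').2
  have p2 : I (y.majority (z.union τ)) = I (y.majority (z.union η)) := by
    refine Cutoff.disc_induction hκ (fun χ => I (y.majority (z.union χ))) ?_ htiny0 hbig0
      hτS hτD hηS hηD
    intro ρ hρ χ χ' hS hD hS' hD'
    have adm := Params.adm_majority hP hs hs' ht hbd (SZ := z.S ∪ Metric.closedBall 0 (κ ^ 2 * ρ))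
      (DZ := z.D ∩ {w | ρ ≤ ‖w‖}) hy.scaled (hdisc hρ hz.scaled)
      (fun x hx w hw => hz.inner x hx.1 w hw.1)
      (fun x hx w hw => hy.outer x hx.1 w hw.1) (fun r x hx => hy.left r x hx.1)
      hy.right (fun r x hx => hz.right r x hx.1) h1
    have hs : ∀ χ : Cutoff, χ.S ⊆ Metric.closedBall 0 (κ ^ 2 * ρ) → (∀ w ∈ χ.D, ρ ≤ ‖w‖) →
        (y.majority (z.union χ)).S ⊆ (y.S ∩ (z.S ∪ Metric.closedBall 0 (κ ^ 2 * ρ))) ∪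
          {w | w⁻¹ ∈ y.D} ∧
        (y.majority (z.union χ)).D ⊆ (y.D ∪ (z.D ∩ {w | ρ ≤ ‖w‖})) ∩ {w | w⁻¹ ∈ y.S} := by
      intro χ hS hD
      have u1 : (z.union χ).S ⊆ z.S ∪ Metric.closedBall 0 (κ ^ 2 * ρ) :=
        (Cutoff.union_S _ _).trans (union_subset_union_right _ hS)
      have u2 : (z.union χ).D ⊆ z.D ∩ {w | ρ ≤ ‖w‖} := (Cutoff.union_D _ _).trans
        (inter_subset_inter_right _ hD)
      exact ⟨(Cutoff.majority_S _ _).trans (union_subset_union_left _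
        (inter_subset_inter_right _ u1)), (Cutoff.majority_D _ _).trans
          (inter_subset_inter_left _ (union_subset_union_right _ u2))⟩
    exact iint_cutoff_eq_of_adm hP hv he n adm (hs χ hS hD).1 (hs χ' hS' hD').1 (hs χ hS hD).2
      (hs χ' hS' hD').2
  rw [e1, e2] at p1
  rw [e3, e4] at p2
  exact p1.trans p2

attribute [local irreducible] poch poch2

/-! ### Contours separating the poles of the regularized integrand -/

/-- The contour `C` separates the poles of the regularized integrand: no pole meets the hull or the
exterior in an unwanted way. All conditions concern compact sets, so that they are stable under
perturbation. -/
structure Contour.Separates {N : ℕ} (C : Contour) (P : Params N) : Prop where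
  zero : C.index 0 = 1
  scaled : ∀ x ∈ C.hull, ∀ u ∈ C.outerInv, poch2 (P.t * (x * u)) P.p P.q ≠ 0
  inner : ∀ u ∈ C.outerInv, ∀ v ∈ C.outerInv, poch2 (P.t * P.s' * (u * v)) P.p P.q ≠ 0
  outer : ∀ x ∈ C.hull, ∀ y ∈ C.hull, poch2 (P.t * P.s * (x * y)) P.p P.q ≠ 0
  left : ∀ r, ∀ x ∈ C.hull, poch2 (P.b r * x) P.p P.q ≠ 0
  right : ∀ r, ∀ u ∈ C.outerInv, poch2 (P.d r * u) P.p P.q ≠ 0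

namespace Contour

variable {N : ℕ} {C : Contour} {P : Params N}

lemma zero_notMem_outer (h : C.index 0 = 1) : (0 : ℂ) ∉ C.outer := by
  simp [outer, h, C.zero_notMem_support]

lemma inv_mem_outerInv {y : ℂ} (hy : y ∈ C.outer) : y⁻¹ ∈ C.outerInv :=
  Or.inr (by rwa [inv_inv])

/-- The separation conditions persist in a neighbourhood of the contour. -/
lemma Separates.exists_adm (h : C.Separates P) (hP : P.Small) {W : Set ℂ} (hW : IsOpen W)
    (hCW : C.support ⊆ W) :
    ∃ O : Set ℂ, IsOpen O ∧ C.support ⊆ O ∧ O ⊆ W ∧ (0 : ℂ) ∉ O ∧ P.Adm (C.hull ∪ O) (C.outer ∪ O) := by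
  have hA := C.isCompact_hull
  have hB := C.isCompact_outerInv h.zero
  have hc := continuous_poch2 hP.p hP.q
  have hopen2 : ∀ c : ℂ, IsOpen {w : ℂ × ℂ | poch2 (c * (w.1 * w.2)) P.p P.q ≠ 0} := fun c =>
    isOpen_ne.preimage (hc.comp (by fun_prop : Continuous fun w : ℂ × ℂ => c * (w.1 * w.2)))
  have htube : ∀ (c : ℂ) {A B : Set ℂ}, IsCompact A → IsCompact B →
      (∀ x ∈ A, ∀ y ∈ B, poch2 (c * (x * y)) P.p P.q ≠ 0) → ∃ U V : Set ℂ, IsOpen U ∧ IsOpen V ∧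
        A ⊆ U ∧ B ⊆ V ∧ ∀ x ∈ U, ∀ y ∈ V, poch2 (c * (x * y)) P.p P.q ≠ 0 := by
    intro c A B hA hB hAB
    obtain ⟨U, V, hU, hV, hAU, hBV, hUV⟩ := generalized_tube_lemma hA hB (hopen2 c)
      (fun w hw => hAB w.1 hw.1 w.2 hw.2)
    exact ⟨U, V, hU, hV, hAU, hBV, fun x hx y hy => hUV (mk_mem_prod hx hy)⟩
  have hopen1 : ∀ c : Fin N → ℂ, IsOpen {w : ℂ | ∀ r, poch2 (c r * w) P.p P.q ≠ 0} := fun c => by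
    simp only [ofPred_forall]
    exact isOpen_iInter_of_finite fun r =>
      isOpen_ne.preimage (hc.comp (by fun_prop : Continuous fun w : ℂ => c r * w))
  obtain ⟨U1, V1, hU1, hV1, hAU1, hBV1, h1⟩ := htube _ hA hB h.scaled
  obtain ⟨V2, V3, hV2, hV3, hBV2, hBV3, h2⟩ := htube _ hB hB h.inner
  obtain ⟨U2, U3, hU2, hU3, hAU2, hAU3, h3⟩ := htube _ hA hA h.outer
  obtain ⟨U, hUo, hAU, k1, k2, k3, k4⟩ : ∃ U : Set ℂ, IsOpen U ∧ C.hull ⊆ U ∧ U ⊆ U1 ∧ U ⊆ U2 ∧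
      U ⊆ U3 ∧ U ⊆ {w : ℂ | ∀ r, poch2 (P.b r * w) P.p P.q ≠ 0} :=
    ⟨U1 ∩ (U2 ∩ (U3 ∩ _)), hU1.inter (hU2.inter (hU3.inter (hopen1 P.b))),
      fun x hx => ⟨hAU1 hx, hAU2 hx, hAU3 hx, fun r => h.left r x hx⟩, fun x hx => hx.1,
      fun x hx => hx.2.1, fun x hx => hx.2.2.1, fun x hx => hx.2.2.2⟩
  obtain ⟨V, hVo, hBV, m1, m2, m3, m4⟩ : ∃ V : Set ℂ, IsOpen V ∧ C.outerInv ⊆ V ∧ V ⊆ V1 ∧ V ⊆ V2 ∧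
      V ⊆ V3 ∧ V ⊆ {w : ℂ | ∀ r, poch2 (P.d r * w) P.p P.q ≠ 0} :=
    ⟨V1 ∩ (V2 ∩ (V3 ∩ _)), hV1.inter (hV2.inter (hV3.inter (hopen1 P.d))),
      fun x hx => ⟨hBV1 hx, hBV2 hx, hBV3 hx, fun r => h.right r x hx⟩, fun x hx => hx.1,
      fun x hx => hx.2.1, fun x hx => hx.2.2.1, fun x hx => hx.2.2.2⟩
  have hinv : IsOpen (({0}ᶜ : Set ℂ) ∩ (fun w : ℂ => w⁻¹) ⁻¹' V) :=
    ContinuousOn.isOpen_inter_preimage continuousOn_inv₀ isOpen_compl_singleton hVo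
  refine ⟨W ∩ U ∩ ({0}ᶜ ∩ (fun w : ℂ => w⁻¹) ⁻¹' V), (hW.inter hUo).inter hinv,
    fun w hw => ⟨⟨hCW hw, hAU (Or.inl hw)⟩, fun h0 => C.zero_notMem_support ?_,
    hBV (inv_mem_outerInv (Or.inl hw))⟩, fun w hw => hw.1.1, fun h0 => h0.2.1 rfl, ?_⟩
  · rwa [← mem_singleton_iff.1 h0]
  have hS : ∀ x ∈ C.hull ∪ (W ∩ U ∩ ({0}ᶜ ∩ (fun w : ℂ => w⁻¹) ⁻¹' V)), x ∈ U :=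
    fun x hx => hx.elim (fun hx => hAU hx) fun hx => hx.1.2
  have hD : ∀ y ∈ C.outer ∪ (W ∩ U ∩ ({0}ᶜ ∩ (fun w : ℂ => w⁻¹) ⁻¹' V)), y⁻¹ ∈ V :=
    fun x hx => hx.elim (fun hx => hBV (inv_mem_outerInv hx)) fun hx => hx.2.2
  refine ⟨fun x hx y hy => ?_, fun x hx y hy => ?_, fun x hx y hy => ?_, fun r x hx => ?_,
    fun r y hy => ?_⟩
  · rw [div_eq_mul_inv]
    exact h1 _ (k1 (hS x hx)) _ (m1 (hD y hy))
  · rw [mul_inv]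
    exact h2 _ (m2 (hD x hx)) _ (m3 (hD y hy))
  · exact h3 _ (k2 (hS x hx)) _ (k3 (hS y hy))
  · exact k4 (hS x hx) r
  · exact m4 (hD y hy) r

/-- A separating contour may be replaced by a smooth cutoff function. -/
lemma Separates.exists_cutoff (h : C.Separates P) (hP : P.Small) (hv : P.v ≠ 0) (he : P.e ≠ 0)
    (n : ℕ) {W : Set ℂ} (hW : IsOpen W) (hCW : C.support ⊆ W) :
    ∃ χ : Cutoff, P.Adm χ.S χ.D ∧ χ.D ⊆ C.outer ∪ W ∧
      Chain.iint (fun _ : Fin n => C.chain) (fun z => P.num z / P.den z) =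
        Chain.iint (fun _ : Fin n => χ.chain) (fun z => P.num z / P.den z) := by
  obtain ⟨O, hO, hCO, hOW, hO0, hadm⟩ := h.exists_adm hP hW hCW
  obtain ⟨ψ, h1, h2, h3, h4⟩ := EllipticSelberg.exists_cutoff C.isCompact_support hO hCO
  have hψ : ∀ w ∉ tsupport ψ, ∀ᶠ u in 𝓝 w, ψ u = 0 := fun w hw =>
    notMem_tsupport_iff_eventuallyEq.1 hw
  have hψ1 : ∀ w ∈ C.support, ∀ᶠ u in 𝓝 w, ψ u = 1 := fun w hw =>
    h4.filter_mono (nhds_le_nhdsSet hw)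
  have hind : ∀ w ∉ C.support, ∀ᶠ u in 𝓝 w, C.index u = C.index w := fun w hw =>
    (C.eventually_index_eq hw).mono fun u hu => hu.2
  have hO0' : (0 : ℂ) ∉ tsupport ψ := fun h => hO0 (h3 h)
  let χ : Cutoff :=
    { toFun := fun w => (1 - ψ w) * C.index w
      contDiff := contDiff_iff_contDiffAt.2 fun w => by
        by_cases hw : w ∈ C.support
        · refine (contDiffAt_const (c := (0 : ℂ))).congr_of_eventuallyEq ?_
          filter_upwards [hψ1 w hw] with u hu
          simp [hu]
        · refine ContDiffAt.congr_of_eventuallyEq (f := fun u => (1 - ψ u) * C.index w)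
            ((contDiffAt_const.sub h1.contDiffAt).mul contDiffAt_const) ?_
          filter_upwards [hind w hw] with u hu
          rw [hu]
      compact := by
        refine C.isCompact_hull.of_isClosed_subset (isClosed_tsupport _)
          (closure_minimal (fun w hw => ?_) C.isClosed_hull)
        refine or_iff_not_imp_left.2 fun _ h0 => hw ?_
        simp [h0]
      near := by
        filter_upwards [hψ 0 hO0', hind 0 C.zero_notMem_support] with u hu hu'
        rw [hu, hu', h.zero]; ring }
  have hχ : ∀ w, χ w = (1 - ψ w) * C.index w := fun w => rfl
  have hS : χ.S ⊆ C.hull := closure_minimal (fun w hw =>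
    or_iff_not_imp_left.2 fun _ h0 => hw (by simp [hχ, h0])) C.isClosed_hull
  have hD : χ.D ⊆ C.outer ∪ tsupport ψ := fun w hw => by
    by_contra hcon
    rw [mem_union, not_or, Contour.outer, mem_ofPred_eq, not_or, not_not] at hcon
    refine Cutoff.notMem_D.2 ?_ hw
    filter_upwards [hψ w hcon.2, hind w hcon.1.1] with u hu hu'
    rw [hχ, hu, hu', hcon.1.2]; ring
  refine ⟨χ, hadm.mono (hS.trans subset_union_left) (hD.trans (union_subset_union_right _ h3)),
    hD.trans (union_subset_union_right _ (h3.trans hOW)), ?_⟩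
  have hCψ : C.support ⊆ tsupport ψ := fun w hw => by
    refine subset_tsupport _ ?_
    rw [Function.mem_support, (hψ1 w hw).self_of_nhds]
    exact one_ne_zero
  refine iint_eq_of_ind_eq hP hv he n (K := tsupport ψ) h2 hO0' hCψ ?_ ?_ ?_
  · intro w hw
    rw [Cutoff.chain_supp] at hw
    by_contra hcon
    refine notMem_tsupport_iff_eventuallyEq.2 ?_ hw
    filter_upwards [(hψ w hcon).eventually_nhds,
      (hind w fun h => hcon (hCψ h)).eventually_nhds] with u hu hu'
    refine dbar_eq_zero ((differentiableAt_const (C.index w)).congr_of_eventuallyEq ?_)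
    filter_upwards [hu, hu'] with x hx hx'
    rw [hχ, hx, hx']; ring
  · intro w _ hw
    rw [Cutoff.chain_ind, hχ, (hψ w hw).self_of_nhds, C.chain_ind fun h => hw (hCψ h)]; ring
  · exact fun z hz => hadm.den_ne_zero (fun j => Or.inr (h3 (hz j))) fun j => Or.inr (h3 (hz j))

lemma Separates.den_ne_zero (h : C.Separates P) {n : ℕ} {z : Fin n → ℂ}
    (hz : ∀ j, z j ∈ C.support) : P.den z ≠ 0 := by
  refine mul_ne_zero (Finset.prod_ne_zero_iff.2 fun j _ => Finset.prod_ne_zero_iff.2 fun k _ => ?_)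
    (Finset.prod_ne_zero_iff.2 fun j _ => Finset.prod_ne_zero_iff.2 fun r _ => ?_)
  · have hi : ∀ j, (z j)⁻¹ ∈ C.outerInv := fun j => inv_mem_outerInv (Or.inl (hz j))
    have hh : ∀ j, z j ∈ C.hull := fun j => Or.inl (hz j)
    rw [mul_inv, div_eq_mul_inv, div_eq_mul_inv]
    exact mul_ne_zero (mul_ne_zero (h.outer _ (hh j) _ (hh k)) (h.inner _ (hi j) _ (hi k)))
      (mul_ne_zero (h.scaled _ (hh j) _ (hi k)) (h.scaled _ (hh k) _ (hi j)))
  · exact mul_ne_zero (h.left r _ (Or.inl (hz j)))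
      (h.right r _ (inv_mem_outerInv (Or.inl (hz j))))

lemma Separates.continuousOn (h : C.Separates P) (hP : P.Small) (hv : P.v ≠ 0) (he : P.e ≠ 0)
    (n : ℕ) : ContinuousOn (fun z : Fin n → ℂ => P.num z / P.den z)
      (univ.pi fun _ => C.support) := by
  have hsub : (univ.pi fun _ : Fin n => C.support) ⊆ {z | ∀ j, z j ≠ 0} := fun z hz j h0 =>
    C.zero_notMem_support (h0 ▸ hz j (mem_univ j))
  exact ((Params.differentiableOn_num hP n hv he).continuousOn.mono hsub).div
    ((Params.differentiableOn_den hP n).continuousOn.mono hsub) fun z hz =>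
      h.den_ne_zero fun j => hz j (mem_univ j)

end Contour

/-- The integrals of the regularized integrand over two separating contours agree, provided that
the exterior of the second one is disjoint from the closed unit disc. -/
theorem integralPow_eq_of_separates {N : ℕ} {P : Params N} (hP : P.Small) (hv : P.v ≠ 0)
    (he : P.e ≠ 0) (hs : P.s = P.p) (hs' : P.s' = 1) (ht : ‖P.t‖ < 1)
    (hbd : ∀ r x, poch2 (P.d r * x) P.p P.q ≠ 0 → poch2 (P.b r * x) P.p P.q ≠ 0) (n : ℕ)
    {C R : Contour} (hC : C.Separates P) (hR : R.Separates P) (h1 : ∀ w ∈ R.outer, 1 < ‖w‖) :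
    C.integralPow n (fun z => P.num z / P.den z) = R.integralPow n (fun z => P.num z / P.den z) := by
  rw [C.integralPow_eq_iint (hC.continuousOn hP hv he n),
    R.integralPow_eq_iint (hR.continuousOn hP hv he n)]
  obtain ⟨z, hz, -, e1⟩ := hC.exists_cutoff hP hv he n isOpen_univ (subset_univ _)
  obtain ⟨y, hy, hyD, e2⟩ := hR.exists_cutoff hP hv he n
    (isOpen_lt continuous_const continuous_norm : IsOpen {w : ℂ | 1 < ‖w‖})
    fun w hw => h1 w (Or.inl hw)
  rw [e1, e2]
  exact iint_cutoff_eq hP hv he hs hs' ht hbd n hy hz fun w hw => (hyD hw).elim (h1 w) id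

namespace Contour

variable {N : ℕ} {C : Contour} {P : Params N}

lemma separates_scale {c : ℂ} (hc : c ≠ 0) (h : C.Separates (P.rescale c)) :
    (C.scale c hc).Separates P := by
  have hh : ∀ x ∈ (C.scale c hc).hull, ∃ y ∈ C.hull, x = c * y := fun x hx =>
    ⟨x / c, by rw [← mem_scale_hull C hc, mul_div_cancel₀ _ hc]; exact hx,
      (mul_div_cancel₀ _ hc).symm⟩
  have ho : ∀ u ∈ (C.scale c hc).outerInv, ∃ y ∈ C.outerInv, u = c⁻¹ * y := fun u hu => by
    refine ⟨c * u, ?_, (inv_mul_cancel_left₀ hc _).symm⟩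
    rcases hu with rfl | hu
    · exact Or.inl (mul_zero _)
    · refine Or.inr ?_
      rw [← mem_scale_outer C hc, mul_inv, mul_inv_cancel_left₀ hc]
      exact hu
  refine ⟨?_, fun x hx u hu => ?_, fun u hu v hv => ?_, fun x hx y hy => ?_, fun r x hx => ?_,
    fun r u hu => ?_⟩
  · rw [← mul_zero c, scale_index, h.zero]
  · obtain ⟨x', hx', rfl⟩ := hh x hx
    obtain ⟨u', hu', rfl⟩ := ho u hu
    rw [show c * x' * (c⁻¹ * u') = x' * u' by field_simp]
    exact h.scaled x' hx' u' hu'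
  · obtain ⟨v', hv', rfl⟩ := ho v hv
    obtain ⟨u', hu', rfl⟩ := ho u hu
    rw [show P.t * P.s' * (c⁻¹ * u' * (c⁻¹ * v')) = P.t * (P.s' / c ^ 2) * (u' * v') by field_simp]
    exact h.inner u' hu' v' hv'
  · obtain ⟨x', hx', rfl⟩ := hh x hx
    obtain ⟨y', hy', rfl⟩ := hh y hy
    rw [show P.t * P.s * (c * x' * (c * y')) = P.t * (P.s * c ^ 2) * (x' * y') by ring]
    exact h.outer x' hx' y' hy'
  · obtain ⟨x', hx', rfl⟩ := hh x hx
    rw [← mul_assoc]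
    exact h.left r x' hx'
  · obtain ⟨u', hu', rfl⟩ := ho u hu
    rw [← mul_assoc, ← div_eq_mul_inv]
    exact h.right r u' hu'

end Contour

/-! ### Continuity in the parameters -/

/-- Componentwise convergence of the parameters, with the limits of `v` and `e` nonzero. -/
structure Params.Tends {N : ℕ} {ι : Type*} (P : ι → Params N) (l : Filter ι) (P₀ : Params N) :
    Prop where
  small : P₀.Small
  v_ne : P₀.v ≠ 0
  e_ne : P₀.e ≠ 0
  t_ne : P₀.t ≠ 0
  p : Tendsto (fun i => (P i).p) l (𝓝 P₀.p)
  q : Tendsto (fun i => (P i).q) l (𝓝 P₀.q)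
  t : Tendsto (fun i => (P i).t) l (𝓝 P₀.t)
  s : Tendsto (fun i => (P i).s) l (𝓝 P₀.s)
  s' : Tendsto (fun i => (P i).s') l (𝓝 P₀.s')
  v : Tendsto (fun i => (P i).v) l (𝓝 P₀.v)
  e : Tendsto (fun i => (P i).e) l (𝓝 P₀.e)
  b : ∀ r, Tendsto (fun i => (P i).b r) l (𝓝 (P₀.b r))
  b' : ∀ r, Tendsto (fun i => (P i).b' r) l (𝓝 (P₀.b' r))
  d : ∀ r, Tendsto (fun i => (P i).d r) l (𝓝 (P₀.d r))
  d' : ∀ r, Tendsto (fun i => (P i).d' r) l (𝓝 (P₀.d' r))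

namespace Params.Tends

variable {N : ℕ} {ι : Type*} {P : ι → Params N} {l : Filter ι} {P₀ : Params N}

lemma eventually_poch2_ne_zero (h : Tends P l P₀) {c : ι → ℂ} {c₀ : ℂ}
    (hc : Tendsto c l (𝓝 c₀)) {X : Type*} [TopologicalSpace X] {K : Set X} (hK : IsCompact K)
    {f : X → ℂ} (hf : Continuous f) (h0 : ∀ x ∈ K, poch2 (c₀ * f x) P₀.p P₀.q ≠ 0) :
    ∀ᶠ i in l, ∀ x ∈ K, poch2 (c i * f x) (P i).p (P i).q ≠ 0 := by
  have key : ∀ᶠ w in l ×ˢ 𝓝ˢ K, poch2 (c w.1 * f w.2) (P w.1).p (P w.1).q ≠ 0 := by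
    refine hK.mem_prod_nhdsSet_of_forall fun x hx => ?_
    have ht : Tendsto (fun w : ι × X => poch2 (c w.1 * f w.2) (P w.1).p (P w.1).q) (l ×ˢ 𝓝 x)
        (𝓝 (poch2 (c₀ * f x) P₀.p P₀.q)) :=
      tendsto_poch2 ((hc.comp tendsto_fst).mul ((hf.tendsto x).comp tendsto_snd))
        (h.p.comp tendsto_fst) (h.q.comp tendsto_fst) h.small.p h.small.q
    exact ht.eventually_ne (h0 x hx)
  filter_upwards [key.curry] with i hi x hx
  exact hi.self_of_nhdsSet x hx

/-- Separation is an open condition on the parameters. -/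
lemma eventually_separates (h : Tends P l P₀) {C : Contour} (hC : C.Separates P₀) :
    ∀ᶠ i in l, C.Separates (P i) := by
  have hA := C.isCompact_hull
  have hB := C.isCompact_outerInv hC.zero
  have hm : Continuous fun w : ℂ × ℂ => w.1 * w.2 := by fun_prop
  have hb := eventually_all.2 fun r => h.eventually_poch2_ne_zero (h.b r) hA continuous_id (hC.left r)
  have hd := eventually_all.2 fun r => h.eventually_poch2_ne_zero (h.d r) hB continuous_id (hC.right r)
  filter_upwards [
    h.eventually_poch2_ne_zero h.t (hA.prod hB) hm fun w hw => hC.scaled _ hw.1 _ hw.2,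
    h.eventually_poch2_ne_zero (h.t.mul h.s') (hB.prod hB) hm fun w hw => hC.inner _ hw.1 _ hw.2,
    h.eventually_poch2_ne_zero (h.t.mul h.s) (hA.prod hA) hm fun w hw => hC.outer _ hw.1 _ hw.2,
    hb, hd] with i h1 h2 h3 h4 h5
  exact ⟨hC.zero, fun x hx u hu => h1 (x, u) ⟨hx, hu⟩, fun x hx u hu => h2 (x, u) ⟨hx, hu⟩,
    fun x hx u hu => h3 (x, u) ⟨hx, hu⟩, h4, h5⟩

lemma eventually_small (h : Tends P l P₀) :
    ∀ᶠ i in l, (P i).Small ∧ (P i).v ≠ 0 ∧ (P i).e ≠ 0 := by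
  filter_upwards [h.p.norm.eventually_lt_const h.small.p, h.q.norm.eventually_lt_const h.small.q,
    h.v.eventually_ne h.v_ne, h.e.eventually_ne h.e_ne] with i h1 h2 h3 h4
  exact ⟨⟨h1, h2⟩, h3, h4⟩

lemma tendsto_num (h : Tends P l P₀) {n : ℕ} {z : Fin n → ℂ} (hz : ∀ j, z j ≠ 0) :
    Tendsto (fun w : ι × (Fin n → ℂ) => (P w.1).num w.2) (l ×ˢ 𝓝 z) (𝓝 (P₀.num z)) := by
  have f : ∀ {g : ι → ℂ} {a : ℂ}, Tendsto g l (𝓝 a) →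
      Tendsto (fun w : ι × (Fin n → ℂ) => g w.1) (l ×ˢ 𝓝 z) (𝓝 a) := fun hg => hg.comp tendsto_fst
  have hc : ∀ j, Tendsto (fun w : ι × (Fin n → ℂ) => w.2 j) (l ×ˢ 𝓝 z) (𝓝 (z j)) := fun j =>
    ((continuous_apply j).tendsto z).comp tendsto_snd
  have hm : ∀ j k, Tendsto (fun w : ι × (Fin n → ℂ) => w.2 j * w.2 k) (l ×ˢ 𝓝 z) (𝓝 (z j * z k)) :=
    fun j k => (hc j).mul (hc k)
  have hmi : ∀ j k, Tendsto (fun w : ι × (Fin n → ℂ) => (w.2 j * w.2 k)⁻¹) (l ×ˢ 𝓝 z)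
      (𝓝 (z j * z k)⁻¹) := fun j k => (hm j k).inv₀ (mul_ne_zero (hz j) (hz k))
  have hd : ∀ j k, Tendsto (fun w : ι × (Fin n → ℂ) => w.2 j / w.2 k) (l ×ˢ 𝓝 z) (𝓝 (z j / z k)) :=
    fun j k => (hc j).div (hc k) (hz k)
  have hdi : ∀ j k, Tendsto (fun w : ι × (Fin n → ℂ) => (w.2 j / w.2 k)⁻¹) (l ×ˢ 𝓝 z)
      (𝓝 (z j / z k)⁻¹) := fun j k => (hd j k).inv₀ (div_ne_zero (hz j) (hz k))
  have hci : ∀ j, Tendsto (fun w : ι × (Fin n → ℂ) => (w.2 j)⁻¹) (l ×ˢ 𝓝 z) (𝓝 (z j)⁻¹) :=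
    fun j => (hc j).inv₀ (hz j)
  have h2 : ∀ {g : ι × (Fin n → ℂ) → ℂ} {a : ℂ}, Tendsto g (l ×ˢ 𝓝 z) (𝓝 a) →
      Tendsto (fun w => poch2 (g w) (P w.1).p (P w.1).q) (l ×ˢ 𝓝 z) (𝓝 (poch2 a P₀.p P₀.q)) :=
    fun hg => tendsto_poch2 hg (f h.p) (f h.q) h.small.p h.small.q
  have hp : ∀ {g : ι × (Fin n → ℂ) → ℂ} {a : ℂ}, Tendsto g (l ×ˢ 𝓝 z) (𝓝 a) →
      Tendsto (fun w => poch (g w) (P w.1).p) (l ×ˢ 𝓝 z) (𝓝 (poch a P₀.p)) :=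
    fun hg => tendsto_poch hg (f h.p) h.small.p
  have hq : ∀ {g : ι × (Fin n → ℂ) → ℂ} {a : ℂ}, Tendsto g (l ×ˢ 𝓝 z) (𝓝 a) →
      Tendsto (fun w => poch (g w) (P w.1).q) (l ×ˢ 𝓝 z) (𝓝 (poch a P₀.q)) :=
    fun hg => tendsto_poch hg (f h.q) h.small.q
  have hth : ∀ {g : ι × (Fin n → ℂ) → ℂ} {a : ℂ}, a ≠ 0 → Tendsto g (l ×ˢ 𝓝 z) (𝓝 a) →
      Tendsto (fun w => theta (g w) (P w.1).q) (l ×ˢ 𝓝 z) (𝓝 (theta a P₀.q)) :=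
    fun ha hg => (hq hg).mul (hq ((f h.q).div hg ha))
  unfold num weyl
  refine Tendsto.mul ?_ ?_
  · refine tendsto_finsetProd _ fun j _ => tendsto_finsetProd _ fun k _ => ?_
    refine Tendsto.mul (Tendsto.mul (Tendsto.mul (h2 ?_) (h2 ?_)) (Tendsto.mul (h2 ?_) (h2 ?_)))
      (Tendsto.mul (Tendsto.mul (Tendsto.mul (hq (hd j k)) (hq (hdi j k)))
        (Tendsto.mul (hp ((f h.p).mul (hd j k))) (hp ((f h.p).mul (hdi j k)))))
        (Tendsto.mul (hp ((f h.s').mul (hmi j k))) (hp ((f h.s).mul (hm j k)))))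
    · exact (((f h.q).mul (f h.s')).div (f h.t) h.t_ne).mul (hmi j k)
    · exact (((f h.q).mul (f h.s)).div (f h.t) h.t_ne).mul (hm j k)
    · exact (((f h.p).mul (f h.q)).div (f h.t) h.t_ne).mul (hd k j)
    · exact (((f h.p).mul (f h.q)).div (f h.t) h.t_ne).mul (hd j k)
  · refine tendsto_finsetProd _ fun j _ => Tendsto.mul (Tendsto.mul
      (tendsto_finsetProd _ fun r _ => ?_) ?_) ?_
    · exact (h2 ((f (h.b' r)).mul (hci j))).mul (h2 ((f (h.d' r)).mul (hc j)))
    · exact (hp ((f h.s').mul (hmi j j))).mul (hp ((f h.s).mul (hm j j)))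
    · exact (hth (mul_ne_zero h.v_ne (hz j)) ((f h.v).mul (hc j))).mul
        (hth (mul_ne_zero h.e_ne (hz j)) ((f h.e).mul (hc j)))

lemma tendsto_den (h : Tends P l P₀) {n : ℕ} {z : Fin n → ℂ} (hz : ∀ j, z j ≠ 0) :
    Tendsto (fun w : ι × (Fin n → ℂ) => (P w.1).den w.2) (l ×ˢ 𝓝 z) (𝓝 (P₀.den z)) := by
  have f : ∀ {g : ι → ℂ} {a : ℂ}, Tendsto g l (𝓝 a) →
      Tendsto (fun w : ι × (Fin n → ℂ) => g w.1) (l ×ˢ 𝓝 z) (𝓝 a) := fun hg => hg.comp tendsto_fst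
  have hc : ∀ j, Tendsto (fun w : ι × (Fin n → ℂ) => w.2 j) (l ×ˢ 𝓝 z) (𝓝 (z j)) := fun j =>
    ((continuous_apply j).tendsto z).comp tendsto_snd
  have h2 : ∀ {g : ι × (Fin n → ℂ) → ℂ} {a : ℂ}, Tendsto g (l ×ˢ 𝓝 z) (𝓝 a) →
      Tendsto (fun w => poch2 (g w) (P w.1).p (P w.1).q) (l ×ˢ 𝓝 z) (𝓝 (poch2 a P₀.p P₀.q)) :=
    fun hg => tendsto_poch2 hg (f h.p) (f h.q) h.small.p h.small.q
  unfold den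
  refine Tendsto.mul ?_ ?_
  · refine tendsto_finsetProd _ fun j _ => tendsto_finsetProd _ fun k _ => ?_
    refine Tendsto.mul (Tendsto.mul (h2 ?_) (h2 ?_)) (Tendsto.mul (h2 ?_) (h2 ?_))
    · exact ((f h.t).mul (f h.s)).mul ((hc j).mul (hc k))
    · exact ((f h.t).mul (f h.s')).mul (((hc j).mul (hc k)).inv₀ (mul_ne_zero (hz j) (hz k)))
    · exact (f h.t).mul ((hc j).div (hc k) (hz k))
    · exact (f h.t).mul ((hc k).div (hc j) (hz j))
  · refine tendsto_finsetProd _ fun j _ => tendsto_finsetProd _ fun r _ => ?_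
    exact (h2 ((f (h.b r)).mul (hc j))).mul (h2 ((f (h.d r)).mul ((hc j).inv₀ (hz j))))

/-- The regularized integral over a fixed separating contour is continuous in the parameters. -/
theorem tendsto_integralPow (h : Tends P l P₀) [l.IsCountablyGenerated] {C : Contour}
    (hC : C.Separates P₀) (n : ℕ) :
    Tendsto (fun i => C.integralPow n fun z => (P i).num z / (P i).den z) l
      (𝓝 (C.integralPow n fun z => P₀.num z / P₀.den z)) := by
  have hev := h.eventually_separates hC
  have hsm := h.eventually_small
  rw [C.integralPow_eq_iint (hC.continuousOn h.small h.v_ne h.e_ne n)]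
  refine Tendsto.congr' (f₁ := fun i => Chain.iint (fun _ : Fin n => C.chain)
    fun z => (P i).num z / (P i).den z) ?_ ?_
  · filter_upwards [hev, hsm] with i h1 h2
    exact (C.integralPow_eq_iint (h1.continuousOn h2.1 h2.2.1 h2.2.2 n)).symm
  have hK : IsCompact (univ.pi fun _ : Fin n => C.support) :=
    isCompact_univ_pi fun _ => C.isCompact_support
  have hjoint : ∀ z ∈ univ.pi fun _ : Fin n => C.support,
      Tendsto (fun w : ι × (Fin n → ℂ) => (P w.1).num w.2 / (P w.1).den w.2) (l ×ˢ 𝓝 z)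
        (𝓝 (P₀.num z / P₀.den z)) := fun z hz => by
    have hz0 : ∀ j, z j ≠ 0 := fun j h0 => C.zero_notMem_support (h0 ▸ hz j (mem_univ j))
    exact (h.tendsto_num hz0).div (h.tendsto_den hz0) (hC.den_ne_zero fun j => hz j (mem_univ j))
  obtain ⟨B, hB⟩ := hK.exists_bound_of_continuousOn (hC.continuousOn h.small h.v_ne h.e_ne n)
  have hbound : ∀ᶠ i in l, ∀ z ∈ univ.pi fun _ : Fin n => C.support,
      ‖(P i).num z / (P i).den z‖ ≤ B + 1 := by
    have key : ∀ᶠ w in l ×ˢ 𝓝ˢ (univ.pi fun _ : Fin n => C.support),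
        ‖(P w.1).num w.2 / (P w.1).den w.2‖ < B + 1 :=
      hK.mem_prod_nhdsSet_of_forall fun z hz => (hjoint z hz).norm.eventually_lt_const
        (by linarith [hB z hz])
    filter_upwards [key.curry] with i hi z hz
    exact (hi.self_of_nhdsSet z hz).le
  have hae := Chain.ae_pi_mem fun _ : Fin n => C.chain
  refine tendsto_integral_filter_of_dominated_convergence
    (fun _ => (B + 1) * ∏ _j : Fin n, C.chain.bound) ?_ ?_ (integrable_const _) ?_
  · filter_upwards [hev, hsm] with i h1 h2
    exact (Chain.integrable_iint (fun _ : Fin n => C.chain)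
      (h1.continuousOn h2.1 h2.2.1 h2.2.2 n)).aestronglyMeasurable
  · filter_upwards [hbound] with i hi
    filter_upwards [hae] with x hx
    rw [norm_mul, norm_prod]
    have h1 := hi (fun j => (x j).1) fun j _ => (hx j).1
    exact mul_le_mul h1 (Finset.prod_le_prod (fun _ _ => norm_nonneg _) fun j _ => (hx j).2)
      (Finset.prod_nonneg fun _ _ => norm_nonneg _) ((norm_nonneg _).trans h1)
  · filter_upwards [hae] with x hx
    refine Tendsto.mul_const _ ?_
    have hc : ∀ (G : ι × (Fin n → ℂ) → ℂ) (z : Fin n → ℂ) (a : ℂ), Tendsto G (l ×ˢ 𝓝 z) (𝓝 a) →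
        Tendsto (fun i => G (i, z)) l (𝓝 a) := fun G z a hG =>
      hG.comp (tendsto_id.prodMk tendsto_const_nhds)
    exact hc (fun w => (P w.1).num w.2 / (P w.1).den w.2) _ _
      (hjoint (fun j => (x j).1) fun j _ => (hx j).1)

end Params.Tends

/-! ### Theta functions with prescribed zeros -/

/-- The zeros of the theta function are simple. -/
lemma deriv_theta_ne_zero {q : ℂ} (hq₀ : q ≠ 0) (hq : ‖q‖ < 1) (k : ℤ) :
    deriv (fun x => theta x q) (q ^ k) ≠ 0 := by
  have hstep : ∀ x : ℂ, x ≠ 0 → theta x q = 0 →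
      q * deriv (fun x => theta x q) (q * x) = -x⁻¹ * deriv (fun x => theta x q) x := by
    intro x hx h0
    have h1 : HasDerivAt (fun y => theta (q * y) q) (q * deriv (fun x => theta x q) (q * x)) x := by
      have := (differentiableAt_theta (mul_ne_zero hq₀ hx) hq).hasDerivAt.comp x
        ((hasDerivAt_id x).const_mul q)
      simpa [mul_comm, Function.comp_def] using this
    have h2 : HasDerivAt (fun y => theta (q * y) q) (-x⁻¹ * deriv (fun x => theta x q) x) x := by
      have h3 := ((hasDerivAt_inv hx).neg).mul (differentiableAt_theta hx hq).hasDerivAt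
      rw [h0, mul_zero, zero_add] at h3
      refine h3.congr_of_eventuallyEq ?_
      filter_upwards [isOpen_ne.mem_nhds hx] with y hy
      exact theta_mul hy hq₀ hq
    exact h1.unique h2
  have hz : ∀ k : ℤ, theta (q ^ k) q = 0 := fun k =>
    (theta_eq_zero_iff (zpow_ne_zero k hq₀) hq₀ hq).2 ⟨k, rfl⟩
  have hiff : ∀ k : ℤ, deriv (fun x => theta x q) (q ^ (k + 1)) ≠ 0 ↔
      deriv (fun x => theta x q) (q ^ k) ≠ 0 := fun k => by
    have h := hstep _ (zpow_ne_zero k hq₀) (hz k)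
    rw [show q * q ^ k = q ^ (k + 1) by rw [zpow_add_one₀ hq₀, mul_comm]] at h
    rw [← not_iff_not, not_not, not_not, ← mul_right_inj' hq₀, h, mul_zero, mul_eq_zero, neg_eq_zero]
    simp [zpow_ne_zero k hq₀]
  induction k using Int.induction_on with
  | zero =>
    have h : HasDerivAt (fun x => theta x q) (-1 * (poch (q * 1) q * poch (q / 1) q)) 1 := by
      have hd : DifferentiableAt ℂ (fun x => poch (q * x) q * poch (q / x) q) 1 :=
        ((differentiable_poch hq _).comp 1 (differentiableAt_id.const_mul q)).mul
          ((differentiable_poch hq _).comp 1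
            (DifferentiableAt.div (differentiableAt_const q) differentiableAt_id one_ne_zero))
      have h3 := ((hasDerivAt_id (1 : ℂ)).const_sub 1).mul hd.hasDerivAt
      simp only [id, sub_self, zero_mul, add_zero] at h3
      refine h3.congr_of_eventuallyEq (Eventually.of_forall fun x => ?_)
      change poch x q * poch (q / x) q = (1 - x) * (poch (q * x) q * poch (q / x) q)
      rw [poch_eq_mul x hq, mul_assoc]
    rw [zpow_zero, h.deriv]
    have h1 : poch q q ≠ 0 := by
      rw [← poch2_zero]
      exact poch2_ne_zero_of_norm_lt_one (by simp) hq hq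
    simp [h1]
  | succ i ih => exact (hiff i).2 ih
  | pred i ih => exact (hiff (-i - 1)).1 (by rwa [sub_add_cancel])

/-- Liouville's theorem on the torus `ℂ* / q^ℤ`: two functions with the same multipliers are
proportional if the zeros of one of them are simple and shared by the other. -/
lemma exists_eq_const_mul {q : ℂ} (hq₀ : q ≠ 0) (hq : ‖q‖ < 1) {D h m : ℂ → ℂ}
    (hD : ∀ x ≠ 0, DifferentiableAt ℂ D x) (hh : ∀ x ≠ 0, DifferentiableAt ℂ h x)
    (hDq : ∀ x ≠ 0, D (q * x) = m x * D x) (hhq : ∀ x ≠ 0, h (q * x) = m x * h x)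
    (hm : ∀ x ≠ 0, m x ≠ 0) (hs : ∀ x ≠ 0, D x = 0 → h x = 0 ∧ deriv D x ≠ 0) :
    ∃ c, ∀ x ≠ 0, h x = c * D x := by
  classical
  let f : ℂ → ℂ := fun x => if D x = 0 then deriv h x / deriv D x else h x / D x
  have hpunct : ∀ x ≠ 0, ∀ᶠ y in 𝓝[≠] x, D y ≠ 0 := fun x hx => by
    by_cases h0 : D x = 0
    · exact (hD x hx).hasDerivAt.eventually_ne (hs x hx h0).2
    · exact ((hD x hx).continuousAt.eventually_ne h0).filter_mono nhdsWithin_le_nhds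
  have hnhds : ∀ x : ℂ, x ≠ 0 → ({0}ᶜ : Set ℂ) ∈ 𝓝 x := fun x hx =>
    isOpen_compl_singleton.mem_nhds hx
  have hf : ∀ x ≠ 0, DifferentiableAt ℂ f x := fun x hx => by
    by_cases h0 : D x = 0
    · have hds : ∀ {g : ℂ → ℂ}, (∀ x ≠ 0, DifferentiableAt ℂ g x) →
          DifferentiableAt ℂ (dslope g x) x := fun hg =>
        ((Complex.differentiableOn_dslope (hnhds x hx)).2
          fun y hy => (hg y hy).differentiableWithinAt).differentiableAt (hnhds x hx)
      have hne : dslope D x x ≠ 0 := by rw [dslope_same]; exact (hs x hx h0).2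
      refine ((hds hh).div (hds hD) hne).congr_of_eventuallyEq ?_
      filter_upwards [eventually_nhdsWithin_iff.1 (hpunct x hx)] with y hy
      by_cases hyx : y = x
      · subst hyx
        simp only [f, h0, if_true, Pi.div_apply, dslope_same]
      · have hyx' : (y - x)⁻¹ ≠ 0 := inv_ne_zero (sub_ne_zero.2 hyx)
        simp only [f, hy hyx, if_false, Pi.div_apply, dslope_of_ne _ hyx, slope_def_field, h0,
          (hs x hx h0).1, sub_zero]
        rw [div_div_div_cancel_right₀ (sub_ne_zero.2 hyx)]
    · refine ((hh x hx).div (hD x hx) h0).congr_of_eventuallyEq ?_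
      filter_upwards [(hD x hx).continuousAt.eventually_ne h0] with y hy
      simp only [f, hy, if_false, Pi.div_apply]
  have hfq : ∀ x ≠ 0, f (q * x) = f x := fun x hx => by
    have hc : ContinuousAt (fun y => f (q * y)) x :=
      ContinuousAt.comp (f := fun y => q * y) (hf _ (mul_ne_zero hq₀ hx)).continuousAt
        (by fun_prop)
    refine tendsto_nhds_unique (hc.tendsto.mono_left (nhdsWithin_le_nhds (s := {x}ᶜ))) ?_
    refine ((hf x hx).continuousAt.tendsto.mono_left (nhdsWithin_le_nhds (s := {x}ᶜ))).congr' ?_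
    filter_upwards [hpunct x hx, nhdsWithin_le_nhds (hnhds x hx)] with y hy hy0
    have hy' : D (q * y) ≠ 0 := by rw [hDq y hy0]; exact mul_ne_zero (hm y hy0) hy
    simp only [f, hy, hy', if_false]
    rw [hDq y hy0, hhq y hy0, mul_div_mul_left _ _ (hm y hy0)]
  have hfk : ∀ (k : ℤ) (x : ℂ), x ≠ 0 → f (q ^ k * x) = f x := fun k x hx => by
    have hne : ∀ k : ℤ, q ^ k * x ≠ 0 := fun k => mul_ne_zero (zpow_ne_zero k hq₀) hx
    have hst : ∀ k : ℤ, f (q ^ (k + 1) * x) = f (q ^ k * x) := fun k => by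
      rw [zpow_add_one₀ hq₀, mul_comm (q ^ k), mul_assoc, hfq _ (hne k)]
    induction k using Int.induction_on with
    | zero => simp
    | succ i ih => rw [hst, ih]
    | pred i ih => rw [← ih, ← hst (-i - 1), sub_add_cancel]
  have hqn : 0 < ‖q‖ := norm_pos_iff.2 hq₀
  have hann : IsCompact {x : ℂ | ‖q‖ ≤ ‖x‖ ∧ ‖x‖ ≤ 1} := by
    refine (isCompact_closedBall (0 : ℂ) 1).of_isClosed_subset
      ((isClosed_le continuous_const continuous_norm).inter
        (isClosed_le continuous_norm continuous_const)) fun x hx => ?_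
    simpa using hx.2
  obtain ⟨M, hM⟩ := hann.exists_bound_of_continuousOn (f := f) fun x hx =>
    (hf x fun h => hq₀ (by simpa [h] using hx)).continuousAt.continuousWithinAt
  have hbound : ∀ x ≠ 0, ‖f x‖ ≤ M := fun x hx => by
    obtain ⟨k, hk⟩ := exists_mem_Ico_zpow (norm_pos_iff.2 hx) ((one_lt_inv₀ hqn).2 hq)
    rw [← hfk (k + 1) x hx]
    have hpos : 0 < ‖q‖ ^ (k + 1) := zpow_pos hqn _
    refine hM _ ⟨?_, ?_⟩
    · rw [norm_mul, norm_zpow]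
      calc ‖q‖ = ‖q‖ ^ (k + 1) * ‖q‖⁻¹ ^ k := by
            rw [inv_zpow, zpow_add_one₀ hqn.ne']; field_simp
        _ ≤ _ := mul_le_mul_of_nonneg_left hk.1 hpos.le
    · rw [norm_mul, norm_zpow]
      calc _ ≤ ‖q‖ ^ (k + 1) * ‖q‖⁻¹ ^ (k + 1) := mul_le_mul_of_nonneg_left hk.2.le hpos.le
        _ = 1 := by rw [inv_zpow]; exact mul_inv_cancel₀ hpos.ne'
  have hF : Differentiable ℂ fun u => f (Complex.exp u) := fun u =>
    DifferentiableAt.comp u (hf _ (Complex.exp_ne_zero u)) Complex.differentiableAt_exp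
  have hconst := hF.apply_eq_apply_of_bounded (isBounded_iff_forall_norm_le.2 ⟨M, by
    rintro _ ⟨u, rfl⟩; exact hbound _ (Complex.exp_ne_zero u)⟩)
  refine ⟨f 1, fun x hx => ?_⟩
  by_cases h0 : D x = 0
  · rw [h0, (hs x hx h0).1, mul_zero]
  · have := hconst (Complex.log x) 0
    simp only [Complex.exp_log hx, Complex.exp_zero] at this
    rw [← this]
    simp only [f, h0, if_false]
    rw [div_mul_cancel₀ _ h0]

/-- A product of functions with simple zeros has simple zeros, if no two of the factors have a
common zero. -/
lemma deriv_prod_ne_zero {ι : Type*} [DecidableEq ι] {s : Finset ι} {f : ι → ℂ → ℂ} {x : ℂ}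
    (hf : ∀ i ∈ s, DifferentiableAt ℂ (f i) x) (hs : ∀ i ∈ s, f i x = 0 → deriv (f i) x ≠ 0)
    (hd : ∀ i ∈ s, ∀ j ∈ s, i ≠ j → f i x = 0 → f j x ≠ 0) (h0 : ∏ i ∈ s, f i x = 0) :
    deriv (fun x => ∏ i ∈ s, f i x) x ≠ 0 := by
  obtain ⟨i, hi, hi0⟩ := Finset.prod_eq_zero_iff.1 h0
  have h : (fun x => ∏ i ∈ s, f i x) = fun x => f i x * ∏ j ∈ s.erase i, f j x :=
    funext fun x => (Finset.mul_prod_erase s (fun i => f i x) hi).symm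
  rw [h, deriv_fun_mul (hf i hi) (differentiableAt_finset_prod fun j hj =>
    hf j (Finset.mem_of_mem_erase hj)), hi0, zero_mul, add_zero]
  exact mul_ne_zero (hs i hi hi0) (Finset.prod_ne_zero_iff.2 fun j hj =>
    hd i hi j (Finset.mem_of_mem_erase hj) (Finset.ne_of_mem_erase hj).symm hi0)

/-! ### A theta function identity of type C -/

/-- The product of `f (y j * y k)` over `j < k`. -/
def pairProd {n : ℕ} (f : ℂ → ℂ) (y : Fin n → ℂ) : ℂ :=
  ∏ j : Fin n, ∏ k ∈ Finset.Ioi j, f (y j * y k)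

lemma pairProd_cons {n : ℕ} (f : ℂ → ℂ) (x : ℂ) (y : Fin n → ℂ) :
    pairProd f (Fin.cons x y : Fin (n + 1) → ℂ) = (∏ k, f (x * y k)) * pairProd f y := by
  rw [pairProd, Fin.prod_univ_succ, Fin.prod_Ioi_zero]
  simp only [Fin.cons_zero, Fin.cons_succ, Fin.prod_Ioi_succ]
  rfl

/-- Separation of the factors which depend on the `i`-th variable. -/
lemma pairProd_split {n : ℕ} (f : ℂ → ℂ) (y : Fin n → ℂ) (i : Fin n) :
    pairProd f y = (∏ k ∈ Finset.univ.erase i, f (y i * y k)) *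
      ∏ j : Fin n, ∏ k ∈ Finset.Ioi j, if j = i ∨ k = i then 1 else f (y j * y k) := by
  have h1 : pairProd f y = (∏ j : Fin n, ∏ k ∈ Finset.Ioi j, if j = i ∨ k = i then f (y j * y k) else 1) *
      ∏ j : Fin n, ∏ k ∈ Finset.Ioi j, if j = i ∨ k = i then 1 else f (y j * y k) := by
    simp only [pairProd, ← Finset.prod_mul_distrib]
    refine Finset.prod_congr rfl fun j _ => Finset.prod_congr rfl fun k _ => ?_
    split_ifs <;> simp
  rw [h1]
  congr 1
  rw [← Finset.mul_prod_erase _ _ (Finset.mem_univ i)]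
  have h2 : ∀ j ∈ Finset.univ.erase i,
      (∏ k ∈ Finset.Ioi j, if j = i ∨ k = i then f (y j * y k) else 1) =
        if j < i then f (y i * y j) else 1 := fun j hj => by
    have hj' := Finset.ne_of_mem_erase hj
    simp only [hj', false_or]
    rw [Finset.prod_ite_eq' (Finset.Ioi j) i fun k => f (y j * y k)]
    simp only [Finset.mem_Ioi, mul_comm (y j)]
  rw [Finset.prod_congr rfl h2]
  have h3 : (∏ k ∈ Finset.Ioi i, if i = i ∨ k = i then f (y i * y k) else 1) =
      ∏ k ∈ Finset.univ.erase i, if i < k then f (y i * y k) else 1 := by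
    simp only [true_or, if_true]
    rw [← Finset.prod_filter]
    refine Finset.prod_congr ?_ fun _ _ => rfl
    ext k
    simp only [Finset.mem_Ioi, Finset.mem_filter, Finset.mem_erase, Finset.mem_univ, and_true]
    exact ⟨fun h => ⟨h.ne', h⟩, fun h => h.2⟩
  rw [h3, ← Finset.prod_mul_distrib]
  refine Finset.prod_congr rfl fun k hk => ?_
  rcases lt_or_gt_of_ne (Finset.ne_of_mem_erase hk) with h | h
  · simp [h, h.le]
  · simp [h, h.le]

/-- The vector of the `z j ^ (± 1)`, with signs given by `ε`. -/
def signs {n : ℕ} (ε : Fin n → Bool) (z : Fin n → ℂ) (j : Fin n) : ℂ :=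
  if ε j then z j else (z j)⁻¹

lemma signs_cons {n : ℕ} (e : Bool) (ε : Fin n → Bool) (x : ℂ) (z : Fin n → ℂ) :
    signs (Fin.cons e ε : Fin (n + 1) → Bool) (Fin.cons x z : Fin (n + 1) → ℂ) =
      Fin.cons (if e then x else x⁻¹) (signs ε z) := by
  funext j
  refine Fin.cases ?_ (fun j => ?_) j <;> simp [signs]

/-- The product `θ(ax) θ(bx) θ(cx) θ(dx)`. -/
def thetaQuad (q a b c d x : ℂ) : ℂ :=
  theta (a * x) q * theta (b * x) q * theta (c * x) q * theta (d * x) q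

/-- The summand of the identity. -/
def thetaTerm (q t a b c d : ℂ) {n : ℕ} (y : Fin n → ℂ) : ℂ :=
  (∏ j, thetaQuad q a b c d (y j) / theta (y j * y j) q) *
    pairProd (fun x => theta (t * x) q / theta x q) y

/-- Points where all denominators of the identity are nonzero. -/
structure ThetaRegular (q : ℂ) {n : ℕ} (z : Fin n → ℂ) : Prop where
  ne_zero : ∀ j, z j ≠ 0
  mul : ∀ j k, theta (z j * z k) q ≠ 0
  div : ∀ j k, j ≠ k → theta (z j / z k) q ≠ 0

section

variable {q t a b c d : ℂ}

lemma theta_inv_ne_zero (hq₀ : q ≠ 0) (hq : ‖q‖ < 1) {x : ℂ} (hx : x ≠ 0) (h : theta x q ≠ 0) :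
    theta x⁻¹ q ≠ 0 := by
  rw [theta_inv hx hq₀ hq]
  exact mul_ne_zero (neg_ne_zero.2 (inv_ne_zero hx)) h

lemma ThetaRegular.signs (hq₀ : q ≠ 0) (hq : ‖q‖ < 1) {n : ℕ} {z : Fin n → ℂ}
    (h : ThetaRegular q z) (ε : Fin n → Bool) : ThetaRegular q (signs ε z) := by
  have hm : ∀ j k, theta (z j * z k)⁻¹ q ≠ 0 := fun j k =>
    theta_inv_ne_zero hq₀ hq (mul_ne_zero (h.ne_zero j) (h.ne_zero k)) (h.mul j k)
  refine ⟨fun j => ?_, fun j k => ?_, fun j k hjk => ?_⟩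
  · unfold EllipticSelberg.signs
    split_ifs
    · exact h.ne_zero j
    · exact inv_ne_zero (h.ne_zero j)
  · by_cases hjk : j = k
    · subst hjk
      unfold EllipticSelberg.signs
      split_ifs
      · exact h.mul j j
      · rw [← mul_inv]; exact hm j j
    · unfold EllipticSelberg.signs
      split_ifs
      · exact h.mul j k
      · rw [← div_eq_mul_inv]; exact h.div j k hjk
      · rw [mul_comm, ← div_eq_mul_inv]; exact h.div k j (Ne.symm hjk)
      · rw [← mul_inv]; exact hm j k
  · unfold EllipticSelberg.signs
    split_ifs
    · exact h.div j k hjk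
    · rw [div_inv_eq_mul]; exact h.mul j k
    · rw [div_eq_mul_inv, ← mul_inv]; exact hm j k
    · rw [div_inv_eq_mul, mul_comm, ← div_eq_mul_inv]; exact h.div k j hjk.symm

/-- The term with first variable `x`, after multiplication by `thetaDen`. -/
def headPos (q t a b c d x : ℂ) {n : ℕ} (y : Fin n → ℂ) : ℂ :=
  thetaQuad q a b c d x * ∏ k, theta (x / y k) q * theta (t * (x * y k)) q

/-- The negative of the term with first variable `x⁻¹`, after multiplication by `thetaDen`. -/
def headNeg (q t a b c d x : ℂ) {n : ℕ} (y : Fin n → ℂ) : ℂ :=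
  x ^ 2 * thetaQuad q a b c d x⁻¹ *
    ∏ k, -(x / y k) * theta (x * y k) q * theta (t * (x⁻¹ * y k)) q

/-- The common denominator of the sum, as a function of the first variable. -/
def thetaDen (q x : ℂ) {n : ℕ} (y : Fin n → ℂ) : ℂ :=
  theta (x * x) q * ∏ k, theta (x * y k) q * theta (x / y k) q

lemma thetaDen_signs {n : ℕ} (x : ℂ) (z : Fin n → ℂ) (ε : Fin n → Bool) :
    thetaDen q x (signs ε z) = thetaDen q x z := by
  unfold thetaDen signs
  congr 1
  refine Finset.prod_congr rfl fun k _ => ?_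
  split_ifs
  · rfl
  · rw [div_inv_eq_mul, ← div_eq_mul_inv, mul_comm]

lemma thetaTerm_cons {n : ℕ} (x : ℂ) (y : Fin n → ℂ) :
    thetaTerm q t a b c d (Fin.cons x y : Fin (n + 1) → ℂ) =
      thetaQuad q a b c d x / theta (x * x) q * (∏ k, theta (t * (x * y k)) q / theta (x * y k) q) *
        thetaTerm q t a b c d y := by
  rw [thetaTerm, pairProd_cons, Fin.prod_univ_succ]
  simp only [Fin.cons_zero, Fin.cons_succ]
  rw [thetaTerm]
  ring

lemma theta_div_eq (hq₀ : q ≠ 0) (hq : ‖q‖ < 1) {x y : ℂ} (hx : x ≠ 0) (hy : y ≠ 0) :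
    theta (x / y) q = -(x / y) * theta (x⁻¹ * y) q := by
  have h := theta_inv (x := x⁻¹ * y) (by positivity) hq₀ hq
  rw [mul_inv, inv_inv, ← div_eq_mul_inv] at h
  exact h

lemma theta_inv_mul_inv (hq₀ : q ≠ 0) (hq : ‖q‖ < 1) {x : ℂ} (hx : x ≠ 0) :
    theta (x⁻¹ * x⁻¹) q = -(x ^ 2)⁻¹ * theta (x * x) q := by
  rw [← mul_inv, theta_inv (mul_ne_zero hx hx) hq₀ hq, sq]

lemma thetaDen_mul_thetaTerm_pos {n : ℕ} {x : ℂ} {y : Fin n → ℂ} (hx2 : theta (x * x) q ≠ 0)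
    (hxy : ∀ k, theta (x * y k) q ≠ 0) :
    thetaDen q x y * thetaTerm q t a b c d (Fin.cons x y : Fin (n + 1) → ℂ) =
      thetaTerm q t a b c d y * headPos q t a b c d x y := by
  rw [thetaTerm_cons, thetaDen, headPos]
  have h : (∏ k, theta (x / y k) q * theta (t * (x * y k)) q) =
      (∏ k, theta (x * y k) q * theta (x / y k) q) *
        ∏ k, theta (t * (x * y k)) q / theta (x * y k) q := by
    rw [← Finset.prod_mul_distrib]
    refine Finset.prod_congr rfl fun k _ => ?_
    have := hxy k
    field_simp
  rw [h]
  generalize theta (x * x) q = A at hx2 ⊢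
  field_simp

lemma thetaDen_mul_thetaTerm_neg (hq₀ : q ≠ 0) (hq : ‖q‖ < 1) {n : ℕ} {x : ℂ} {y : Fin n → ℂ}
    (hx : x ≠ 0) (hy : ∀ k, y k ≠ 0) (hx2 : theta (x * x) q ≠ 0)
    (hxy : ∀ k, theta (x⁻¹ * y k) q ≠ 0) :
    thetaDen q x y * thetaTerm q t a b c d (Fin.cons x⁻¹ y : Fin (n + 1) → ℂ) =
      -(thetaTerm q t a b c d y * headNeg q t a b c d x y) := by
  rw [thetaTerm_cons, thetaDen, headNeg, theta_inv_mul_inv hq₀ hq hx]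
  have h : (∏ k, -(x / y k) * theta (x * y k) q * theta (t * (x⁻¹ * y k)) q) =
      (∏ k, theta (x * y k) q * theta (x / y k) q) *
        ∏ k, theta (t * (x⁻¹ * y k)) q / theta (x⁻¹ * y k) q := by
    rw [← Finset.prod_mul_distrib]
    refine Finset.prod_congr rfl fun k _ => ?_
    rw [theta_div_eq hq₀ hq hx (hy k)]
    have := hxy k
    generalize theta (x⁻¹ * y k) q = B at this ⊢
    field_simp
  rw [h]
  generalize theta (x * x) q = A at hx2 ⊢
  field_simp

/-- The cancellation of the residues at `x = y i`. -/
lemma thetaTerm_mul_headNeg_eq (hq₀ : q ≠ 0) (hq : ‖q‖ < 1) {n : ℕ} {y : Fin n → ℂ}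
    (hy : ThetaRegular q y) (i : Fin n) :
    thetaTerm q t a b c d y * headNeg q t a b c d (y i) y =
      thetaTerm q t a b c d (Function.update y i (y i)⁻¹) *
        headPos q t a b c d (y i) (Function.update y i (y i)⁻¹) := by
  set w := y i with hw
  set y' := Function.update y i w⁻¹ with hy'
  have hw0 : w ≠ 0 := hy.ne_zero i
  have hyi : y' i = w⁻¹ := by simp [hy']
  have hyk : ∀ k, k ≠ i → y' k = y k := fun k hk => by simp [hy', hk]
  have hww : theta (w * w) q ≠ 0 := hy.mul i i
  unfold thetaTerm headNeg headPos
  rw [pairProd_split _ y i, pairProd_split _ y' i,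
    ← Finset.mul_prod_erase _ (fun j => thetaQuad q a b c d (y j) / theta (y j * y j) q) (Finset.mem_univ i),
    ← Finset.mul_prod_erase _ (fun j => thetaQuad q a b c d (y' j) / theta (y' j * y' j) q) (Finset.mem_univ i),
    ← Finset.mul_prod_erase _ (fun k => -(w / y k) * theta (w * y k) q * theta (t * (w⁻¹ * y k)) q)
      (Finset.mem_univ i),
    ← Finset.mul_prod_erase _ (fun k => theta (w / y' k) q * theta (t * (w * y' k)) q)
      (Finset.mem_univ i)]
  have e1 : (∏ k ∈ Finset.univ.erase i, thetaQuad q a b c d (y' k) / theta (y' k * y' k) q) =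
      ∏ k ∈ Finset.univ.erase i, thetaQuad q a b c d (y k) / theta (y k * y k) q :=
    Finset.prod_congr rfl fun k hk => by rw [hyk k (Finset.ne_of_mem_erase hk)]
  have e2 : (∏ j : Fin n, ∏ k ∈ Finset.Ioi j, if j = i ∨ k = i then 1 else
        theta (t * (y' j * y' k)) q / theta (y' j * y' k) q) =
      ∏ j : Fin n, ∏ k ∈ Finset.Ioi j, if j = i ∨ k = i then 1 else
        theta (t * (y j * y k)) q / theta (y j * y k) q :=
    Finset.prod_congr rfl fun j _ => Finset.prod_congr rfl fun k _ => by
      split_ifs with h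
      · rfl
      · rw [not_or] at h
        rw [hyk j h.1, hyk k h.2]
  have e3 : (∏ k ∈ Finset.univ.erase i, theta (t * (y i * y k)) q / theta (y i * y k) q) *
        (∏ k ∈ Finset.univ.erase i, -(w / y k) * theta (w * y k) q * theta (t * (w⁻¹ * y k)) q) =
      (∏ k ∈ Finset.univ.erase i, theta (t * (y' i * y' k)) q / theta (y' i * y' k) q) *
        ∏ k ∈ Finset.univ.erase i, theta (w / y' k) q * theta (t * (w * y' k)) q := by
    rw [← Finset.prod_mul_distrib, ← Finset.prod_mul_distrib]
    refine Finset.prod_congr rfl fun k hk => ?_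
    have hki := Finset.ne_of_mem_erase hk
    rw [hyk k hki, hyi, ← hw, theta_div_eq hq₀ hq hw0 (hy.ne_zero k)]
    have h1 : theta (w * y k) q ≠ 0 := hy.mul i k
    have h2 : theta (w⁻¹ * y k) q ≠ 0 := by
      rw [mul_comm, ← div_eq_mul_inv]; exact hy.div k i hki
    generalize theta (w * y k) q = A at h1 ⊢
    generalize theta (w⁻¹ * y k) q = B at h2 ⊢
    field_simp
  have e4 : thetaQuad q a b c d (y i) / theta (y i * y i) q * (w ^ 2 * thetaQuad q a b c d w⁻¹) *
        (-(w / y i) * theta (w * y i) q * theta (t * (w⁻¹ * y i)) q) =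
      thetaQuad q a b c d (y' i) / theta (y' i * y' i) q * thetaQuad q a b c d w *
        (theta (w / y' i) q * theta (t * (w * y' i)) q) := by
    rw [hyi, ← hw, theta_inv_mul_inv hq₀ hq hw0, div_inv_eq_mul, inv_mul_cancel₀ hw0,
      mul_inv_cancel₀ hw0, div_self hw0]
    field_simp
  rw [e1, e2]
  linear_combination (thetaQuad q a b c d (y i) / theta (y i * y i) q * (w ^ 2 * thetaQuad q a b c d w⁻¹) *
        (-(w / y i) * theta (w * y i) q * theta (t * (w⁻¹ * y i)) q) *
      (∏ k ∈ Finset.univ.erase i, thetaQuad q a b c d (y k) / theta (y k * y k) q) *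
      (∏ j : Fin n, ∏ k ∈ Finset.Ioi j, if j = i ∨ k = i then 1 else
        theta (t * (y j * y k)) q / theta (y j * y k) q)) * e3 +
    ((∏ k ∈ Finset.univ.erase i, theta (t * (y' i * y' k)) q / theta (y' i * y' k) q) *
        (∏ k ∈ Finset.univ.erase i, theta (w / y' k) q * theta (t * (w * y' k)) q) *
      (∏ k ∈ Finset.univ.erase i, thetaQuad q a b c d (y k) / theta (y k * y k) q) *
      (∏ j : Fin n, ∏ k ∈ Finset.Ioi j, if j = i ∨ k = i then 1 else
        theta (t * (y j * y k)) q / theta (y j * y k) q)) * e4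

/-! #### Quasi-periodicity -/

lemma thetaQuad_mul (hq₀ : q ≠ 0) (hq : ‖q‖ < 1) (ha : a ≠ 0) (hb : b ≠ 0) (hc : c ≠ 0)
    (hd : d ≠ 0) {x : ℂ} (hx : x ≠ 0) :
    a * b * c * d * x ^ 4 * thetaQuad q a b c d (q * x) = thetaQuad q a b c d x := by
  have h : ∀ {a : ℂ}, a ≠ 0 → theta (a * (q * x)) q = -(a * x)⁻¹ * theta (a * x) q := fun ha => by
    rw [mul_left_comm, theta_mul (mul_ne_zero ha hx) hq₀ hq]
  rw [thetaQuad, thetaQuad, h ha, h hb, h hc, h hd]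
  field_simp

lemma theta_mul_inv_mul (hq₀ : q ≠ 0) (hq : ‖q‖ < 1) {x : ℂ} (hx : x ≠ 0) :
    theta (q⁻¹ * x) q = -(q⁻¹ * x) * theta x q := by
  have h := theta_mul (x := q⁻¹ * x) (by positivity) hq₀ hq
  rw [mul_inv_cancel_left₀ hq₀] at h
  rw [h]
  field_simp

lemma headPos_mul (hq₀ : q ≠ 0) (hq : ‖q‖ < 1) (ht : t ≠ 0) (ha : a ≠ 0) (hb : b ≠ 0) (hc : c ≠ 0)
    (hd : d ≠ 0) {n : ℕ} (hbal : a * b * c * d * t ^ n = q) {x : ℂ} (hx : x ≠ 0) {y : Fin n → ℂ}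
    (hy : ∀ k, y k ≠ 0) :
    headPos q t a b c d (q * x) y = (q * x ^ 4 * (x ^ 2) ^ n)⁻¹ * headPos q t a b c d x y := by
  have h1 : ∀ k, theta (q * x / y k) q * theta (t * (q * x * y k)) q =
      (t * x ^ 2)⁻¹ * (theta (x / y k) q * theta (t * (x * y k)) q) := fun k => by
    have hyk := hy k
    rw [mul_div_assoc, theta_mul (by positivity) hq₀ hq,
      show t * (q * x * y k) = q * (t * (x * y k)) by ring, theta_mul (by positivity) hq₀ hq]
    field_simp
  rw [headPos, headPos, Finset.prod_congr rfl fun k _ => h1 k, Finset.prod_mul_distrib,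
    Finset.prod_const, Finset.card_univ, Fintype.card_fin, ← thetaQuad_mul hq₀ hq ha hb hc hd hx]
  generalize thetaQuad q a b c d (q * x) = A
  generalize ∏ k, theta (x / y k) q * theta (t * (x * y k)) q = B
  rw [← hbal, inv_pow, mul_pow]
  field_simp

lemma headNeg_mul (hq₀ : q ≠ 0) (hq : ‖q‖ < 1) (ht : t ≠ 0) (ha : a ≠ 0) (hb : b ≠ 0) (hc : c ≠ 0)
    (hd : d ≠ 0) {n : ℕ} (hbal : a * b * c * d * t ^ n = q) {x : ℂ} (hx : x ≠ 0) {y : Fin n → ℂ}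
    (hy : ∀ k, y k ≠ 0) :
    headNeg q t a b c d (q * x) y = (q * x ^ 4 * (x ^ 2) ^ n)⁻¹ * headNeg q t a b c d x y := by
  have h1 : ∀ k, -(q * x / y k) * theta (q * x * y k) q * theta (t * ((q * x)⁻¹ * y k)) q =
      t * (x ^ 2)⁻¹ * (-(x / y k) * theta (x * y k) q * theta (t * (x⁻¹ * y k)) q) := fun k => by
    have hyk := hy k
    rw [mul_assoc q, theta_mul (mul_ne_zero hx hyk) hq₀ hq,
      show t * ((q * x)⁻¹ * y k) = q⁻¹ * (t * (x⁻¹ * y k)) by rw [mul_inv]; ring,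
      theta_mul_inv_mul hq₀ hq (by positivity)]
    field_simp
  have h2 := thetaQuad_mul hq₀ hq ha hb hc hd (x := (q * x)⁻¹) (by positivity)
  rw [show q * (q * x)⁻¹ = x⁻¹ by field_simp] at h2
  rw [headNeg, headNeg, Finset.prod_congr rfl fun k _ => h1 k, Finset.prod_mul_distrib,
    Finset.prod_const, Finset.card_univ, Fintype.card_fin, ← h2, mul_pow t]
  have h4 : t ^ n = q / (a * b * c * d) := by rw [eq_div_iff (by positivity), ← hbal]; ring
  rw [h4, inv_pow (x ^ 2)]
  generalize (∏ k, -(x / y k) * theta (x * y k) q * theta (t * (x⁻¹ * y k)) q) = B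
  generalize thetaQuad q a b c d x⁻¹ = A
  field_simp

lemma thetaDen_mul (hq₀ : q ≠ 0) (hq : ‖q‖ < 1) {n : ℕ} {x : ℂ} (hx : x ≠ 0) {y : Fin n → ℂ}
    (hy : ∀ k, y k ≠ 0) :
    thetaDen q (q * x) y = (q * x ^ 4 * (x ^ 2) ^ n)⁻¹ * thetaDen q x y := by
  have h1 : ∀ k, theta (q * x * y k) q * theta (q * x / y k) q =
      (x ^ 2)⁻¹ * (theta (x * y k) q * theta (x / y k) q) := fun k => by
    have hyk := hy k
    rw [mul_assoc, mul_div_assoc, theta_mul (by positivity) hq₀ hq,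
      theta_mul (by positivity) hq₀ hq]
    field_simp
  rw [thetaDen, thetaDen, Finset.prod_congr rfl fun k _ => h1 k, Finset.prod_mul_distrib,
    Finset.prod_const, Finset.card_univ, Fintype.card_fin,
    show q * x * (q * x) = q * (q * (x * x)) by ring, theta_mul (by positivity) hq₀ hq,
    theta_mul (by positivity) hq₀ hq, inv_pow]
  generalize ∏ k, theta (x * y k) q * theta (x / y k) q = B
  field_simp

/-! #### The removable singularities -/

lemma headPos_eq_headNeg_of_sq_eq_one (hq₀ : q ≠ 0) (hq : ‖q‖ < 1) {n : ℕ} {x : ℂ} (hx : x * x = 1)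
    {y : Fin n → ℂ} (hy : ∀ k, y k ≠ 0) :
    headPos q t a b c d x y = headNeg q t a b c d x y := by
  have hx0 : x ≠ 0 := fun h => by simp [h] at hx
  have hxi : x⁻¹ = x := inv_eq_of_mul_eq_one_left hx
  rw [headPos, headNeg, hxi, sq, hx, one_mul]
  congr 1
  refine Finset.prod_congr rfl fun k _ => ?_
  rw [theta_div_eq hq₀ hq hx0 (hy k), hxi]

lemma headPos_eq_headNeg_of_sq_eq (hq₀ : q ≠ 0) (hq : ‖q‖ < 1) (ht : t ≠ 0) (ha : a ≠ 0)
    (hb : b ≠ 0) (hc : c ≠ 0) (hd : d ≠ 0) {n : ℕ} (hbal : a * b * c * d * t ^ n = q) {x : ℂ}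
    (hx : x * x = q) {y : Fin n → ℂ} (hy : ∀ k, y k ≠ 0) :
    headPos q t a b c d x y = headNeg q t a b c d x y := by
  have hx0 : x ≠ 0 := fun h => hq₀ (by rw [← hx, h, mul_zero])
  have h2 := thetaQuad_mul hq₀ hq ha hb hc hd (x := x⁻¹) (by positivity)
  have hxi : q * x⁻¹ = x := by rw [← hx]; field_simp
  have hxi' : x⁻¹ = q⁻¹ * x := by rw [← hx]; field_simp
  rw [hxi] at h2
  have h1 : ∀ k, -(x / y k) * theta (x * y k) q * theta (t * (x⁻¹ * y k)) q =
      t * (theta (x / y k) q * theta (t * (x * y k)) q) := fun k => by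
    have hyk := hy k
    rw [show t * (x⁻¹ * y k) = q⁻¹ * (t * (x * y k)) by rw [hxi']; ring,
      theta_mul_inv_mul hq₀ hq (by positivity), ← theta_div (x := x * y k) (by positivity) hq₀,
      show q / (x * y k) = x / y k by rw [← hx]; field_simp, ← hx]
    field_simp
  have h4 : (∏ k, -(x / y k) * theta (x * y k) q * theta (t * (x⁻¹ * y k)) q) =
      t ^ n * ∏ k, theta (x / y k) q * theta (t * (x * y k)) q := by
    rw [Finset.prod_congr rfl fun k _ => h1 k, Finset.prod_mul_distrib,
      Finset.prod_const, Finset.card_univ, Fintype.card_fin]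
  rw [headPos, headNeg, h4, ← h2]
  have h3 : x ^ 2 * (a * b * c * d * x⁻¹ ^ 4) * t ^ n = 1 := by
    calc x ^ 2 * (a * b * c * d * x⁻¹ ^ 4) * t ^ n = (a * b * c * d * t ^ n) * (x ^ 2 * x⁻¹ ^ 4) := by
          ring
      _ = 1 := by rw [hbal, ← hx]; field_simp
  linear_combination (-(thetaQuad q a b c d x * ∏ k, theta (x / y k) q * theta (t * (x * y k)) q)) * h3

end

section

variable {q t a b c d : ℂ}

lemma finite_setOf_sq_eq (w : ℂ) : {a : ℂ | a ^ 2 = w}.Finite := by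
  obtain ⟨r, hr⟩ := IsAlgClosed.exists_pow_nat_eq w two_pos
  exact ((finite_singleton (-r)).insert r).subset fun a (ha : a ^ 2 = w) =>
    sq_eq_sq_iff_eq_or_eq_neg.1 (ha.trans hr.symm)

/-- The numerator of the sum, as a function of the first variable. -/
def thetaNum (q t a b c d x : ℂ) {n : ℕ} (z : Fin n → ℂ) : ℂ :=
  ∑ ε : Fin n → Bool, thetaTerm q t a b c d (signs ε z) *
    (headPos q t a b c d x (signs ε z) - headNeg q t a b c d x (signs ε z))

lemma signs_ne_zero {n : ℕ} {z : Fin n → ℂ} (hz : ∀ j, z j ≠ 0) (ε : Fin n → Bool) (j : Fin n) :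
    signs ε z j ≠ 0 := by
  unfold signs
  split_ifs
  · exact hz j
  · exact inv_ne_zero (hz j)

lemma sum_signs_cons {n : ℕ} (F : (Fin (n + 1) → ℂ) → ℂ) (x : ℂ) (z : Fin n → ℂ) :
    ∑ ε : Fin (n + 1) → Bool, F (signs ε (Fin.cons x z)) =
      ∑ ε : Fin n → Bool, (F (Fin.cons x (signs ε z)) + F (Fin.cons x⁻¹ (signs ε z))) := by
  rw [← (Fin.consEquiv fun _ => Bool).sum_comp, Fintype.sum_prod_type_right]
  refine Finset.sum_congr rfl fun ε _ => ?_
  rw [Fintype.sum_bool]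
  simp only [Fin.consEquiv, Equiv.coe_fn_mk, signs_cons, if_true, Bool.false_eq_true, if_false]

lemma thetaDen_mul_sum (hq₀ : q ≠ 0) (hq : ‖q‖ < 1) {n : ℕ} {x : ℂ} {z : Fin n → ℂ}
    (h : ThetaRegular q (Fin.cons x z : Fin (n + 1) → ℂ)) :
    thetaDen q x z * ∑ ε, thetaTerm q t a b c d (signs ε (Fin.cons x z : Fin (n + 1) → ℂ)) =
      thetaNum q t a b c d x z := by
  rw [sum_signs_cons, Finset.mul_sum, thetaNum]
  refine Finset.sum_congr rfl fun ε _ => ?_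
  have hx : x ≠ 0 := h.ne_zero 0
  have hz : ∀ j, z j ≠ 0 := fun j => h.ne_zero j.succ
  have hx2 : theta (x * x) q ≠ 0 := h.mul 0 0
  have e1 := h.signs hq₀ hq (Fin.cons true ε)
  have e2 := h.signs hq₀ hq (Fin.cons false ε)
  rw [signs_cons] at e1 e2
  have e3 : ∀ k, theta (x * signs ε z k) q ≠ 0 := fun k => by simpa using e1.mul 0 k.succ
  have e4 : ∀ k, theta (x⁻¹ * signs ε z k) q ≠ 0 := fun k => by simpa using e2.mul 0 k.succ
  rw [mul_add, ← thetaDen_signs x z ε, thetaDen_mul_thetaTerm_pos hx2 e3,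
    thetaDen_mul_thetaTerm_neg hq₀ hq hx (signs_ne_zero hz ε) hx2 e4]
  ring

lemma thetaNum_eq_zero_of_mem (hq₀ : q ≠ 0) (hq : ‖q‖ < 1) {n : ℕ} {z : Fin n → ℂ}
    (h : ThetaRegular q z) (i : Fin n) (e : Bool) :
    thetaNum q t a b c d (if e then z i else (z i)⁻¹) z = 0 := by
  have hθ1 : theta 1 q = 0 := (theta_eq_zero_iff one_ne_zero hq₀ hq).2 ⟨0, by simp⟩
  set w : ℂ := if e then z i else (z i)⁻¹ with hw
  have hw0 : w ≠ 0 := by rw [hw]; split_ifs; exacts [h.ne_zero i, inv_ne_zero (h.ne_zero i)]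
  have hcase : ∀ ε : Fin n → Bool, signs ε z i = if ε i = e then w else w⁻¹ := fun ε => by
    unfold signs
    rw [hw]
    cases e <;> cases ε i <;> simp
  have hpos : ∀ y : Fin n → ℂ, y i = w → headPos q t a b c d w y = 0 := fun y hy => by
    rw [headPos, Finset.prod_eq_zero (Finset.mem_univ i), mul_zero]
    rw [hy, div_self hw0, hθ1, zero_mul]
  have hneg : ∀ y : Fin n → ℂ, y i = w⁻¹ → headNeg q t a b c d w y = 0 := fun y hy => by
    rw [headNeg, Finset.prod_eq_zero (Finset.mem_univ i), mul_zero]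
    rw [hy, mul_inv_cancel₀ hw0, hθ1, mul_zero, zero_mul]
  have hflip : ∀ ε : Fin n → Bool, signs (Function.update ε i (!ε i)) z =
      Function.update (signs ε z) i (signs ε z i)⁻¹ := fun ε => by
    funext k
    by_cases hk : k = i
    · subst hk
      simp only [signs, Function.update_self]
      cases ε k <;> simp
    · simp [signs, hk]
  -- terms whose `i`-th signs are opposite cancel
  have key : ∀ ε : Fin n → Bool, ε i = e →
      thetaTerm q t a b c d (signs ε z) *
        (headPos q t a b c d w (signs ε z) - headNeg q t a b c d w (signs ε z)) +
      thetaTerm q t a b c d (signs (Function.update ε i (!ε i)) z) *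
        (headPos q t a b c d w (signs (Function.update ε i (!ε i)) z) -
          headNeg q t a b c d w (signs (Function.update ε i (!ε i)) z)) = 0 := fun ε he => by
    have h1 : signs ε z i = w := by rw [hcase, if_pos he]
    have h2 := thetaTerm_mul_headNeg_eq (t := t) (a := a) (b := b) (c := c) (d := d) hq₀ hq
      (h.signs hq₀ hq ε) i
    rw [← hflip, h1] at h2
    rw [hpos _ h1, hneg (signs (Function.update ε i (!ε i)) z) (by rw [hflip, Function.update_self, h1])]
    linear_combination -h2
  refine Finset.sum_involution (fun ε _ => Function.update ε i (!ε i)) (fun ε _ => ?_)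
    (fun ε _ _ hε => ?_) (fun _ _ => Finset.mem_univ _) (fun ε _ => ?_)
  · by_cases he : ε i = e
    · exact key ε he
    · have he' : Function.update ε i (!ε i) i = e := by
        rw [Function.update_self]; cases e <;> simp_all
      have := key _ he'
      simp only [Function.update_self, Bool.not_not, Function.update_idem,
        Function.update_eq_self] at this
      rw [add_comm]
      exact this
  · have := congrFun hε i
    simp at this
  · simp

lemma thetaDen_eq_prod {n : ℕ} (x : ℂ) (z : Fin n → ℂ) :
    thetaDen q x z = ∏ o : Option (Fin n × Bool),
      (match o with
        | none => theta (x * x) q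
        | some (k, true) => theta (x * z k) q
        | some (k, false) => theta (x / z k) q) := by
  rw [thetaDen, Fintype.prod_option, Fintype.prod_prod_type]
  simp only [Fintype.prod_bool]

lemma deriv_thetaDen_ne_zero (hq₀ : q ≠ 0) (hq : ‖q‖ < 1) {n : ℕ} {z : Fin n → ℂ}
    (h : ThetaRegular q z) {x : ℂ} (hx : x ≠ 0) (h0 : thetaDen q x z = 0) :
    deriv (fun x => thetaDen q x z) x ≠ 0 := by
  simp only [thetaDen_eq_prod] at h0 ⊢
  have hder : ∀ {f : ℂ → ℂ} {f' : ℂ}, HasDerivAt f f' x → f' ≠ 0 → f x ≠ 0 → theta (f x) q = 0 →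
      deriv (fun x => theta (f x) q) x ≠ 0 := by
    intro f f' hf hf' hfx hθ
    obtain ⟨k, hk⟩ := (theta_eq_zero_iff hfx hq₀ hq).1 hθ
    have h1 := HasDerivAt.comp x (h₂ := fun x => theta x q)
      (differentiableAt_theta hfx hq).hasDerivAt hf
    rw [show (fun x => theta (f x) q) = (fun x => theta x q) ∘ f from rfl, h1.deriv, hk]
    exact mul_ne_zero (deriv_theta_ne_zero hq₀ hq k) hf'
  have hθ : ∀ {u : ℂ}, u ≠ 0 → theta u q = 0 → ∃ k : ℤ, u = q ^ k := fun hu h =>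
    (theta_eq_zero_iff hu hq₀ hq).1 h
  have hθ' : ∀ {u : ℂ} (k : ℤ), u = q ^ k → theta u q = 0 := fun k hk => by
    rw [hk]; exact (theta_eq_zero_iff (zpow_ne_zero k hq₀) hq₀ hq).2 ⟨k, rfl⟩
  refine deriv_prod_ne_zero ?_ ?_ ?_ h0
  · rintro (_ | ⟨k, _ | _⟩) -
    · exact DifferentiableAt.comp (g := fun x => theta x q) x
        (differentiableAt_theta (mul_ne_zero hx hx) hq) (differentiableAt_id.mul differentiableAt_id)
    · exact DifferentiableAt.comp (g := fun x => theta x q) x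
        (differentiableAt_theta (div_ne_zero hx (h.ne_zero k)) hq) (differentiableAt_id.div_const _)
    · exact DifferentiableAt.comp (g := fun x => theta x q) x
        (differentiableAt_theta (mul_ne_zero hx (h.ne_zero k)) hq) (differentiableAt_id.mul_const _)
  · rintro (_ | ⟨k, _ | _⟩) - h1
    · refine hder (f := fun x => x * x) ((hasDerivAt_id x).mul (hasDerivAt_id x)) ?_
        (mul_ne_zero hx hx) h1
      simpa [← two_mul] using hx
    · refine hder (f := fun x => x / z k) ((hasDerivAt_id x).div_const _) ?_
        (div_ne_zero hx (h.ne_zero k)) h1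
      simpa using h.ne_zero k
    · refine hder (f := fun x => x * z k) ((hasDerivAt_id x).mul_const _) ?_
        (mul_ne_zero hx (h.ne_zero k)) h1
      simpa using h.ne_zero k
  · have hxx := mul_ne_zero hx hx
    have hxm : ∀ k, x * z k ≠ 0 := fun k => mul_ne_zero hx (h.ne_zero k)
    have hxd : ∀ k, x / z k ≠ 0 := fun k => div_ne_zero hx (h.ne_zero k)
    have A : ∀ k, theta (x * x) q = 0 → theta (x * z k) q ≠ 0 := fun k h1 h2 => by
      obtain ⟨i, hi⟩ := hθ hxx h1
      obtain ⟨j, hj⟩ := hθ (hxm k) h2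
      refine h.mul k k (hθ' (j + j - i) ?_)
      rw [zpow_sub₀ hq₀, zpow_add₀ hq₀, ← hi, ← hj]; field_simp
    have B : ∀ k, theta (x * x) q = 0 → theta (x / z k) q ≠ 0 := fun k h1 h2 => by
      obtain ⟨i, hi⟩ := hθ hxx h1
      obtain ⟨j, hj⟩ := hθ (hxd k) h2
      have hk := h.ne_zero k
      refine h.mul k k (hθ' (i - (j + j)) ?_)
      rw [zpow_sub₀ hq₀, zpow_add₀ hq₀, ← hi, ← hj]; field_simp
    have E : ∀ k l, theta (x / z k) q = 0 → theta (x * z l) q ≠ 0 := fun k l h1 h2 => by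
      obtain ⟨i, hi⟩ := hθ (hxd k) h1
      obtain ⟨j, hj⟩ := hθ (hxm l) h2
      have hk := h.ne_zero k
      refine h.mul l k (hθ' (j - i) ?_)
      rw [zpow_sub₀ hq₀, ← hi, ← hj]; field_simp
    have F : ∀ k l, k ≠ l → theta (x / z k) q = 0 → theta (x / z l) q ≠ 0 := fun k l hkl h1 h2 => by
      obtain ⟨i, hi⟩ := hθ (hxd k) h1
      obtain ⟨j, hj⟩ := hθ (hxd l) h2
      have hk := h.ne_zero k
      have hl := h.ne_zero l
      refine h.div k l hkl (hθ' (j - i) ?_)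
      rw [zpow_sub₀ hq₀, ← hi, ← hj]; field_simp
    have G : ∀ k l, k ≠ l → theta (x * z k) q = 0 → theta (x * z l) q ≠ 0 := fun k l hkl h1 h2 => by
      obtain ⟨i, hi⟩ := hθ (hxm k) h1
      obtain ⟨j, hj⟩ := hθ (hxm l) h2
      have hk := h.ne_zero k
      have hl := h.ne_zero l
      refine h.div k l hkl (hθ' (i - j) ?_)
      rw [zpow_sub₀ hq₀, ← hi, ← hj]; field_simp
    rintro (_ | ⟨k, _ | _⟩) - (_ | ⟨l, _ | _⟩) - hne h1
    · exact absurd rfl hne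
    · exact B l h1
    · exact A l h1
    · exact fun h2 => B k h2 h1
    · exact F k l (fun h => hne (by rw [h])) h1
    · exact E k l h1
    · exact fun h2 => A k h2 h1
    · exact fun h2 => E l k h2 h1
    · exact G k l (fun h => hne (by rw [h])) h1

lemma differentiableAt_thetaDen (hq : ‖q‖ < 1) {n : ℕ} {z : Fin n → ℂ} (hz : ∀ j, z j ≠ 0)
    {x : ℂ} (hx : x ≠ 0) : DifferentiableAt ℂ (fun x => thetaDen q x z) x := by
  have hc : ∀ {f : ℂ → ℂ}, f x ≠ 0 → DifferentiableAt ℂ f x →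
      DifferentiableAt ℂ (fun x => theta (f x) q) x := fun h hf =>
    DifferentiableAt.comp (g := fun x => theta x q) x (differentiableAt_theta h hq) hf
  unfold thetaDen
  refine (hc (f := fun x => x * x) (mul_ne_zero hx hx) (by fun_prop)).mul
    (differentiableAt_finset_prod fun k _ => ?_)
  exact (hc (f := fun x => x * z k) (mul_ne_zero hx (hz k)) (by fun_prop)).mul
    (hc (f := fun x => x / z k) (div_ne_zero hx (hz k)) (by fun_prop))

lemma differentiableAt_thetaNum (hq : ‖q‖ < 1) (ht : t ≠ 0) (ha : a ≠ 0) (hb : b ≠ 0) (hc : c ≠ 0)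
    (hd : d ≠ 0) {n : ℕ} {z : Fin n → ℂ} (hz : ∀ j, z j ≠ 0)
    {x : ℂ} (hx : x ≠ 0) : DifferentiableAt ℂ (fun x => thetaNum q t a b c d x z) x := by
  have hθ : ∀ {f : ℂ → ℂ}, f x ≠ 0 → DifferentiableAt ℂ f x →
      DifferentiableAt ℂ (fun x => theta (f x) q) x := fun h hf =>
    DifferentiableAt.comp (g := fun x => theta x q) x (differentiableAt_theta h hq) hf
  have hi : DifferentiableAt ℂ (fun x : ℂ => x⁻¹) x := differentiableAt_inv hx
  have hx' := inv_ne_zero hx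
  unfold thetaNum headPos headNeg thetaQuad
  refine DifferentiableAt.fun_sum fun ε _ => DifferentiableAt.const_mul (DifferentiableAt.sub ?_ ?_) _
  · refine DifferentiableAt.mul (((DifferentiableAt.mul ?_ ?_).mul ?_).mul ?_)
      (differentiableAt_finset_prod fun k _ => DifferentiableAt.mul ?_ ?_)
    · exact hθ (mul_ne_zero ha hx) (differentiableAt_id.const_mul _)
    · exact hθ (mul_ne_zero hb hx) (differentiableAt_id.const_mul _)
    · exact hθ (mul_ne_zero hc hx) (differentiableAt_id.const_mul _)
    · exact hθ (mul_ne_zero hd hx) (differentiableAt_id.const_mul _)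
    · exact hθ (div_ne_zero hx (signs_ne_zero hz ε k)) (differentiableAt_id.div_const _)
    · exact hθ (mul_ne_zero ht (mul_ne_zero hx (signs_ne_zero hz ε k)))
        ((differentiableAt_id.mul_const _).const_mul _)
  · refine DifferentiableAt.mul (DifferentiableAt.mul (differentiableAt_id.pow 2)
      (((DifferentiableAt.mul ?_ ?_).mul ?_).mul ?_))
      (differentiableAt_finset_prod fun k _ => DifferentiableAt.mul (DifferentiableAt.mul ?_ ?_) ?_)
    · exact hθ (mul_ne_zero ha hx') (hi.const_mul _)
    · exact hθ (mul_ne_zero hb hx') (hi.const_mul _)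
    · exact hθ (mul_ne_zero hc hx') (hi.const_mul _)
    · exact hθ (mul_ne_zero hd hx') (hi.const_mul _)
    · exact (differentiableAt_id.div_const _).neg
    · exact hθ (mul_ne_zero hx (signs_ne_zero hz ε k)) (differentiableAt_id.mul_const _)
    · exact hθ (mul_ne_zero ht (mul_ne_zero hx' (signs_ne_zero hz ε k)))
        ((hi.mul_const _).const_mul _)

/-- The sum does not depend on the first variable. -/
lemma exists_thetaNum_eq (hq₀ : q ≠ 0) (hq : ‖q‖ < 1) (ht : t ≠ 0) (ha : a ≠ 0) (hb : b ≠ 0)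
    (hc : c ≠ 0) (hd : d ≠ 0) {n : ℕ} (hbal : a * b * c * d * t ^ n = q) {z : Fin n → ℂ}
    (h : ThetaRegular q z) :
    ∃ C, ∀ x ≠ 0, thetaNum q t a b c d x z = C * thetaDen q x z := by
  have hz := h.ne_zero
  have hmul : ∀ x ≠ 0, thetaNum q t a b c d (q * x) z =
      (q * x ^ 4 * (x ^ 2) ^ n)⁻¹ * thetaNum q t a b c d x z := fun x hx => by
    rw [thetaNum, thetaNum, Finset.mul_sum]
    refine Finset.sum_congr rfl fun ε _ => ?_
    rw [headPos_mul hq₀ hq ht ha hb hc hd hbal hx (signs_ne_zero hz ε),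
      headNeg_mul hq₀ hq ht ha hb hc hd hbal hx (signs_ne_zero hz ε)]
    ring
  have hm0 : ∀ x : ℂ, x ≠ 0 → (q * x ^ 4 * (x ^ 2) ^ n)⁻¹ ≠ 0 := fun x hx => by positivity
  have hshift : ∀ (k : ℤ) (x : ℂ), x ≠ 0 → thetaNum q t a b c d x z = 0 →
      thetaNum q t a b c d (q ^ k * x) z = 0 := fun k x hx h0 => by
    have hne : ∀ k : ℤ, q ^ k * x ≠ 0 := fun k => mul_ne_zero (zpow_ne_zero k hq₀) hx
    have hst : ∀ k : ℤ, thetaNum q t a b c d (q ^ (k + 1) * x) z = 0 ↔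
        thetaNum q t a b c d (q ^ k * x) z = 0 := fun k => by
      rw [zpow_add_one₀ hq₀, mul_comm (q ^ k), mul_assoc, hmul _ (hne k), mul_eq_zero,
        or_iff_right (hm0 _ (hne k))]
    induction k using Int.induction_on with
    | zero => simpa using h0
    | succ i ih => exact (hst i).2 ih
    | pred i ih => exact (hst (-i - 1)).1 (by rwa [sub_add_cancel])
  refine exists_eq_const_mul hq₀ hq (D := fun x => thetaDen q x z)
    (h := fun x => thetaNum q t a b c d x z) (m := fun x => (q * x ^ 4 * (x ^ 2) ^ n)⁻¹)
    (fun x hx => differentiableAt_thetaDen hq hz hx)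
    (fun x hx => differentiableAt_thetaNum hq ht ha hb hc hd hz hx)
    (fun x hx => thetaDen_mul hq₀ hq hx hz) hmul hm0
    fun x hx h0 => ⟨?_, deriv_thetaDen_ne_zero hq₀ hq h hx h0⟩
  rw [thetaDen, mul_eq_zero, Finset.prod_eq_zero_iff] at h0
  rcases h0 with h0 | ⟨i, -, h0⟩
  · obtain ⟨k, hk⟩ := (theta_eq_zero_iff (mul_ne_zero hx hx) hq₀ hq).1 h0
    obtain ⟨j, rfl | rfl⟩ := Int.even_or_odd' k
    · have hne : q ^ (-j) * x ≠ 0 := mul_ne_zero (zpow_ne_zero _ hq₀) hx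
      have h1 : q ^ (-j) * x * (q ^ (-j) * x) = 1 := by
        rw [mul_mul_mul_comm, hk, ← zpow_add₀ hq₀, ← zpow_add₀ hq₀,
          show -j + -j + 2 * j = 0 by ring, zpow_zero]
      have h2 : thetaNum q t a b c d (q ^ (-j) * x) z = 0 := Finset.sum_eq_zero fun ε _ => by
        rw [headPos_eq_headNeg_of_sq_eq_one hq₀ hq h1 (signs_ne_zero hz ε), sub_self, mul_zero]
      have h3 := hshift j _ hne h2
      rwa [← mul_assoc, ← zpow_add₀ hq₀, add_neg_cancel, zpow_zero, one_mul] at h3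
    · have hne : q ^ (-j) * x ≠ 0 := mul_ne_zero (zpow_ne_zero _ hq₀) hx
      have h1 : q ^ (-j) * x * (q ^ (-j) * x) = q := by
        rw [mul_mul_mul_comm, hk, ← zpow_add₀ hq₀, ← zpow_add₀ hq₀,
          show -j + -j + (2 * j + 1) = 1 by ring, zpow_one]
      have h2 : thetaNum q t a b c d (q ^ (-j) * x) z = 0 := Finset.sum_eq_zero fun ε _ => by
        rw [headPos_eq_headNeg_of_sq_eq hq₀ hq ht ha hb hc hd hbal h1 (signs_ne_zero hz ε),
          sub_self, mul_zero]
      have h3 := hshift j _ hne h2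
      rwa [← mul_assoc, ← zpow_add₀ hq₀, add_neg_cancel, zpow_zero, one_mul] at h3
  · have hzi := hz i
    rcases mul_eq_zero.1 h0 with h0 | h0
    · obtain ⟨k, hk⟩ := (theta_eq_zero_iff (mul_ne_zero hx hzi) hq₀ hq).1 h0
      have h2 := hshift k _ (inv_ne_zero hzi) (thetaNum_eq_zero_of_mem hq₀ hq h i false)
      rwa [← hk, mul_inv_cancel_right₀ hzi] at h2
    · obtain ⟨k, hk⟩ := (theta_eq_zero_iff (div_ne_zero hx hzi) hq₀ hq).1 h0
      have h2 := hshift k _ hzi (thetaNum_eq_zero_of_mem hq₀ hq h i true)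
      rwa [← hk, div_mul_cancel₀ _ hzi] at h2

/-- At `x = a⁻¹` half of the terms vanish, and the others combine to a sum of lower order. -/
lemma thetaNum_inv (hq₀ : q ≠ 0) (hq : ‖q‖ < 1) (ha : a ≠ 0) {n : ℕ} {z : Fin n → ℂ}
    (hz : ∀ j, z j ≠ 0) (h0 : thetaDen q a⁻¹ z ≠ 0) :
    thetaNum q t a b c d a⁻¹ z = theta (a * b) q * theta (a * c) q * theta (a * d) q *
      (∑ ε, thetaTerm q t (t * a) b c d (signs ε z)) * thetaDen q a⁻¹ z := by
  have hθ1 : theta 1 q = 0 := (theta_eq_zero_iff one_ne_zero hq₀ hq).2 ⟨0, by simp⟩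
  rw [thetaNum, Finset.mul_sum, Finset.sum_mul]
  refine Finset.sum_congr rfl fun ε _ => ?_
  rw [← thetaDen_signs _ z ε] at h0 ⊢
  have hy := signs_ne_zero hz ε
  generalize signs ε z = y at h0 hy
  have hdiv : ∀ k, theta (a⁻¹ / y k) q = -(a⁻¹ / y k) * theta (a * y k) q := fun k => by
    have := theta_div_eq hq₀ hq (inv_ne_zero ha) (hy k)
    rwa [inv_inv] at this
  have hP : headPos q t a b c d a⁻¹ y = 0 := by
    rw [headPos, thetaQuad, mul_inv_cancel₀ ha, hθ1]; ring
  rw [thetaDen, mul_ne_zero_iff, Finset.prod_ne_zero_iff] at h0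
  have ha2 : theta (a * a) q ≠ 0 := fun h => h0.1 (by rw [theta_inv_mul_inv hq₀ hq ha, h, mul_zero])
  have hay : ∀ k, theta (a * y k) q ≠ 0 := fun k h => h0.2 k (Finset.mem_univ k) (by
    rw [hdiv, h, mul_zero, mul_zero])
  have e1 : (∏ k, -(a⁻¹ / y k) * theta (a⁻¹ * y k) q * theta (t * (a⁻¹⁻¹ * y k)) q) =
      (∏ k, theta (a⁻¹ * y k) q * theta (a⁻¹ / y k) q) *
        ∏ k, theta (t * a * y k) q / theta (a * y k) q := by
    rw [← Finset.prod_mul_distrib]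
    refine Finset.prod_congr rfl fun k _ => ?_
    rw [hdiv, inv_inv, mul_assoc t]
    have := hay k
    generalize theta (a * y k) q = A at this ⊢
    field_simp
  have e2 : thetaTerm q t (t * a) b c d y =
      thetaTerm q t a b c d y * ∏ k, theta (t * a * y k) q / theta (a * y k) q := by
    rw [thetaTerm, thetaTerm, mul_right_comm, ← Finset.prod_mul_distrib]
    congr 1
    refine Finset.prod_congr rfl fun k _ => ?_
    rw [thetaQuad, thetaQuad]
    have := hay k
    generalize theta (a * y k) q = A at this ⊢
    field_simp
  rw [hP, e2, headNeg, e1, thetaDen, theta_inv_mul_inv hq₀ hq ha, inv_inv, thetaQuad]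
  field_simp
  ring

/-- The sum over all sign changes of a product of theta quotients is a product of theta functions.
The sum is an elliptic function of the first variable without poles, hence constant, and its value
at `a⁻¹` is a sum of the same kind with one variable less. -/
theorem sum_thetaTerm (hq₀ : q ≠ 0) (hq : ‖q‖ < 1) (ht : t ≠ 0) (n : ℕ) :
    ∀ {a b c d : ℂ}, a ≠ 0 → b ≠ 0 → c ≠ 0 → d ≠ 0 → a * b * c * d * t ^ n = q * t →
    ∀ {z : Fin n → ℂ}, ThetaRegular q z →
      ∑ ε, thetaTerm q t a b c d (signs ε z) =
        ∏ i ∈ Finset.range n,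
          theta (t ^ i * a * b) q * theta (t ^ i * a * c) q * theta (t ^ i * a * d) q := by
  induction n with
  | zero =>
    intro a b c d _ _ _ _ _ z _
    simp [thetaTerm, pairProd]
  | succ n ih =>
    intro a b c d ha hb hc hd hbal z hz
    obtain ⟨x, y, rfl⟩ : ∃ (x : ℂ) (y : Fin n → ℂ), z = Fin.cons x y :=
      ⟨z 0, Fin.tail z, (Fin.cons_self_tail z).symm⟩
    have hy : ThetaRegular q y := ⟨fun j => hz.ne_zero j.succ, fun j k => hz.mul j.succ k.succ,
      fun j k hjk => hz.div j.succ k.succ fun h => hjk (Fin.succ_injective _ h)⟩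
    have hx : x ≠ 0 := hz.ne_zero 0
    have hDx : thetaDen q x y ≠ 0 := mul_ne_zero (hz.mul 0 0) (Finset.prod_ne_zero_iff.2 fun k _ =>
      mul_ne_zero (hz.mul 0 k.succ) (hz.div 0 k.succ (Fin.succ_ne_zero k).symm))
    -- `d` is a function of `a`, and the identity is proved for generic `a` first
    let δ : ℂ → ℂ := fun a => q / (b * c * t ^ n * a)
    have hδ : ∀ a ≠ 0, δ a ≠ 0 := fun a ha => by positivity
    have hδb : ∀ a ≠ 0, a * b * c * δ a * t ^ n = q := fun a ha => by simp only [δ]; field_simp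
    have hdδ : d = δ a := by
      have : a * b * c * d * t ^ n = q := mul_right_cancel₀ ht (by rw [← hbal]; ring)
      simp only [δ]
      rw [eq_div_iff (by positivity), ← this]; ring
    have hgen : ∀ a ≠ 0, thetaDen q a⁻¹ y ≠ 0 →
        ∑ ε, thetaTerm q t a b c (δ a) (signs ε (Fin.cons x y : Fin (n + 1) → ℂ)) =
        ∏ i ∈ Finset.range (n + 1),
          theta (t ^ i * a * b) q * theta (t ^ i * a * c) q * theta (t ^ i * a * δ a) q := by
      intro a ha h0
      obtain ⟨C, hC⟩ := exists_thetaNum_eq hq₀ hq ht ha hb hc (hδ a ha) (hδb a ha) hy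
      have h1 := hC a⁻¹ (inv_ne_zero ha)
      rw [thetaNum_inv hq₀ hq ha hy.ne_zero h0] at h1
      have h2 := mul_right_cancel₀ h0 h1
      have h3 := hC x hx
      rw [← thetaDen_mul_sum hq₀ hq hz, mul_comm] at h3
      rw [mul_right_cancel₀ hDx h3, ← h2, ih (mul_ne_zero ht ha) hb hc (hδ a ha)
        (by rw [← hδb a ha]; ring) hy, Finset.prod_range_succ', mul_comm]
      simp only [pow_zero, one_mul, pow_succ, mul_assoc]
    rw [hdδ]
    have hcont : ∀ {f : ℂ → ℂ}, ContinuousOn f {0}ᶜ → (∀ a ≠ 0, f a ≠ 0) →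
        ContinuousOn (fun a => theta (f a) q) {0}ᶜ := fun hf h0 a ha =>
      ContinuousAt.comp_continuousWithinAt (g := fun x => theta x q)
        (differentiableAt_theta (h0 a ha) hq).continuousAt (hf a ha)
    have hδc : ContinuousOn δ {0}ᶜ := continuousOn_const.div (by fun_prop) fun a ha =>
      mul_ne_zero (by positivity) ha
    have hcQ : Set.Countable {a : ℂ | a ≠ 0 → thetaDen q a⁻¹ y = 0} := by
      have hsub : {a : ℂ | a ≠ 0 → thetaDen q a⁻¹ y = 0} ⊆ {0} ∪
          (⋃ k : ℤ, {a : ℂ | a ^ 2 = q ^ k}) ∪ ⋃ j, ⋃ k : ℤ, {q ^ k * y j, q ^ k * (y j)⁻¹} := by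
        intro a h
        by_cases ha : a = 0
        · exact Or.inl (Or.inl ha)
        have h0 := h ha
        rw [thetaDen, mul_eq_zero, Finset.prod_eq_zero_iff] at h0
        have hai := inv_ne_zero ha
        rcases h0 with h0 | ⟨j, -, h0⟩
        · obtain ⟨k, hk⟩ := (theta_eq_zero_iff (mul_ne_zero hai hai) hq₀ hq).1 h0
          refine Or.inl (Or.inr (mem_iUnion.2 ⟨-k, ?_⟩))
          rw [mem_ofPred_eq, zpow_neg, ← hk]
          field_simp
        · refine Or.inr (mem_iUnion.2 ⟨j, ?_⟩)
          have hyj := hy.ne_zero j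
          rcases mul_eq_zero.1 h0 with h0 | h0
          · obtain ⟨k, hk⟩ := (theta_eq_zero_iff (mul_ne_zero hai hyj) hq₀ hq).1 h0
            refine mem_iUnion.2 ⟨-k, Or.inl ?_⟩
            rw [zpow_neg, ← hk]
            field_simp
          · obtain ⟨k, hk⟩ := (theta_eq_zero_iff (div_ne_zero hai hyj) hq₀ hq).1 h0
            refine mem_iUnion.2 ⟨-k, Or.inr ?_⟩
            rw [mem_singleton_iff, zpow_neg, ← hk]
            field_simp
      refine Set.Countable.mono hsub (((countable_singleton _).union
        (countable_iUnion fun k => ?_)).union (countable_iUnion fun j => countable_iUnion fun k =>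
          ((countable_singleton _).insert _)))
      exact (finite_setOf_sq_eq (q ^ k)).countable
    have hdense := hcQ.dense_compl ℝ
    have hEq : EqOn (fun a => ∑ ε, thetaTerm q t a b c (δ a) (signs ε (Fin.cons x y : Fin (n + 1) → ℂ)))
        (fun a => ∏ i ∈ Finset.range (n + 1),
          theta (t ^ i * a * b) q * theta (t ^ i * a * c) q * theta (t ^ i * a * δ a) q) {0}ᶜ := by
      have hsub : ({0}ᶜ : Set ℂ) ⊆ closure ({0}ᶜ ∩ {a : ℂ | a ≠ 0 → thetaDen q a⁻¹ y = 0}ᶜ) :=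
        hdense.open_subset_closure_inter isOpen_compl_singleton
      refine Set.EqOn.of_subset_closure (s := {0}ᶜ ∩ {a : ℂ | a ≠ 0 → thetaDen q a⁻¹ y = 0}ᶜ)
        (fun a ha => ?_) ?_ ?_ inter_subset_left hsub
      · have h2 := ha.2
        rw [mem_compl_iff, mem_ofPred_eq, Classical.not_imp] at h2
        exact hgen a ha.1 h2.2
      · unfold thetaTerm thetaQuad
        refine continuousOn_finsetSum _ fun ε _ => ContinuousOn.mul
          (continuousOn_finsetProd _ fun j _ => ContinuousOn.div_const ?_ _) continuousOn_const
        have hs := signs_ne_zero hz.ne_zero ε j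
        refine ((ContinuousOn.mul ?_ continuousOn_const).mul continuousOn_const).mul ?_
        · exact hcont (by fun_prop) fun a ha => mul_ne_zero ha hs
        · exact hcont (hδc.mul continuousOn_const) fun a ha => mul_ne_zero (hδ a ha) hs
      · refine continuousOn_finsetProd _ fun i _ => (ContinuousOn.mul ?_ ?_).mul ?_
        · exact hcont (by fun_prop) fun a ha => by positivity
        · exact hcont (by fun_prop) fun a ha => by positivity
        · exact hcont (ContinuousOn.mul (by fun_prop) hδc) fun a ha =>
            mul_ne_zero (by positivity) (hδ a ha)
    exact hEq ha

end

/-! ### Symmetrization of the elliptic Selberg integral -/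

/-- The multiplicative group generated by `p` and `q`. -/
def lattice (p q : ℂ) : Set ℂ := {x | ∃ i j : ℤ, x = p ^ i * q ^ j}

section

variable {p q : ℂ}

lemma countable_lattice (p q : ℂ) : (lattice p q).Countable := by
  refine (countable_range fun ij : ℤ × ℤ => p ^ ij.1 * q ^ ij.2).mono ?_
  rintro x ⟨i, j, rfl⟩
  exact ⟨(i, j), rfl⟩

lemma inv_mem_lattice {x : ℂ} : x⁻¹ ∈ lattice p q ↔ x ∈ lattice p q := by
  have h : ∀ {x : ℂ}, x ∈ lattice p q → x⁻¹ ∈ lattice p q := by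
    rintro _ ⟨i, j, rfl⟩
    exact ⟨-i, -j, by rw [mul_inv, zpow_neg, zpow_neg]⟩
  exact ⟨fun hx => by simpa using h hx, h⟩

lemma poch2_ne_zero_of_notMem (hp : ‖p‖ < 1) (hq : ‖q‖ < 1) {x : ℂ} (hx : x ∉ lattice p q) :
    poch2 x p q ≠ 0 := by
  refine (poch2_ne_zero_iff hp hq).2 fun i j h => hx ⟨-i, -j, ?_⟩
  rw [zpow_neg, zpow_neg, zpow_natCast, zpow_natCast, ← mul_inv]
  rw [mul_assoc] at h
  exact eq_inv_of_mul_eq_one_left h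

lemma theta_ne_zero_of_notMem (hq₀ : q ≠ 0) (hq : ‖q‖ < 1) {x : ℂ} (hx₀ : x ≠ 0)
    (hx : x ∉ lattice p q) : theta x q ≠ 0 := fun h => by
  obtain ⟨k, hk⟩ := (theta_eq_zero_iff hx₀ hq₀ hq).1 h
  exact hx ⟨0, k, by simpa using hk⟩

lemma theta_mul_ellGamma (hp : ‖p‖ < 1) (hq : ‖q‖ < 1) {x : ℂ} (hx : x ∉ lattice p q) :
    theta x q * ellGamma x p q = poch2 (q / x) p q / poch2 (p * x) p q := by
  have h := poch2_ne_zero_of_notMem hp hq hx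
  rw [poch2_eq_poch_mul x hp hq, mul_ne_zero_iff] at h
  rw [theta, ellGamma, poch2_eq_poch_mul x hp hq, poch2_eq_poch_mul (q / x) hp hq, ← mul_div_assoc p]
  have h1 := h.1
  have h2 := h.2
  field_simp

/-- The reciprocal of `Γ(x) Γ(1/x)`. -/
lemma ellGamma_mul_ellGamma_inv (hp : ‖p‖ < 1) (hq : ‖q‖ < 1) {x : ℂ}
    (hx : x ∉ lattice p q) :
    (poch x q * poch x⁻¹ q * (poch (p * x) p * poch (p * x⁻¹) p)) *
      (ellGamma x p q * ellGamma x⁻¹ p q) = 1 := by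
  have key : ∀ x : ℂ, poch2 x p q = poch x q * (poch (p * x) p * poch2 (p * q * x) p q) := fun x => by
    rw [poch2_eq_poch_mul x hp hq, poch2_eq_poch_mul' (p * x) hp hq]
    ring_nf
  have h1 := poch2_ne_zero_of_notMem hp hq hx
  have h2 := poch2_ne_zero_of_notMem hp hq (mt inv_mem_lattice.1 hx)
  rw [key, mul_ne_zero_iff, mul_ne_zero_iff] at h1 h2
  obtain ⟨a1, a2, a3⟩ := h1
  obtain ⟨b1, b2, b3⟩ := h2
  rw [ellGamma, ellGamma, key x, key x⁻¹, div_inv_eq_mul, div_eq_mul_inv (p * q)]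
  generalize poch x q = A1, poch (p * x) p = A2, poch2 (p * q * x) p q = A3, poch x⁻¹ q = B1,
    poch (p * x⁻¹) p = B2, poch2 (p * q * x⁻¹) p q = B3 at *
  field_simp

lemma weyl_mul_eq (hp : ‖p‖ < 1) (hq : ‖q‖ < 1) (x : ℂ) :
    poch x⁻¹ p * poch (p * x) p * theta x q =
      poch x q * poch x⁻¹ q * (poch (p * x) p * poch (p * x⁻¹) p) := by
  rw [theta, poch_eq_mul x⁻¹ hp, poch_eq_mul x⁻¹ hq, ← div_eq_mul_inv q]
  ring

end

/-- The parameters of the regularized integrand belonging to an elliptic Selberg integral. The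
factors `Γ(T 0 z) Γ(T 1 z)` are multiplied by `θ(T 0 z) θ(T 1 z)`, which shifts two of the
parameters by `p`; the auxiliary parameter `v` is free. -/
def selbergParams (n m : ℕ) (T : Fin (2 * m + 6) → ℂ) (t p q v : ℂ) : Params (2 * m + 6) where
  p := p
  q := q
  t := t
  s := p
  s' := 1
  v := v
  e := q / (t ^ (n - 1) * v * T 0 * T 1)
  b r := if r = 0 ∨ r = 1 then p * T r else T r
  b' r := if r = 0 ∨ r = 1 then q / T r else p * q / T r
  d := T
  d' r := p * q / T r

lemma prod_ite_zero_one {m : ℕ} (f : Fin (2 * m + 6) → ℂ) :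
    (∏ r, if r = 0 ∨ r = 1 then f r else 1) = f 0 * f 1 := by
  rw [← Finset.prod_filter, show Finset.univ.filter (fun r : Fin (2 * m + 6) => r = 0 ∨ r = 1) =
    {0, 1} by ext r; simp, Finset.prod_pair (by simp)]

/-- The points where the integrands may be undefined, or where a denominator of the theta function
identity may vanish, belong to this countable set (in `z j`, `z j * z k` or `z j / z k`). -/
def exceptional (m : ℕ) (T : Fin (2 * m + 6) → ℂ) (t p q : ℂ) : Set ℂ :=
  {x | x ^ 2 ∈ lattice p q} ∪ ({x | x ∈ lattice p q} ∪ {x | t * x ∈ lattice p q} ∪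
    {x | t * x⁻¹ ∈ lattice p q}) ∪
    ⋃ r, ({x | T r * x ∈ lattice p q} ∪ {x | T r * x⁻¹ ∈ lattice p q})

lemma countable_exceptional {m : ℕ} {T : Fin (2 * m + 6) → ℂ} {t p q : ℂ} (ht : t ≠ 0)
    (hT : ∀ r, T r ≠ 0) : (exceptional m T t p q).Countable := by
  have hW := countable_lattice p q
  have h1 : ∀ {c : ℂ}, c ≠ 0 → {x | c * x ∈ lattice p q}.Countable := fun hc =>
    hW.preimage (mul_right_injective₀ hc)
  have h2 : ∀ {c : ℂ}, c ≠ 0 → {x | c * x⁻¹ ∈ lattice p q}.Countable := fun hc =>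
    hW.preimage ((mul_right_injective₀ hc).comp inv_injective)
  refine (Countable.union ?_ ((hW.union (h1 ht)).union (h2 ht))).union
    (countable_iUnion fun r => (h1 (hT r)).union (h2 (hT r)))
  have : {x : ℂ | x ^ 2 ∈ lattice p q} = ⋃ w ∈ lattice p q, {x | x ^ 2 = w} := by ext; simp
  rw [this]
  exact hW.biUnion fun w _ => (finite_setOf_sq_eq w).countable

/-- Points where neither the integrand nor the theta function identity degenerates. -/
structure Nondegenerate (m : ℕ) (T : Fin (2 * m + 6) → ℂ) (t p q : ℂ) {n : ℕ} (z : Fin n → ℂ) :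
    Prop where
  ne_zero : ∀ j, z j ≠ 0
  single : ∀ j, z j ∉ exceptional m T t p q
  mul : ∀ j k, j ≠ k → z j * z k ∉ exceptional m T t p q
  div : ∀ j k, j ≠ k → z j / z k ∉ exceptional m T t p q

section

variable {n m : ℕ} {T : Fin (2 * m + 6) → ℂ} {t p q v : ℂ}

lemma Nondegenerate.thetaRegular (hq₀ : q ≠ 0) (hq : ‖q‖ < 1) {z : Fin n → ℂ}
    (h : Nondegenerate m T t p q z) : ThetaRegular q z := by
  refine ⟨h.ne_zero, fun j k => theta_ne_zero_of_notMem (p := p) hq₀ hq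
    (mul_ne_zero (h.ne_zero j) (h.ne_zero k)) fun hmem => ?_,
    fun j k hjk => theta_ne_zero_of_notMem (p := p) hq₀ hq
      (div_ne_zero (h.ne_zero j) (h.ne_zero k)) fun hmem =>
        h.div j k hjk (Or.inl (Or.inr (Or.inl (Or.inl hmem))))⟩
  by_cases hjk : j = k
  · subst hjk
    exact h.single j (Or.inl (Or.inl (by rwa [mem_ofPred_eq, sq])))
  · exact h.mul j k hjk (Or.inl (Or.inr (Or.inl (Or.inl hmem))))

lemma num_div_den_eq (hp : ‖p‖ < 1) (hq₀ : q ≠ 0) (hq : ‖q‖ < 1)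
    {z : Fin n → ℂ} (h : Nondegenerate m T t p q z) :
    (selbergParams n m T t p q v).num z / (selbergParams n m T t p q v).den z =
      integrand n m T t p q z *
        thetaTerm q t (T 0) (T 1) v (q / (t ^ (n - 1) * v * T 0 * T 1)) z := by
  have hreg := h.thetaRegular hq₀ hq
  -- the pair factors
  have hpair : ∀ j, ∀ k ∈ Finset.Ioi j,
      (poch2 (q * 1 / t * (z j * z k)⁻¹) p q * poch2 (q * p / t * (z j * z k)) p q *
        (poch2 (p * q / t * (z k / z j)) p q * poch2 (p * q / t * (z j / z k)) p q) *
        ((poch (z j / z k) q * poch (z j / z k)⁻¹ q *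
          (poch (p * (z j / z k)) p * poch (p * (z j / z k)⁻¹) p)) *
          (poch (1 * (z j * z k)⁻¹) p * poch (p * (z j * z k)) p))) /
      (poch2 (t * p * (z j * z k)) p q * poch2 (t * 1 * (z j * z k)⁻¹) p q *
        (poch2 (t * (z j / z k)) p q * poch2 (t * (z k / z j)) p q)) =
      (ellGamma (t * z j * z k) p q * ellGamma (t * z j / z k) p q *
        ellGamma (t * z k / z j) p q * ellGamma (t / (z j * z k)) p q) /
      (ellGamma (z j * z k) p q * ellGamma (z j / z k) p q *
        ellGamma (z k / z j) p q * ellGamma (1 / (z j * z k)) p q) *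
      (theta (t * (z j * z k)) q / theta (z j * z k) q) := by
    intro j k hk
    have hjk : j ≠ k := (Finset.mem_Ioi.1 hk).ne
    have hX := h.mul j k hjk
    have hR := h.div j k hjk
    have hj := h.ne_zero j
    have hk0 := h.ne_zero k
    rw [show t * z j * z k = t * (z j * z k) by ring, show z k / z j = (z j / z k)⁻¹ by rw [inv_div],
      show t * z j / z k = t * (z j / z k) by ring,
      show t * z k / z j = t * (z j / z k)⁻¹ by rw [inv_div]; ring, div_eq_mul_inv t, one_div (z j * z k)]
    generalize z j * z k = X at hX ⊢
    generalize z j / z k = R at hR ⊢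
    have hXl : X ∉ lattice p q := fun hm => hX (Or.inl (Or.inr (Or.inl (Or.inl hm))))
    have hXt : t * X ∉ lattice p q := fun hm => hX (Or.inl (Or.inr (Or.inl (Or.inr hm))))
    have hRl : R ∉ lattice p q := fun hm => hR (Or.inl (Or.inr (Or.inl (Or.inl hm))))
    have e1 := ellGamma_mul_ellGamma_inv hp hq hXl
    have e2 := ellGamma_mul_ellGamma_inv hp hq hRl
    have e3 := theta_mul_ellGamma hp hq hXt
    have e4 := weyl_mul_eq hp hq X
    have hwX := left_ne_zero_of_mul (e1.trans_ne one_ne_zero)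
    have hθX : theta X q ≠ 0 := right_ne_zero_of_mul (e4.trans_ne hwX)
    rw [mul_one q, one_mul, mul_one t, show t * p * X = p * (t * X) by ring,
      show q / t * X⁻¹ = q / (t * X) by rw [← div_eq_mul_inv, div_div],
      show ellGamma (t * R) p q = poch2 (p * q / t * R⁻¹) p q / poch2 (t * R) p q by
        rw [ellGamma, ← div_div, div_eq_mul_inv (p * q / t)],
      show ellGamma (t * R⁻¹) p q = poch2 (p * q / t * R) p q / poch2 (t * R⁻¹) p q by
        rw [ellGamma, ← div_div, div_inv_eq_mul],
      show ellGamma (t * X⁻¹) p q = poch2 (q * p / t * X) p q / poch2 (t * X⁻¹) p q by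
        rw [ellGamma, ← div_div, div_inv_eq_mul, mul_comm p]]
    have h1 : (ellGamma X p q * ellGamma R p q * ellGamma R⁻¹ p q * ellGamma X⁻¹ p q)⁻¹ =
        (poch X q * poch X⁻¹ q * (poch (p * X) p * poch (p * X⁻¹) p)) *
        (poch R q * poch R⁻¹ q * (poch (p * R) p * poch (p * R⁻¹) p)) := by
      refine inv_eq_of_mul_eq_one_left ?_
      linear_combination e2 + (poch R q * poch R⁻¹ q * (poch (p * R) p * poch (p * R⁻¹) p)) *
        (ellGamma R p q * ellGamma R⁻¹ p q) * e1
    have e5 : theta X q * (theta X q)⁻¹ = 1 := mul_inv_cancel₀ hθX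
    set K := poch2 (q * p / t * X) p q * poch2 (p * q / t * R⁻¹) p q * poch2 (p * q / t * R) p q *
      (poch R q * poch R⁻¹ q * (poch (p * R) p * poch (p * R⁻¹) p)) *
      (poch X⁻¹ p * poch (p * X) p) * (poch2 (t * X⁻¹) p q)⁻¹ * (poch2 (t * R) p q)⁻¹ *
      (poch2 (t * R⁻¹) p q)⁻¹ with hK
    rw [div_eq_mul_inv _ (ellGamma X p q * ellGamma R p q * ellGamma R⁻¹ p q * ellGamma X⁻¹ p q), h1,
      ← e4]
    linear_combination -K * e3 - K * (theta (t * X) q * ellGamma (t * X) p q) * e5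
  -- the one-variable factors
  have hsingle : ∀ j, ((∏ r, poch2 ((if r = 0 ∨ r = 1 then q / T r else p * q / T r) * (z j)⁻¹) p q *
          poch2 (p * q / T r * z j) p q) *
        (poch (1 * (z j * z j)⁻¹) p * poch (p * (z j * z j)) p) *
        (theta (v * z j) q * theta (q / (t ^ (n - 1) * v * T 0 * T 1) * z j) q)) /
      (∏ r, poch2 ((if r = 0 ∨ r = 1 then p * T r else T r) * z j) p q *
        poch2 (T r * (z j)⁻¹) p q) =
      (∏ r, ellGamma (T r * z j) p q * ellGamma (T r / z j) p q) /
        (ellGamma (z j ^ 2) p q * ellGamma (1 / z j ^ 2) p q) *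
      (thetaQuad q (T 0) (T 1) v (q / (t ^ (n - 1) * v * T 0 * T 1)) (z j) /
        theta (z j * z j) q) := by
    intro j
    have hj := h.ne_zero j
    have hs := h.single j
    generalize z j = x at hj hs ⊢
    have hxx : x * x ∉ lattice p q := fun hm => hs (Or.inl (Or.inl (by rwa [mem_ofPred_eq, sq])))
    have e1 := ellGamma_mul_ellGamma_inv hp hq hxx
    have e4 := weyl_mul_eq hp hq (x * x)
    have hθ : theta (x * x) q ≠ 0 := right_ne_zero_of_mul (e4.trans_ne
      (left_ne_zero_of_mul (e1.trans_ne one_ne_zero)))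
    have e5 : theta (x * x) q * (theta (x * x) q)⁻¹ = 1 := mul_inv_cancel₀ hθ
    have hr : ∀ r, poch2 ((if r = 0 ∨ r = 1 then q / T r else p * q / T r) * x⁻¹) p q *
          poch2 (p * q / T r * x) p q / (poch2 ((if r = 0 ∨ r = 1 then p * T r else T r) * x) p q *
        poch2 (T r * x⁻¹) p q) = (if r = 0 ∨ r = 1 then theta (T r * x) q else 1) *
          (ellGamma (T r * x) p q * ellGamma (T r / x) p q) := by
      intro r
      have hTx : T r * x ∉ lattice p q := fun hm => hs (Or.inr (mem_iUnion.2 ⟨r, Or.inl hm⟩))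
      have e6 : ellGamma (T r / x) p q = poch2 (p * q / T r * x) p q / poch2 (T r * x⁻¹) p q := by
        rw [ellGamma, div_div_eq_mul_div, ← div_eq_mul_inv, mul_div_right_comm]
      split_ifs
      · rw [← mul_assoc (theta (T r * x) q), theta_mul_ellGamma hp hq hTx, e6, div_mul_div_comm,
          ← div_div q, div_eq_mul_inv (q / T r), mul_assoc p]
      · rw [one_mul, e6, ellGamma, div_mul_div_comm, ← div_div (p * q), div_eq_mul_inv (p * q / T r)]
    rw [mul_div_right_comm, mul_div_right_comm, ← Finset.prod_div_distrib,
      Finset.prod_congr rfl fun r _ => hr r, Finset.prod_mul_distrib,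
      prod_ite_zero_one fun r => theta (T r * x) q, div_eq_mul_inv _ (ellGamma _ p q * _),
      show (ellGamma (x ^ 2) p q * ellGamma (1 / x ^ 2) p q)⁻¹ =
        poch (x * x)⁻¹ p * poch (p * (x * x)) p * theta (x * x) q by
          rw [e4, sq, one_div]; exact inv_eq_of_mul_eq_one_left e1, one_mul, thetaQuad]
    linear_combination -(theta (T 0 * x) q * theta (T 1 * x) q *
      (∏ r, ellGamma (T r * x) p q * ellGamma (T r / x) p q) *
      (poch (x * x)⁻¹ p * poch (p * (x * x)) p) *
      (theta (v * x) q * theta (q / (t ^ (n - 1) * v * T 0 * T 1) * x) q)) * e5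
  unfold Params.num Params.den
  simp only [selbergParams, Params.weyl]
  have hdd : ∀ f g : Fin n → Fin n → ℂ, (∏ j, ∏ k ∈ Finset.Ioi j, f j k) /
      (∏ j, ∏ k ∈ Finset.Ioi j, g j k) = ∏ j, ∏ k ∈ Finset.Ioi j, f j k / g j k := fun f g => by
    simp only [Finset.prod_div_distrib]
  have hcomb : ∀ a s g f : ℂ, a * s * (g * f) = (a * f) * (s * g) := fun a s g f => by ring
  rw [mul_div_mul_comm, hdd, ← Finset.prod_div_distrib,
    Finset.prod_congr rfl fun j _ => Finset.prod_congr rfl (hpair j),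
    Finset.prod_congr rfl fun j _ => hsingle j, integrand, thetaTerm, pairProd,
    hcomb]
  simp only [← Finset.prod_mul_distrib]

/-- The integrand is invariant under inversion of variables. -/
lemma integrand_signs (z : Fin n → ℂ) (ε : Fin n → Bool) :
    integrand n m T t p q (signs ε z) = integrand n m T t p q z := by
  have hpair : ∀ j k, (ellGamma (t * signs ε z j * signs ε z k) p q *
        ellGamma (t * signs ε z j / signs ε z k) p q *
        ellGamma (t * signs ε z k / signs ε z j) p q *
        ellGamma (t / (signs ε z j * signs ε z k)) p q) /
      (ellGamma (signs ε z j * signs ε z k) p q * ellGamma (signs ε z j / signs ε z k) p q *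
        ellGamma (signs ε z k / signs ε z j) p q * ellGamma (1 / (signs ε z j * signs ε z k)) p q) =
      (ellGamma (t * z j * z k) p q * ellGamma (t * z j / z k) p q *
        ellGamma (t * z k / z j) p q * ellGamma (t / (z j * z k)) p q) /
      (ellGamma (z j * z k) p q * ellGamma (z j / z k) p q *
        ellGamma (z k / z j) p q * ellGamma (1 / (z j * z k)) p q) := by
    intro j k
    let F : ℂ → ℂ → ℂ := fun X R =>
      (ellGamma (t * X) p q * ellGamma (t * R) p q * ellGamma (t * R⁻¹) p q * ellGamma (t * X⁻¹) p q) /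
        (ellGamma X p q * ellGamma R p q * ellGamma R⁻¹ p q * ellGamma X⁻¹ p q)
    have hF : ∀ x y : ℂ, (ellGamma (t * x * y) p q * ellGamma (t * x / y) p q *
          ellGamma (t * y / x) p q * ellGamma (t / (x * y)) p q) /
        (ellGamma (x * y) p q * ellGamma (x / y) p q * ellGamma (y / x) p q *
          ellGamma (1 / (x * y)) p q) = F (x * y) (x / y) := fun x y => by
      simp only [F]
      rw [inv_div, mul_assoc t x y, mul_div_assoc t x y, mul_div_assoc t y x,
        div_eq_mul_inv t (x * y), one_div]
    have hcomm : ∀ X R, F X R = F R X := fun X R => by simp only [F]; ring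
    have hinv : ∀ X R, F X⁻¹ R = F X R := fun X R => by simp only [F, inv_inv]; ring
    have hinv' : ∀ X R, F X R⁻¹ = F X R := fun X R => by rw [hcomm, hinv, hcomm]
    rw [hF, hF]
    unfold signs
    split_ifs
    · rfl
    · rw [div_inv_eq_mul, ← div_eq_mul_inv, hcomm]
    · rw [show (z j)⁻¹ / z k = (z j * z k)⁻¹ by rw [mul_inv, div_eq_mul_inv],
        show (z j)⁻¹ * z k = (z j / z k)⁻¹ by rw [inv_div, mul_comm, ← div_eq_mul_inv],
        hinv, hinv', hcomm]
    · rw [div_inv_eq_mul, ← mul_inv, hinv, mul_comm (z j)⁻¹, ← div_eq_mul_inv, ← inv_div, hinv']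
  have hsingle : ∀ j, (∏ r, ellGamma (T r * signs ε z j) p q * ellGamma (T r / signs ε z j) p q) /
        (ellGamma (signs ε z j ^ 2) p q * ellGamma (1 / signs ε z j ^ 2) p q) =
      (∏ r, ellGamma (T r * z j) p q * ellGamma (T r / z j) p q) /
        (ellGamma (z j ^ 2) p q * ellGamma (1 / z j ^ 2) p q) := by
    intro j
    unfold signs
    split_ifs
    · rfl
    · congr 1
      · refine Finset.prod_congr rfl fun r _ => ?_
        rw [div_inv_eq_mul, ← div_eq_mul_inv, mul_comm]
      · rw [inv_pow, one_div, one_div, inv_inv, mul_comm]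
  unfold integrand
  rw [Finset.prod_congr rfl fun j _ => Finset.prod_congr rfl fun k _ => hpair j k,
    Finset.prod_congr rfl fun j _ => hsingle j]

lemma Nondegenerate.signs {z : Fin n → ℂ} (h : Nondegenerate m T t p q z) (ε : Fin n → Bool) :
    Nondegenerate m T t p q (signs ε z) := by
  have hinv : ∀ {x : ℂ}, x⁻¹ ∈ exceptional m T t p q → x ∈ exceptional m T t p q := by
    intro x hx
    simp only [exceptional, mem_union, mem_ofPred_eq, mem_iUnion, inv_pow, inv_mem_lattice,
      inv_inv] at hx ⊢
    rcases hx with (hx | (hx | hx) | hx) | ⟨r, hx | hx⟩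
    · exact Or.inl (Or.inl hx)
    · exact Or.inl (Or.inr (Or.inl (Or.inl hx)))
    · exact Or.inl (Or.inr (Or.inr hx))
    · exact Or.inl (Or.inr (Or.inl (Or.inr hx)))
    · exact Or.inr ⟨r, Or.inr hx⟩
    · exact Or.inr ⟨r, Or.inl hx⟩
  refine ⟨fun j => signs_ne_zero h.ne_zero ε j, fun j => ?_, fun j k hjk => ?_, fun j k hjk => ?_⟩
  · unfold EllipticSelberg.signs
    split_ifs
    · exact h.single j
    · exact fun hx => h.single j (hinv hx)
  · unfold EllipticSelberg.signs
    split_ifs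
    · exact h.mul j k hjk
    · rw [← div_eq_mul_inv]; exact h.div j k hjk
    · rw [mul_comm, ← div_eq_mul_inv]; exact h.div k j (Ne.symm hjk)
    · rw [← mul_inv]; exact fun hx => h.mul j k hjk (hinv hx)
  · unfold EllipticSelberg.signs
    split_ifs
    · exact h.div j k hjk
    · rw [div_inv_eq_mul]; exact h.mul j k hjk
    · rw [div_eq_mul_inv, ← mul_inv]; exact fun hx => h.mul j k hjk (hinv hx)
    · rw [div_inv_eq_mul, mul_comm, ← div_eq_mul_inv]; exact h.div k j hjk.symm

lemma sum_num_div_den (hn : 1 ≤ n) (hp : ‖p‖ < 1) (hq₀ : q ≠ 0) (hq : ‖q‖ < 1)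
    (ht : t ≠ 0) (hT : ∀ r, T r ≠ 0) (hv : v ≠ 0) {z : Fin n → ℂ} (h : Nondegenerate m T t p q z) :
    ∑ ε, (selbergParams n m T t p q v).num (signs ε z) / (selbergParams n m T t p q v).den (signs ε z) =
      (∏ i ∈ Finset.range n, theta (t ^ i * T 0 * T 1) q *
        (theta (t ^ i * T 0 * v) q * theta (t ^ i * T 1 * v) q)) * integrand n m T t p q z := by
  have h0 := hT 0
  have h1 := hT 1
  have he : q / (t ^ (n - 1) * v * T 0 * T 1) ≠ 0 := by positivity
  obtain ⟨k, rfl⟩ : ∃ k, n = k + 1 := ⟨n - 1, by omega⟩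
  rw [Nat.add_sub_cancel] at he
  have hsum := sum_thetaTerm hq₀ hq ht (k + 1) h0 h1 hv he
    (by rw [pow_succ]; field_simp) (h.thetaRegular hq₀ hq)
  rw [Finset.sum_congr rfl fun ε _ => num_div_den_eq hp hq₀ hq (h.signs ε)]
  simp only [integrand_signs]
  rw [← Finset.mul_sum, Nat.add_sub_cancel, hsum, mul_comm]
  congr 1
  have hrefl : (∏ i ∈ Finset.range (k + 1), theta (t ^ i * T 0 * (q / (t ^ k * v * T 0 * T 1))) q) =
      ∏ i ∈ Finset.range (k + 1), theta (t ^ i * T 1 * v) q := by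
    rw [← Finset.prod_range_reflect]
    refine Finset.prod_congr rfl fun i hi => ?_
    have hik : i ≤ k := Nat.lt_succ_iff.1 (Finset.mem_range.1 hi)
    rw [← theta_div (x := t ^ i * T 1 * v) (by positivity) hq₀]
    congr 1
    rw [show k + 1 - 1 - i = k - i by omega]
    have : t ^ k = t ^ (k - i) * t ^ i := by rw [← pow_add]; congr 1; omega
    rw [this]
    field_simp
  rw [Finset.prod_mul_distrib, hrefl, ← Finset.prod_mul_distrib]
  exact Finset.prod_congr rfl fun i _ => mul_assoc _ _ _

/-- The integral of the elliptic Selberg integrand in terms of the regularized integrand, obtained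
by averaging the latter over all inversions of the variables. -/
theorem mul_integralPow_integrand (hn : 1 ≤ n) (hp : ‖p‖ < 1) (hq₀ : q ≠ 0)
    (hq : ‖q‖ < 1) (ht : t ≠ 0) (hT : ∀ r, T r ≠ 0) (hv : v ≠ 0) {C : Contour}
    (hC : C.InversionInvariant) (hsep : C.Separates (selbergParams n m T t p q v)) :
    (∏ i ∈ Finset.range n, theta (t ^ i * T 0 * T 1) q *
      (theta (t ^ i * T 0 * v) q * theta (t ^ i * T 1 * v) q)) *
        C.integralPow n (integrand n m T t p q) =
      2 ^ n * C.integralPow n fun z =>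
        (selbergParams n m T t p q v).num z / (selbergParams n m T t p q v).den z := by
  set P := selbergParams n m T t p q v with hP
  have h0 := hT 0
  have h1 := hT 1
  have hcont := hsep.continuousOn (n := n) ⟨hp, hq⟩ hv
    (show q / (t ^ (n - 1) * v * T 0 * T 1) ≠ 0 by positivity)
  have hsigns : ∀ (ε : Fin n → Bool) (z : Fin n → ℂ),
      signs ε z = Contour.invertAt (Finset.univ.filter fun j => ε j = false) z := fun ε z => by
    funext j
    unfold signs Contour.invertAt
    cases h : ε j <;> simp [h]
  have hc : ∀ ε : Fin n → Bool, ContinuousOn (fun z => P.num (signs ε z) / P.den (signs ε z))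
      (univ.pi fun _ => C.support) := fun ε => by
    simp only [hsigns]
    exact hC.continuousOn_invertAt hcont _
  have e1 : ∀ ε : Fin n → Bool, C.integralPow n (fun z => P.num (signs ε z) / P.den (signs ε z)) =
      C.integralPow n fun z => P.num z / P.den z := fun ε => by
    rw [C.integralPow_eq_iint (hc ε), C.integralPow_eq_iint hcont, ← hC.iint_invertAt hcont
      (Finset.univ.filter fun j => ε j = false)]
    simp only [hsigns]
  have e2 : ∑ ε : Fin n → Bool, C.integralPow n (fun z => P.num (signs ε z) / P.den (signs ε z)) =
      C.integralPow n fun z => ∑ ε, P.num (signs ε z) / P.den (signs ε z) := by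
    rw [C.integralPow_eq_iint (continuousOn_finsetSum _ fun ε _ => hc ε),
      Finset.sum_congr rfl fun ε _ => C.integralPow_eq_iint (hc ε)]
    unfold Chain.iint
    rw [← integral_finsetSum _ fun ε _ => Chain.integrable_iint (fun _ : Fin n => C.chain) (hc ε)]
    simp only [Finset.sum_mul]
  rw [Finset.sum_congr rfl fun ε _ => e1 ε, Finset.sum_const, Finset.card_univ, Fintype.card_fun,
    Fintype.card_bool, Fintype.card_fin, nsmul_eq_mul, Nat.cast_pow, Nat.cast_two] at e2
  rw [e2, C.integralPow_congr (countable_exceptional ht hT) fun z hz h2 h3 =>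
    sum_num_div_den (v := v) hn hp hq₀ hq ht hT hv ⟨fun j h => C.zero_notMem_support (h ▸ hz j), h2,
      fun j k hjk => (h3 j k hjk).2, fun j k hjk => (h3 j k hjk).1⟩]
  unfold Contour.integralPow
  rw [Finset.mul_sum]
  refine Finset.sum_congr rfl fun a _ => ?_
  rw [mul_left_comm, ← integral_const_mul]
  simp only [mul_assoc]

end

/-! ### Separation of the poles by the given contours -/

lemma Contour.InversionInvariant.mem_outerInv {C : Contour} (h : C.InversionInvariant)
    (h0 : C.index 0 = 1) {w : ℂ} : w ∈ C.hull ↔ w ∈ C.outerInv := by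
  by_cases hw : w = 0
  · subst hw
    exact ⟨fun _ => Or.inl rfl, fun _ => Or.inr (by rw [h0]; exact one_ne_zero)⟩
  · rw [← h.inv_mem_outer h0 hw]
    simp [Contour.outerInv, hw]

lemma IsContour.separates {n m : ℕ} {T : Fin (2 * m + 6) → ℂ} {t p q v : ℂ} (hp₀ : p ≠ 0)
    (hp : ‖p‖ < 1) (hq₀ : q ≠ 0) (hq : ‖q‖ < 1) (ht₀ : t ≠ 0) {C : Contour}
    (h : IsContour m T t p q C) : C.Separates (selbergParams n m T t p q v) := by
  have h0 : C.index 0 = 1 :=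
    C.index_zero_of_includes hq fun j => by simpa using h.includes 0 0 j
  have hscaled : ∀ x ∈ C.hull, ∀ u ∈ C.outerInv, poch2 (t * (x * u)) p q ≠ 0 := by
    intro x hx u hu
    rcases eq_or_ne x 0 with rfl | hx0
    · simp [poch2_zero_left]
    rcases hu with rfl | hu
    · simp [poch2_zero_left]
    refine (poch2_ne_zero_iff hp hq).2 fun i j hij => ?_
    refine (h.scaled i j).mul_notMem_outer (by positivity) hx hx0 ?_
    rwa [show p ^ i * q ^ j * t * x = u⁻¹ from eq_inv_of_mul_eq_one_left (by rw [← hij]; ring)]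
  refine ⟨h0, hscaled, fun u hu v hv => ?_, fun x hx y hy => ?_, fun r x hx => ?_,
    fun r u hu => ?_⟩
  · have := hscaled u ((h.inv.mem_outerInv h0).2 hu) v hv
    simpa [selbergParams] using this
  · have := poch2_mul_ne_zero hp hq (hscaled x hx y ((h.inv.mem_outerInv h0).1 hy))
    change poch2 (t * p * (x * y)) p q ≠ 0
    rwa [mul_right_comm, mul_comm]
  · have : poch2 (T r * x) p q ≠ 0 := (poch2_ne_zero_iff hp hq).2 fun i j hij => by
      have he := (Contour.excludes_iff C).1 (h.excludes r i j)
      rw [← show x = (p ^ i * q ^ j * T r)⁻¹ from eq_inv_of_mul_eq_one_left (by rw [← hij]; ring)] at he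
      exact he hx
    change poch2 ((if r = 0 ∨ r = 1 then p * T r else T r) * x) p q ≠ 0
    split_ifs
    · rw [mul_assoc]
      exact poch2_mul_ne_zero hp hq this
    · exact this
  · change poch2 (T r * u) p q ≠ 0
    rcases hu with rfl | hu
    · simp [poch2_zero_left]
    refine (poch2_ne_zero_iff hp hq).2 fun i j hij => ?_
    refine (Contour.includes_iff C).1 (h.includes r i j) ?_
    rwa [show p ^ i * q ^ j * T r = u⁻¹ from eq_inv_of_mul_eq_one_left (by rw [← hij]; ring)]

/-- The limit of `p ^ β` as `p → 0`, for `β ≥ 0`. -/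
def zeroPow (β : ℝ) : ℂ := if β = 0 then 1 else 0

lemma zeroPow_zero : zeroPow 0 = 1 := if_pos rfl

lemma zeroPow_of_pos {β : ℝ} (h : 0 < β) : zeroPow β = 0 := if_neg h.ne'

lemma tendsto_cpow_zeroPow {β : ℝ} (h : 0 ≤ β) :
    Tendsto (fun p : ℂ => p ^ (β : ℂ)) (𝓝[≠] 0) (𝓝 (zeroPow β)) := by
  rcases h.eq_or_lt with rfl | h
  · simp [zeroPow_zero]
  · rw [zeroPow_of_pos h, tendsto_zero_iff_norm_tendsto_zero]
    have h1 : Tendsto (fun p : ℂ => ‖p‖ ^ β) (𝓝[≠] 0) (𝓝 0) := by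
      have : Tendsto (fun p : ℂ => ‖p‖ ^ β) (𝓝 0) (𝓝 (‖(0 : ℂ)‖ ^ β)) :=
        (continuous_norm.tendsto 0).rpow_const (Or.inr h.le)
      rw [norm_zero, Real.zero_rpow h.ne'] at this
      exact this.mono_left nhdsWithin_le_nhds
    refine h1.congr' ?_
    filter_upwards [self_mem_nhdsWithin] with p hp
    rw [Complex.norm_cpow_real]

/-- The parameters of the rescaled regularized integrand at `p = 0`. -/
def limitParams (n m : ℕ) (T : Fin (2 * m + 6) → ℂ) (t q : ℂ) (α : Fin (2 * m + 6) → ℝ) (ζ : ℝ)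
    (v : ℂ) : Params (2 * m + 6) where
  p := 0
  q := q
  t := t
  s := zeroPow (1 + 2 * ζ)
  s' := 0
  v := v
  e := q / (t ^ (n - 1) * v * T 0 * T 1)
  b r := T r * zeroPow (if r = 0 ∨ r = 1 then 1 + 2 * ζ else α r + ζ)
  b' _ := 0
  d r := T r * zeroPow (α r - ζ)
  d' r := q / T r * zeroPow (1 + ζ - α r)

/-- The conditions on the exponents, apart from the value of their sum. -/
structure IsExponents (m : ℕ) (α : Fin (2 * m + 6) → ℝ) (ζ : ℝ) : Prop where
  ge : -1 / 2 ≤ ζ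
  neg : ζ < 0
  zero : α 0 = ζ
  one : α 1 = ζ
  mem : ∀ r, r ≠ 0 → r ≠ 1 → -ζ ≤ α r ∧ α r ≤ 1 + ζ


section

variable {n m : ℕ} {T : Fin (2 * m + 6) → ℂ} {t q v : ℂ} {α : Fin (2 * m + 6) → ℝ} {ζ : ℝ}

lemma zeroPow_ne_zero {β : ℝ} (h : zeroPow β ≠ 0) : β = 0 := by
  by_contra h'
  exact h (if_neg h')

lemma IsLimitContour.separates (hα : IsExponents m α ζ) (hq₀ : q ≠ 0) (hq : ‖q‖ < 1)
    (ht₀ : t ≠ 0) {C : Contour} (h : IsLimitContour m T t q α ζ C) :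
    C.Separates (limitParams n m T t q α ζ v) := by
  have h0 : C.index 0 = 1 := C.index_zero_of_includes hq h.includes_zero
  have h2ζ : ∀ {β : ℝ}, β = 1 + 2 * ζ → zeroPow β ≠ 0 → ζ = -1 / 2 := fun hβ h' => by
    linarith [zeroPow_ne_zero h']
  have hpoch : ∀ {x : ℂ}, (∀ j : ℕ, x * q ^ j ≠ 1) → poch2 x 0 q ≠ 0 := fun hx => by
    rw [poch2_zero]; exact (poch_ne_zero_iff hq).2 hx
  refine ⟨h0, fun x hx u hu => ?_, fun u _ v _ => ?_, fun x hx y hy => ?_, fun r x hx => ?_,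
    fun r u hu => ?_⟩
  · change poch2 (t * (x * u)) 0 q ≠ 0
    rcases eq_or_ne x 0 with rfl | hx0
    · simp [poch2_zero_left]
    rcases hu with rfl | hu
    · simp [poch2_zero_left]
    refine hpoch fun j hj => (h.scaled j).mul_notMem_outer (by positivity) hx hx0 ?_
    rwa [show t * q ^ j * x = u⁻¹ from eq_inv_of_mul_eq_one_left (by rw [← hj]; ring)]
  · change poch2 (t * 0 * (u * v)) 0 q ≠ 0
    simp [poch2_zero_left]
  · change poch2 (t * zeroPow (1 + 2 * ζ) * (x * y)) 0 q ≠ 0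
    by_cases hs : zeroPow (1 + 2 * ζ) = 0
    · simp [hs, poch2_zero_left]
    have hζ := h2ζ rfl hs
    rw [show 1 + 2 * ζ = 0 by linarith, zeroPow_zero, mul_one]
    rcases eq_or_ne x 0 with rfl | hx0
    · simp [poch2_zero_left]
    refine hpoch fun j hj => Contour.inv_notMem_hull (h.excludes_inv hζ j) (by positivity) hx hx0 ?_
    rwa [← show y = (t * q ^ j * x)⁻¹ from eq_inv_of_mul_eq_one_left (by rw [← hj]; ring)]
  · have hex : (∀ j : ℕ, C.Excludes (q ^ j * T r)⁻¹) → poch2 (T r * 1 * x) 0 q ≠ 0 := fun he =>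
      hpoch fun j hj => by
        have := (Contour.excludes_iff C).1 (he j)
        rw [← show x = (q ^ j * T r)⁻¹ from eq_inv_of_mul_eq_one_left (by rw [← hj]; ring)] at this
        exact this hx
    change poch2 (T r * zeroPow (if r = 0 ∨ r = 1 then 1 + 2 * ζ else α r + ζ) * x) 0 q ≠ 0
    by_cases hs : zeroPow (if r = 0 ∨ r = 1 then 1 + 2 * ζ else α r + ζ) = 0
    · simp [hs, poch2_zero_left]
    have hs' := zeroPow_ne_zero hs
    rw [hs', zeroPow_zero]
    refine hex ?_
    split_ifs at hs' with hr
    · have hζ : ζ = -1 / 2 := by linarith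
      rcases hr with rfl | rfl
      · exact h.excludes_zero hζ
      · exact h.excludes_one hζ
    · exact h.excludes r (by linarith)
  · change poch2 (T r * zeroPow (α r - ζ) * u) 0 q ≠ 0
    rcases hu with rfl | hu
    · simp [poch2_zero_left]
    have hin : (∀ j : ℕ, C.Includes (q ^ j * T r)) → poch2 (T r * 1 * u) 0 q ≠ 0 := fun he =>
      hpoch fun j hj => by
        have := (Contour.includes_iff C).1 (he j)
        rw [show q ^ j * T r = u⁻¹ from eq_inv_of_mul_eq_one_left (by rw [← hj]; ring)] at this
        exact this hu
    by_cases hr0 : r = 0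
    · subst hr0
      rw [hα.zero, sub_self, zeroPow_zero]
      exact hin h.includes_zero
    by_cases hr1 : r = 1
    · subst hr1
      rw [hα.one, sub_self, zeroPow_zero]
      exact hin h.includes_one
    rw [zeroPow_of_pos (by have := hα.mem r hr0 hr1; have := hα.neg; linarith), mul_zero, zero_mul,
      poch2_zero_left]
    exact one_ne_zero

/-- The parameters of the regularized integrand for the elliptic Selberg integral with parameters
`τ r * p ^ α r`, in the coordinates `y = p ^ (-ζ) z`. -/
def rescaledParams (n m : ℕ) (t q : ℂ) (α : Fin (2 * m + 6) → ℝ) (ζ : ℝ) (v : ℂ)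
    (w : ℂ × (Fin (2 * m + 6) → ℂ)) : Params (2 * m + 6) where
  p := w.1
  q := q
  t := t
  s := w.1 ^ ((1 + 2 * ζ : ℝ) : ℂ)
  s' := w.1 ^ ((-2 * ζ : ℝ) : ℂ)
  v := v
  e := q / (t ^ (n - 1) * v * w.2 0 * w.2 1)
  b r := w.2 r * w.1 ^ ((if r = 0 ∨ r = 1 then 1 + 2 * ζ else α r + ζ : ℝ) : ℂ)
  b' r := q / w.2 r * w.1 ^ ((if r = 0 ∨ r = 1 then -2 * ζ else 1 - α r - ζ : ℝ) : ℂ)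
  d r := w.2 r * w.1 ^ ((α r - ζ : ℝ) : ℂ)
  d' r := q / w.2 r * w.1 ^ ((1 + ζ - α r : ℝ) : ℂ)

lemma selbergParams_rescale (hα : IsExponents m α ζ) {p : ℂ} (hp : p ≠ 0)
    {τ : Fin (2 * m + 6) → ℂ} :
    (selbergParams n m (fun r => τ r * p ^ (α r : ℂ)) t p q (v * p ^ (-ζ : ℂ))).rescale
      (p ^ (ζ : ℂ)) = rescaledParams n m t q α ζ v (p, τ) := by
  have hsub : ∀ a b : ℝ, p ^ ((a - b : ℝ) : ℂ) = p ^ (a : ℂ) * (p ^ (b : ℂ))⁻¹ := fun a b => by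
    rw [Complex.ofReal_sub, Complex.cpow_sub _ _ hp, div_eq_mul_inv]
  have hadd : ∀ a b : ℝ, p ^ ((a + b : ℝ) : ℂ) = p ^ (a : ℂ) * p ^ (b : ℂ) := fun a b => by
    rw [Complex.ofReal_add, Complex.cpow_add _ _ hp]
  have h1 : p ^ ((1 : ℝ) : ℂ) = p := by rw [Complex.ofReal_one, Complex.cpow_one]
  have hc : p ^ (ζ : ℂ) ≠ 0 := by simp [Complex.cpow_eq_zero_iff, hp]
  have h2 : p ^ ((2 * ζ : ℝ) : ℂ) = p ^ (ζ : ℂ) * p ^ (ζ : ℂ) := by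
    rw [two_mul, hadd]
  have h3 : p ^ (-ζ : ℂ) = (p ^ (ζ : ℂ))⁻¹ := Complex.cpow_neg _ _
  have h4 : p ^ ((-2 * ζ : ℝ) : ℂ) = (p ^ (ζ : ℂ) * p ^ (ζ : ℂ))⁻¹ := by
    rw [neg_mul, Complex.ofReal_neg, Complex.cpow_neg, two_mul, hadd]
  ext r
  · rfl
  · rfl
  · rfl
  · change p * (p ^ (ζ : ℂ)) ^ 2 = p ^ ((1 + 2 * ζ : ℝ) : ℂ)
    rw [hadd, h1, h2, sq]
  · change 1 / (p ^ (ζ : ℂ)) ^ 2 = p ^ ((-2 * ζ : ℝ) : ℂ)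
    rw [h4, one_div, sq]
  · change v * p ^ (-ζ : ℂ) * p ^ (ζ : ℂ) = v
    rw [h3, inv_mul_cancel_right₀ hc]
  · change q / (t ^ (n - 1) * (v * p ^ (-ζ : ℂ)) * (τ 0 * p ^ (α 0 : ℂ)) * (τ 1 * p ^ (α 1 : ℂ))) *
      p ^ (ζ : ℂ) = q / (t ^ (n - 1) * v * τ 0 * τ 1)
    rw [hα.zero, hα.one, h3]
    generalize p ^ (ζ : ℂ) = c at hc
    rw [show t ^ (n - 1) * (v * c⁻¹) * (τ 0 * c) * (τ 1 * c) =
      t ^ (n - 1) * v * τ 0 * τ 1 * c * (c⁻¹ * c) by ring, inv_mul_cancel₀ hc, mul_one,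
      ← div_div, div_mul_cancel₀ _ hc]
  · change (if r = 0 ∨ r = 1 then p * (τ r * p ^ (α r : ℂ)) else τ r * p ^ (α r : ℂ)) * p ^ (ζ : ℂ) =
      τ r * p ^ ((if r = 0 ∨ r = 1 then 1 + 2 * ζ else α r + ζ : ℝ) : ℂ)
    split_ifs with hr
    · have : α r = ζ := by rcases hr with rfl | rfl; exacts [hα.zero, hα.one]
      rw [this, hadd, h1, h2, mul_assoc, mul_assoc, mul_left_comm]
    · rw [hadd]; ring
  · change (if r = 0 ∨ r = 1 then q / (τ r * p ^ (α r : ℂ)) else p * q / (τ r * p ^ (α r : ℂ))) /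
      p ^ (ζ : ℂ) = q / τ r * p ^ ((if r = 0 ∨ r = 1 then -2 * ζ else 1 - α r - ζ : ℝ) : ℂ)
    split_ifs with hr
    · have : α r = ζ := by rcases hr with rfl | rfl; exacts [hα.zero, hα.one]
      rw [this, h4, mul_inv, div_eq_mul_inv, div_eq_mul_inv, mul_inv, div_eq_mul_inv]; ring
    · rw [hsub, hsub, h1, div_eq_mul_inv, div_eq_mul_inv, mul_inv, div_eq_mul_inv]; ring
  · change τ r * p ^ (α r : ℂ) / p ^ (ζ : ℂ) = τ r * p ^ ((α r - ζ : ℝ) : ℂ)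
    rw [hsub, mul_div_assoc, div_eq_mul_inv]
  · change p * q / (τ r * p ^ (α r : ℂ)) * p ^ (ζ : ℂ) = q / τ r * p ^ ((1 + ζ - α r : ℝ) : ℂ)
    rw [hsub, hadd, h1, div_eq_mul_inv, mul_inv, div_eq_mul_inv]; ring

/-- Convergence of the rescaled parameters to the limit parameters as `p → 0`. -/
lemma tends_limitParams (hα : IsExponents m α ζ) (hq₀ : q ≠ 0) (hq : ‖q‖ < 1) (ht₀ : t ≠ 0)
    (hT : ∀ r, T r ≠ 0) (hv : v ≠ 0) :
    Params.Tends (rescaledParams n m t q α ζ v) (𝓝[≠] 0 ×ˢ 𝓝 T) (limitParams n m T t q α ζ v) := by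
  have h0 := hT 0
  have h1 := hT 1
  have hζ := hα.neg
  have hζ' := hα.ge
  have hτ : ∀ r, Tendsto (fun w : ℂ × (Fin (2 * m + 6) → ℂ) => w.2 r) (𝓝[≠] 0 ×ˢ 𝓝 T) (𝓝 (T r)) :=
    fun r => ((continuous_apply r).tendsto T).comp tendsto_snd
  have hpow : ∀ {β : ℝ}, 0 ≤ β → Tendsto (fun w : ℂ × (Fin (2 * m + 6) → ℂ) => w.1 ^ (β : ℂ))
      (𝓝[≠] 0 ×ˢ 𝓝 T) (𝓝 (zeroPow β)) := fun hβ => (tendsto_cpow_zeroPow hβ).comp tendsto_fst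
  have hpow0 : ∀ {β : ℝ}, 0 < β → Tendsto (fun w : ℂ × (Fin (2 * m + 6) → ℂ) => w.1 ^ (β : ℂ))
      (𝓝[≠] 0 ×ˢ 𝓝 T) (𝓝 0) := fun hβ => zeroPow_of_pos hβ ▸ hpow hβ.le
  have hqτ : ∀ r, Tendsto (fun w : ℂ × (Fin (2 * m + 6) → ℂ) => q / w.2 r) (𝓝[≠] 0 ×ˢ 𝓝 T)
      (𝓝 (q / T r)) := fun r => tendsto_const_nhds.div (hτ r) (hT r)
  have hα' : ∀ r, ¬(r = 0 ∨ r = 1) → -ζ ≤ α r ∧ α r ≤ 1 + ζ := fun r hr => by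
    push Not at hr; exact hα.mem r hr.1 hr.2
  have hα'' : ∀ r, ζ ≤ α r ∧ α r ≤ 1 + ζ := fun r => by
    by_cases hr : r = 0 ∨ r = 1
    · rcases hr with rfl | rfl
      · rw [hα.zero]; constructor <;> linarith
      · rw [hα.one]; constructor <;> linarith
    · have := hα' r hr; constructor <;> linarith
  refine ⟨⟨by simp [limitParams], hq⟩, hv, ?_, ht₀, ?_, tendsto_const_nhds, tendsto_const_nhds,
    hpow (by linarith), hpow0 (by linarith), tendsto_const_nhds, ?_, fun r => (hτ r).mul (hpow ?_),
    fun r => ?_, fun r => (hτ r).mul (hpow ?_), fun r => (hqτ r).mul (hpow ?_)⟩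
  · change q / (t ^ (n - 1) * v * T 0 * T 1) ≠ 0
    positivity
  · exact tendsto_fst.mono_right nhdsWithin_le_nhds
  · exact tendsto_const_nhds.div ((tendsto_const_nhds.mul (hτ 0)).mul (hτ 1)) (by positivity)
  · split_ifs with hr
    · linarith
    · linarith [hα' r hr]
  · have := (hqτ r).mul (hpow0 (β := if r = 0 ∨ r = 1 then -2 * ζ else 1 - α r - ζ) (by
      split_ifs with hr
      · linarith
      · linarith [hα' r hr]))
    rwa [mul_zero] at this
  · linarith [hα'' r]
  · linarith [hα'' r]

/-- Continuity of the rescaled parameters at fixed `p`. -/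
lemma tends_rescaledParams {p : ℂ} (hp : ‖p‖ < 1) (hq₀ : q ≠ 0) (hq : ‖q‖ < 1) (ht₀ : t ≠ 0)
    (hT : ∀ r, T r ≠ 0) (hv : v ≠ 0) :
    Params.Tends (fun τ => rescaledParams n m t q α ζ v (p, τ)) (𝓝 T)
      (rescaledParams n m t q α ζ v (p, T)) := by
  have h0 := hT 0
  have h1 := hT 1
  have hτ : ∀ r, Tendsto (fun w : Fin (2 * m + 6) → ℂ => w r) (𝓝 T) (𝓝 (T r)) :=
    fun r => (continuous_apply r).tendsto T
  refine ⟨⟨hp, hq⟩, hv, ?_, ht₀, tendsto_const_nhds, tendsto_const_nhds, tendsto_const_nhds,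
    tendsto_const_nhds, tendsto_const_nhds, tendsto_const_nhds, ?_, fun r => (hτ r).mul_const _,
    fun r => (tendsto_const_nhds.div (hτ r) (hT r)).mul_const _, fun r => (hτ r).mul_const _,
    fun r => (tendsto_const_nhds.div (hτ r) (hT r)).mul_const _⟩
  · change q / (t ^ (n - 1) * v * T 0 * T 1) ≠ 0
    positivity
  · exact tendsto_const_nhds.div ((tendsto_const_nhds.mul (hτ 0)).mul (hτ 1)) (by positivity)

end

/-! ### The elliptic Selberg integral as a regularized integral -/

/-- The prefactor of the regularized integral. For an elliptic Selberg integral `A r s` is the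
product of two parameters, except that `A 0 1 = p T 0 T 1`, and `B = q / (T 0 T 1)`. -/
def regPrefactor {N : ℕ} (n : ℕ) (p q t : ℂ) (A : Fin N → Fin N → ℂ) (B c₀ c₁ : ℂ) : ℂ :=
  poch q q ^ n * poch p p ^ n * ellGamma t p q ^ n / (n.factorial : ℂ) *
    ∏ i ∈ Finset.range n, (∏ r, ∏ s ∈ Finset.Ioi r, poch2 (t ^ i * A r s) p q) /
      (poch (B / t ^ i) q * (theta (t ^ i * c₀) q * theta (t ^ i * c₁) q))

section

variable {n m : ℕ} {T : Fin (2 * m + 6) → ℂ} {t p q v : ℂ}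

lemma prod_Ioi_ite_zero_one (c : ℂ) :
    (∏ r : Fin (2 * m + 6), ∏ s ∈ Finset.Ioi r, if r = 0 ∧ s = 1 then c else 1) = c := by
  rw [Finset.prod_eq_single 0, Finset.prod_eq_single 1]
  · simp
  · intro s _ hs; simp [hs]
  · intro h
    exact absurd (Finset.mem_Ioi.2 (by simp)) h
  · intro r _ hr; simp [hr]
  · simp

lemma prefactor_eq (hp : ‖p‖ < 1) (hq : ‖q‖ < 1)
    (hB : ∀ i < n, poch (q / (T 0 * T 1) / t ^ i) q ≠ 0)
    (hθ : ∀ i < n, theta (t ^ i * (T 0 * v)) q ≠ 0 ∧ theta (t ^ i * (T 1 * v)) q ≠ 0) :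
    prefactor n m T t p q * 2 ^ n =
      regPrefactor n p q t (fun r s => if r = 0 ∧ s = 1 then p * (T 0 * T 1) else T r * T s)
        (q / (T 0 * T 1)) (T 0 * v) (T 1 * v) *
      ∏ i ∈ Finset.range n, theta (t ^ i * T 0 * T 1) q *
        (theta (t ^ i * T 0 * v) q * theta (t ^ i * T 1 * v) q) := by
  unfold prefactor regPrefactor
  rw [mul_assoc _ (Finset.prod _ _) (Finset.prod _ _), ← Finset.prod_mul_distrib]
  have key : ∀ i ∈ Finset.range n, (∏ r : Fin (2 * m + 6), ∏ s ∈ Finset.Ioi r,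
        poch2 (t ^ i * if r = 0 ∧ s = 1 then p * (T 0 * T 1) else T r * T s) p q) /
        (poch (q / (T 0 * T 1) / t ^ i) q * (theta (t ^ i * (T 0 * v)) q *
          theta (t ^ i * (T 1 * v)) q)) *
      (theta (t ^ i * T 0 * T 1) q * (theta (t ^ i * T 0 * v) q * theta (t ^ i * T 1 * v) q)) =
      ∏ r : Fin (2 * m + 6), ∏ s ∈ Finset.Ioi r, poch2 (t ^ i * T r * T s) p q := by
    intro i hi
    rw [Finset.mem_range] at hi
    obtain ⟨h1, h2⟩ := hθ i hi
    have h3 := hB i hi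
    have e1 : theta (t ^ i * T 0 * T 1) q =
        poch (t ^ i * T 0 * T 1) q * poch (q / (T 0 * T 1) / t ^ i) q := by
      rw [theta, div_div]; congr 3; ring
    have e2 : ∀ r s, poch2 (t ^ i * T r * T s) p q =
        poch2 (t ^ i * if r = 0 ∧ s = 1 then p * (T 0 * T 1) else T r * T s) p q *
          if r = 0 ∧ s = 1 then poch (t ^ i * T 0 * T 1) q else 1 := by
      intro r s
      split_ifs with h
      · rw [h.1, h.2, poch2_eq_poch_mul _ hp hq, mul_comm]
        congr 2; ring
      · rw [mul_one, mul_assoc]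
    simp only [e2, Finset.prod_mul_distrib, prod_Ioi_ite_zero_one]
    rw [e1, ← mul_assoc (t ^ i) (T 0) v, ← mul_assoc (t ^ i) (T 1) v]
    rw [← mul_assoc (t ^ i)] at h1 h2
    rw [div_mul_eq_mul_div, div_eq_iff (mul_ne_zero h3 (mul_ne_zero h1 h2))]
    ring
  rw [Finset.prod_congr rfl key]
  have h2 : (2 : ℂ) ^ n ≠ 0 := pow_ne_zero _ two_ne_zero
  have hf : (n.factorial : ℂ) ≠ 0 := by exact_mod_cast n.factorial_ne_zero
  field_simp

/-- The elliptic Selberg integral equals a regularized integral over any separating contour whose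
exterior lies outside the unit disc. -/
theorem genericII_eq (hn : 1 ≤ n) (hp₀ : p ≠ 0) (hp : ‖p‖ < 1) (hq₀ : q ≠ 0) (hq : ‖q‖ < 1)
    (ht₀ : t ≠ 0) (ht : ‖t‖ < 1) (hT : ∀ r, T r ≠ 0) (hv : v ≠ 0)
    (hB : ∀ i < n, poch (q / (T 0 * T 1) / t ^ i) q ≠ 0)
    (hθ : ∀ i < n, theta (t ^ i * (T 0 * v)) q ≠ 0 ∧ theta (t ^ i * (T 1 * v)) q ≠ 0)
    (hex : ∃ C, IsContour m T t p q C) {R : Contour} (hR : R.Separates (selbergParams n m T t p q v))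
    (hR1 : ∀ w ∈ R.outer, 1 < ‖w‖) :
    genericII n m T t p q =
      regPrefactor n p q t (fun r s => if r = 0 ∧ s = 1 then p * (T 0 * T 1) else T r * T s)
        (q / (T 0 * T 1)) (T 0 * v) (T 1 * v) *
      R.integralPow n fun z =>
        (selbergParams n m T t p q v).num z / (selbergParams n m T t p q v).den z := by
  have h0 := hT 0
  have h1 := hT 1
  have hC := hex.choose_spec
  have hsep := hC.separates (n := n) (v := v) hp₀ hp hq₀ hq ht₀
  have e1 := mul_integralPow_integrand hn hp hq₀ hq ht₀ hT hv hC.inv hsep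
  rw [integralPow_eq_of_separates ⟨hp, hq⟩ hv
    (show q / (t ^ (n - 1) * v * T 0 * T 1) ≠ 0 by positivity) rfl rfl ht
    (fun r x hx => by
      change poch2 ((if r = 0 ∨ r = 1 then p * T r else T r) * x) p q ≠ 0
      split_ifs
      · rw [mul_assoc]; exact poch2_mul_ne_zero hp hq hx
      · exact hx) n hsep hR hR1] at e1
  have e2 := prefactor_eq (v := v) hp hq hB hθ
  rw [genericII, dif_pos hex]
  have h2 : (2 : ℂ) ^ n ≠ 0 := pow_ne_zero _ two_ne_zero
  refine mul_right_cancel₀ h2 ?_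
  rw [mul_right_comm, e2, mul_assoc, e1]
  ring

end

section

variable {ι : Type*} {l : Filter ι} {N n : ℕ} {q t : ℂ}

lemma tendsto_theta {f : ι → ℂ} {x : ℂ} (hx : x ≠ 0) (hq : ‖q‖ < 1) (hf : Tendsto f l (𝓝 x)) :
    Tendsto (fun i => theta (f i) q) l (𝓝 (theta x q)) :=
  (differentiableAt_theta hx hq).continuousAt.tendsto.comp hf

lemma tendsto_regPrefactor (hq : ‖q‖ < 1) (ht₀ : t ≠ 0) (ht : ‖t‖ < 1) {p : ι → ℂ}
    {A : ι → Fin N → Fin N → ℂ} {B c₀ c₁ : ι → ℂ} {p' B' c₀' c₁' : ℂ} {A' : Fin N → Fin N → ℂ}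
    (hp : Tendsto p l (𝓝 p')) (hp' : ‖p'‖ < 1)
    (hA : ∀ r s, r < s → Tendsto (fun i => A i r s) l (𝓝 (A' r s)))
    (hB : Tendsto B l (𝓝 B')) (hc₀ : Tendsto c₀ l (𝓝 c₀')) (hc₁ : Tendsto c₁ l (𝓝 c₁'))
    (h0 : c₀' ≠ 0) (h1 : c₁' ≠ 0) (hB' : ∀ i < n, poch (B' / t ^ i) q ≠ 0)
    (hθ : ∀ i < n, theta (t ^ i * c₀') q ≠ 0 ∧ theta (t ^ i * c₁') q ≠ 0) :
    Tendsto (fun i => regPrefactor n (p i) q t (A i) (B i) (c₀ i) (c₁ i)) l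
      (𝓝 (regPrefactor n p' q t A' B' c₀' c₁')) := by
  have hpoch : Tendsto (fun i => poch (p i) (p i)) l (𝓝 (poch p' p')) := tendsto_poch hp hp hp'
  have hgam : Tendsto (fun i => ellGamma t (p i) q) l (𝓝 (ellGamma t p' q)) :=
    (tendsto_poch2 ((hp.mul_const q).div_const t) hp tendsto_const_nhds hp' hq).div
      (tendsto_poch2 tendsto_const_nhds hp tendsto_const_nhds hp' hq)
      (poch2_ne_zero_of_norm_lt_one hp' hq ht)
  refine (((tendsto_const_nhds.mul (hpoch.pow n)).mul (hgam.pow n)).div_const _).mul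
    (tendsto_finsetProd _ fun i hi => ?_)
  rw [Finset.mem_range] at hi
  have hti : t ^ i ≠ 0 := pow_ne_zero _ ht₀
  refine Tendsto.div (tendsto_finsetProd _ fun r _ => tendsto_finsetProd _ fun s hs =>
    tendsto_poch2 (tendsto_const_nhds.mul (hA r s (Finset.mem_Ioi.1 hs))) hp tendsto_const_nhds
      hp' hq) ((tendsto_poch (hB.div_const _) tendsto_const_nhds hq).mul
      ((tendsto_theta (mul_ne_zero hti h0) hq (tendsto_const_nhds.mul hc₀)).mul
        (tendsto_theta (mul_ne_zero hti h1) hq (tendsto_const_nhds.mul hc₁)))) ?_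
  exact mul_ne_zero (hB' i hi) (mul_ne_zero (hθ i hi).1 (hθ i hi).2)

end

/-! ### The limit of the regularized integral -/

section

variable {n m : ℕ} {T : Fin (2 * m + 6) → ℂ} {t q v : ℂ} {α : Fin (2 * m + 6) → ℝ} {ζ : ℝ}

/-- The exponents of `p` in the products of two parameters, raised by `1` for the pair `(0, 1)`. -/
def pairExponent (α : Fin (2 * m + 6) → ℝ) (r s : Fin (2 * m + 6)) : ℝ :=
  if r = 0 ∧ s = 1 then 1 + α r + α s else α r + α s

lemma IsExponents.nonneg (hα : IsExponents m α ζ) {r s : Fin (2 * m + 6)} (hrs : r < s) :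
    0 ≤ pairExponent α r s := by
  have hζ := hα.neg
  have hζ' := hα.ge
  have h0 := hα.zero
  have h1 := hα.one
  have hs0 : s ≠ 0 := (Fin.zero_le r |>.trans_lt hrs).ne'
  unfold pairExponent
  split_ifs with h
  · rw [h.1, h.2]; linarith
  by_cases hs1 : s = 1
  · subst hs1
    refine absurd ⟨?_, rfl⟩ h
    exact Fin.ext (by have := Fin.lt_def.1 hrs; simpa using this)
  have hs := hα.mem s hs0 hs1
  by_cases hr0 : r = 0
  · rw [hr0]; linarith
  by_cases hr1 : r = 1
  · rw [hr1]; linarith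
  linarith [hα.mem r hr0 hr1]

open Classical in
lemma regPrefactor_limit (hα : IsExponents m α ζ) :
    regPrefactor n 0 q t (fun r s => T r * T s * zeroPow (pairExponent α r s)) 0 (T 0 * v)
      (T 1 * v) = limitPrefactor n m T t q α ζ v := by
  have hζ := hα.neg
  have hζ' := hα.ge
  have h0 := hα.zero
  have h1 := hα.one
  have key : ∀ i : ℕ, (∏ r : Fin (2 * m + 6), ∏ s ∈ Finset.Ioi r,
      poch2 (t ^ i * (T r * T s * zeroPow (pairExponent α r s))) 0 q) =
      (if ζ = -1 / 2 then poch (t ^ i * T 0 * T 1) q else 1) *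
        ∏ r with α r = -ζ, poch (t ^ i * T r * T 0) q * poch (t ^ i * T r * T 1) q := by
    intro i
    let g : Fin (2 * m + 6) → Fin (2 * m + 6) → ℂ := fun r s =>
      if α s = -ζ then poch (t ^ i * T s * T r) q else 1
    have hg0 : ∀ r, g r 0 = 1 := fun r => if_neg (by rw [h0]; linarith)
    have hg1 : ∀ r, g r 1 = 1 := fun r => if_neg (by rw [h1]; linarith)
    have e : ∀ r, ∀ s ∈ Finset.Ioi r,
        poch2 (t ^ i * (T r * T s * zeroPow (pairExponent α r s))) 0 q =
        (if r = 0 ∨ r = 1 then g r s else 1) * if r = 0 ∧ s = 1 then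
          (if ζ = -1 / 2 then poch (t ^ i * T 0 * T 1) q else 1) else 1 := by
      intro r s hs
      rw [Finset.mem_Ioi] at hs
      rw [poch2_zero]
      have hs0 : s ≠ 0 := (Fin.zero_le r |>.trans_lt hs).ne'
      have hz : ∀ {β : ℝ}, 0 < β → poch (t ^ i * (T r * T s * zeroPow β)) q = 1 := fun hβ => by
        rw [zeroPow_of_pos hβ, mul_zero, mul_zero, poch_zero_left]
      unfold pairExponent
      by_cases h : r = 0 ∧ s = 1
      · rw [if_pos h, if_pos (Or.inl h.1), if_pos h, h.1, h.2, hg1, one_mul, h0, h1]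
        split_ifs with hh
        · rw [hh, show (1 : ℝ) + -1 / 2 + -1 / 2 = 0 by norm_num, zeroPow_zero, mul_one, mul_assoc]
        · have : 0 < 1 + ζ + ζ := lt_of_le_of_ne (by linarith) fun h' => hh (by linarith)
          rw [zeroPow_of_pos this, mul_zero, mul_zero, poch_zero_left]
      rw [if_neg h, if_neg h, mul_one]
      by_cases hs1 : s = 1
      · subst hs1
        refine absurd ⟨?_, rfl⟩ h
        exact Fin.ext (by have := Fin.lt_def.1 hs; simpa using this)
      have hs := hα.mem s hs0 hs1
      split_ifs with hr
      · have : α r = ζ := by rcases hr with rfl | rfl <;> assumption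
        rw [this]
        simp only [g]
        split_ifs with hh
        · rw [hh, add_neg_cancel, zeroPow_zero, mul_one, mul_comm (T r), mul_assoc]
        · refine hz (lt_of_le_of_ne (by linarith) fun h' => hh (by linarith))
      · push Not at hr
        exact hz (by linarith [hα.mem r hr.1 hr.2])
    rw [Finset.prod_congr rfl fun r _ => Finset.prod_congr rfl (e r)]
    simp only [Finset.prod_mul_distrib]
    rw [prod_Ioi_ite_zero_one, mul_comm]
    congr 1
    have e2 : ∀ r : Fin (2 * m + 6), (∏ s ∈ Finset.Ioi r, if r = 0 ∨ r = 1 then g r s else 1) =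
        if r = 0 ∨ r = 1 then ∏ s, g r s else 1 := by
      intro r
      split_ifs with hr
      · refine Finset.prod_subset (Finset.subset_univ _) fun s _ hs => ?_
        rw [Finset.mem_Ioi, not_lt, Fin.le_def] at hs
        rcases hr with rfl | rfl
        · rw [show s = 0 from Fin.ext (by simpa using hs), hg0]
        · have : (s : ℕ) ≤ 1 := by simpa using hs
          rcases Nat.le_one_iff_eq_zero_or_eq_one.1 this with h | h
          · rw [show s = 0 from Fin.ext (by simpa using h), hg0]
          · rw [show s = 1 from Fin.ext (by simpa using h), hg1]
      · exact Finset.prod_const_one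
    rw [Finset.prod_congr rfl fun r _ => e2 r, prod_ite_zero_one]
    simp only [g, Finset.prod_filter]
  unfold regPrefactor limitPrefactor
  rw [Finset.prod_congr rfl fun i _ => by rw [key i]]
  congr 1
  · rw [poch_zero_left, ellGamma, zero_mul, zero_div, poch2_zero_left, poch2_zero, one_pow, mul_one,
      div_pow, one_pow, mul_one_div, div_div, mul_comm (poch t q ^ n)]
  · refine Finset.prod_congr rfl fun i _ => ?_
    rw [zero_div, poch_zero_left, one_mul, mul_assoc (t ^ i) (T 0) v, mul_assoc (t ^ i) (T 1) v]

end

section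

variable {n m : ℕ} {T : Fin (2 * m + 6) → ℂ} {t q v : ℂ} {α : Fin (2 * m + 6) → ℝ} {ζ : ℝ}

open Classical in
/-- At `p = 0` the regularized integrand becomes the limit integrand, where the latter makes sense:
for `ζ = -1/2` it is written with a factor `(q x; q)` in both numerator and denominator. -/
lemma limitParams_num_div_den (hα : IsExponents m α ζ) (hq : ‖q‖ < 1) {z : Fin n → ℂ}
    (h1 : ∀ j, poch (q * z j ^ 2) q ≠ 0) (h2 : ∀ j k, j ≠ k → poch (q * z j * z k) q ≠ 0) :
    (limitParams n m T t q α ζ v).num z / (limitParams n m T t q α ζ v).den z =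
      limitIntegrand n m T t q α ζ v z := by
  have hζ := hα.neg
  have hζ' := hα.ge
  have hs : ζ ≠ -1 / 2 → zeroPow (1 + 2 * ζ) = 0 := fun h =>
    zeroPow_of_pos (lt_of_le_of_ne (by linarith) fun h' => h (by linarith))
  have hs' : ζ = -1 / 2 → zeroPow (1 + 2 * ζ) = 1 := fun h => by
    rw [h, show (1 : ℝ) + 2 * (-1 / 2) = 0 by norm_num, zeroPow_zero]
  have hcancel : ∀ a b c d X : ℂ, X ≠ 0 → a * (b * X) / (c * (d * X)) = a * b / (c * d) :=
    fun a b c d X hX => by rw [← mul_assoc, ← mul_assoc, mul_div_mul_right _ _ hX]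
  have hpair : ∀ j, ∀ k ∈ Finset.Ioi j,
      (poch2 (q * 0 / t * (z j * z k)⁻¹) 0 q *
        poch2 (q * zeroPow (1 + 2 * ζ) / t * (z j * z k)) 0 q *
        (poch2 (0 * q / t * (z k / z j)) 0 q * poch2 (0 * q / t * (z j / z k)) 0 q) *
        ((poch (z j / z k) q * poch (z j / z k)⁻¹ q *
          (poch (0 * (z j / z k)) 0 * poch (0 * (z j / z k)⁻¹) 0)) *
          (poch (0 * (z j * z k)⁻¹) 0 * poch (zeroPow (1 + 2 * ζ) * (z j * z k)) 0))) /
      (poch2 (t * zeroPow (1 + 2 * ζ) * (z j * z k)) 0 q * poch2 (t * 0 * (z j * z k)⁻¹) 0 q *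
        (poch2 (t * (z j / z k)) 0 q * poch2 (t * (z k / z j)) 0 q)) =
      (poch (z j / z k) q * poch (z k / z j) q) /
        (poch (t * z j / z k) q * poch (t * z k / z j) q) *
      (if ζ = -1 / 2 then
        (poch (z j * z k) q * poch (q * z j * z k / t) q) /
          (poch (t * z j * z k) q * poch (q * z j * z k) q)
      else 1) := by
    intro j k hk
    have hjk : j ≠ k := (Finset.mem_Ioi.1 hk).ne
    have h3 := h2 j k hjk
    simp only [mul_zero, zero_mul, zero_div, poch_zero_left, poch2_zero, poch_zero_right, mul_one,
      one_mul]
    rw [inv_div, ← mul_div_assoc t, ← mul_div_assoc t]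
    split_ifs with h
    · rw [hs' h, mul_one, mul_one, one_mul, poch_eq_mul (z j * z k) hq, ← mul_assoc q,
        ← mul_assoc t, show q / t * (z j * z k) = q * z j * z k / t by ring, div_mul_div_comm]
      generalize poch (q * z j * z k) q = X at h3
      rw [show (1 - z j * z k) * X * poch (q * z j * z k / t) q =
        (1 - z j * z k) * poch (q * z j * z k / t) q * X by ring,
        hcancel _ _ _ _ X h3]
      congr 1 <;> ring
    · rw [hs h]
      simp only [mul_zero, zero_mul, zero_div, poch_zero_left, sub_zero, mul_one, one_mul]
  have hsingle : ∀ j, (∏ r, poch2 (0 * (z j)⁻¹) 0 q *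
        poch2 (q / T r * zeroPow (1 + ζ - α r) * z j) 0 q) *
        (poch (0 * (z j * z j)⁻¹) 0 * poch (zeroPow (1 + 2 * ζ) * (z j * z j)) 0) *
        (theta (v * z j) q * theta (q / (t ^ (n - 1) * v * T 0 * T 1) * z j) q) /
      (∏ r, poch2 (T r * zeroPow (if r = 0 ∨ r = 1 then 1 + 2 * ζ else α r + ζ) * z j) 0 q *
        poch2 (T r * zeroPow (α r - ζ) * (z j)⁻¹) 0 q) =
      (∏ r with α r = 1 + ζ, poch (q * z j / T r) q) /
        (poch (T 0 / z j) q * poch (T 1 / z j) q * ∏ r with α r = -ζ, poch (T r * z j) q) *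
      (if ζ = -1 / 2 then
        poch (z j ^ 2) q / (poch (T 0 * z j) q * poch (T 1 * z j) q * poch (q * z j ^ 2) q)
      else 1) *
      (theta (v * z j) q * theta (q * z j / (t ^ (n - 1) * v * T 0 * T 1)) q) := by
    intro j
    have h3 := h1 j
    have e1 : ∀ r, poch2 (q / T r * zeroPow (1 + ζ - α r) * z j) 0 q =
        if α r = 1 + ζ then poch (q * z j / T r) q else 1 := fun r => by
      rw [poch2_zero]
      split_ifs with h
      · rw [h, sub_self, zeroPow_zero, mul_one, div_mul_eq_mul_div]
      · rw [zeroPow, if_neg fun h' => h (by linarith), mul_zero, zero_mul, poch_zero_left]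
    have e2 : ∀ r, poch2 (T r * zeroPow (if r = 0 ∨ r = 1 then 1 + 2 * ζ else α r + ζ) * z j) 0 q =
        (if α r = -ζ then poch (T r * z j) q else 1) * if r = 0 ∨ r = 1 then
          (if ζ = -1 / 2 then poch (T r * z j) q else 1) else 1 := fun r => by
      rw [poch2_zero]
      by_cases hr : r = 0 ∨ r = 1
      · have hr' : α r = ζ := by rcases hr with rfl | rfl; exacts [hα.zero, hα.one]
        rw [if_pos hr, if_pos hr, if_neg (by rw [hr']; linarith), one_mul]
        split_ifs with h
        · rw [hs' h, mul_one]
        · rw [hs h, mul_zero, zero_mul, poch_zero_left]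
      · rw [if_neg hr, if_neg hr, mul_one]
        split_ifs with h
        · rw [h, neg_add_cancel, zeroPow_zero, mul_one]
        · rw [zeroPow, if_neg fun h' => h (by linarith), mul_zero, zero_mul, poch_zero_left]
    have e3 : ∀ r, poch2 (T r * zeroPow (α r - ζ) * (z j)⁻¹) 0 q =
        if r = 0 ∨ r = 1 then poch (T r / z j) q else 1 := fun r => by
      rw [poch2_zero]
      split_ifs with hr
      · have hr' : α r = ζ := by rcases hr with rfl | rfl; exacts [hα.zero, hα.one]
        rw [hr', sub_self, zeroPow_zero, mul_one, div_eq_mul_inv]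
      · push Not at hr
        rw [zeroPow_of_pos (by linarith [hα.mem r hr.1 hr.2]), mul_zero, zero_mul, poch_zero_left]
    simp only [e1, e2, e3, zero_mul, poch2_zero_left, poch_zero_left, one_mul,
      Finset.prod_mul_distrib]
    rw [prod_ite_zero_one (fun r => poch (T r / z j) q),
      prod_ite_zero_one (fun r => if ζ = -1 / 2 then poch (T r * z j) q else 1),
      ← Finset.prod_filter, ← Finset.prod_filter, div_mul_eq_mul_div q, poch_zero_right]
    split_ifs with h
    · rw [sq] at h3
      rw [hs' h, one_mul, poch_eq_mul (z j ^ 2) hq, sq]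
      generalize poch (q * (z j * z j)) q = X at h3
      rw [div_mul_div_comm, hcancel _ _ _ _ X h3, div_mul_eq_mul_div]
      congr 1
      ring
    · rw [hs h, zero_mul, sub_zero, mul_one, mul_one, mul_one, mul_one, div_mul_eq_mul_div]
      congr 1; ring
  unfold Params.num Params.den
  simp only [limitParams, Params.weyl]
  have hdd : ∀ f g : Fin n → Fin n → ℂ, (∏ j, ∏ k ∈ Finset.Ioi j, f j k) /
      (∏ j, ∏ k ∈ Finset.Ioi j, g j k) = ∏ j, ∏ k ∈ Finset.Ioi j, f j k / g j k := fun f g => by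
    simp only [Finset.prod_div_distrib]
  rw [mul_div_mul_comm, hdd, ← Finset.prod_div_distrib,
    Finset.prod_congr rfl fun j _ => Finset.prod_congr rfl (hpair j),
    Finset.prod_congr rfl fun j _ => hsingle j, limitIntegrand]

lemma integralPow_limitIntegrand (hα : IsExponents m α ζ) (hq : ‖q‖ < 1) (C : Contour) :
    C.integralPow n (limitIntegrand n m T t q α ζ v) =
      C.integralPow n fun z =>
        (limitParams n m T t q α ζ v).num z / (limitParams n m T t q α ζ v).den z := by
  have hQ : ({x : ℂ | ∃ j : ℕ, x = (q * q ^ j)⁻¹} ∪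
      {x : ℂ | ∃ j : ℕ, x ^ 2 = (q * q ^ j)⁻¹}).Countable := by
    refine Countable.union ?_ ?_
    · refine (countable_range fun j : ℕ => (q * q ^ j)⁻¹).mono ?_
      rintro x ⟨j, rfl⟩
      exact ⟨j, rfl⟩
    · rw [show {x : ℂ | ∃ j : ℕ, x ^ 2 = (q * q ^ j)⁻¹} = ⋃ j : ℕ, {x | x ^ 2 = (q * q ^ j)⁻¹} by
        ext; simp]
      exact countable_iUnion fun j => (finite_setOf_sq_eq _).countable
  refine C.integralPow_congr hQ fun z _ h2 h3 => (limitParams_num_div_den hα hq (fun j => ?_)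
    fun j k hjk => ?_).symm
  · refine (poch_ne_zero_iff hq).2 fun i hi => h2 j (Or.inr ⟨i, ?_⟩)
    exact eq_inv_of_mul_eq_one_left (by rw [← hi]; ring)
  · refine (poch_ne_zero_iff hq).2 fun i hi => (h3 j k hjk).2 (Or.inl ⟨i, ?_⟩)
    exact eq_inv_of_mul_eq_one_left (by rw [← hi]; ring)

end

/-! ### Building contours -/

namespace Contour

/-- The sum of two cycles. -/
def add (C D : Contour) : Contour where
  size := C.size + D.size
  mult := Fin.append C.mult D.mult
  path := Fin.append C.path D.path
  contDiff i := by
    refine Fin.addCases (fun i => ?_) (fun i => ?_) i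
    · rw [Fin.append_left]; exact C.contDiff i
    · rw [Fin.append_right]; exact D.contDiff i
  closed i := by
    refine Fin.addCases (fun i => ?_) (fun i => ?_) i
    · rw [Fin.append_left]; exact C.closed i
    · rw [Fin.append_right]; exact D.closed i
  ne_zero i := by
    refine Fin.addCases (fun i => ?_) (fun i => ?_) i
    · rw [Fin.append_left]; exact C.ne_zero i
    · rw [Fin.append_right]; exact D.ne_zero i

lemma add_support (C D : Contour) : (C.add D).support = C.support ∪ D.support := by
  ext w
  simp only [support, mem_union, mem_iUnion]
  change (∃ i : Fin (C.size + D.size), w ∈ Fin.append C.path D.path i '' Icc 0 1) ↔ _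
  constructor
  · rintro ⟨i, hi⟩
    revert hi
    refine Fin.addCases (fun i hi => ?_) (fun i hi => ?_) i
    · rw [Fin.append_left] at hi; exact Or.inl ⟨i, hi⟩
    · rw [Fin.append_right] at hi; exact Or.inr ⟨i, hi⟩
  · rintro (⟨i, hi⟩ | ⟨i, hi⟩)
    · exact ⟨Fin.castAdd _ i, by rwa [Fin.append_left]⟩
    · exact ⟨Fin.natAdd _ i, by rwa [Fin.append_right]⟩

lemma add_integral (C D : Contour) (f : ℂ → ℂ) :
    (C.add D).integral f = C.integral f + D.integral f := by
  change (∑ i : Fin (C.size + D.size), ((Fin.append C.mult D.mult i : ℤ) : ℂ) *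
    ∫ x in (0 : ℝ)..1, f (Fin.append C.path D.path i x) * deriv (Fin.append C.path D.path i) x) = _
  rw [Fin.sum_univ_add]
  simp only [Fin.append_left, Fin.append_right, integral]

lemma add_index (C D : Contour) (w : ℂ) : (C.add D).index w = C.index w + D.index w := by
  rw [index, add_integral, mul_add, index, index]

/-- The image of a cycle under inversion, with reversed orientation. The curves are required to avoid
the origin also outside the parameter interval `[0, 1]`, so that their inverses are smooth. -/
def invert (C : Contour) (h : ∀ i x, C.path i x ≠ 0) : Contour where
  size := C.size
  mult i := -C.mult i
  path i x := (C.path i x)⁻¹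
  contDiff i := (C.contDiff i).inv (h i)
  closed i := by rw [C.closed i]
  ne_zero i x _ := inv_ne_zero (h i x)

lemma mem_invert_support (C : Contour) (h : ∀ i x, C.path i x ≠ 0) {w : ℂ} :
    w ∈ (C.invert h).support ↔ w⁻¹ ∈ C.support := by
  simp only [support, mem_iUnion, invert, mem_image]
  refine exists_congr fun i => exists_congr fun x => and_congr_right fun _ => ?_
  rw [inv_eq_iff_eq_inv]

lemma invert_integral (C : Contour) (h : ∀ i x, C.path i x ≠ 0) (f : ℂ → ℂ) :
    (C.invert h).integral f = C.integral fun z => f z⁻¹ / z ^ 2 := by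
  change (∑ i : Fin C.size, ((-C.mult i : ℤ) : ℂ) * ∫ x in (0 : ℝ)..1, f (C.path i x)⁻¹ *
    deriv (fun x => (C.path i x)⁻¹) x) = _
  unfold integral
  refine Finset.sum_congr rfl fun i _ => ?_
  rw [Int.cast_neg, neg_mul, ← mul_neg, ← intervalIntegral.integral_neg]
  congr 1
  refine intervalIntegral.integral_congr fun x _ => ?_
  have hd : HasDerivAt (C.path i) (deriv (C.path i) x) x :=
    ((C.contDiff i).differentiable one_ne_zero x).hasDerivAt
  simp only [(hd.fun_inv (h i x)).deriv]
  ring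

lemma invert_index_zero (C : Contour) (h : ∀ i x, C.path i x ≠ 0) :
    (C.invert h).index 0 = C.index 0 := by
  rw [index, index, invert_integral]
  congr 2
  funext z
  rcases eq_or_ne z 0 with rfl | hz
  · simp
  · rw [sub_zero, sub_zero, inv_inv]; field_simp

lemma invert_index (C : Contour) (h : ∀ i x, C.path i x ≠ 0) {w : ℂ} (hw0 : w ≠ 0) (hw : w⁻¹ ∉ C.support) :
    (C.invert h).index w = C.index 0 - C.index w⁻¹ := by
  have hne : ∀ z ∈ C.support, z - w⁻¹ ≠ 0 := fun z hz h => hw (by rwa [← sub_eq_zero.1 h])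
  have hint : ∀ {u}, u ∉ C.support → ∀ i, IntervalIntegrable
      (fun x => (C.path i x - u)⁻¹ * deriv (C.path i) x) volume 0 1 := fun {u} hu i => by
    refine ContinuousOn.intervalIntegrable ?_
    rw [uIcc_of_le zero_le_one]
    refine ContinuousOn.mul (ContinuousOn.inv₀ ((C.contDiff i).continuous.continuousOn.sub
      continuousOn_const) fun x hx h0 => hu ?_) (C.continuous_deriv_path i).continuousOn
    rw [← sub_eq_zero.1 h0]
    exact C.path_mem_support i hx
  rw [index, index, index, invert_integral, ← mul_sub]
  congr 1
  unfold integral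
  rw [← Finset.sum_sub_distrib]
  refine Finset.sum_congr rfl fun i _ => ?_
  rw [← mul_sub, ← intervalIntegral.integral_sub (hint C.zero_notMem_support i) (hint hw i)]
  congr 1
  refine intervalIntegral.integral_congr fun x hx => ?_
  rw [uIcc_of_le zero_le_one] at hx
  have h1 := h i x
  have h2 := hne _ (C.path_mem_support i hx)
  simp only [← sub_mul, sub_zero]
  congr 1
  generalize C.path i x = z at h1 h2
  have h3 : z⁻¹ - w ≠ 0 := fun h3 => h2 (by rw [← sub_eq_zero.1 h3, inv_inv, sub_self])
  have h4 : 1 - z * w ≠ 0 := fun h4 => h3 (by field_simp; rw [h4, mul_zero])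
  have h5 : z * w - 1 ≠ 0 := fun h5 => h4 (by rw [← neg_sub, h5, neg_zero])
  rw [show z⁻¹ - w = (1 - z * w) / z by field_simp, show z - w⁻¹ = (z * w - 1) / w by field_simp]
  field_simp
  ring

lemma inversionInvariant_add_invert (C : Contour) (h : ∀ i x, C.path i x ≠ 0) :
    (C.add (C.invert h)).InversionInvariant := by
  refine ⟨fun w hw => ?_, fun f _ => ?_⟩
  · rw [add_support, mem_union, mem_invert_support] at hw ⊢
    rw [inv_inv]
    exact hw.symm
  · have e : ∀ g : ℂ → ℂ, (C.invert h).integral (fun z => g z⁻¹ / z) =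
        C.integral (fun z => g z / z) := fun g => by
      rw [invert_integral]
      congr 1
      funext z
      rcases eq_or_ne z 0 with rfl | hz
      · simp
      · rw [inv_inv]; field_simp
    rw [add_integral, add_integral, e, ← e fun z => f z⁻¹]
    simp only [inv_inv, add_comm]

lemma InversionInvariant.add {C D : Contour} (hC : C.InversionInvariant)
    (hD : D.InversionInvariant) : (C.add D).InversionInvariant := by
  have hs : ∀ {w}, w ∈ (C.add D).support ↔ w ∈ C.support ∨ w ∈ D.support := by
    simp [add_support]
  refine ⟨fun w hw => hs.2 ((hs.1 hw).imp (hC.1 w) (hD.1 w)), fun f hf => ?_⟩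
  rw [add_support] at hf
  rw [add_integral, add_integral, hC.2 f (hf.mono subset_union_left),
    hD.2 f (hf.mono subset_union_right)]

/-! ### Small circles -/

lemma circleMap_ne_zero_of_lt {a : ℂ} {δ : ℝ} (hδ : 0 < δ) (ha : δ < ‖a‖) (θ : ℝ) :
    circleMap a δ θ ≠ 0 := fun h => by
  have h1 : ‖circleMap a δ θ - a‖ = δ := by
    rw [← dist_eq_norm]; exact circleMap_mem_sphere _ hδ.le _
  rw [h, zero_sub, norm_neg] at h1
  exact ha.ne' h1

/-- The circles of radius `δ` about finitely many points. -/
def circles {k : ℕ} (a : Fin k → ℂ) (δ : ℝ) (hδ : 0 < δ) (ha : ∀ i, δ < ‖a i‖) : Contour where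
  size := k
  mult _ := 1
  path i x := circleMap (a i) δ (2 * Real.pi * x)
  contDiff i := (contDiff_circleMap (a i) δ).comp (contDiff_const.mul contDiff_id)
  closed i := by
    have := periodic_circleMap (a i) δ 0
    rw [mul_zero, mul_one, ← this, zero_add]
  ne_zero i x _ := circleMap_ne_zero_of_lt hδ (ha i) _

section circles

variable {k : ℕ} {a : Fin k → ℂ} {δ : ℝ} {hδ : 0 < δ} {ha : ∀ i, δ < ‖a i‖}

lemma circles_path_ne_zero (i : Fin (circles a δ hδ ha).size) (x : ℝ) :
    (circles a δ hδ ha).path i x ≠ 0 := circleMap_ne_zero_of_lt hδ (ha i) _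

lemma exists_of_mem_circles_support {w : ℂ} (hw : w ∈ (circles a δ hδ ha).support) :
    ∃ i, ‖w - a i‖ = δ := by
  obtain ⟨i, x, -, rfl⟩ := mem_iUnion.1 hw
  exact ⟨i, by rw [← dist_eq_norm]; exact circleMap_mem_sphere _ hδ.le _⟩

lemma circles_index {w : ℂ} (hw : ∀ i, ‖w - a i‖ ≠ δ) :
    (circles a δ hδ ha).index w = ∑ i, if ‖w - a i‖ < δ then 1 else 0 := by
  have h2π : (2 * Real.pi * Complex.I : ℂ) ≠ 0 := Complex.two_pi_I_ne_zero
  change (2 * Real.pi * Complex.I : ℂ)⁻¹ * (∑ i : Fin k, ((1 : ℤ) : ℂ) * ∫ x in (0 : ℝ)..1,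
    (circleMap (a i) δ (2 * Real.pi * x) - w)⁻¹ *
      deriv (fun x => circleMap (a i) δ (2 * Real.pi * x)) x) = _
  rw [Finset.mul_sum]
  refine Finset.sum_congr rfl fun i _ => ?_
  have e : (∫ x in (0 : ℝ)..1, (circleMap (a i) δ (2 * Real.pi * x) - w)⁻¹ *
      deriv (fun x => circleMap (a i) δ (2 * Real.pi * x)) x) =
      ∮ z in C(a i, δ), (z - w)⁻¹ := by
    have h1 : ∀ x : ℝ, deriv (fun x : ℝ => circleMap (a i) δ (2 * Real.pi * x)) x =
        ((2 * Real.pi : ℝ) : ℂ) * deriv (circleMap (a i) δ) (2 * Real.pi * x) := fun x => by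
      have h2 : HasDerivAt (fun x : ℝ => 2 * Real.pi * x) (2 * Real.pi * 1) x :=
        (hasDerivAt_id x).const_mul _
      have h3 := (hasDerivAt_circleMap (a i) δ (2 * Real.pi * x)).scomp x h2
      rw [mul_one] at h3
      rw [(hasDerivAt_circleMap _ _ _).deriv]
      exact h3.deriv
    simp only [h1]
    rw [circleIntegral]
    have := intervalIntegral.smul_integral_comp_mul_left (a := 0) (b := 1)
      (fun θ => deriv (circleMap (a i) δ) θ • (circleMap (a i) δ θ - w)⁻¹) (2 * Real.pi)
    rw [mul_zero, mul_one] at this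
    rw [← this, ← intervalIntegral.integral_smul]
    refine intervalIntegral.integral_congr fun x _ => ?_
    simp only [smul_eq_mul, Complex.real_smul]
    ring
  rw [e, Int.cast_one, one_mul]
  split_ifs with h
  · rw [circleIntegral.integral_sub_inv_of_mem_ball (by rwa [Metric.mem_ball, dist_eq_norm]),
      inv_mul_cancel₀ h2π]
  · rw [Complex.circleIntegral_eq_zero_of_differentiable_on_off_countable hδ.le countable_empty,
      mul_zero]
    · refine ContinuousOn.inv₀ (by fun_prop) fun z hz hzw => ?_
      rw [Metric.mem_closedBall, dist_eq_norm, sub_eq_zero.1 hzw] at hz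
      exact h (lt_of_le_of_ne hz (hw i))
    · intro z hz
      refine DifferentiableAt.inv (by fun_prop) fun hzw => ?_
      rw [sdiff_empty, Metric.mem_ball, dist_eq_norm, sub_eq_zero.1 hzw] at hz
      exact h hz

end circles

/-! ### A family of self-inverse curves -/

/-- The function `log ‖z‖ - ε sin (arg z)`. -/
def wave (ε : ℝ) (z : ℂ) : ℝ := Real.log ‖z‖ - ε * (z.im / ‖z‖)

lemma wave_inv (ε : ℝ) (z : ℂ) : wave ε z⁻¹ = -wave ε z := by
  rcases eq_or_ne z 0 with rfl | hz
  · simp [wave]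
  have : ‖z‖ ≠ 0 := norm_ne_zero_iff.2 hz
  rw [wave, wave, norm_inv, Real.log_inv, Complex.inv_im, Complex.normSq_eq_norm_sq]
  field_simp
  ring

lemma wave_real_mul (ε : ℝ) {r : ℝ} (hr : 0 < r) {z : ℂ} (hz : z ≠ 0) :
    wave ε (r * z) = Real.log r + wave ε z := by
  have : ‖z‖ ≠ 0 := norm_ne_zero_iff.2 hz
  rw [wave, wave, norm_mul, Complex.norm_real, Real.norm_of_nonneg hr.le, Complex.im_ofReal_mul,
    Real.log_mul hr.ne' this]
  field_simp
  ring

lemma continuousAt_wave (ε : ℝ) {z : ℂ} (hz : z ≠ 0) : ContinuousAt (wave ε) z := by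
  have h1 : ‖z‖ ≠ 0 := norm_ne_zero_iff.2 hz
  exact (continuous_norm.continuousAt.log h1).sub (continuousAt_const.mul
    (Complex.continuous_im.continuousAt.div continuous_norm.continuousAt h1))

lemma wave_mul_lt {ε : ℝ} (hε : 0 ≤ ε) {c z : ℂ} (hc : c ≠ 0) (hz : z ≠ 0)
    (h : Real.log ‖c‖ + 2 * ε < 0) : wave ε (c * z) < wave ε z := by
  have h1 : ∀ w : ℂ, |w.im / ‖w‖| ≤ 1 := fun w => by
    rw [abs_div, abs_norm]
    exact div_le_one_of_le₀ (Complex.abs_im_le_norm w) (norm_nonneg w)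
  have h2 := (abs_le.1 (h1 z)).2
  have h3 := (abs_le.1 (h1 (c * z))).1
  rw [wave, wave, norm_mul, Real.log_mul (norm_ne_zero_iff.2 hc) (norm_ne_zero_iff.2 hz)]
  rw [norm_mul] at h3
  nlinarith

/-- The curve `θ ↦ exp (iθ + ε sin θ)`, the zero set of `wave ε`. Inversion maps it to itself. -/
def waveCurve (ε : ℝ) : Contour where
  size := 1
  mult _ := 1
  path _ x := Complex.exp (2 * Real.pi * x * Complex.I + (ε * Real.sin (2 * Real.pi * x) : ℝ))
  contDiff _ := by
    refine ContDiff.cexp (ContDiff.add ?_ ?_)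
    · exact (contDiff_const.mul Complex.ofRealCLM.contDiff).mul contDiff_const
    · exact Complex.ofRealCLM.contDiff.comp
        (contDiff_const.mul (Real.contDiff_sin.comp (contDiff_const.mul contDiff_id)))
  closed _ := by simp [Complex.exp_two_pi_mul_I]
  ne_zero _ _ _ := Complex.exp_ne_zero _

lemma waveCurve_path_ne_zero (ε : ℝ) (i) (x : ℝ) : (waveCurve ε).path i x ≠ 0 :=
  Complex.exp_ne_zero _

lemma wave_eq_zero_of_mem {ε : ℝ} {w : ℂ} (hw : w ∈ (waveCurve ε).support) : wave ε w = 0 := by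
  obtain ⟨i, x, -, rfl⟩ := mem_iUnion.1 hw
  change wave ε (Complex.exp (2 * Real.pi * x * Complex.I + (ε * Real.sin (2 * Real.pi * x) : ℝ))) = 0
  rw [wave, Complex.norm_exp, Complex.exp_im, Real.log_exp]
  have e1 : (2 * Real.pi * x * Complex.I + (ε * Real.sin (2 * Real.pi * x) : ℝ) : ℂ).re =
      ε * Real.sin (2 * Real.pi * x) := by
    rw [Complex.add_re, Complex.ofReal_re]
    simp
  have e2 : (2 * Real.pi * x * Complex.I + (ε * Real.sin (2 * Real.pi * x) : ℝ) : ℂ).im =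
      2 * Real.pi * x := by
    rw [Complex.add_im, Complex.ofReal_im]
    simp
  rw [e1, e2, mul_div_cancel_left₀ _ (Real.exp_ne_zero _), sub_self]

lemma waveCurve_deriv (ε x : ℝ) (i) : deriv ((waveCurve ε).path i) x = (waveCurve ε).path i x *
    (2 * Real.pi * (Complex.I + (ε * Real.cos (2 * Real.pi * x) : ℝ))) := by
  have h2 : HasDerivAt (fun x : ℝ => 2 * Real.pi * x) (2 * Real.pi * 1) x :=
    (hasDerivAt_id x).const_mul _
  have h3 : HasDerivAt (fun x : ℝ => ((ε * Real.sin (2 * Real.pi * x) : ℝ) : ℂ))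
      ((ε * (Real.cos (2 * Real.pi * x) * (2 * Real.pi * 1)) : ℝ) : ℂ) x :=
    HasDerivAt.ofReal_comp (h2.sin.const_mul ε)
  have h4 : HasDerivAt (fun x : ℝ => (2 * Real.pi * x * Complex.I : ℂ))
      (2 * Real.pi * 1 * Complex.I) x :=
    ((Complex.ofRealCLM.hasDerivAt (x := x)).const_mul (2 * Real.pi : ℂ)).mul_const Complex.I
  refine ((h4.add h3).cexp.deriv).trans ?_
  change _ = Complex.exp (2 * Real.pi * x * Complex.I + (ε * Real.sin (2 * Real.pi * x) : ℝ)) * _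
  congr 1
  push_cast
  ring

lemma waveCurve_inversionInvariant (ε : ℝ) : (waveCurve ε).InversionInvariant := by
  have hinv : ∀ i x, (waveCurve ε).path i (1 - x) = ((waveCurve ε).path i x)⁻¹ := fun i x => by
    change Complex.exp (2 * Real.pi * ((1 - x : ℝ) : ℂ) * Complex.I +
      (ε * Real.sin (2 * Real.pi * (1 - x)) : ℝ)) =
      (Complex.exp (2 * Real.pi * x * Complex.I + (ε * Real.sin (2 * Real.pi * x) : ℝ)))⁻¹
    rw [← Complex.exp_neg, mul_sub, mul_one, Real.sin_two_pi_sub]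
    refine Eq.trans ?_ (Complex.exp_periodic _)
    congr 1
    push_cast
    ring
  refine ⟨fun w hw => ?_, fun f _ => ?_⟩
  · obtain ⟨i, x, hx, rfl⟩ := mem_iUnion.1 hw
    exact mem_iUnion.2 ⟨i, 1 - x, ⟨by linarith [hx.2], by linarith [hx.1]⟩, hinv i x⟩
  · unfold integral
    refine Finset.sum_congr rfl fun i _ => ?_
    congr 1
    have e : ∀ g : ℂ → ℂ, ∀ x, g ((waveCurve ε).path i x) / (waveCurve ε).path i x *
        deriv ((waveCurve ε).path i) x = g ((waveCurve ε).path i x) *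
          (2 * Real.pi * (Complex.I + (ε * Real.cos (2 * Real.pi * x) : ℝ))) := fun g x => by
      rw [waveCurve_deriv, ← mul_assoc, div_mul_cancel₀ _ (waveCurve_path_ne_zero ε i x)]
    have e1 := fun x => e (fun z => f z⁻¹) x
    simp only [e1, e f]
    have := intervalIntegral.integral_comp_sub_left (a := 0) (b := 1)
      (fun x : ℝ => f ((waveCurve ε).path i x) *
        (2 * Real.pi * (Complex.I + (ε * Real.cos (2 * Real.pi * x) : ℝ)))) 1
    rw [sub_self, sub_zero] at this
    rw [← this]
    refine intervalIntegral.integral_congr fun x _ => ?_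
    simp only [hinv, mul_sub, mul_one, Real.cos_two_pi_sub]

lemma waveCurve_index_zero (ε : ℝ) : (waveCurve ε).index 0 = 1 := by
  have e : ∀ i x, ((waveCurve ε).path i x - 0)⁻¹ * deriv ((waveCurve ε).path i) x =
      2 * Real.pi * (Complex.I + (ε * Real.cos (2 * Real.pi * x) : ℝ)) := fun i x => by
    rw [waveCurve_deriv, sub_zero, inv_mul_cancel_left₀ (waveCurve_path_ne_zero ε i x)]
  have hd : ∀ x : ℝ, HasDerivAt (fun x : ℝ => (2 * Real.pi * x * Complex.I : ℂ) +
      (ε * Real.sin (2 * Real.pi * x) : ℝ))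
      (2 * Real.pi * (Complex.I + (ε * Real.cos (2 * Real.pi * x) : ℝ))) x := fun x => by
    have h2 : HasDerivAt (fun x : ℝ => 2 * Real.pi * x) (2 * Real.pi * 1) x :=
      (hasDerivAt_id x).const_mul _
    have h3 : HasDerivAt (fun x : ℝ => ((ε * Real.sin (2 * Real.pi * x) : ℝ) : ℂ))
        ((ε * (Real.cos (2 * Real.pi * x) * (2 * Real.pi * 1)) : ℝ) : ℂ) x :=
      HasDerivAt.ofReal_comp (h2.sin.const_mul ε)
    have h4 : HasDerivAt (fun x : ℝ => (2 * Real.pi * x * Complex.I : ℂ))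
        (2 * Real.pi * 1 * Complex.I) x :=
      ((Complex.ofRealCLM.hasDerivAt (x := x)).const_mul (2 * Real.pi : ℂ)).mul_const Complex.I
    refine (h4.add h3).congr_deriv ?_
    push_cast
    ring
  rw [index, integral]
  simp only [e]
  change (2 * Real.pi * Complex.I : ℂ)⁻¹ * (∑ i : Fin 1, ((1 : ℤ) : ℂ) * ∫ x in (0 : ℝ)..1,
    2 * Real.pi * (Complex.I + (ε * Real.cos (2 * Real.pi * x) : ℝ))) = 1
  rw [Fin.sum_univ_one, Int.cast_one, one_mul, intervalIntegral.integral_eq_sub_of_hasDerivAt (fun x _ => hd x)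
    (Continuous.intervalIntegrable (by fun_prop) _ _)]
  simp only [Complex.ofReal_one, Complex.ofReal_zero, mul_one, mul_zero, zero_mul, Real.sin_two_pi,
    Real.sin_zero, add_zero, sub_zero]
  exact inv_mul_cancel₀ Complex.two_pi_I_ne_zero

lemma waveCurve_index_of_neg {ε : ℝ} {w : ℂ} (hw : wave ε w < 0) : (waveCurve ε).index w = 1 := by
  rcases eq_or_ne w 0 with rfl | hw0
  · exact waveCurve_index_zero ε
  rw [← waveCurve_index_zero ε]
  refine (waveCurve ε).index_eq_of_isPreconnected (s := (fun r : ℝ => (r : ℂ) * w) '' Icc 0 1)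
    (isPreconnected_Icc.image _ (by fun_prop)) ?_ ⟨1, ⟨zero_le_one, le_rfl⟩, by simp⟩
    ⟨0, ⟨le_rfl, zero_le_one⟩, by simp⟩
  rintro _ ⟨r, hr, rfl⟩ hmem
  rcases hr.1.eq_or_lt with rfl | hr0
  · exact (waveCurve ε).zero_notMem_support (by simpa using hmem)
  · have := wave_eq_zero_of_mem hmem
    rw [wave_real_mul ε hr0 hw0] at this
    linarith [Real.log_nonpos hr0.le hr.2]

lemma waveCurve_index_of_pos {ε : ℝ} {w : ℂ} (hw : 0 < wave ε w) : (waveCurve ε).index w = 0 := by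
  have hw0 : w ≠ 0 := fun h => by simp [h, wave] at hw
  obtain ⟨R, hR0, hR⟩ := (waveCurve ε).exists_index_eq_zero
  have hpos : 0 < ‖w‖ := norm_pos_iff.2 hw0
  let s : ℝ := max 1 (2 * R / ‖w‖)
  have hs : (1 : ℝ) ≤ s := le_max_left _ _
  have h2 := (hR ((s : ℂ) * w) (by
    rw [norm_mul, Complex.norm_real, Real.norm_of_nonneg (by positivity)]
    calc R < 2 * R / ‖w‖ * ‖w‖ := by rw [div_mul_cancel₀ _ hpos.ne']; linarith
      _ ≤ _ := by gcongr; exact le_max_right _ _)).2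
  rw [← h2]
  refine (waveCurve ε).index_eq_of_isPreconnected (s := (fun r : ℝ => (r : ℂ) * w) '' Icc 1 s)
    (isPreconnected_Icc.image _ (by fun_prop)) ?_ ⟨1, ⟨le_rfl, hs⟩, by simp⟩
    ⟨s, ⟨hs, le_rfl⟩, rfl⟩
  rintro _ ⟨r, hr, rfl⟩ hmem
  have := wave_eq_zero_of_mem hmem
  rw [wave_real_mul ε (zero_lt_one.trans_le hr.1) hw0] at this
  linarith [Real.log_nonneg hr.1]

end Contour

/-! ### Existence of contours -/

lemma isOpen_wave_pos (ε : ℝ) : IsOpen {x : ℂ | 0 < Contour.wave ε x} := by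
  refine isOpen_iff_mem_nhds.2 fun x hx => ?_
  have hx0 : x ≠ 0 := fun h => by simp [h, Contour.wave] at hx
  exact (Contour.continuousAt_wave ε hx0).eventually_const_lt hx

lemma isOpen_wave_neg {ε : ℝ} (hε : 0 ≤ ε) : IsOpen {x : ℂ | x = 0 ∨ Contour.wave ε x < 0} := by
  refine isOpen_iff_mem_nhds.2 fun x hx => ?_
  rcases eq_or_ne x 0 with rfl | hx0
  · filter_upwards [Metric.ball_mem_nhds (0 : ℂ) (Real.exp_pos (-ε))] with x hx
    rw [mem_ball_zero_iff] at hx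
    rcases eq_or_ne x 0 with rfl | hx0
    · exact Or.inl rfl
    · refine Or.inr ?_
      have h1 : |x.im / ‖x‖| ≤ 1 := by
        rw [abs_div, abs_norm]
        exact div_le_one_of_le₀ (Complex.abs_im_le_norm x) (norm_nonneg x)
      have h2 := (Real.log_lt_iff_lt_exp (norm_pos_iff.2 hx0)).2 hx
      rw [Contour.wave]
      nlinarith [(abs_le.1 h1).1]
  · have h1 : Contour.wave ε x < 0 := hx.resolve_left hx0
    filter_upwards [(Contour.continuousAt_wave ε hx0).eventually_lt_const h1] with y hy
    exact Or.inr hy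

/-- A set of points whose products are never `1`, accumulating only at `0`, avoids one of the curves
`wave ε = 0` with `ε` small. -/
lemma exists_wave_ne_zero {ι : Type*} [Countable ι] {f : ι → ℂ} (h0 : ∀ i, f i ≠ 0)
    (h1 : ∀ i, f i * f i ≠ 1) {ρ : ℝ} (hρ : 0 < ρ) :
    ∃ ε, 0 < ε ∧ ε < ρ ∧ ∀ i, Contour.wave ε (f i) ≠ 0 := by
  have hbad : (⋃ i, {ε : ℝ | Contour.wave ε (f i) = 0}).Countable := by
    refine countable_iUnion fun i => Set.Subsingleton.countable fun ε hε ε' hε' => ?_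
    have hn : ‖f i‖ ≠ 0 := norm_ne_zero_iff.2 (h0 i)
    simp only [Contour.wave, mem_ofPred_eq] at hε hε'
    have hs : (f i).im / ‖f i‖ ≠ 0 := fun hs => by
      rw [hs, mul_zero, sub_zero] at hε
      have him : (f i).im = 0 := by simpa [hn] using hs
      have hnorm : ‖f i‖ = 1 := by
        rcases Real.log_eq_zero.1 hε with h | h | h
        · exact absurd h hn
        · exact h
        · linarith [norm_nonneg (f i)]
      have hsq := Complex.sq_norm (f i)
      rw [hnorm, Complex.normSq_apply, him] at hsq
      exact h1 i (Complex.ext (by simp [him]; linarith) (by simp [him]))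
    exact mul_right_cancel₀ hs (by linarith)
  obtain ⟨ε, hε, hε'⟩ := (hbad.dense_compl ℝ).inter_open_nonempty (Ioo 0 ρ) isOpen_Ioo
    (nonempty_Ioo.2 hρ)
  exact ⟨ε, hε.1, hε.2, fun i hi => hε' (mem_iUnion.2 ⟨i, hi⟩)⟩

lemma eventually_closedBall_subset {K U : Set ℂ} (hK : IsCompact K) (hU : IsOpen U) (hKU : K ⊆ U) :
    ∀ᶠ δ in 𝓝[>] (0 : ℝ), ∀ a ∈ K, Metric.closedBall a δ ⊆ U := by
  obtain ⟨δ₀, hδ₀, h⟩ := hK.exists_cthickening_subset_open hU hKU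
  filter_upwards [Ioc_mem_nhdsGT hδ₀] with δ hδ a ha
  exact ((Metric.closedBall_subset_cthickening ha δ).trans
    (Metric.cthickening_mono hδ.2 K)).trans h

/-- Existence of a self-inverse contour containing the values of `f`, excluding their reciprocals,
and containing its multiples by the elements of `S`. It consists of a curve close to the unit circle,
of small circles about the finitely many values of `f` outside this curve, and of the inverses of
these circles. -/
theorem exists_separating_contour {ι : Type*} [Countable ι] {f : ι → ℂ}
    (hf : Tendsto f cofinite (𝓝 0)) (h0 : ∀ i, f i ≠ 0) (h1 : ∀ i j, f i * f j ≠ 1) {S : Set ℂ}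
    {τ : ℝ} (hτ₀ : 0 < τ) (hτ : τ < 1) (hS : ∀ c ∈ S, c ≠ 0 ∧ ‖c‖ ≤ τ ∧ ∀ i, ∃ j, f j = c * f i) :
    ∃ C : Contour, C.InversionInvariant ∧ (∀ i, C.Includes (f i)) ∧ (∀ i, C.Excludes (f i)⁻¹) ∧
      ∀ c ∈ S, C.ContainsScaled c := by
  obtain ⟨ε, hε, hερ, hwave⟩ := exists_wave_ne_zero h0 (fun i => h1 i i)
    (show 0 < -Real.log τ / 2 by linarith [Real.log_neg hτ₀ hτ])
  have hK : IsCompact (insert 0 (range f)) := hf.isCompact_insert_range_of_cofinite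
  have hmul : ∀ c ∈ S, ∀ x : ℂ, x ≠ 0 → Contour.wave ε (c * x) < Contour.wave ε x := fun c hc x hx =>
    Contour.wave_mul_lt hε.le (hS c hc).1 hx (by
      have := Real.log_le_log (norm_pos_iff.2 (hS c hc).1) (hS c hc).2.1
      linarith)
  have hw0 : Contour.wave ε 0 = 0 := by simp [Contour.wave]
  -- the values outside the curve
  let E : Set ℂ := {a | a ∈ range f ∧ 0 < Contour.wave ε a}
  have hE : E.Finite := by
    have h2 := hf.eventually ((isOpen_wave_neg hε.le).mem_nhds (Or.inl rfl : (0 : ℂ) ∈ _))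
    refine (Set.Finite.image f (eventually_cofinite.1 h2)).subset ?_
    rintro _ ⟨⟨i, rfl⟩, hi⟩
    exact ⟨i, fun h => h.elim (h0 i) fun h => lt_asymm h hi, rfl⟩
  -- the choice of the radius
  have hd1 := eventually_closedBall_subset hE.isCompact (isOpen_wave_pos ε) fun a ha => ha.2
  have hd4 := eventually_closedBall_subset (hK.diff (isOpen_wave_pos ε)) (isOpen_wave_neg hε.le) (by
    rintro x ⟨rfl | ⟨i, rfl⟩, hx⟩
    · exact Or.inl rfl
    · exact Or.inr (lt_of_le_of_ne (not_lt.1 hx) (hwave i)))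
  have hd3 : ∀ᶠ δ in 𝓝[>] (0 : ℝ), ∀ i j, ∀ y ∈ Metric.closedBall (f i) δ,
      ∀ y' ∈ Metric.closedBall (f j) δ, y * y' ≠ 1 := by
    obtain ⟨δ₀, hδ₀, h⟩ := (hK.prod hK).exists_cthickening_subset_open
      (t := {w : ℂ × ℂ | w.1 * w.2 ≠ 1}) (isOpen_ne_fun (by fun_prop) continuous_const) (by
        rintro ⟨x, y⟩ ⟨hx, hy⟩
        change x * y ≠ 1
        rcases hx with rfl | ⟨i, rfl⟩
        · simp
        · rcases hy with h | ⟨j, h⟩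
          · rw [show y = 0 from h]; simp
          · change f j = y at h; rw [← h]; exact h1 i j)
    filter_upwards [Ioc_mem_nhdsGT hδ₀] with δ hδ i j y hy y' hy'
    have hmem : (f i, f j) ∈ insert 0 (range f) ×ˢ insert 0 (range f) :=
      mk_mem_prod (Or.inr ⟨i, rfl⟩) (Or.inr ⟨j, rfl⟩)
    have hyy : (y, y') ∈ Metric.closedBall (f i, f j) δ := by
      rw [← closedBall_prod_same]
      exact ⟨hy, hy'⟩
    exact h (Metric.cthickening_mono hδ.2 _ (Metric.closedBall_subset_cthickening hmem δ hyy))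
  have hd2 : ∀ᶠ δ in 𝓝[>] (0 : ℝ), ∀ a ∈ E, ∀ i, f i ≠ a → 2 * δ ≤ ‖f i - a‖ := by
    refine (eventually_all_finite hE).2 fun a ha => ?_
    have ha0 : a ≠ 0 := by obtain ⟨⟨i, rfl⟩, -⟩ := ha; exact h0 i
    have hpos : 0 < ‖a‖ / 2 := half_pos (norm_pos_iff.2 ha0)
    have h2 := eventually_cofinite.1 (hf.eventually (Metric.ball_mem_nhds (0 : ℂ) hpos))
    have hWf : (f '' {i | ¬ f i ∈ Metric.ball 0 (‖a‖ / 2)} \ {a}).Finite := (h2.image f).sdiff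
    obtain ⟨r, hr, hball⟩ := Metric.isOpen_iff.1 hWf.isClosed.isOpen_compl a (by simp)
    filter_upwards [Ioc_mem_nhdsGT (show 0 < min (r / 2) (‖a‖ / 4) by positivity)] with δ hδ i hi
    have h3 := (hδ.2.trans (min_le_left _ _))
    have h4 := (hδ.2.trans (min_le_right _ _))
    by_cases hfi : f i ∈ Metric.ball 0 (‖a‖ / 2)
    · rw [mem_ball_zero_iff] at hfi
      have := norm_sub_norm_le a (f i)
      rw [norm_sub_rev] at this
      linarith
    · by_contra! h5
      exact hball (by rw [Metric.mem_ball, dist_eq_norm]; linarith : f i ∈ Metric.ball a r)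
        ⟨⟨i, hfi, rfl⟩, hi⟩
  obtain ⟨δ, hd1, hd2, hd3, hd4, hδ⟩ :=
    (hd1.and (hd2.and (hd3.and (hd4.and self_mem_nhdsWithin)))).exists
  have hδ : 0 < δ := hδ
  have := hE.fintype
  let e := Fintype.equivFin E
  let a : Fin (Fintype.card E) → ℂ := fun i => (e.symm i : ℂ)
  have haE : ∀ i, a i ∈ E := fun i => (e.symm i).2
  have haex : ∀ b ∈ E, ∃ i, a i = b := fun b hb => ⟨e ⟨b, hb⟩, by simp [a]⟩
  have hainj : Function.Injective a := Subtype.val_injective.comp e.symm.injective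
  have hbw : ∀ i, ∀ x, ‖x - a i‖ ≤ δ → 0 < Contour.wave ε x := fun i x hx =>
    hd1 (a i) (haE i) (by rwa [Metric.mem_closedBall, dist_eq_norm])
  have ha : ∀ i, δ < ‖a i‖ := fun i => by
    by_contra! h
    have := hbw i 0 (by rwa [zero_sub, norm_neg])
    rw [hw0] at this
    exact lt_irrefl _ this
  let D := Contour.circles a δ hδ ha
  have hDne : ∀ i x, D.path i x ≠ 0 := Contour.circles_path_ne_zero
  let W := Contour.waveCurve ε
  let C := W.add (D.add (D.invert hDne))
  have hC : C.InversionInvariant :=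
    (Contour.waveCurve_inversionInvariant ε).add (D.inversionInvariant_add_invert hDne)
  have hsupp : ∀ {x}, x ∈ C.support ↔ x ∈ W.support ∨ x ∈ D.support ∨ x⁻¹ ∈ D.support := by
    intro x
    rw [Contour.add_support, Contour.add_support, mem_union, mem_union, Contour.mem_invert_support]
  have hDs : ∀ {x}, (∀ i, ‖x - a i‖ ≠ δ) → x ∉ D.support := fun hx h => by
    obtain ⟨i, hi⟩ := Contour.exists_of_mem_circles_support h
    exact hx i hi
  have hD0 : ∀ {x}, (∀ i, δ < ‖x - a i‖) → D.index x = 0 := fun hx => by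
    rw [Contour.circles_index fun i => (hx i).ne']
    exact Finset.sum_eq_zero fun i _ => if_neg (hx i).not_gt
  have hDzero : ∀ i, δ < ‖0 - a i‖ := fun i => by rw [zero_sub, norm_neg]; exact ha i
  have hCi : ∀ {x : ℂ}, x ≠ 0 → (∀ i, ‖x⁻¹ - a i‖ ≠ δ) →
      C.index x = W.index x + (D.index x - D.index x⁻¹) := fun hx0 hx => by
    rw [Contour.add_index, Contour.add_index, Contour.invert_index _ _ hx0 (hDs hx), hD0 hDzero]
    ring
  -- points inside the curve but not in the inverse discs
  have hin : ∀ x, x = 0 ∨ Contour.wave ε x < 0 → (∀ i, δ < ‖x⁻¹ - a i‖) → C.Includes x := by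
    intro x hx hx'
    have hxa : ∀ i, δ < ‖x - a i‖ := fun i => by
      by_contra! h
      have h2 := hbw i x h
      rcases hx with rfl | hx
      · rw [hw0] at h2; exact lt_irrefl _ h2
      · exact lt_asymm hx h2
    have hxW : x ∉ W.support := fun h => by
      rcases hx with rfl | hx
      · exact W.zero_notMem_support h
      · exact hx.ne (Contour.wave_eq_zero_of_mem h)
    refine ⟨fun h => ?_, ?_⟩
    · rcases hsupp.1 h with h | h | h
      · exact hxW h
      · exact hDs (fun i => (hxa i).ne') h
      · exact hDs (fun i => (hx' i).ne') h
    · rcases eq_or_ne x 0 with rfl | hx0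
      · rw [Contour.add_index, Contour.add_index, Contour.invert_index_zero, hD0 hDzero,
          Contour.waveCurve_index_zero, add_zero, add_zero]
      · rw [hCi hx0 fun i => (hx' i).ne', hD0 hxa, hD0 hx', sub_zero, add_zero,
          Contour.waveCurve_index_of_neg (hx.resolve_left hx0)]
  -- points in the small discs
  have hin' : ∀ x i, ‖x - a i‖ < δ → C.Includes x := by
    intro x i hx
    have hpos := hbw i x hx.le
    have hx0 : x ≠ 0 := fun h => by rw [h, hw0] at hpos; exact lt_irrefl _ hpos
    have hx' : ∀ i, δ < ‖x⁻¹ - a i‖ := fun i => by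
      by_contra! h
      have h2 := hbw i _ h
      rw [Contour.wave_inv] at h2
      linarith
    have hother : ∀ j, j ≠ i → δ < ‖x - a j‖ := fun j hj => by
      by_contra! h
      obtain ⟨⟨k, hk⟩, -⟩ := haE j
      have h2 := hd2 (a i) (haE i) k (by rw [hk]; exact fun h => hj (hainj h))
      rw [hk] at h2
      have h3 := norm_sub_le_norm_sub_add_norm_sub (a j) x (a i)
      rw [norm_sub_rev (a j) x] at h3
      linarith
    have hoff : ∀ j, ‖x - a j‖ ≠ δ := fun j => by
      by_cases hj : j = i
      · rw [hj]; exact hx.ne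
      · exact (hother j hj).ne'
    refine ⟨fun h => ?_, ?_⟩
    · rcases hsupp.1 h with h | h | h
      · exact hpos.ne' (Contour.wave_eq_zero_of_mem h)
      · exact hDs hoff h
      · exact hDs (fun i => (hx' i).ne') h
    · rw [hCi hx0 fun i => (hx' i).ne', hD0 hx', Contour.waveCurve_index_of_pos hpos, zero_add,
        sub_zero, Contour.circles_index hoff, Finset.sum_eq_single i, if_pos hx]
      · exact fun j _ hj => if_neg (hother j hj).not_gt
      · exact fun h => absurd (Finset.mem_univ i) h
  have hC0 : C.index 0 = 1 := (hin 0 (Or.inl rfl) (by rwa [inv_zero])).2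
  have hex : ∀ x, x ≠ 0 → C.Includes x → C.Excludes x⁻¹ := fun x hx0 h =>
    ⟨fun h' => h.1 (hC.inv_mem_support.1 h'), by rw [hC.index_inv hC0 hx0 h.1, h.2, sub_self]⟩
  have hfin : ∀ i, C.Includes (f i) := fun i => by
    by_cases hi : 0 < Contour.wave ε (f i)
    · obtain ⟨k, hk⟩ := haex (f i) ⟨⟨i, rfl⟩, hi⟩
      exact hin' (f i) k (by rw [hk, sub_self, norm_zero]; exact hδ)
    · refine hin _ (Or.inr (lt_of_le_of_ne (not_lt.1 hi) (hwave i))) fun k => ?_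
      by_contra! h
      obtain ⟨⟨l, hl⟩, -⟩ := haE k
      refine hd3 l i (f i)⁻¹ (by rwa [hl, Metric.mem_closedBall, dist_eq_norm]) (f i)
        (Metric.mem_closedBall_self hδ.le) (inv_mul_cancel₀ (h0 i))
  have hscaled : ∀ c ∈ S, ∀ w ∈ C.support, C.Includes (c * w) := by
    intro c hc w hw
    have hc0 := (hS c hc).1
    have hcn : ‖c‖ < 1 := (hS c hc).2.1.trans_lt hτ
    have hw0 : w ≠ 0 := fun h => C.zero_notMem_support (h ▸ hw)
    have hcw : Contour.wave ε (c * w) < Contour.wave ε w := hmul c hc w hw0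
    -- if the reciprocal of `c w` is in a small disc, then `w⁻¹` is in a smaller concentric disc
    have hsmall : ∀ k, ‖(c * w)⁻¹ - a k‖ ≤ δ → ∃ i, ‖w⁻¹ - f i‖ ≤ ‖c‖ * δ := fun k hk => by
      obtain ⟨⟨l, hl⟩, -⟩ := haE k
      obtain ⟨j, hj⟩ := (hS c hc).2.2 l
      refine ⟨j, ?_⟩
      rw [hj, hl, show w⁻¹ - c * a k = c * ((c * w)⁻¹ - a k) by field_simp, norm_mul]
      gcongr
    have hcδ : ‖c‖ * δ < δ := by nlinarith
    rcases hsupp.1 hw with hw | hw | hw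
    · have hww := Contour.wave_eq_zero_of_mem hw
      refine hin _ (Or.inr (by rwa [hww] at hcw)) fun k => ?_
      by_contra! h
      obtain ⟨i, hi⟩ := hsmall k h
      have hne : Contour.wave ε w⁻¹ = 0 := by rw [Contour.wave_inv, hww, neg_zero]
      by_cases hfi : 0 < Contour.wave ε (f i)
      · obtain ⟨k', hk'⟩ := haex (f i) ⟨⟨i, rfl⟩, hfi⟩
        have := hbw k' w⁻¹ (by rw [hk']; linarith)
        rw [hne] at this
        exact lt_irrefl _ this
      · rcases hd4 (f i) ⟨Or.inr ⟨i, rfl⟩, hfi⟩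
          (by rw [Metric.mem_closedBall, dist_eq_norm]; linarith : w⁻¹ ∈ Metric.closedBall (f i) δ)
          with h | h
        · exact inv_ne_zero hw0 h
        · rw [hne] at h; exact lt_irrefl _ h
    · obtain ⟨k, hk⟩ := Contour.exists_of_mem_circles_support hw
      obtain ⟨⟨l, hl⟩, -⟩ := haE k
      obtain ⟨j, hj⟩ := (hS c hc).2.2 l
      have hdist : ‖c * w - f j‖ < δ := by
        rw [hj, hl, ← mul_sub, norm_mul, hk]; exact hcδ
      by_cases hfj : 0 < Contour.wave ε (f j)
      · obtain ⟨k', hk'⟩ := haex (f j) ⟨⟨j, rfl⟩, hfj⟩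
        exact hin' _ k' (by rwa [hk'])
      · have hmem : c * w ∈ Metric.closedBall (f j) δ := by
          rw [Metric.mem_closedBall, dist_eq_norm]; exact hdist.le
        refine hin _ (hd4 (f j) ⟨Or.inr ⟨j, rfl⟩, hfj⟩ hmem) fun k' => ?_
        by_contra! h
        obtain ⟨⟨l', hl'⟩, -⟩ := haE k'
        exact hd3 l' j (c * w)⁻¹ (by rwa [hl', Metric.mem_closedBall, dist_eq_norm]) (c * w) hmem
          (inv_mul_cancel₀ (mul_ne_zero hc0 hw0))
    · obtain ⟨k, hk⟩ := Contour.exists_of_mem_circles_support hw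
      have hpos := hbw k _ hk.le
      rw [Contour.wave_inv] at hpos
      refine hin _ (Or.inr (by linarith)) fun k' => ?_
      by_contra! h
      obtain ⟨i, hi⟩ := hsmall k' h
      by_cases hik : f i = a k
      · rw [hik, hk] at hi
        linarith
      · have h2 := hd2 (a k) (haE k) i hik
        have h3 := norm_sub_le_norm_sub_add_norm_sub (f i) w⁻¹ (a k)
        rw [norm_sub_rev (f i) w⁻¹] at h3
        linarith
  refine ⟨C, hC, hfin, fun i => hex _ (h0 i) (hfin i), fun c hc w hw => ⟨hscaled c hc w hw, ?_⟩⟩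
  have hw0 : w ≠ 0 := fun h => C.zero_notMem_support (h ▸ hw)
  have := hex _ (mul_ne_zero (hS c hc).1 (inv_ne_zero hw0)) (hscaled c hc _ (hC.1 _ hw))
  rwa [mul_inv, inv_inv, mul_comm, ← div_eq_mul_inv] at this

/-- Contours for the elliptic Selberg integral exist for all generic parameters. -/
theorem exists_isContour {m : ℕ} {T : Fin (2 * m + 6) → ℂ} {t p q : ℂ} (hp₀ : p ≠ 0) (hp : ‖p‖ < 1)
    (hq₀ : q ≠ 0) (hq : ‖q‖ < 1) (ht₀ : t ≠ 0) (ht : ‖t‖ < 1) (hT : ∀ r, T r ≠ 0)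
    (hgen : Generic m T t p q) : ∃ C, IsContour m T t p q C := by
  let f : Fin (2 * m + 6) × ℕ × ℕ × ℕ → ℂ := fun x => p ^ x.2.1 * (q ^ x.2.2.1 * t ^ x.2.2.2) * T x.1
  have hsum : Summable fun x => ‖f x‖ := by
    have h1 := (summable_geometric_of_lt_one (norm_nonneg p) hp).mul_of_nonneg
      ((summable_geometric_of_lt_one (norm_nonneg q) hq).mul_of_nonneg
        (summable_geometric_of_lt_one (norm_nonneg t) ht) (fun _ => by positivity)
        fun _ => by positivity) (fun _ => by positivity) (fun _ => by positivity)
    have h2 := (Summable.of_finite (f := fun r => ‖T r‖)).mul_of_nonneg h1 (fun _ => by positivity)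
      fun _ => by positivity
    refine h2.congr fun x => ?_
    simp only [f, norm_mul, norm_pow]
    ring
  obtain ⟨C, h1, h2, h3, h4⟩ := exists_separating_contour (f := f)
    (tendsto_zero_iff_norm_tendsto_zero.2 hsum.tendsto_cofinite_zero)
    (fun x => by have := hT x.1; simp only [f]; positivity)
    (fun x y h => hgen x.1 y.1 (x.2.1 + y.2.1) (x.2.2.1 + y.2.2.1) (x.2.2.2 + y.2.2.2) (by
      rw [← h]; simp only [f]; ring))
    (S := {c | ∃ i j : ℕ, c = p ^ i * q ^ j * t}) (norm_pos_iff.2 ht₀) ht (by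
      rintro _ ⟨i, j, rfl⟩
      refine ⟨by positivity, ?_, fun x => ⟨(x.1, x.2.1 + i, x.2.2.1 + j, x.2.2.2 + 1), ?_⟩⟩
      · rw [norm_mul, norm_mul, norm_pow, norm_pow]
        refine mul_le_of_le_one_left (norm_nonneg _) (mul_le_one₀ (pow_le_one₀ (norm_nonneg _) hp.le)
          (by positivity) (pow_le_one₀ (norm_nonneg _) hq.le))
      · simp only [f]; ring)
  have hfx : ∀ r, ∀ i j : ℕ, f (r, i, j, 0) = p ^ i * q ^ j * T r := fun r i j => by
    simp only [f, pow_zero, mul_one]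
  exact ⟨C, h1, fun r i j => hfx r i j ▸ h2 (r, i, j, 0), fun r i j => hfx r i j ▸ h3 (r, i, j, 0),
    fun i j => h4 _ ⟨i, j, rfl⟩⟩

/-! ### Contours for the limiting integral and density of generic parameters -/

namespace Contour

lemma includes_scale (C : Contour) {c : ℂ} (hc : c ≠ 0) {w : ℂ} :
    (C.scale c hc).Includes (c * w) ↔ C.Includes w := by
  rw [Includes, Includes, mem_scale_support, scale_index]

lemma excludes_scale (C : Contour) {c : ℂ} (hc : c ≠ 0) {w : ℂ} :
    (C.scale c hc).Excludes (c * w) ↔ C.Excludes w := by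
  rw [Excludes, Excludes, mem_scale_support, scale_index]

end Contour

section

variable {n m : ℕ} {T : Fin (2 * m + 6) → ℂ} {t p q v : ℂ} {α : Fin (2 * m + 6) → ℝ} {ζ : ℝ}

/-- Rescaling a contour for the parameters `T r * p ^ α r`, with any `p`, gives a contour for the
limit. -/
lemma IsContour.isLimitContour (hp : p ≠ 0) (hα : IsExponents m α ζ) {C : Contour}
    (h : IsContour m (fun r => T r * p ^ (α r : ℂ)) t p q C) (hc : p ^ (-ζ : ℂ) ≠ 0) :
    IsLimitContour m T t q α ζ (C.scale (p ^ (-ζ : ℂ)) hc) := by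
  have hζ : p ^ (ζ : ℂ) = (p ^ (-ζ : ℂ))⁻¹ := by rw [Complex.cpow_neg, inv_inv]
  have hhalf : ζ = -1 / 2 → p = p ^ (-ζ : ℂ) * p ^ (-ζ : ℂ) := fun hz => by
    rw [← Complex.cpow_add _ _ hp, hz]
    have : (-((-1 / 2 : ℝ) : ℂ) + -((-1 / 2 : ℝ) : ℂ)) = 1 := by push_cast; norm_num
    rw [this, Complex.cpow_one]
  have hαζ : ∀ r, α r = -ζ → p ^ (α r : ℂ) = p ^ (-ζ : ℂ) := fun r hr => by
    rw [hr, Complex.ofReal_neg]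
  have hin : ∀ r, α r = ζ → ∀ j : ℕ, (C.scale (p ^ (-ζ : ℂ)) hc).Includes (q ^ j * T r) := by
    intro r hr j
    have h1 := h.includes r 0 j
    simp only [hr, hζ, pow_zero, one_mul] at h1
    rw [← C.includes_scale hc] at h1
    convert h1 using 1
    field_simp
  have hex : ζ = -1 / 2 → ∀ r, α r = ζ → ∀ j : ℕ,
      (C.scale (p ^ (-ζ : ℂ)) hc).Excludes (q ^ j * T r)⁻¹ := by
    intro hz r hr j
    have h1 := h.excludes r 1 j
    simp only [hr, hζ, pow_one] at h1
    have h2 := hhalf hz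
    generalize p ^ (-ζ : ℂ) = c at *
    rw [← C.excludes_scale hc, h2] at h1
    convert h1 using 1
    simp only [mul_inv, inv_inv]
    field_simp
  refine ⟨hin 0 hα.zero, hin 1 hα.one, fun r hr j => ?_, fun hz => hex hz 0 hα.zero,
    fun hz => hex hz 1 hα.one, fun j w hw => ?_, fun hz j w hw => ?_⟩
  · have h1 := h.excludes r 0 j
    simp only [hαζ r hr, pow_zero, one_mul] at h1
    rw [← C.excludes_scale hc] at h1
    convert h1 using 1
    simp only [mul_inv]
    field_simp
  · obtain ⟨u, rfl⟩ : ∃ u, p ^ (-ζ : ℂ) * u = w := ⟨w / p ^ (-ζ : ℂ), mul_div_cancel₀ _ hc⟩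
    obtain ⟨h1, h2⟩ := h.scaled 0 j u ((C.mem_scale_support hc).1 hw)
    rw [← C.includes_scale hc] at h1
    rw [← C.excludes_scale hc] at h2
    constructor
    · convert h1 using 1; ring
    · convert h2 using 1; rw [pow_zero, one_mul, mul_comm t, mul_div_assoc]
  · obtain ⟨u, rfl⟩ : ∃ u, p ^ (-ζ : ℂ) * u = w := ⟨w / p ^ (-ζ : ℂ), mul_div_cancel₀ _ hc⟩
    have h1 := (h.scaled 1 j u⁻¹ (h.inv.1 _ ((C.mem_scale_support hc).1 hw))).2
    have h2 := hhalf hz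
    generalize p ^ (-ζ : ℂ) = c at *
    rw [← C.excludes_scale hc, pow_one, h2] at h1
    convert h1 using 1
    simp only [mul_inv, div_eq_mul_inv]
    rw [show c * (u⁻¹ * (c⁻¹ * c⁻¹ * (q ^ j)⁻¹ * t⁻¹)) =
      c * c⁻¹ * (t⁻¹ * (q ^ j)⁻¹ * (c⁻¹ * u⁻¹)) by ring, mul_inv_cancel₀ hc, one_mul]

/-- Contours for the limiting integral exist. -/
theorem exists_isLimitContour (hq₀ : q ≠ 0) (hq : ‖q‖ < 1) (ht₀ : t ≠ 0) (ht : ‖t‖ < 1)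
    (hT : ∀ r, T r ≠ 0) (hgen : LimitGeneric m T t q) (hα : IsExponents m α ζ) :
    ∃ C, IsLimitContour m T t q α ζ C := by
  -- for all but countably many `x ∈ (0, 1)` the parameters `T r * x ^ α r` are generic
  let bad : (Fin (2 * m + 6) × Fin (2 * m + 6)) × ℕ × ℕ × ℕ → Set ℝ := fun w =>
    {x | 0 < x ∧ T w.1.1 * (x : ℂ) ^ (α w.1.1 : ℂ) * (T w.1.2 * (x : ℂ) ^ (α w.1.2 : ℂ)) *
      ((x : ℂ) ^ w.2.1 * q ^ w.2.2.1 * t ^ w.2.2.2) = 1}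
  have hbad : (⋃ w, bad w).Countable := by
    refine countable_iUnion fun w => Set.Subsingleton.countable ?_
    obtain ⟨⟨r, s⟩, i, j, k⟩ := w
    have key : ∀ x ∈ bad ((r, s), i, j, k), x ^ (α r + α s + i) * ‖T r * T s * (q ^ j * t ^ k)‖ = 1 ∧
        α r + α s + i ≠ 0 := by
      rintro x ⟨hx, h⟩
      have hx' : (x : ℂ) ≠ 0 := by exact_mod_cast hx.ne'
      have e : ((x ^ (α r + α s + i) : ℝ) : ℂ) * (T r * T s * (q ^ j * t ^ k)) = 1 := by
        rw [Complex.ofReal_cpow hx.le]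
        push_cast
        rw [Complex.cpow_add _ _ hx', Complex.cpow_add _ _ hx', Complex.cpow_natCast, ← h]
        ring
      constructor
      · have e' := congrArg norm e
        rwa [norm_mul, norm_one, Complex.norm_real, Real.norm_of_nonneg (by positivity)] at e'
      · intro h0
        rw [h0, Real.rpow_zero, Complex.ofReal_one, one_mul] at e
        exact hgen r s j k e
    intro x hx y hy
    obtain ⟨h1, h2⟩ := key x hx
    obtain ⟨h3, -⟩ := key y hy
    exact Real.rpow_left_injOn h2 hx.1.le hy.1.le
      (mul_right_cancel₀ (right_ne_zero_of_mul (h1.trans_ne one_ne_zero)) (h1.trans h3.symm))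
  obtain ⟨x, ⟨hx0, hx1⟩, hx⟩ := (hbad.dense_compl ℝ).inter_open_nonempty (Ioo 0 1) isOpen_Ioo
    (nonempty_Ioo.2 zero_lt_one)
  have hx' : (x : ℂ) ≠ 0 := by exact_mod_cast hx0.ne'
  have hpow : ∀ β : ℂ, (x : ℂ) ^ β ≠ 0 := fun β => by simp [Complex.cpow_eq_zero_iff, hx']
  obtain ⟨C, hC⟩ := exists_isContour (m := m) (T := fun r => T r * (x : ℂ) ^ (α r : ℂ)) (t := t)
    (p := x) (q := q) hx'
    (by rwa [Complex.norm_real, Real.norm_of_nonneg hx0.le]) hq₀ hq ht₀ ht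
    (fun r => mul_ne_zero (hT r) (hpow _)) fun r s i j k h =>
      hx (mem_iUnion.2 ⟨((r, s), i, j, k), hx0, h⟩)
  exact ⟨_, hC.isLimitContour hx' hα (hpow _)⟩

/-- Generic parameters are dense among the balanced ones. -/
lemma Balanced.mem_closure (h : Balanced n m T t p q) :
    T ∈ closure {T' | Balanced n m T' t p q ∧ Generic m T' t p q} := by
  let c : Fin (2 * m + 6) → ℝ := fun r => if r = 0 then -(2 * m + 5) else 1
  have hc : ∀ r s, c r + c s ≠ 0 := fun r s => by
    simp only [c]
    have : (0 : ℝ) ≤ m := Nat.cast_nonneg m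
    split_ifs <;> intro h <;> linarith
  have hcsum : ∑ r, c r = 0 := by
    rw [Fin.sum_univ_succ]
    simp only [c, if_true, Fin.succ_ne_zero, if_false, Finset.sum_const, Finset.card_univ,
      Fintype.card_fin, nsmul_eq_mul, mul_one]
    push_cast
    ring
  let g : ℝ → Fin (2 * m + 6) → ℂ := fun x r => T r * Real.exp (x * c r)
  have hg : Continuous g := by fun_prop
  have hg0 : g 0 = T := by funext r; simp [g]
  let bad : (Fin (2 * m + 6) × Fin (2 * m + 6)) × ℕ × ℕ × ℕ → Set ℝ := fun w =>
    {x | g x w.1.1 * g x w.1.2 * (p ^ w.2.1 * q ^ w.2.2.1 * t ^ w.2.2.2) = 1}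
  have hbad : (⋃ w, bad w).Countable := by
    refine countable_iUnion fun w => Set.Subsingleton.countable ?_
    obtain ⟨⟨r, s⟩, i, j, k⟩ := w
    have key : ∀ x ∈ bad ((r, s), i, j, k), Real.exp (x * (c r + c s)) *
        ‖T r * T s * (p ^ i * q ^ j * t ^ k)‖ = 1 := by
      intro x hx
      rw [← norm_one (α := ℂ), ← show _ = (1 : ℂ) from hx]
      simp only [g, norm_mul, Complex.norm_real, Real.norm_eq_abs, Real.abs_exp, mul_add,
        Real.exp_add]
      ring
    intro x hx y hy
    have h1 := key x hx
    have h2 := mul_right_cancel₀ (right_ne_zero_of_mul (h1.trans_ne one_ne_zero))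
      (h1.trans (key y hy).symm)
    exact mul_right_cancel₀ (hc r s) (Real.exp_injective h2)
  rw [← hg0]
  refine map_mem_closure hg (hbad.dense_compl ℝ 0) fun x hx => ⟨⟨fun r => ?_, ?_⟩, ?_⟩
  · exact mul_ne_zero (h.1 r) (by exact_mod_cast (Real.exp_pos _).ne')
  · simp only [g]
    rw [Finset.prod_mul_distrib, ← Complex.ofReal_prod, ← Real.exp_sum, ← Finset.mul_sum, hcsum,
      mul_zero, Real.exp_zero, Complex.ofReal_one, mul_one, h.2]
  · exact fun r s i j k hxx => hx (mem_iUnion.2 ⟨((r, s), i, j, k), hxx⟩)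

lemma balanced_mul_cpow (hp : p ≠ 0) (hT : ∀ r, T r ≠ 0)
    (hbal : t ^ (2 * (n - 1)) * ∏ r, T r = q ^ (m + 1)) (hsum : ∑ r, α r = m + 1) :
    Balanced n m (fun r => T r * p ^ (α r : ℂ)) t p q := by
  refine ⟨fun r => mul_ne_zero (hT r) (by simp [Complex.cpow_eq_zero_iff, hp]), ?_⟩
  have e : ∏ r, p ^ (α r : ℂ) = p ^ (m + 1) := by
    have h1 : ∀ r, p ^ (α r : ℂ) = Complex.exp (Complex.log p * α r) := fun r =>
      Complex.cpow_def_of_ne_zero hp _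
    rw [Finset.prod_congr rfl fun r _ => h1 r, ← Complex.exp_sum, ← Finset.mul_sum,
      ← Complex.ofReal_sum, hsum, ← Complex.cpow_def_of_ne_zero hp]
    push_cast
    exact_mod_cast Complex.cpow_natCast p (m + 1)
  rw [Finset.prod_mul_distrib, ← mul_assoc, hbal, e, mul_pow, mul_comm]

/-! ### The limit -/

/-- The elliptic Selberg integral with parameters `τ r * p ^ α r`, expressed as a regularized
integral over a contour of the limiting integral. -/
def limitForm (n m : ℕ) (t q : ℂ) (α : Fin (2 * m + 6) → ℝ) (ζ : ℝ) (v : ℂ) (C : Contour)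
    (w : ℂ × (Fin (2 * m + 6) → ℂ)) : ℂ :=
  regPrefactor n w.1 q t (fun r s => w.2 r * w.2 s * w.1 ^ (pairExponent α r s : ℂ))
      (q / (w.2 0 * w.2 1) * w.1 ^ ((-2 * ζ : ℝ) : ℂ)) (w.2 0 * v) (w.2 1 * v) *
    C.integralPow n fun z =>
      (rescaledParams n m t q α ζ v w).num z / (rescaledParams n m t q α ζ v w).den z

/-- The conditions under which the elliptic Selberg integral is given by `limitForm`. -/
structure LimitFormValid (n m : ℕ) (t q : ℂ) (α : Fin (2 * m + 6) → ℝ) (ζ : ℝ) (v : ℂ) (C : Contour)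
    (w : ℂ × (Fin (2 * m + 6) → ℂ)) : Prop where
  p_ne : w.1 ≠ 0
  p_lt : ‖w.1‖ < 1
  ne_zero : ∀ r, w.2 r ≠ 0
  separates : C.Separates (rescaledParams n m t q α ζ v w)
  poch : ∀ i < n, poch (q / (w.2 0 * w.2 1) * w.1 ^ ((-2 * ζ : ℝ) : ℂ) / t ^ i) q ≠ 0
  theta : ∀ i < n, theta (t ^ i * (w.2 0 * v)) q ≠ 0 ∧ theta (t ^ i * (w.2 1 * v)) q ≠ 0
  outer : ∀ y ∈ C.outer, ‖w.1 ^ (-ζ : ℂ)‖ < ‖y‖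

lemma genericII_eq_limitForm (hn : 1 ≤ n) (hq₀ : q ≠ 0) (hq : ‖q‖ < 1) (ht₀ : t ≠ 0) (ht : ‖t‖ < 1)
    (hα : IsExponents m α ζ) (hv : v ≠ 0) {C : Contour} {w : ℂ × (Fin (2 * m + 6) → ℂ)}
    (h : LimitFormValid n m t q α ζ v C w)
    (hgen : Generic m (fun r => w.2 r * w.1 ^ (α r : ℂ)) t w.1 q) :
    genericII n m (fun r => w.2 r * w.1 ^ (α r : ℂ)) t w.1 q = limitForm n m t q α ζ v C w := by
  obtain ⟨p, τ⟩ := w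
  obtain ⟨hp₀, hp, hτ, hsep, hpoch, hθ, hout⟩ := h
  dsimp only at *
  have hpow : ∀ β : ℂ, p ^ β ≠ 0 := fun β => by simp [Complex.cpow_eq_zero_iff, hp₀]
  have hc := hpow ζ
  have hneg : p ^ (-ζ : ℂ) = (p ^ (ζ : ℂ))⁻¹ := Complex.cpow_neg _ _
  have hadd : ∀ a b : ℝ, p ^ ((a + b : ℝ) : ℂ) = p ^ (a : ℂ) * p ^ (b : ℂ) := fun a b => by
    rw [Complex.ofReal_add, Complex.cpow_add _ _ hp₀]
  have hB : q / (τ 0 * p ^ (α 0 : ℂ) * (τ 1 * p ^ (α 1 : ℂ))) =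
      q / (τ 0 * τ 1) * p ^ ((-2 * ζ : ℝ) : ℂ) := by
    rw [hα.zero, hα.one, neg_mul, Complex.ofReal_neg, Complex.cpow_neg, two_mul ζ, hadd,
      mul_mul_mul_comm, ← div_div, div_eq_mul_inv (q / _)]
  have hτv : ∀ r, α r = ζ → τ r * p ^ (α r : ℂ) * (v * p ^ (-ζ : ℂ)) = τ r * v := fun r hr => by
    rw [hr, hneg]
    generalize p ^ (ζ : ℂ) = c at hc
    field_simp
  have hA : (fun r s : Fin (2 * m + 6) => if r = 0 ∧ s = 1 then
      p * (τ 0 * p ^ (α 0 : ℂ) * (τ 1 * p ^ (α 1 : ℂ)))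
      else τ r * p ^ (α r : ℂ) * (τ s * p ^ (α s : ℂ))) =
      fun r s => τ r * τ s * p ^ (pairExponent α r s : ℂ) := by
    funext r s
    unfold pairExponent
    split_ifs with hrs
    · rw [hrs.1, hrs.2, hadd, hadd, Complex.ofReal_one, Complex.cpow_one]; ring
    · rw [hadd]; ring
  rw [genericII_eq hn hp₀ hp hq₀ hq ht₀ ht (fun r => mul_ne_zero (hτ r) (hpow _))
    (mul_ne_zero hv (hpow (-ζ))) (by rw [hB]; exact hpoch) (by rw [hτv 0 hα.zero, hτv 1 hα.one]; exact hθ)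
    (exists_isContour hp₀ hp hq₀ hq ht₀ ht (fun r => mul_ne_zero (hτ r) (hpow _)) hgen)
    (R := C.scale (p ^ (ζ : ℂ)) hc)
    (Contour.separates_scale hc (by rw [selbergParams_rescale hα hp₀]; exact hsep)) ?_,
    hB, hτv 0 hα.zero, hτv 1 hα.one, hA, Contour.scale_integralPow, limitForm]
  · simp only [← Params.num_rescale _ hc, ← Params.den_rescale _ hc, selbergParams_rescale hα hp₀]
  · intro w hw
    obtain ⟨y, rfl⟩ : ∃ y, p ^ (ζ : ℂ) * y = w := ⟨w / p ^ (ζ : ℂ), mul_div_cancel₀ _ hc⟩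
    have h1 := hout y ((C.mem_scale_outer hc).1 hw)
    rw [hneg, norm_inv] at h1
    have h2 : 0 < ‖p ^ (ζ : ℂ)‖ := norm_pos_iff.2 hc
    rw [norm_mul, mul_comm]
    rwa [inv_lt_iff_one_lt_mul₀ h2] at h1

section limit

variable {C : Contour}

lemma eventually_limitFormValid (hq₀ : q ≠ 0) (hq : ‖q‖ < 1) (ht₀ : t ≠ 0)
    (hα : IsExponents m α ζ) (hT : ∀ r, T r ≠ 0) (hv : v ≠ 0) (hC : IsLimitContour m T t q α ζ C)
    (hθ : ∀ i < n, theta (t ^ i * (T 0 * v)) q ≠ 0 ∧ theta (t ^ i * (T 1 * v)) q ≠ 0) :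
    ∀ᶠ w in 𝓝[≠] 0 ×ˢ 𝓝 T, LimitFormValid n m t q α ζ v C w := by
  have hsep := hC.separates (n := n) (v := v) hα hq₀ hq ht₀
  have hτ : ∀ r, Tendsto (fun w : ℂ × (Fin (2 * m + 6) → ℂ) => w.2 r) (𝓝[≠] 0 ×ˢ 𝓝 T) (𝓝 (T r)) :=
    fun r => ((continuous_apply r).tendsto T).comp tendsto_snd
  have hpow0 : ∀ {β : ℝ}, 0 < β → Tendsto (fun w : ℂ × (Fin (2 * m + 6) → ℂ) => w.1 ^ (β : ℂ))
      (𝓝[≠] 0 ×ˢ 𝓝 T) (𝓝 0) := fun hβ => by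
    have h := (tendsto_cpow_zeroPow hβ.le).comp (tendsto_fst (g := 𝓝 T))
    rwa [zeroPow_of_pos hβ] at h
  have hp : Tendsto (fun w : ℂ × (Fin (2 * m + 6) → ℂ) => w.1) (𝓝[≠] 0 ×ˢ 𝓝 T) (𝓝 0) :=
    tendsto_fst.mono_right nhdsWithin_le_nhds
  have hζ := hα.neg
  obtain ⟨r, hr, hball⟩ := Metric.isOpen_iff.1 C.isClosed_outer.isOpen_compl 0
    (Contour.zero_notMem_outer hsep.zero)
  have hB := ((tendsto_const_nhds (x := q)).div ((hτ 0).mul (hτ 1)) (mul_ne_zero (hT 0) (hT 1))).mul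
    (hpow0 (show 0 < -2 * ζ by linarith))
  rw [mul_zero] at hB
  have h1 : ∀ᶠ w : ℂ × (Fin (2 * m + 6) → ℂ) in 𝓝[≠] 0 ×ˢ 𝓝 T, ∀ i ∈ Finset.range n,
      poch (q / (w.2 0 * w.2 1) * w.1 ^ ((-2 * ζ : ℝ) : ℂ) / t ^ i) q ≠ 0 := by
    refine (Finset.eventually_all _).2 fun i _ => ?_
    have := tendsto_poch (hB.div_const (t ^ i)) tendsto_const_nhds hq
    rw [zero_div, poch_zero_left] at this
    exact this.eventually_ne one_ne_zero
  have h2 : ∀ᶠ w : ℂ × (Fin (2 * m + 6) → ℂ) in 𝓝[≠] 0 ×ˢ 𝓝 T, ∀ i ∈ Finset.range n,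
      theta (t ^ i * (w.2 0 * v)) q ≠ 0 ∧ theta (t ^ i * (w.2 1 * v)) q ≠ 0 := by
    refine (Finset.eventually_all _).2 fun i hi => ?_
    have h3 := hθ i (Finset.mem_range.1 hi)
    have hne : ∀ r, t ^ i * (T r * v) ≠ 0 := fun r =>
      mul_ne_zero (pow_ne_zero _ ht₀) (mul_ne_zero (hT r) hv)
    exact ((tendsto_theta (hne 0) hq (((hτ 0).mul_const v).const_mul _)).eventually_ne h3.1).and
      ((tendsto_theta (hne 1) hq (((hτ 1).mul_const v).const_mul _)).eventually_ne h3.2)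
  filter_upwards [(eventually_mem_nhdsWithin (a := (0 : ℂ)) (s := {0}ᶜ)).prod_inl (𝓝 T),
    hp.norm.eventually_lt_const (show ‖(0 : ℂ)‖ < 1 by simp),
    eventually_all.2 fun r => (hτ r).eventually_ne (hT r),
    (tends_limitParams hα hq₀ hq ht₀ hT hv).eventually_separates hsep, h1, h2,
    (hpow0 (show 0 < -ζ by linarith)).norm.eventually_lt_const (show ‖(0 : ℂ)‖ < r by simpa using hr)]
    with w w1 w2 w3 w4 w5 w6 w7
  refine ⟨w1, w2, w3, w4, fun i hi => w5 i (Finset.mem_range.2 hi),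
    fun i hi => w6 i (Finset.mem_range.2 hi), fun y hy => ?_⟩
  rw [Complex.ofReal_neg] at w7
  by_contra! h
  exact hball (by rw [mem_ball_zero_iff]; linarith : y ∈ Metric.ball 0 r) hy

lemma tendsto_limitForm (hq₀ : q ≠ 0) (hq : ‖q‖ < 1) (ht₀ : t ≠ 0) (ht : ‖t‖ < 1)
    (hα : IsExponents m α ζ) (hT : ∀ r, T r ≠ 0) (hv : v ≠ 0) (hC : IsLimitContour m T t q α ζ C)
    (hθ : ∀ i < n, theta (t ^ i * (T 0 * v)) q ≠ 0 ∧ theta (t ^ i * (T 1 * v)) q ≠ 0) :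
    Tendsto (limitForm n m t q α ζ v C) (𝓝[≠] 0 ×ˢ 𝓝 T)
      (𝓝 (limitPrefactor n m T t q α ζ v * C.integralPow n (limitIntegrand n m T t q α ζ v))) := by
  have hτ : ∀ r, Tendsto (fun w : ℂ × (Fin (2 * m + 6) → ℂ) => w.2 r) (𝓝[≠] 0 ×ˢ 𝓝 T) (𝓝 (T r)) :=
    fun r => ((continuous_apply r).tendsto T).comp tendsto_snd
  have hpow : ∀ {β : ℝ}, 0 ≤ β → Tendsto (fun w : ℂ × (Fin (2 * m + 6) → ℂ) => w.1 ^ (β : ℂ))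
      (𝓝[≠] 0 ×ˢ 𝓝 T) (𝓝 (zeroPow β)) := fun hβ => (tendsto_cpow_zeroPow hβ).comp tendsto_fst
  have hζ := hα.neg
  have hB := ((tendsto_const_nhds (x := q)).div ((hτ 0).mul (hτ 1)) (mul_ne_zero (hT 0) (hT 1))).mul
    (hpow (show 0 ≤ -2 * ζ by linarith))
  rw [zeroPow_of_pos (by linarith), mul_zero] at hB
  rw [← regPrefactor_limit hα, integralPow_limitIntegrand hα hq]
  refine (tendsto_regPrefactor hq ht₀ ht (tendsto_fst.mono_right nhdsWithin_le_nhds) (by simp)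
    (fun r s hrs => ((hτ r).mul (hτ s)).mul (hpow (hα.nonneg hrs))) hB ((hτ 0).mul_const v)
    ((hτ 1).mul_const v) (mul_ne_zero (hT 0) hv) (mul_ne_zero (hT 1) hv) (fun i _ => ?_) hθ).mul ?_
  · rw [zero_div, poch_zero_left]; exact one_ne_zero
  · exact (tends_limitParams hα hq₀ hq ht₀ hT hv).tendsto_integralPow
      (hC.separates hα hq₀ hq ht₀) n

lemma continuousAt_limitForm (hq₀ : q ≠ 0) (hq : ‖q‖ < 1) (ht₀ : t ≠ 0) (ht : ‖t‖ < 1)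
    (hv : v ≠ 0) (h : LimitFormValid n m t q α ζ v C (p, T)) :
    ContinuousAt (fun τ => limitForm n m t q α ζ v C (p, τ)) T := by
  have hT := h.ne_zero
  have hτ : ∀ r, Tendsto (fun w : Fin (2 * m + 6) → ℂ => w r) (𝓝 T) (𝓝 (T r)) :=
    fun r => (continuous_apply r).tendsto T
  have h1 := tendsto_regPrefactor (n := n) (p := fun _ => p) hq ht₀ ht tendsto_const_nhds h.p_lt
    (fun r s _ => ((hτ r).mul (hτ s)).mul_const (p ^ (pairExponent α r s : ℂ)))
    ((tendsto_const_nhds.div ((hτ 0).mul (hτ 1)) (mul_ne_zero (hT 0) (hT 1))).mul_const _)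
    ((hτ 0).mul_const v) ((hτ 1).mul_const v) (mul_ne_zero (hT 0) hv) (mul_ne_zero (hT 1) hv)
    h.poch h.theta
  exact h1.mul ((tends_rescaledParams h.p_lt hq₀ hq ht₀ hT hv).tendsto_integralPow h.separates n)

/-- The value of the elliptic Selberg integral, also at nongeneric parameters. -/
lemma II_eq_limitForm (hn : 1 ≤ n) (hq₀ : q ≠ 0) (hq : ‖q‖ < 1) (ht₀ : t ≠ 0) (ht : ‖t‖ < 1)
    (hα : IsExponents m α ζ) (hv : v ≠ 0) (hbal : t ^ (2 * (n - 1)) * ∏ r, T r = q ^ (m + 1))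
    (hsum : ∑ r, α r = m + 1) (hval : ∀ᶠ τ in 𝓝 T, LimitFormValid n m t q α ζ v C (p, τ)) :
    II n m (fun r => T r * p ^ (α r : ℂ)) t p q = limitForm n m t q α ζ v C (p, T) := by
  have h := hval.self_of_nhds
  have hp₀ : p ≠ 0 := h.p_ne
  unfold II
  split_ifs with hgen
  · exact genericII_eq_limitForm hn hq₀ hq ht₀ ht hα hv h hgen
  · have hcl := (balanced_mul_cpow (t := t) hp₀ h.ne_zero hbal hsum).mem_closure
    have := mem_closure_iff_nhdsWithin_neBot.1 hcl
    have hpow : ∀ r, p ^ (α r : ℂ) ≠ 0 := fun r => by simp [Complex.cpow_eq_zero_iff, hp₀]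
    -- undo the scaling of the parameters
    let g : (Fin (2 * m + 6) → ℂ) → Fin (2 * m + 6) → ℂ := fun T' r => T' r / p ^ (α r : ℂ)
    have hg : Tendsto g (𝓝 fun r => T r * p ^ (α r : ℂ)) (𝓝 T) := by
      have : Continuous g := by fun_prop
      convert this.tendsto _ using 2
      funext r
      exact (mul_div_cancel_right₀ _ (hpow r)).symm
    have hg' := hg.mono_left (nhdsWithin_le_nhds
      (s := {T' | Balanced n m T' t p q ∧ Generic m T' t p q}))
    refine Tendsto.limUnder_eq (((continuousAt_limitForm hq₀ hq ht₀ ht hv h).tendsto.comp hg').congr' ?_)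
    filter_upwards [hg'.eventually hval, self_mem_nhdsWithin] with T' h1 h2
    have e : (fun r => g T' r * p ^ (α r : ℂ)) = T' :=
      funext fun r => div_mul_cancel₀ _ (hpow r)
    have h3 := genericII_eq_limitForm hn hq₀ hq ht₀ ht hα hv h1 (by dsimp only; rw [e]; exact h2.2)
    dsimp only at h3
    rw [e] at h3
    exact h3.symm

end limit

end

end EllipticSelberg

end

theorem mainTheorem11 (n m : ℕ) (hn : 1 ≤ n) (q t : ℂ)
    (hq₀ : q ≠ 0) (hq₁ : ‖q‖ < 1) (ht₀ : t ≠ 0) (ht₁ : ‖t‖ < 1)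
    (T : Fin (2 * m + 6) → ℂ) (hT₀ : ∀ r, T r ≠ 0)
    (hT : t ^ (2 * (n - 1)) * ∏ r, T r = q ^ (m + 1))
    (hgen : EllipticSelberg.LimitGeneric m T t q)
    (α : Fin (2 * m + 6) → ℝ) (ζ : ℝ) (hζ : -1 / 2 ≤ ζ) (hζ₀ : ζ < 0)
    (hα₀ : α 0 = ζ) (hα₁ : α 1 = ζ)
    (hα : ∀ r, r ≠ 0 → r ≠ 1 → -ζ ≤ α r ∧ α r ≤ 1 + ζ)
    (hsum : ∑ r, α r = m + 1) :
    (∃ C, EllipticSelberg.IsLimitContour m T t q α ζ C) ∧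
    ∀ C, EllipticSelberg.IsLimitContour m T t q α ζ C →
    ∀ v : ℂ, v ≠ 0 →
    (∀ i < n, EllipticSelberg.theta (t ^ i * T 0 * v) q ≠ 0 ∧
      EllipticSelberg.theta (t ^ i * T 1 * v) q ≠ 0) →
    Tendsto
      (fun p : ℂ => EllipticSelberg.II n m (fun r => T r * p ^ (α r : ℂ)) t p q)
      (𝓝[≠] 0)
      (𝓝 (EllipticSelberg.limitPrefactor n m T t q α ζ v *
        C.integralPow n (EllipticSelberg.limitIntegrand n m T t q α ζ v))) := by
  have hexp : EllipticSelberg.IsExponents m α ζ := ⟨hζ, hζ₀, hα₀, hα₁, hα⟩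
  refine ⟨EllipticSelberg.exists_isLimitContour hq₀ hq₁ ht₀ ht₁ hT₀ hgen hexp, ?_⟩
  intro C hC v hv hθ
  simp only [mul_assoc] at hθ
  have hval := EllipticSelberg.eventually_limitFormValid hq₀ hq₁ ht₀ hexp hT₀ hv hC hθ
  have hlim := EllipticSelberg.tendsto_limitForm hq₀ hq₁ ht₀ ht₁ hexp hT₀ hv hC hθ
  refine (hlim.comp (tendsto_id.prodMk tendsto_const_nhds)).congr' ?_
  filter_upwards [hval.curry] with p hp
  exact (EllipticSelberg.II_eq_limitForm hn hq₀ hq₁ ht₀ ht₁ hexp hv hT hsum hp).symm
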